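/- **Setting.** Let $a,b,\dots\in\{0,\dots,5\}$ be vector indices (metric $\eta=\mathrm{diag}(-1,1,1,1,1,1)$), $\alpha,\beta,\dots$ four-valued Weyl spinor indices, $i,j,\dots$ four-valued $\mathrm{USp}(4)$ indices, moved with the symplectic form by $v_i=\Omega_{ij}v^j$, $v^i=\Omega^{ij}v_j$, $\Omega_{ij}\Omega^{jk}=\delta_i^k$. The Weyl gamma matrices $(\gamma^a)_{\alpha\beta}=-(\gamma^a)_{\beta\alpha}$, $(\tilde\gamma^a)^{\alpha\beta}=\frac12\varepsilon^{\alpha\beta\gamma\delta}(\gamma^a)_{\gamma\delta}$ satisfy $\gamma^a\tilde\gamma^b+\gamma^b\tilde\gamma^a=-2\eta^{ab}$; $\gamma_{ab}=\gamma_{[a}\tilde\gamma_{b]}$, $\tilde\gamma_{ab}=\tilde\gamma_{[a}\gamma_{b]}$, $\gamma_{abc}=\gamma_{[a}\tilde\gamma_b\gamma_{c]}$, $\nabla_{\alpha\beta}=(\gamma^a)_{\alpha\beta}\nabla_a$, $M_\alpha{}^\beta=-\frac14(\gamma^{ab})_\alpha{}^\beta M_{ab}$. Symmetrizations have unit weight.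 A *6D $\mathcal N=(2,0)$ conformal superspace* consists of a supercommutative $\mathbb Z_2$-graded complex $*$-algebra $A$ of superfields, generators $\nabla_A=(\nabla_a,\nabla_\alpha^i)$ and $X_{\underline a}=(M_{ab},D,J_{ij},S^\alpha_i,K_a)$ acting on $A$ as graded derivations ($\nabla_\alpha^i$, $S^\alpha_i$ odd, the others even), linearly independent over $A$, and the super-Weyl tensor $W^{\alpha\beta ij}=W^{(\alpha\beta)[ij]}$, $\Omega_{ij}W^{\alpha\beta ij}=0$, an even primary ($S^\gamma_kW^{\alpha\beta ij}=0$) of dimension $1$ that transforms under $M,J$ as its indices indicate. Put $$X_\alpha{}^{\beta\gamma i}=\nabla_\alpha^jW^{\beta\gamma i}{}_j,\qquad X^{\alpha i,jk}=\nabla_\beta^iW^{\alpha\beta jk},\qquad Y_\alpha{}^{\beta ij}=\nabla_\alpha^kX^{\beta(i,j)}{}_k .$$ The super-Weyl tensor obeys $\nabla_\alpha^iW^{\alpha\beta j}{}_i=0$ and $$\nabla_\alpha^iW^{\beta\gamma jk}=\tfrac15\Omega^{jk}X_\alpha{}^{\beta\gamma i}+\tfrac25\big(\Omega^{ij}X_\alpha{}^{\beta\gamma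 k}-\Omega^{ik}X_\alpha{}^{\beta\gamma j}\big)+\tfrac15\big(\delta_\alpha^\beta X^{\gamma i,jk}+\delta_\alpha^\gamma X^{\beta i,jk}\big).$$ The generators $M_{ab},D,J^{ij}$ form $\mathfrak{so}(5,1)\oplus\mathbb R\oplus\mathfrak{usp}(4)$ and act on $\nabla_a,\nabla_\alpha^i,S^\alpha_i,K_a$ as the indices and the dimensions $1,\frac12,-\frac12,-1$ indicate. Furthermore $\{S^\alpha_i,S^\beta_j\}=-2\mathrm i\,\Omega_{ij}(\tilde\gamma^c)^{\alpha\beta}K_c$, $[S^\alpha_i,K_a]=[K_a,K_b]=0$, and $$[K_a,\nabla_b]=2\eta_{ab}D+2M_{ab},\qquad[K_a,\nabla_\alpha^i]=-\mathrm i(\gamma_a)_{\alpha\beta}S^{\beta i},$$ $$\{S^\alpha_i,\nabla_\beta^j\}=2\delta^\alpha_\beta\delta^j_iD-4\delta^j_iM_\beta{}^\alpha+8\delta^\alpha_\beta J_i{}^j+\tfrac{\mathrm i}{10}(\gamma_c)_{\beta\gamma}W^{\alpha\gamma}{}_i{}^jK^c,$$ $$[S^{\alpha i},\nabla_b]=-\mathrm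 i(\tilde\gamma_b)^{\alpha\beta}\nabla_\beta^i+\tfrac{\mathrm i}{40}(\gamma_b)_{\beta\gamma}W^{\alpha\beta ij}S^\gamma_j+\tfrac1{160}(\gamma_{bc})_\beta{}^\gamma X_\gamma{}^{\alpha\beta i}K^c,$$ $$\{\nabla_\alpha^i,\nabla_\beta^j\}=-2\mathrm i\,\Omega^{ij}\nabla_{\alpha\beta}-\tfrac12\varepsilon_{\alpha\beta\gamma\epsilon}W^{\gamma\delta ij}M_\delta{}^\epsilon+\tfrac1{40}\varepsilon_{\alpha\beta\gamma\delta}X^{\gamma k,ij}S^\delta_k+\tfrac3{40}(\gamma_a)_{\gamma[\alpha}\nabla_{\beta]\delta}W^{\delta\gamma ij}K^a-\tfrac{\mathrm i}{480}(\gamma_a)_{\gamma(\alpha}Y_{\beta)}{}^{\gamma ij}K^a .$$ The operators $\nabla_a,M_{ab},D,K_a$ are real, $J_{ij}$ and $\nabla_\alpha^i$ obey the $\mathrm{USp}(4)$ and symplectic Majorana--Weyl reality conditions, and $W_{abc}{}^{ij}:=\frac18(\gamma_{abc})_{\alpha\beta}W^{\alpha\beta ij}$ satisfies $\overline{W_{abc}{}^{ij}}=-W_{abc\,ij}$.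 Put $T_{abc}{}^{ij}=\frac{\mathrm i}2W_{abc}{}^{ij}$. *Covariant fields* are the polynomials, without constant term, in $W^{\alpha\beta ij}$ and its descendants $\nabla_A\cdots\nabla_BW^{\alpha\beta ij}$. A *field deformation* keeps $M_{ab},D,J_{ij}$ fixed and adds to each of $\nabla_a,\nabla_\alpha^i,S^\alpha_i,K_a$ a linear combination of the generators $\nabla_A,X_{\underline a}$ with covariant fields as coefficients, the new $\nabla_a$ being real. A list of generators is a *gauged superconformal algebra* if it is linearly independent over $A$, its $M,D,J$ close as above and act on the other generators as above, its $S,K$ satisfy the above algebra, and its other graded commutators $$[X_{\underline a},\nabla_B\}=-f_{\underline aB}{}^C\nabla_C-f_{\underline aB}{}^{\underline c}X_{\underline c}-F_{\underline aB}{}^{\underline c}X_{\underline c}\quad(X_{\underline a}=S,K),\qquad[\nabla_A,\nabla_B\}=-T_{AB}{}^C\nabla_C-R_{AB}{}^{\underline c}X_{\underline c}$$ have the structure constants $f$ of the superconformal algebra and have $F$, $R$ and $T$ (apart from the constant torsion in $\{\nabla_\alpha^i,\nabla_\beta^j\}$) built from covariant fields. The generators being operators, the graded Jacobi identities and the Bianchi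 identities $[\nabla_A,[\nabla_B,\nabla_C\}\}+(\text{graded permutations})=0$ then hold. **Theorem.** In every 6D $\mathcal N=(2,0)$ conformal superspace the following holds. 1. The given generators form a gauged superconformal algebra. 2. (Rigidity.) A field deformation yields a gauged superconformal algebra if and only if there is $\lambda\in\mathbb R$ such that $S^\alpha_i$, $K_a$, $\nabla_\alpha^i$ are not deformed and $\nabla_a$ becomes $$\hat\nabla_a=\nabla_a-\lambda\,(\gamma_a)_{\alpha\beta}(\gamma_b)_{\gamma\delta}W^{\alpha\gamma ij}W^{\beta\delta}{}_{ij}K^b .$$ The same conclusion holds if one only requires of the field deformation that the deformed generators transform under $M,D,J$ like the original ones. 3. For every $\lambda\in\mathbb R$ the replacement of $\nabla_a$ by $\hat\nabla_a$ is such a deformation, and it does not change the commutators $[K_a,\nabla_b]$, $[K_a,\nabla_\alpha^i]$, $\{S^\alpha_i,\nabla_\beta^j\}$, $[S^{\alpha i},\nabla_b]$ given above (with $\nabla_b$ replaced by $\hat\nabla_b$ throughout). 4. (Conventional constraints.) For every $\lambda\in\mathbb R$, $[\hat\nabla_a,\hat\nabla_b]$ has an expansion $$-\hat R(P)_{ab}{}^c\hat\nabla_c-\hat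 R(Q)_{ab}{}^\gamma_k\nabla_\gamma^k-\tfrac12\hat R(M)_{ab}{}^{cd}M_{cd}-\hat R(J)_{ab\,ij}J^{ij}-\hat R(D)_{ab}D-\hat R(S)_{ab\,\gamma}^{\ \ \ \,k}S^\gamma_k-\hat R(K)_{ab}{}^cK_c$$ with $\hat R(M)_{ab}{}^{cd}=-\hat R(M)_{ab}{}^{dc}$ and $\hat R(J)_{ab\,ij}=\hat R(J)_{ab\,ji}$, and in every such expansion $$\hat R(P)_{ab}{}^c=0,\qquad\hat R(M)_{ad}{}^{cd}=-\big(\tfrac14+256\lambda\big)T_{aef}{}^{ij}T^{cef}{}_{ij},\qquad(\gamma^a)_{\delta\gamma}\hat R(Q)_{ab}{}^\gamma_k=0 .$$ 5. (Traceless frame.) For $\lambda=-\frac1{1024}$ one has $\hat R(M)_{ad}{}^{cd}=0$. 6. If $T_{aef}{}^{ij}T^{cef}{}_{ij}$ does not vanish identically, then different $\lambda$ give different $\hat\nabla_a$, and $\lambda=-\frac1{1024}$ is the only value with $\hat R(M)_{ad}{}^{cd}=0$. -/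

import Mathlib

open scoped BigOperators

noncomputable section

namespace SixD

/-! ## Conventions for tensors

Vector indices are `a b c d : Fin 6`, Weyl spinor indices `α β γ δ : Fin 4`, `USp(4)` indices
`i j k l : Fin 4`.  Upper and lower positions are recorded in the doc comments. -/

/-- The flat metric `η = diag(-1, 1, 1, 1, 1, 1)` (the same with upper or lower indices). -/
def eta (a b : Fin 6) : ℂ := if a = b then (if a = 0 then -1 else 1) else 0

/-- The symplectic form `Ω^{ij}` with `Ω^{12} = Ω^{34} = 1`. -/
def OmU (i j : Fin 4) : ℂ :=
  !![0, 1, 0, 0; -1, 0, 0, 0; 0, 0, 0, 1; 0, 0, -1, 0] i j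

/-- `Ω_{ij} = -Ω^{ij}`, so that `Ω_{ij} Ω^{jk} = δ_i^k`. -/
def OmL (i j : Fin 4) : ℂ := -OmU i j

/-- The Levi-Civita symbol on four spinor indices (upper or lower), `ε_{1234} = ε^{1234} = 1`:
the product of all differences is `± 12` on permutations and `0` otherwise. -/
def lc (α β γ δ : Fin 4) : ℂ :=
  ((((β.val : ℤ) - α.val) * ((γ.val : ℤ) - α.val) * ((δ.val : ℤ) - α.val) *
    ((γ.val : ℤ) - β.val) * ((δ.val : ℤ) - β.val) * ((δ.val : ℤ) - γ.val) : ℤ) : ℂ) / 12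

/-- Kronecker delta. -/
def kd (i j : Fin 4) : ℂ := if i = j then 1 else 0

/-- The antisymmetric Weyl gamma matrices `(γ^a)_{αβ}`. -/
def gU (a : Fin 6) : Matrix (Fin 4) (Fin 4) ℂ :=
  ![!![0, 0, 0, 1; 0, 0, -1, 0; 0, 1, 0, 0; -1, 0, 0, 0],
    !![0, 1, 0, 0; -1, 0, 0, 0; 0, 0, 0, 1; 0, 0, -1, 0],
    !![0, 0, 1, 0; 0, 0, 0, -1; -1, 0, 0, 0; 0, 1, 0, 0],
    !![0, 0, 0, 1; 0, 0, 1, 0; 0, -1, 0, 0; -1, 0, 0, 0],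
    !![0, 0, Complex.I, 0; 0, 0, 0, Complex.I; -Complex.I, 0, 0, 0; 0, -Complex.I, 0, 0],
    !![0, Complex.I, 0, 0; -Complex.I, 0, 0, 0; 0, 0, 0, -Complex.I; 0, 0, Complex.I, 0]] a

/-- `(γ̃^a)^{αβ} = ½ ε^{αβγδ} (γ^a)_{γδ}`. -/
def gtU (a : Fin 6) : Matrix (Fin 4) (Fin 4) ℂ :=
  Matrix.of fun α β => (1 / 2) * ∑ γ, ∑ δ, lc α β γ δ * gU a γ δ

/-- `(γ_a)_{αβ}`. -/
def gL (a : Fin 6) : Matrix (Fin 4) (Fin 4) ℂ := ∑ b, eta a b • gU b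

/-- `(γ̃_a)^{αβ}`. -/
def gtL (a : Fin 6) : Matrix (Fin 4) (Fin 4) ℂ := ∑ b, eta a b • gtU b

/-- `(γ_{ab})_α^β`, where `γ_{ab} = γ_{[a} γ̃_{b]}`. -/
def gam2 (a b : Fin 6) : Matrix (Fin 4) (Fin 4) ℂ :=
  (1 / 2 : ℂ) • (gL a * gtL b - gL b * gtL a)

/-- `(γ̃_{ab})^α_β`, where `γ̃_{ab} = γ̃_{[a} γ_{b]}`. -/
def gamt2 (a b : Fin 6) : Matrix (Fin 4) (Fin 4) ℂ :=
  (1 / 2 : ℂ) • (gtL a * gL b - gtL b * gL a)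

/-- `(γ_{abc})_{αβ}`, where `γ_{abc} = γ_{[a} γ̃_b γ_{c]}`. -/
def gam3 (a b c : Fin 6) : Matrix (Fin 4) (Fin 4) ℂ :=
  (1 / 6 : ℂ) • (gL a * gtL b * gL c + gL b * gtL c * gL a + gL c * gtL a * gL b
    - gL b * gtL a * gL c - gL a * gtL c * gL b - gL c * gtL b * gL a)

/-- The charge conjugation matrix `B` on Weyl spinors: `B γ^a Bᵀ` is the complex conjugate of
`γ^a`, and `B B* = -1`. -/
def Bmat : Matrix (Fin 4) (Fin 4) ℂ :=
  !![0, 0, 0, 1; 0, 0, -1, 0; 0, 1, 0, 0; -1, 0, 0, 0]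

section Lowering

variable {V : Type*} [AddCommGroup V] [Module ℂ V]

/-- `v_i = Ω_{ij} v^j`. -/
def low (v : Fin 4 → V) (i : Fin 4) : V := ∑ j, OmL i j • v j

/-- `v^i = Ω^{ij} v_j`. -/
def raise (v : Fin 4 → V) (i : Fin 4) : V := ∑ j, OmU i j • v j

/-- `t_{ij} = Ω_{ik} Ω_{jl} t^{kl}`. -/
def low2 (t : Fin 4 → Fin 4 → V) (i j : Fin 4) : V := ∑ k, ∑ l, (OmL i k * OmL j l) • t k l

/-- `w^a = η^{ab} w_b`. -/
def upV (w : Fin 6 → V) (a : Fin 6) : V := ∑ b, eta a b • w b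

/-- `2 η_{c[a} w_{b]} = η_{ca} w_b - η_{cb} w_a`. -/
def vrot (a b : Fin 6) (w : Fin 6 → V) (c : Fin 6) : V := eta c a • w b - eta c b • w a

/-- `Ω^{k(i} v^{j)}`. -/
def jrot (i j : Fin 4) (v : Fin 4 → V) (k : Fin 4) : V :=
  (1 / 2 : ℂ) • (OmU k i • v j + OmU k j • v i)

end Lowering

/-! ## Operators on superfields -/

section Operators

variable {A : Type*} [Ring A] [Algebra ℂ A]

/-- The commutator of two operators. -/
def comm (X Y : Module.End ℂ A) : Module.End ℂ A := X * Y - Y * X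

/-- The anticommutator of two operators. -/
def acomm (X Y : Module.End ℂ A) : Module.End ℂ A := X * Y + Y * X

/-- An even derivation of the superalgebra of superfields. -/
structure IsEvenDer (𝒜 : ZMod 2 → Submodule ℂ A) (X : Module.End ℂ A) : Prop where
  map_mem : ∀ p, ∀ f ∈ 𝒜 p, X f ∈ 𝒜 p
  leibniz : ∀ f h : A, X (f * h) = X f * h + f * X h

/-- An odd derivation of the superalgebra of superfields. -/
structure IsOddDer (𝒜 : ZMod 2 → Submodule ℂ A) (X : Module.End ℂ A) : Prop where
  map_mem : ∀ p, ∀ f ∈ 𝒜 p, X f ∈ 𝒜 (p + 1)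
  leibniz_even : ∀ f ∈ 𝒜 0, ∀ h : A, X (f * h) = X f * h + f * X h
  leibniz_odd : ∀ f ∈ 𝒜 1, ∀ h : A, X (f * h) = X f * h - f * X h

/-- Labels of a complete list of independent generators. -/
inductive GenIx : Type
  | P (a : Fin 6)
  | Q (α i : Fin 4)
  | M (a b : Fin 6) (hab : a < b)
  | D
  | J (i j : Fin 4) (hij : i ≤ j)
  | S (α i : Fin 4)
  | K (a : Fin 6)

/-- The labels of the generators `X_{\underline a} = (M, D, J, S, K)` of the subgroup `H`. -/
def hIx : Set GenIx := {g | (∀ a, g ≠ GenIx.P a) ∧ ∀ α i, g ≠ GenIx.Q α i}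

variable (A) in
/-- A list of generators, acting on superfields: the covariant derivatives `P a = ∇_a`,
`Q α i = ∇_α^i`, and `M a b = M_{ab}`, `D`, `J i j = J^{ij}`, `S α i = S^α_i`, `K a = K_a`. -/
structure Gens where
  P : Fin 6 → Module.End ℂ A
  Q : Fin 4 → Fin 4 → Module.End ℂ A
  M : Fin 6 → Fin 6 → Module.End ℂ A
  D : Module.End ℂ A
  J : Fin 4 → Fin 4 → Module.End ℂ A
  S : Fin 4 → Fin 4 → Module.End ℂ A
  K : Fin 6 → Module.End ℂ A

namespace Gens

/-- The independent generators as one family. -/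
def gen (G : Gens A) : GenIx → Module.End ℂ A
  | .P a => G.P a
  | .Q α i => G.Q α i
  | .M a b _ => G.M a b
  | .D => G.D
  | .J i j _ => G.J i j
  | .S α i => G.S α i
  | .K a => G.K a

/-- `∇_{αβ} = (γ^a)_{αβ} ∇_a`. -/
def Pss (G : Gens A) (α β : Fin 4) : Module.End ℂ A := ∑ a, gU a α β • G.P a

/-- `M_α^β = -¼ (γ^{ab})_α^β M_{ab}`. -/
def Mss (G : Gens A) (α β : Fin 4) : Module.End ℂ A :=
  ∑ a, ∑ b, ∑ c, ∑ d, (-(1 / 4) * eta a c * eta b d * gam2 c d α β) • G.M a b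

/-- `J_i^j = Ω_{ik} J^{kj}`. -/
def Jmix (G : Gens A) (i j : Fin 4) : Module.End ℂ A := low (fun k => G.J k j) i

/-- `S^{α i} = Ω^{ij} S^α_j`. -/
def Sup (G : Gens A) (α i : Fin 4) : Module.End ℂ A := raise (G.S α) i

/-- `∇_{α i} = Ω_{ij} ∇_α^j`. -/
def Qlow (G : Gens A) (α i : Fin 4) : Module.End ℂ A := low (G.Q α) i

/-- `K^a`. -/
def Kup (G : Gens A) (a : Fin 6) : Module.End ℂ A := upV G.K a

/-- The bosonic algebra of Lorentz transformations, dilatations and `R`-symmetry. -/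
structure IsBosonic (G : Gens A) : Prop where
  M_antisymm : ∀ a b, G.M a b = -G.M b a
  J_symm : ∀ i j, G.J i j = G.J j i
  MM : ∀ a b c d, comm (G.M a b) (G.M c d) =
    vrot a b (fun e => G.M e d) c - vrot a b (fun e => G.M e c) d
  JJ : ∀ i j k l, comm (G.J i j) (G.J k l) =
    jrot i j (fun m => G.J m l) k + jrot i j (fun m => G.J m k) l
  MD : ∀ a b, comm (G.M a b) G.D = 0
  MJ : ∀ a b i j, comm (G.M a b) (G.J i j) = 0
  DJ : ∀ i j, comm G.D (G.J i j) = 0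

/-- `M`, `D` and `J` act on `∇_a`, `∇_α^i`, `S^α_i`, `K_a` as the indices and the dilatation
dimensions `1, ½, -½, -1` dictate. -/
structure IsCovariant (G : Gens A) : Prop where
  MP : ∀ a b c, comm (G.M a b) (G.P c) = vrot a b G.P c
  DP : ∀ c, comm G.D (G.P c) = G.P c
  JP : ∀ i j c, comm (G.J i j) (G.P c) = 0
  MQ : ∀ a b γ k, comm (G.M a b) (G.Q γ k) =
    (-(1 / 2) : ℂ) • ∑ δ, gam2 a b γ δ • G.Q δ k
  DQ : ∀ γ k, comm G.D (G.Q γ k) = (1 / 2 : ℂ) • G.Q γ k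
  JQ : ∀ i j γ k, comm (G.J i j) (G.Q γ k) = jrot i j (G.Q γ) k
  MS : ∀ a b γ k, comm (G.M a b) (G.S γ k) =
    (-(1 / 2) : ℂ) • ∑ δ, gamt2 a b γ δ • G.S δ k
  DS : ∀ γ k, comm G.D (G.S γ k) = (-(1 / 2) : ℂ) • G.S γ k
  JS : ∀ i j γ k, comm (G.J i j) (G.S γ k) =
    (1 / 2 : ℂ) • (kd k i • G.Sup γ j + kd k j • G.Sup γ i)
  MK : ∀ a b c, comm (G.M a b) (G.K c) = vrot a b G.K c
  DK : ∀ c, comm G.D (G.K c) = -G.K c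
  JK : ∀ i j c, comm (G.J i j) (G.K c) = 0

/-- The algebra of the special conformal generators. -/
structure IsSpecialConformal (G : Gens A) : Prop where
  SS : ∀ α i β j, acomm (G.S α i) (G.S β j) =
    (-2 * Complex.I * OmL i j) • ∑ c, gtU c α β • G.K c
  SK : ∀ α i a, comm (G.S α i) (G.K a) = 0
  KK : ∀ a b, comm (G.K a) (G.K b) = 0

/-- `2 η_{ab} D + 2 M_{ab}`: the value of `[K_a, P_b]` in the superconformal algebra. -/
def flatKP (G : Gens A) (a b : Fin 6) : Module.End ℂ A :=
  (2 * eta a b) • G.D + (2 : ℂ) • G.M a b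

/-- `-i (γ_a)_{αβ} S^{βi}`: the value of `[K_a, Q_α^i]`. -/
def flatKQ (G : Gens A) (a : Fin 6) (α i : Fin 4) : Module.End ℂ A :=
  (-Complex.I) • ∑ β, gL a α β • G.Sup β i

/-- `2 δ^α_β δ^j_i D - 4 δ^j_i M_β^α + 8 δ^α_β J_i^j`: the value of `{S^α_i, Q_β^j}`. -/
def flatSQ (G : Gens A) (α i β j : Fin 4) : Module.End ℂ A :=
  (2 * kd α β * kd i j) • G.D - (4 * kd i j) • G.Mss β α + (8 * kd α β) • G.Jmix i j

/-- `-i (γ̃_b)^{αβ} Q_β^i`: the value of `[S^{αi}, P_b]`. -/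
def flatSP (G : Gens A) (α i : Fin 4) (b : Fin 6) : Module.End ℂ A :=
  (-Complex.I) • ∑ β, gtL b α β • G.Q β i

/-- `-2 i Ω^{ij} (γ^a)_{αβ} P_a`: the value of `{Q_α^i, Q_β^j}`. -/
def flatQQ (G : Gens A) (α i β j : Fin 4) : Module.End ℂ A :=
  (-2 * Complex.I * OmU i j) • G.Pss α β

end Gens

/-! ## The super-Weyl tensor and its descendants -/

/-- `X_α^{βγ i} = ∇_α^j W^{βγ i}_j`. -/
def X36 (G : Gens A) (W : Fin 4 → Fin 4 → Fin 4 → Fin 4 → A) (α β γ i : Fin 4) : A :=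
  ∑ j, G.Q α j (low (fun k => W β γ i k) j)

/-- `X^{α i,jk} = ∇_β^i W^{αβ jk}`. -/
def X16 (G : Gens A) (W : Fin 4 → Fin 4 → Fin 4 → Fin 4 → A) (α i j k : Fin 4) : A :=
  ∑ β, G.Q β i (W α β j k)

/-- `Y_α^{β ij} = ∇_α^k X^{β (i,j)}_k`. -/
def Y15 (G : Gens A) (W : Fin 4 → Fin 4 → Fin 4 → Fin 4 → A) (α β i j : Fin 4) : A :=
  (1 / 2 : ℂ) • ∑ k, G.Q α k (low (fun l => X16 G W β i j l) k + low (fun l => X16 G W β j i l) k)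

/-- `W_{abc}^{ij} = ⅛ (γ_{abc})_{αβ} W^{αβ ij}`, an anti-self-dual three-form. -/
def Wvec (W : Fin 4 → Fin 4 → Fin 4 → Fin 4 → A) (a b c : Fin 6) (i j : Fin 4) : A :=
  (1 / 8 : ℂ) • ∑ α, ∑ β, gam3 a b c α β • W α β i j

/-- `T_{abc}^{ij} = (i/2) W_{abc}^{ij}`. -/
def Tvec (W : Fin 4 → Fin 4 → Fin 4 → Fin 4 → A) (a b c : Fin 6) (i j : Fin 4) : A :=
  (Complex.I / 2) • Wvec W a b c i j

/-- `T_{aef}^{ij} T^{cef}_{ij}` (first index lower, second index upper). -/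
def TT (W : Fin 4 → Fin 4 → Fin 4 → Fin 4 → A) (a c : Fin 6) : A :=
  ∑ c', ∑ e, ∑ e', ∑ f, ∑ f', ∑ i, ∑ j, (eta c c' * eta e e' * eta f f') •
    (Tvec W a e f i j * low2 (Tvec W c' e' f') i j)

/-- `(γ_a)_{αβ} (γ_b)_{γδ} W^{αγ ij} W^{βδ}_{ij}`. -/
def WW (W : Fin 4 → Fin 4 → Fin 4 → Fin 4 → A) (a b : Fin 6) : A :=
  ∑ α, ∑ β, ∑ γ, ∑ δ, ∑ i, ∑ j, (gL a α β * gL b γ δ) • (W α γ i j * low2 (W β δ) i j)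

/-- `-W_{αβ}^{ij} - G_{αβ}^{ij}`: the curvature operator in `{∇_α^i, ∇_β^j}`, that is
`-½ ε_{αβγε} W^{γδ ij} M_δ^ε + (1/40) ε_{αβγδ} X^{γ k,ij} S^δ_k
+ (3/40) (γ_a)_{γ[α} ∇_{β]δ} W^{δγ ij} K^a - (i/480) (γ_a)_{γ(α} Y_{β)}^{γ ij} K^a`. -/
def curvQQ (G : Gens A) (W : Fin 4 → Fin 4 → Fin 4 → Fin 4 → A) (α i β j : Fin 4) :
    Module.End ℂ A :=
  (∑ γ, ∑ δ, ∑ ε, (-(1 / 2) * lc α β γ ε) • (W γ δ i j • G.Mss δ ε))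
  + (∑ γ, ∑ δ, ∑ k, ((1 / 40) * lc α β γ δ) • (X16 G W γ k i j • G.S δ k))
  + (∑ a, ((3 / 80 : ℂ) • ∑ γ, ∑ δ,
        (gL a γ α • G.Pss β δ (W δ γ i j) - gL a γ β • G.Pss α δ (W δ γ i j))) • G.Kup a)
  + (∑ a, ((-Complex.I / 960) • ∑ γ,
        (gL a γ α • Y15 G W β γ i j + gL a γ β • Y15 G W α γ i j)) • G.Kup a)

/-- The commutators `[K^A, ∇_B]`, with their structure functions. -/
structure HasStructureFunctions (G : Gens A) (W : Fin 4 → Fin 4 → Fin 4 → Fin 4 → A) : Prop where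
  KP : ∀ a b, comm (G.K a) (G.P b) = G.flatKP a b
  KQ : ∀ a α i, comm (G.K a) (G.Q α i) = G.flatKQ a α i
  /-- `{S^α_i, ∇_β^j} = … + (i/10) (γ_c)_{βγ} W^{αγ}_i^j K^c`. -/
  SQ : ∀ α i β j, acomm (G.S α i) (G.Q β j) = G.flatSQ α i β j +
    ∑ c, ((Complex.I / 10) • ∑ γ, gL c β γ • low (fun k => W α γ k j) i) • G.Kup c
  /-- `[S^{iα}, ∇_b] = … + (i/40) (γ_b)_{βγ} W^{αβ ij} S^γ_j
  + (1/160) (γ_{bc})_β^γ X_γ^{αβ i} K^c`. -/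
  SP : ∀ α i b, comm (G.Sup α i) (G.P b) = G.flatSP α i b +
    (∑ β, ∑ γ, ∑ j, ((Complex.I / 40) * gL b β γ) • (W α β i j • G.S γ j)) +
    ∑ c, ((1 / 160 : ℂ) • ∑ β, ∑ γ, gam2 b c β γ • X36 G W γ α β i) • G.Kup c

/-- The covariant fields: polynomials without constant term in the super-Weyl tensor and its
descendants `∇_A ⋯ ∇_B W`. -/
inductive IsCovField (G : Gens A) (W : Fin 4 → Fin 4 → Fin 4 → Fin 4 → A) : A → Prop
  | weyl (α β i j : Fin 4) : IsCovField G W (W α β i j)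
  | add {f h : A} : IsCovField G W f → IsCovField G W h → IsCovField G W (f + h)
  | smul (c : ℂ) {f : A} : IsCovField G W f → IsCovField G W (c • f)
  | mul {f h : A} : IsCovField G W f → IsCovField G W h → IsCovField G W (f * h)
  | nabla_vector (a : Fin 6) {f : A} : IsCovField G W f → IsCovField G W (G.P a f)
  | nabla_spinor (α i : Fin 4) {f : A} : IsCovField G W f → IsCovField G W (G.Q α i f)

/-- The operators `∑ f^g X_g`, where `g` runs over the generators with label in `s` and the
coefficients `f^g` satisfy `F`. -/
def fieldSpan (F : A → Prop) (G : Gens A) (s : Set GenIx) : Submodule ℂ (Module.End ℂ A) :=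
  Submodule.span ℂ {T | ∃ f, F f ∧ ∃ g ∈ s, T = f • G.gen g}

/-- The generators `G` form a gauged superconformal algebra
`[X_a, X_b] = -f_{ab}^c X_c`, `[X_a, ∇_B] = -f_{aB}^C ∇_C - f_{aB}^c X_c - F_{aB}^c X_c`,
`[∇_A, ∇_B] = -T_{AB}^C ∇_C - R_{AB}^c X_c`, where the `f` are the structure constants of the
superconformal algebra, `F` vanishes when `X_a` is `M`, `D` or `J`, and the structure functions
`F`, the curvatures `R` and the torsions `T` (up to the constant torsion in `{∇_α^i, ∇_β^j}`) are
built from fields satisfying `F`.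
The generators are operators on superfields and the brackets are their graded commutators, so the
graded Jacobi identities of nested brackets, which include the Bianchi identities
`[∇_A, [∇_B, ∇_C]] + (graded perms) = 0`, hold for the resulting `f`, `F`, `T` and `R`. -/
structure IsGaugedAlgebra (F : A → Prop) (G : Gens A) : Prop where
  bosonic : G.IsBosonic
  covariant : G.IsCovariant
  special : G.IsSpecialConformal
  independent : LinearIndependent A G.gen
  KP : ∀ a b, comm (G.K a) (G.P b) - G.flatKP a b ∈ fieldSpan F G hIx
  KQ : ∀ a α i, comm (G.K a) (G.Q α i) - G.flatKQ a α i ∈ fieldSpan F G hIx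
  SQ : ∀ α i β j, acomm (G.S α i) (G.Q β j) - G.flatSQ α i β j ∈ fieldSpan F G hIx
  SP : ∀ α i b, comm (G.Sup α i) (G.P b) - G.flatSP α i b ∈ fieldSpan F G hIx
  QQ : ∀ α i β j, acomm (G.Q α i) (G.Q β j) - G.flatQQ α i β j ∈ fieldSpan F G Set.univ
  QP : ∀ α i b, comm (G.Q α i) (G.P b) ∈ fieldSpan F G Set.univ
  PP : ∀ a b, comm (G.P a) (G.P b) ∈ fieldSpan F G Set.univ

/-- An expansion of `[∇_a, ∇_b]` into torsions and curvatures: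
`[∇_a, ∇_b] = -R(P)_{ab}^c ∇_c - R(Q)_{ab}^γ_k ∇_γ^k - ½ R(M)_{ab}^{cd} M_{cd}
- R(J)_{ab ij} J^{ij} - R(D)_{ab} D - R(S)_{ab γ}^k S^γ_k - R(K)_{ab}^c K_c`. -/
structure VectorCurvature (G : Gens A) where
  RP : Fin 6 → Fin 6 → Fin 6 → A
  RQ : Fin 6 → Fin 6 → Fin 4 → Fin 4 → A
  RM : Fin 6 → Fin 6 → Fin 6 → Fin 6 → A
  RJ : Fin 6 → Fin 6 → Fin 4 → Fin 4 → A
  RD : Fin 6 → Fin 6 → A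
  RS : Fin 6 → Fin 6 → Fin 4 → Fin 4 → A
  RK : Fin 6 → Fin 6 → Fin 6 → A
  RM_antisymm : ∀ a b c d, RM a b c d = -RM a b d c
  RJ_symm : ∀ a b i j, RJ a b i j = RJ a b j i
  expansion : ∀ a b, comm (G.P a) (G.P b) =
    -(∑ c, RP a b c • G.P c) - (∑ γ, ∑ k, RQ a b γ k • G.Q γ k)
    - (1 / 2 : ℂ) • (∑ c, ∑ d, RM a b c d • G.M c d) - (∑ i, ∑ j, RJ a b i j • G.J i j)
    - RD a b • G.D - (∑ γ, ∑ k, RS a b γ k • G.S γ k) - (∑ c, RK a b c • G.K c)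

/-- The trace `R(M)_{ad}^{cd}`. -/
def VectorCurvature.traceRM {G : Gens A} (R : VectorCurvature G) (a c : Fin 6) : A :=
  ∑ d, R.RM a d c d

end Operators

/-! ## 6D N=(2,0) conformal superspace -/

/-- A 6D `N = (2,0)` conformal superspace, as the gauged superconformal algebra acting on
superfields.  `A` is the supercommutative `*`-algebra of complex superfields, graded by statistics
(`star` is Grassmann conjugation, which reverses products).  The generators act on `A` by graded
derivations and are linearly independent over `A`.  The super-Weyl tensor `W α β i j = W^{αβ ij}`
is a primary of dimension `1`, symmetric in its spinor indices and an `Ω`-traceless two-form in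
its `USp(4)` indices, which obeys the superspace constraint. -/
structure ConformalSuperspace {A : Type*} [Ring A] [StarRing A] [Algebra ℂ A] [StarModule ℂ A]
    (𝒜 : ZMod 2 → Submodule ℂ A) [GradedAlgebra 𝒜] extends Gens A where
  W : Fin 4 → Fin 4 → Fin 4 → Fin 4 → A
  -- the superalgebra of superfields
  even_comm : ∀ f ∈ 𝒜 0, ∀ h : A, f * h = h * f
  odd_comm : ∀ f ∈ 𝒜 1, ∀ h ∈ 𝒜 1, f * h = -(h * f)
  star_mem : ∀ p, ∀ f ∈ 𝒜 p, star f ∈ 𝒜 p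
  -- the generators
  P_der : ∀ a, IsEvenDer 𝒜 (P a)
  Q_der : ∀ α i, IsOddDer 𝒜 (Q α i)
  M_der : ∀ a b, IsEvenDer 𝒜 (M a b)
  D_der : IsEvenDer 𝒜 D
  J_der : ∀ i j, IsEvenDer 𝒜 (J i j)
  S_der : ∀ α i, IsOddDer 𝒜 (S α i)
  K_der : ∀ a, IsEvenDer 𝒜 (K a)
  independent : LinearIndependent A toGens.gen
  -- the super-Weyl tensor
  W_even : ∀ α β i j, W α β i j ∈ 𝒜 0
  W_symm : ∀ α β i j, W α β i j = W β α i j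
  W_antisymm : ∀ α β i j, W α β i j = -W α β j i
  W_traceless : ∀ α β, ∑ i, ∑ j, OmL i j • W α β i j = 0
  M_W : ∀ a b α β i j, M a b (W α β i j) =
    (-(1 / 2) : ℂ) • ∑ δ, (gamt2 a b α δ • W δ β i j + gamt2 a b β δ • W α δ i j)
  D_W : ∀ α β i j, D (W α β i j) = W α β i j
  J_W : ∀ i j α β k l, J i j (W α β k l) =
    jrot i j (fun m => W α β m l) k + jrot i j (fun m => W α β k m) l
  S_W : ∀ γ k α β i j, S γ k (W α β i j) = 0
  -- `∇_α^i W^{αβ j}_i = 0`, and `∇_α^i W^{βγ jk}` has only the two descendants `X`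
  constraint_trace : ∀ β j, ∑ α, ∑ i, Q α i (low (fun k => W α β j k) i) = 0
  constraint : ∀ α i β γ j k, Q α i (W β γ j k) =
    ((1 / 5) * OmU j k) • X36 toGens W α β γ i
    + (2 / 5 : ℂ) • (OmU i j • X36 toGens W α β γ k - OmU i k • X36 toGens W α β γ j)
    + (1 / 5 : ℂ) • (kd α β • X16 toGens W γ i j k + kd α γ • X16 toGens W β i j k)
  -- the gauged algebra
  bosonic : toGens.IsBosonic
  covariant : toGens.IsCovariant
  special : toGens.IsSpecialConformal
  structureFunctions : HasStructureFunctions toGens W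
  QQ : ∀ α i β j, acomm (Q α i) (Q β j) = toGens.flatQQ α i β j + curvQQ toGens W α i β j
  -- the reality conditions
  P_real : ∀ a f, star (P a f) = P a (star f)
  M_real : ∀ a b f, star (M a b f) = M a b (star f)
  D_real : ∀ f, star (D f) = D (star f)
  J_real : ∀ i j f, star (J i j f) = low2 J i j (star f)
  K_real : ∀ a f, star (K a f) = K a (star f)
  Q_real_even : ∀ α i, ∀ f ∈ 𝒜 0, star (Q α i f) =
    -∑ β, Bmat α β • toGens.Qlow β i (star f)
  Q_real_odd : ∀ α i, ∀ f ∈ 𝒜 1, star (Q α i f) =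
    ∑ β, Bmat α β • toGens.Qlow β i (star f)
  W_real : ∀ a b c i j, star (Wvec W a b c i j) = -low2 (Wvec W a b c) i j

section Deformations

variable {A : Type*} [Ring A] [StarRing A] [Algebra ℂ A] [StarModule ℂ A]
  {𝒜 : ZMod 2 → Submodule ℂ A} [GradedAlgebra 𝒜]

namespace ConformalSuperspace

/-- The covariant fields of a conformal superspace. -/
def IsCov (𝒮 : ConformalSuperspace 𝒜) : A → Prop := IsCovField 𝒮.toGens 𝒮.W

/-- `G` is obtained from the generators of `𝒮` by keeping `M`, `D`, `J` fixed and adding to each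
of `∇_a`, `∇_α^i`, `S^α_i`, `K_a` a combination of the generators whose coefficients are covariant
fields, such that the new `∇_a` is real. -/
structure IsFieldDeformation (𝒮 : ConformalSuperspace 𝒜) (G : Gens A) : Prop where
  M_eq : G.M = 𝒮.M
  D_eq : G.D = 𝒮.D
  J_eq : G.J = 𝒮.J
  P_sub : ∀ a, G.P a - 𝒮.P a ∈ fieldSpan 𝒮.IsCov 𝒮.toGens Set.univ
  Q_sub : ∀ α i, G.Q α i - 𝒮.Q α i ∈ fieldSpan 𝒮.IsCov 𝒮.toGens Set.univ
  S_sub : ∀ α i, G.S α i - 𝒮.S α i ∈ fieldSpan 𝒮.IsCov 𝒮.toGens Set.univ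
  K_sub : ∀ a, G.K a - 𝒮.K a ∈ fieldSpan 𝒮.IsCov 𝒮.toGens Set.univ
  P_real : ∀ a f, star (G.P a f) = G.P a (star f)

/-- `∇̂_a = ∇_a - λ (γ_a)_{αβ} (γ_b)_{γδ} W^{αγ ij} W^{βδ}_{ij} K^b`. -/
def hatP (𝒮 : ConformalSuperspace 𝒜) (lam : ℝ) (a : Fin 6) : Module.End ℂ A :=
  𝒮.P a - (lam : ℂ) • ∑ b, WW 𝒮.W a b • 𝒮.Kup b

/-- The generators with `∇_a` replaced by `∇̂_a` and all others unchanged. -/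
def deformed (𝒮 : ConformalSuperspace 𝒜) (lam : ℝ) : Gens A :=
  { 𝒮.toGens with P := 𝒮.hatP lam }

end ConformalSuperspace

end Deformations

end SixD

end

open scoped BigOperators

noncomputable section

namespace SixD

section

/-! ## Numerical identities for the gamma matrices -/

section Gamma

/-! Dimension and representation theory leave almost nothing to deform. A covariant field is a sum
of eigenvectors of `D`, the lowest being `W` of dimension 1. If the deformed generators are
covariant under `M`, `D`, `J`, then the coefficients of a deformation are covariant tensors of
prescribed dimension. The generators `P`, `Q`, (`M`, `D`, `J`), `S`, `K` have dimensions 1, 1/2, 0,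
-1/2, -1. A correction of `S` or `K` would therefore need a coefficient of dimension at most 1/2,
and there is none. A correction of `Q` may contain `S` (coefficient of dimension 1) and `K`
(dimension 3/2). A correction of `P` may contain `M`, `D`, `J` (dimension 1), `S` (dimension 3/2)
and `K` (dimension 2).

Up to dimension two the fields are spanned by `W`, by its spinor gradient, by its double spinor
gradient and by products of two `W`, because the vector derivative is eliminated through the
anticommutator of two spinor derivatives (`cov_classification`). The tensors needed are then sought
in these spaces. For `USp(4)` this is classical invariant theory: the unitary trick and
`invariant_rank_four` give `mem_span_contractions`. For the Lorentz algebra, which is sl(4) on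
complex spinors, quadratic Casimir eigenvalues and weights are compared. The outcome is that
dimension 1 contains no `USp(4)` singlet, no adjoint and no tensor with two lower spinor indices
(`cov_two_singlet`, `cov_two_adjoint`, `cov_two_lower_lower`); dimension 3/2 contains no
vector-spinor in the fundamental of `USp(4)` (`cov_three_vector_spinor`); and in dimension 2 the
only singlet with two vector indices is `WW`, up to a factor (`exists_eq_smul_WW`). This is rigidity
(`spinor_rigidity`, `vector_rigidity`). Reality of the vector derivative makes the factor real, or
the correction zero.

Conversely the correction `shift` works: `WW` is real and annihilated by `S` and `K`, so `shift`
commutes with `S`, `K` and with itself. Closure of the original algebra follows from Jacobi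
identities, since `P` is an anticommutator of two `Q` up to curvature: the identity for three `Q` is
solved for `[Q, P]` (`comm_Q_Pss`), and this gives `[P, P]` (`comm_PP_mem`).

The same classification gives the conventional constraints: R(P) is a singlet of dimension 1, and
the gamma trace of R(Q) is a vector-spinor of dimension 3/2, so both vanish. For the trace of R(M),
the Bianchi identity of `Q`, `P`, `P` is projected on `Q` and traced over `USp(4)` (`bianchi_QPP`),
which removes the S-curvature and the J-curvature. A gamma trace then removes R(Q) and equates the
Ricci trace with a square of the torsion (`vecCurv_ricci`). The deformation shifts this trace by a
multiple of the same tensor, because `[P, K]` contains `M`. -/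

/-- The gamma matrices with Gaussian integer entries. -/
def gammaZ (a : Fin 6) (α β : Fin 4) : GaussianInt :=
  (![!![0, 0, 0, 1; 0, 0, -1, 0; 0, 1, 0, 0; -1, 0, 0, 0],
    !![0, 1, 0, 0; -1, 0, 0, 0; 0, 0, 0, 1; 0, 0, -1, 0],
    !![0, 0, 1, 0; 0, 0, 0, -1; -1, 0, 0, 0; 0, 1, 0, 0],
    !![0, 0, 0, 1; 0, 0, 1, 0; 0, -1, 0, 0; -1, 0, 0, 0],
    !![0, 0, ⟨0, 1⟩, 0; 0, 0, 0, ⟨0, 1⟩; ⟨0, -1⟩, 0, 0, 0; 0, ⟨0, -1⟩, 0, 0],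
    !![0, ⟨0, 1⟩, 0, 0; ⟨0, -1⟩, 0, 0, 0; 0, 0, 0, ⟨0, -1⟩; 0, 0, ⟨0, 1⟩, 0]] :
      Fin 6 → Matrix (Fin 4) (Fin 4) GaussianInt) a α β

/-- The diagonal of the flat metric. -/
def etaZ (a : Fin 6) : GaussianInt := if a = 0 then -1 else 1

/-- The Levi-Civita symbol with integer values. -/
def lcZ (α β γ δ : Fin 4) : ℤ :=
  (((β.val : ℤ) - α.val) * ((γ.val : ℤ) - α.val) * ((δ.val : ℤ) - α.val) *
    ((γ.val : ℤ) - β.val) * ((δ.val : ℤ) - β.val) * ((δ.val : ℤ) - γ.val)) / 12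

/-- Kronecker delta with Gaussian integer values. -/
def kdZ (i j : Fin 4) : GaussianInt := if i = j then 1 else 0

/-- The gamma matrices with upper spinor indices and Gaussian integer entries. -/
def gammatZ (a : Fin 6) (α β : Fin 4) : GaussianInt :=
  (![!![0, 0, 0, -1; 0, 0, 1, 0; 0, -1, 0, 0; 1, 0, 0, 0],
    !![0, 1, 0, 0; -1, 0, 0, 0; 0, 0, 0, 1; 0, 0, -1, 0],
    !![0, 0, 1, 0; 0, 0, 0, -1; -1, 0, 0, 0; 0, 1, 0, 0],
    !![0, 0, 0, 1; 0, 0, 1, 0; 0, -1, 0, 0; -1, 0, 0, 0],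
    !![0, 0, ⟨0, -1⟩, 0; 0, 0, 0, ⟨0, -1⟩; ⟨0, 1⟩, 0, 0, 0; 0, ⟨0, 1⟩, 0, 0],
    !![0, ⟨0, -1⟩, 0, 0; ⟨0, 1⟩, 0, 0, 0; 0, 0, 0, ⟨0, 1⟩; 0, 0, ⟨0, -1⟩, 0]] :
      Fin 6 → Matrix (Fin 4) (Fin 4) GaussianInt) a α β

/-- Twice `γ_{ab}`, with Gaussian integer entries. -/
def gammaTwoZ (a b : Fin 6) (α β : Fin 4) : GaussianInt :=
  ∑ z, (etaZ a * etaZ b) * (gammaZ a α z * gammatZ b z β - gammaZ b α z * gammatZ a z β)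

/-- Twice the antisymmetrized product with upper first index, with Gaussian integer entries. -/
def gammatTwoZ (a b : Fin 6) (α β : Fin 4) : GaussianInt :=
  ∑ z, (etaZ a * etaZ b) * (gammatZ a α z * gammaZ b z β - gammatZ b α z * gammaZ a z β)

local notation "toC" => GaussianInt.toComplex

/-- The metric, the Levi-Civita symbol and the gamma matrices have Gaussian integer entries, where
equality is decidable. Carrying them along `GaussianInt.toComplex` turns each finite identity over
the complex numbers into a kernel computation; the products with two gamma matrices are doubled to
stay integral. -/
theorem eta_eq_toComplex (a b : Fin 6) : eta a b = if a = b then toC (etaZ a) else 0 := by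
  unfold eta etaZ; split_ifs <;> simp

theorem eta_comm (a b : Fin 6) : eta a b = eta b a := by
  by_cases h : a = b
  · rw [h]
  · simp [eta, h, Ne.symm h]

theorem eta_of_ne {a b : Fin 6} (h : a ≠ b) : eta a b = 0 := if_neg h

theorem eta_mul_self (a : Fin 6) : eta a a * eta a a = 1 := by
  unfold eta
  rw [if_pos rfl]
  split_ifs <;> simp

theorem kd_eq_toComplex (i j : Fin 4) : kd i j = toC (kdZ i j) := by
  unfold kd kdZ; split_ifs <;> simp

theorem gU_eq_toComplex (a : Fin 6) (α β : Fin 4) : gU a α β = toC (gammaZ a α β) := by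
  fin_cases a <;> fin_cases α <;> fin_cases β <;>
    simp [gU, gammaZ, GaussianInt.toComplex_def]

theorem lc_eq_toComplex (α β γ δ : Fin 4) : lc α β γ δ = toC (lcZ α β γ δ : ℤ) := by
  have h : ∀ α β γ δ : Fin 4, (((β.val : ℤ) - α.val) * ((γ.val : ℤ) - α.val) *
      ((δ.val : ℤ) - α.val) * ((γ.val : ℤ) - β.val) * ((δ.val : ℤ) - β.val) *
      ((δ.val : ℤ) - γ.val)) = 12 * lcZ α β γ δ := by decide +kernel
  unfold lc
  rw [h]
  push_cast
  simp

theorem gtU_eq_toComplex (a : Fin 6) (α β : Fin 4) : gtU a α β = toC (gammatZ a α β) := by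
  have h : ∀ (a : Fin 6) (α β : Fin 4), 2 * gammatZ a α β =
      ∑ γ, ∑ δ, ((lcZ α β γ δ : ℤ) : GaussianInt) * gammaZ a γ δ := by decide +kernel
  have h2 := congrArg toC (h a α β)
  simp only [map_mul, map_sum, map_ofNat] at h2
  simp only [gtU, Matrix.of_apply, gU_eq_toComplex, lc_eq_toComplex]
  rw [← h2]; ring

theorem gL_apply (a : Fin 6) (α β : Fin 4) : gL a α β = eta a a * gU a α β := by
  unfold gL
  rw [Matrix.sum_apply, Finset.sum_eq_single a]
  · simp
  · intro b _ h; simp [eta_of_ne h.symm]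
  · simp

theorem gtL_apply (a : Fin 6) (α β : Fin 4) : gtL a α β = eta a a * gtU a α β := by
  unfold gtL
  rw [Matrix.sum_apply, Finset.sum_eq_single a]
  · simp
  · intro b _ h; simp [eta_of_ne h.symm]
  · simp

theorem gL_eq_toComplex (a : Fin 6) (α β : Fin 4) :
    gL a α β = toC (etaZ a * gammaZ a α β) := by
  simp [gL_apply, eta_eq_toComplex, gU_eq_toComplex]

theorem gtL_eq_toComplex (a : Fin 6) (α β : Fin 4) :
    gtL a α β = toC (etaZ a * gammatZ a α β) := by
  simp [gtL_apply, eta_eq_toComplex, gtU_eq_toComplex]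

theorem gam2_eq_toComplex (a b : Fin 6) (α β : Fin 4) :
    gam2 a b α β = (1 / 2) * toC (gammaTwoZ a b α β) := by
  simp only [gam2, gammaTwoZ, Matrix.smul_apply, Matrix.sub_apply, Matrix.mul_apply, smul_eq_mul,
    gL_eq_toComplex, gtL_eq_toComplex, map_sum, map_mul, map_sub]
  rw [← Finset.sum_sub_distrib]
  congr 1
  exact Finset.sum_congr rfl fun _ _ => by ring

theorem gamt2_eq_toComplex (a b : Fin 6) (α β : Fin 4) :
    gamt2 a b α β = (1 / 2) * toC (gammatTwoZ a b α β) := by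
  simp only [gamt2, gammatTwoZ, Matrix.smul_apply, Matrix.sub_apply, Matrix.mul_apply, smul_eq_mul,
    gL_eq_toComplex, gtL_eq_toComplex, map_sum, map_mul, map_sub]
  rw [← Finset.sum_sub_distrib]
  congr 1
  exact Finset.sum_congr rfl fun _ _ => by ring

theorem gU_antisymm (a : Fin 6) (α β : Fin 4) : gU a α β = -gU a β α := by
  have h : ∀ (a : Fin 6) (α β : Fin 4), gammaZ a α β = -gammaZ a β α := by decide +kernel
  rw [gU_eq_toComplex, gU_eq_toComplex, h, map_neg]

theorem gL_antisymm (a : Fin 6) (α β : Fin 4) : gL a α β = -gL a β α := by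
  rw [gL_apply, gL_apply, gU_antisymm]; ring

theorem gtU_antisymm (a : Fin 6) (α β : Fin 4) : gtU a α β = -gtU a β α := by
  have h : ∀ (a : Fin 6) (α β : Fin 4), gammatZ a α β = -gammatZ a β α := by decide +kernel
  rw [gtU_eq_toComplex, gtU_eq_toComplex, h, map_neg]

theorem gtL_antisymm (a : Fin 6) (α β : Fin 4) : gtL a α β = -gtL a β α := by
  rw [gtL_apply, gtL_apply, gtU_antisymm]; ring

/-- The six gamma matrices form a basis of the antisymmetric 4×4 matrices, so a contracted pair of
vector indices is the invariant ε. This converts later vector contractions into spinor algebra. -/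
theorem gU_completeness (α β γ δ : Fin 4) : ∑ a, gU a α β * gL a γ δ = 2 * lc α β γ δ := by
  have h : ∀ α β γ δ : Fin 4, ∑ a, gammaZ a α β * (etaZ a * gammaZ a γ δ) =
      2 * ((lcZ α β γ δ : ℤ) : GaussianInt) := by decide +kernel
  have h2 := congrArg toC (h α β γ δ)
  simpa only [map_sum, map_mul, map_ofNat, gU_eq_toComplex, gL_eq_toComplex, lc_eq_toComplex]
    using h2

theorem gtU_completeness (α β γ δ : Fin 4) : ∑ a, gtU a α β * gtL a γ δ = 2 * lc α β γ δ := by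
  have h : ∀ α β γ δ : Fin 4, ∑ a, gammatZ a α β * (etaZ a * gammatZ a γ δ) =
      2 * ((lcZ α β γ δ : ℤ) : GaussianInt) := by decide +kernel
  have h2 := congrArg toC (h α β γ δ)
  simpa only [map_sum, map_mul, map_ofNat, gtU_eq_toComplex, gtL_eq_toComplex, lc_eq_toComplex]
    using h2

/-- The matrices with upper indices are, up to 4, the basis dual to the γ^a, so a vector is
recovered from its bispinor. -/
theorem gtL_gU_trace (a b : Fin 6) :
    ∑ α, ∑ β, gtL b α β * gU a α β = if a = b then 4 else 0 := by
  have h : ∀ a b : Fin 6, ∑ α, ∑ β, (etaZ b * gammatZ b α β) * gammaZ a α β =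
      if a = b then 4 else 0 := by decide +kernel
  have h2 := congrArg toC (h a b)
  simp only [map_sum, map_mul, apply_ite toC, map_ofNat, map_zero] at h2
  simp only [gU_eq_toComplex, gtL_eq_toComplex, map_mul]
  exact h2

theorem gL_eq_lc_gtL (a : Fin 6) (α β : Fin 4) :
    ∑ γ, ∑ δ, lc α β γ δ * gtL a γ δ = 2 * gL a α β := by
  have h : ∀ (a : Fin 6) (α β : Fin 4), ∑ γ, ∑ δ, ((lcZ α β γ δ : ℤ) : GaussianInt) *
      (etaZ a * gammatZ a γ δ) = 2 * (etaZ a * gammaZ a α β) := by decide +kernel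
  have h2 := congrArg toC (h a α β)
  simpa only [map_sum, map_mul, map_ofNat, gL_eq_toComplex, gtL_eq_toComplex, lc_eq_toComplex]
    using h2

/-- The fifteen γ_{ab} span the traceless 4×4 matrices: this is so(6) = sl(4) over the complex
numbers, and the term with 1/4 removes the trace. -/
theorem gam2_completeness (α β γ δ : Fin 4) :
    ∑ a, ∑ b, eta a a * eta b b * gam2 a b α β * gam2 a b γ δ =
      -8 * (kd α δ * kd β γ - (1 / 4) * (kd α β * kd γ δ)) := by
  have h : ∀ α β γ δ : Fin 4, ∑ a, ∑ b, etaZ a * etaZ b * gammaTwoZ a b α β * gammaTwoZ a b γ δ =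
      -32 * (kdZ α δ * kdZ β γ) + 8 * (kdZ α β * kdZ γ δ) := by decide +kernel
  have h2 := congrArg toC (h α β γ δ)
  simp only [map_sum, map_mul, map_add, map_neg, map_ofNat] at h2
  simp only [gam2_eq_toComplex, kd_eq_toComplex, eta_eq_toComplex, if_true]
  rw [show (-8 * (toC (kdZ α δ) * toC (kdZ β γ) - 1 / 4 * (toC (kdZ α β) * toC (kdZ γ δ))) : ℂ) =
    (1 / 4) * (-32 * (toC (kdZ α δ) * toC (kdZ β γ)) + 8 * (toC (kdZ α β) * toC (kdZ γ δ)))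
    by ring, ← h2]
  simp only [Finset.mul_sum]
  exact Finset.sum_congr rfl fun _ _ => Finset.sum_congr rfl fun _ _ => by ring

theorem gam2_trace (a b c d : Fin 6) :
    ∑ α, ∑ β, gam2 a b β α * gam2 c d α β = 4 * (eta b c * eta a d - eta a c * eta b d) := by
  have h : ∀ a b c d : Fin 6, ∑ α, ∑ β, gammaTwoZ a b β α * gammaTwoZ c d α β =
      16 * ((if b = c then etaZ b else 0) * (if a = d then etaZ a else 0) -
        (if a = c then etaZ a else 0) * (if b = d then etaZ b else 0)) := by decide +kernel
  have h2 := congrArg toC (h a b c d)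
  simp only [map_sum, map_mul, map_sub, apply_ite toC, map_ofNat, map_zero] at h2
  simp only [gam2_eq_toComplex, eta_eq_toComplex]
  rw [show ∀ x : ℂ, 4 * x = (1 / 4) * (16 * x) from fun x => by ring, ← h2]
  simp only [Finset.mul_sum]
  exact Finset.sum_congr rfl fun _ _ => Finset.sum_congr rfl fun _ _ => by ring

theorem gamt2_eq (a b : Fin 6) (α β : Fin 4) : gamt2 a b α β = -gam2 a b β α := by
  have h : ∀ (a b : Fin 6) (α β : Fin 4), gammatTwoZ a b α β = -gammaTwoZ a b β α := by
    decide +kernel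
  rw [gam2_eq_toComplex, gamt2_eq_toComplex, h, map_neg]; ring

/-- Invariance of the gamma matrices: rotating both spinor indices amounts to rotating the vector
index. -/
theorem gam2_gU (a b d : Fin 6) (α β : Fin 4) :
    (-(1 / 2) : ℂ) * ∑ z, (gam2 a b α z * gU d z β + gam2 a b β z * gU d α z) =
      eta a a * gU a α β * (if b = d then 1 else 0) -
        eta b b * gU b α β * (if a = d then 1 else 0) := by
  have h : ∀ (a b d : Fin 6) (α β : Fin 4),
      -∑ z, (gammaTwoZ a b α z * gammaZ d z β + gammaTwoZ a b β z * gammaZ d α z) =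
      4 * (etaZ a * gammaZ a α β * (if b = d then 1 else 0) -
        etaZ b * gammaZ b α β * (if a = d then 1 else 0)) := by decide +kernel
  have h2 := congrArg toC (h a b d α β)
  simp only [map_sum, map_mul, map_sub, map_add, map_neg, apply_ite toC, map_ofNat, map_zero,
    map_one] at h2
  simp only [gam2_eq_toComplex, gU_eq_toComplex, eta_eq_toComplex, if_true]
  rw [← mul_right_inj' (show (4 : ℂ) ≠ 0 by norm_num), ← h2, Finset.mul_sum, Finset.mul_sum,
    ← Finset.sum_neg_distrib]
  exact Finset.sum_congr rfl fun _ _ => by ring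

end Gamma

end

section

/-! ## Invariant theory of `USp(4)` for tensors of rank four -/

section Invariants

theorem OmU_antisymm (i j : Fin 4) : OmU i j = -OmU j i := by
  fin_cases i <;> fin_cases j <;> simp [OmU]

theorem OmL_antisymm (i j : Fin 4) : OmL i j = -OmL j i := by
  simp only [OmL, OmU_antisymm i j]

theorem OmU_mul_OmL (i k : Fin 4) : ∑ j, OmU i j * OmL j k = kd i k := by
  fin_cases i <;> fin_cases k <;> simp [OmU, OmL, kd, Fin.sum_univ_four]

theorem OmL_mul_OmU (i k : Fin 4) : ∑ j, OmL i j * OmU j k = kd i k := by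
  fin_cases i <;> fin_cases k <;> simp [OmU, OmL, kd, Fin.sum_univ_four]

theorem kd_comm (i j : Fin 4) : kd i j = kd j i := by simp [kd, eq_comm]

theorem sum_kd_smul {V : Type*} [AddCommGroup V] [Module ℂ V] (i : Fin 4) (v : Fin 4 → V) :
    ∑ j, kd i j • v j = v i := by simp [kd]

theorem sum_kd_smul' {V : Type*} [AddCommGroup V] [Module ℂ V] (i : Fin 4) (v : Fin 4 → V) :
    ∑ j, kd j i • v j = v i := by simp [kd]

theorem sum_kd_mul (i : Fin 4) (v : Fin 4 → ℂ) : ∑ j, kd i j * v j = v i := by simp [kd]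

theorem sum_kd_mul' (i : Fin 4) (v : Fin 4 → ℂ) : ∑ j, kd j i * v j = v i := by simp [kd]

/-- The matrix of `J^{ab}` on an upper `USp(4)` index. -/
def jmat (a b i p : Fin 4) : ℂ := (1 / 2) * (OmU i a * kd p b + OmU i b * kd p a)

theorem jrot_eq_sum {V : Type*} [AddCommGroup V] [Module ℂ V] (a b : Fin 4) (v : Fin 4 → V)
    (i : Fin 4) : jrot a b v i = ∑ p, jmat a b i p • v p := by
  simp only [jrot, jmat, mul_smul, add_smul, ← Finset.smul_sum, Finset.sum_add_distrib]
  congr 2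
  · rw [← sum_kd_smul' b v, Finset.smul_sum]
  · rw [← sum_kd_smul' a v, Finset.smul_sum]

/-- The partner of a `USp(4)` index. -/
def jflip : Fin 4 → Fin 4 := ![1, 0, 3, 2]

/-- These matrices span the complexification of the compact algebra usp(4), hence a space closed
under Hermitian conjugation. That is the input of the unitary trick. -/
theorem exists_jmat_adjoint (a b : Fin 4) :
    ∃ c : ℂ, ∀ i p, star (jmat a b p i) = c * jmat (jflip b) (jflip a) i p := by
  refine ⟨if a.val % 2 = b.val % 2 then -1 else 1, ?_⟩
  fin_cases a <;> fin_cases b <;> intro i p <;> fin_cases i <;> fin_cases p <;>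
    simp [jmat, jflip, OmU, kd] <;> norm_num

theorem sum_jmat_first (b : Fin 4) (m : Fin 4 → ℂ) :
    ∑ p, ∑ i, jmat p b i p * m i = (5 / 2) * ∑ i, OmU i b * m i := by
  rw [Finset.sum_comm, Finset.mul_sum]
  refine Finset.sum_congr rfl fun i _ => ?_
  rw [← Finset.sum_mul, ← mul_assoc]
  congr 1
  simp only [jmat, ← Finset.mul_sum, Finset.sum_add_distrib]
  have h : ∑ p, OmU i p * kd p b = OmU i b := by simp [kd]
  have h2 : ∑ p, kd p p = 4 := by simp [kd]
  rw [h, h2]; ring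

theorem sum_jmat_second (b q : Fin 4) (m : Fin 4 → Fin 4 → ℂ) :
    ∑ p, ∑ i, jmat p b i q * m p i =
      (1 / 2) * (kd q b * ∑ p, ∑ i, OmU i p * m p i + ∑ i, OmU i b * m q i) := by
  have h : ∑ i, OmU i b * m q i = ∑ p, ∑ i, kd q p * (OmU i b * m p i) := by
    simp only [← Finset.mul_sum]
    rw [sum_kd_mul q fun p => ∑ i, OmU i b * m p i]
  rw [h, Finset.mul_sum, ← Finset.sum_add_distrib, Finset.mul_sum]
  refine Finset.sum_congr rfl fun p _ => ?_
  rw [Finset.mul_sum, ← Finset.sum_add_distrib, Finset.mul_sum]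
  refine Finset.sum_congr rfl fun i _ => ?_
  unfold jmat; ring

theorem sum_OmU_OmL_mul (c : Fin 4) (m : Fin 4 → ℂ) :
    ∑ b, (∑ i, OmU i b * m i) * OmL b c = m c := by
  simp only [Finset.sum_mul]
  rw [Finset.sum_comm, ← sum_kd_mul' c m]
  refine Finset.sum_congr rfl fun i _ => ?_
  rw [← OmU_mul_OmL, Finset.sum_mul]
  exact Finset.sum_congr rfl fun b _ => by ring

theorem sum_kd_OmL (q c : Fin 4) (t : ℂ) : ∑ b, kd q b * t * OmL b c = t * OmL q c := by
  simp [kd]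

/-- Setting the first label of J^{ab} equal to the first tensor index and summing turns invariance
into one linear relation, 5 m_{cs} + m_{sc} + t Ω_{sc} = 0. Together with its transpose it
determines m. -/
theorem invariant_rank_two {m : Fin 4 → Fin 4 → ℂ}
    (h : ∀ a b r s, ∑ i, jmat a b i r * m i s + ∑ i, jmat a b i s * m r i = 0) :
    ∃ t : ℂ, ∀ r s, m r s = t * OmL r s := by
  set t := ∑ p, ∑ i, OmU i p * m p i with ht
  have key : ∀ c s, 5 * m c s + t * OmL s c + m s c = 0 := by
    intro c s
    have h1 : ∀ b, (5 / 2) * ∑ i, OmU i b * m i s +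
        (1 / 2) * (kd s b * t + ∑ i, OmU i b * m s i) = 0 := by
      intro b
      rw [ht, ← sum_jmat_second, ← sum_jmat_first, ← Finset.sum_add_distrib]
      exact Finset.sum_eq_zero fun p _ => h p b p s
    have h2 : ∑ b, (5 * ((∑ i, OmU i b * m i s) * OmL b c) + kd s b * t * OmL b c +
        (∑ i, OmU i b * m s i) * OmL b c) = 0 :=
      Finset.sum_eq_zero fun b _ => by linear_combination 2 * OmL b c * h1 b
    simp only [Finset.sum_add_distrib, ← Finset.mul_sum] at h2
    rwa [sum_OmU_OmL_mul c fun i => m i s, sum_OmU_OmL_mul c fun i => m s i,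
      sum_kd_OmL] at h2
  refine ⟨t / 4, fun r s => ?_⟩
  have h1 := key r s
  have h2 := key s r
  rw [OmL_antisymm s r] at h1
  linear_combination (5 / 24) * h1 - (1 / 24) * h2

theorem jmat_OmU (a b i q : Fin 4) :
    ∑ p, OmU q p * jmat a b i p + ∑ p, jmat a b q p * OmU p i = 0 := by
  have h1 : ∑ p, OmU q p * jmat a b i p = (1 / 2) * (OmU i a * OmU q b + OmU i b * OmU q a) := by
    have : ∀ p, OmU q p * jmat a b i p =
        (1 / 2) * (OmU i a * (kd p b * OmU q p) + OmU i b * (kd p a * OmU q p)) := fun p => by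
      unfold jmat; ring
    simp only [this, ← Finset.mul_sum, Finset.sum_add_distrib]
    rw [sum_kd_mul' b (OmU q), sum_kd_mul' a (OmU q)]
  have h2 : ∑ p, jmat a b q p * OmU p i = (1 / 2) * (OmU q a * OmU b i + OmU q b * OmU a i) := by
    have : ∀ p, jmat a b q p * OmU p i =
        (1 / 2) * (OmU q a * (kd p b * OmU p i) + OmU q b * (kd p a * OmU p i)) := fun p => by
      unfold jmat; ring
    simp only [this, ← Finset.mul_sum, Finset.sum_add_distrib]
    rw [sum_kd_mul' b fun p => OmU p i, sum_kd_mul' a fun p => OmU p i]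
  rw [h1, h2, OmU_antisymm b i, OmU_antisymm a i]; ring

theorem trace_jmat (a b : Fin 4) (m : Fin 4 → Fin 4 → ℂ) :
    ∑ p, ∑ q, OmU q p * (∑ i, jmat a b i p * m i q + ∑ i, jmat a b i q * m p i) = 0 := by
  simp only [mul_add, Finset.sum_add_distrib, Finset.mul_sum]
  have h1 : ∑ p, ∑ q, ∑ i, OmU q p * (jmat a b i p * m i q) =
      ∑ i, ∑ q, (∑ p, OmU q p * jmat a b i p) * m i q := by
    rw [Finset.sum_congr rfl fun p _ => Finset.sum_comm, Finset.sum_comm]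
    refine Finset.sum_congr rfl fun i _ => ?_
    rw [Finset.sum_comm]
    simp only [Finset.sum_mul, mul_assoc]
  have h2 : ∑ p, ∑ q, ∑ i, OmU q p * (jmat a b i q * m p i) =
      ∑ p, ∑ i, (∑ q, jmat a b i q * OmU q p) * m p i := by
    refine Finset.sum_congr rfl fun p _ => ?_
    rw [Finset.sum_comm]
    simp only [Finset.sum_mul]
    exact Finset.sum_congr rfl fun i _ => Finset.sum_congr rfl fun q _ => by ring
  rw [h1, h2, ← Finset.sum_add_distrib]
  refine Finset.sum_eq_zero fun p _ => ?_
  rw [← Finset.sum_add_distrib]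
  refine Finset.sum_eq_zero fun q _ => ?_
  rw [← add_mul, jmat_OmU, zero_mul]

/-- The infinitesimal action of `J^{ab}` on the coefficients of a contravariant rank four tensor. -/
def jact (a b : Fin 4) (n : Fin 4 → Fin 4 → Fin 4 → Fin 4 → ℂ) (p q r s : Fin 4) : ℂ :=
  ∑ i, jmat a b i p * n i q r s + ∑ i, jmat a b i q * n p i r s +
    ∑ i, jmat a b i r * n p q i s + ∑ i, jmat a b i s * n p q r i

/-- The contraction with Ω kills the action on the contracted indices (`trace_jmat`), so the partial
trace is an invariant of rank two. -/
theorem trace_invariant {n : Fin 4 → Fin 4 → Fin 4 → Fin 4 → ℂ}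
    (h : ∀ a b p q r s, jact a b n p q r s = 0) :
    ∃ t : ℂ, ∀ r s, ∑ p, ∑ q, OmU q p * n p q r s = t * OmL r s := by
  refine invariant_rank_two fun a b r s => ?_
  have h1 : ∑ p, ∑ q, OmU q p * jact a b n p q r s = 0 :=
    Finset.sum_eq_zero fun p _ => Finset.sum_eq_zero fun q _ => by rw [h, mul_zero]
  have h2 := trace_jmat a b fun p q => n p q r s
  have h3 : ∀ (k : Fin 4) (f : Fin 4 → Fin 4 → Fin 4 → ℂ),
      ∑ i, jmat a b i k * ∑ p, ∑ q, OmU q p * f p q i =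
      ∑ p, ∑ q, OmU q p * ∑ i, jmat a b i k * f p q i := by
    intro k f
    simp only [Finset.mul_sum]
    rw [Finset.sum_comm]
    refine Finset.sum_congr rfl fun p _ => ?_
    rw [Finset.sum_comm]
    exact Finset.sum_congr rfl fun q _ => Finset.sum_congr rfl fun i _ => by ring
  rw [h3 r fun p q i => n p q i s, h3 s fun p q i => n p q r i]
  rw [← h1, ← zero_add (∑ p, _ + _), ← h2]
  simp only [← Finset.sum_add_distrib]
  refine Finset.sum_congr rfl fun p _ => Finset.sum_congr rfl fun q _ => ?_
  simp only [jact]; 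
  simp only [Finset.sum_add_distrib]
  ring

/-- The contraction used for rank two, now with three further indices: each of them contributes a
transposition with the first index and a trace term. -/
theorem invariant_rank_four_eq {n : Fin 4 → Fin 4 → Fin 4 → Fin 4 → ℂ}
    (h : ∀ a b p q r s, jact a b n p q r s = 0) (c q r s : Fin 4) :
    5 * n c q r s + n q c r s + n r q c s + n s q r c +
      (∑ p, ∑ i, OmU i p * n p i r s) * OmL q c + (∑ p, ∑ i, OmU i p * n p q i s) * OmL r c +
      (∑ p, ∑ i, OmU i p * n p q r i) * OmL s c = 0 := by
  set t1 := ∑ p, ∑ i, OmU i p * n p i r s with ht1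
  set t2 := ∑ p, ∑ i, OmU i p * n p q i s with ht2
  set t3 := ∑ p, ∑ i, OmU i p * n p q r i with ht3
  have h1 : ∀ b, (5 / 2) * ∑ i, OmU i b * n i q r s +
      (1 / 2) * (kd q b * t1 + ∑ i, OmU i b * n q i r s) +
      (1 / 2) * (kd r b * t2 + ∑ i, OmU i b * n r q i s) +
      (1 / 2) * (kd s b * t3 + ∑ i, OmU i b * n s q r i) = 0 := by
    intro b
    rw [ht1, ht2, ht3, ← sum_jmat_second b q fun p i => n p i r s,
      ← sum_jmat_second b r fun p i => n p q i s, ← sum_jmat_second b s fun p i => n p q r i,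
      ← sum_jmat_first, ← Finset.sum_add_distrib, ← Finset.sum_add_distrib,
      ← Finset.sum_add_distrib]
    exact Finset.sum_eq_zero fun p _ => h p b p q r s
  have h2 : ∑ b, (5 * ((∑ i, OmU i b * n i q r s) * OmL b c) + kd q b * t1 * OmL b c +
      (∑ i, OmU i b * n q i r s) * OmL b c + kd r b * t2 * OmL b c +
      (∑ i, OmU i b * n r q i s) * OmL b c + kd s b * t3 * OmL b c +
      (∑ i, OmU i b * n s q r i) * OmL b c) = 0 :=
    Finset.sum_eq_zero fun b _ => by linear_combination 2 * OmL b c * h1 b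
  simp only [Finset.sum_add_distrib, ← Finset.mul_sum] at h2
  rw [sum_OmU_OmL_mul c fun i => n i q r s, sum_OmU_OmL_mul c fun i => n q i r s,
    sum_OmU_OmL_mul c fun i => n r q i s, sum_OmU_OmL_mul c fun i => n s q r i,
    sum_kd_OmL, sum_kd_OmL, sum_kd_OmL] at h2
  linear_combination h2

/-- Every invariant of `USp(4)` in a product of four fundamental representations is a combination
of products of symplectic forms. -/
theorem invariant_rank_four {n : Fin 4 → Fin 4 → Fin 4 → Fin 4 → ℂ}
    (h : ∀ a b p q r s, jact a b n p q r s = 0) :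
    ∃ x y z : ℂ, ∀ p q r s, n p q r s = x * (OmL p q * OmL r s) + y * (OmL p r * OmL q s) +
      z * (OmL p s * OmL q r) := by
  obtain ⟨t1, h1⟩ := trace_invariant h
  have hsw13 : ∀ a b p q r s, jact a b (fun p q r s => n p r q s) p q r s = 0 := by
    intro a b p q r s
    have := h a b p r q s
    simp only [jact] at this ⊢
    linear_combination this
  have hsw14 : ∀ a b p q r s, jact a b (fun p q r s => n p s r q) p q r s = 0 := by
    intro a b p q r s
    have := h a b p s r q
    simp only [jact] at this ⊢
    linear_combination this
  obtain ⟨t2, h2⟩ := trace_invariant hsw13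
  obtain ⟨t3, h3⟩ := trace_invariant hsw14
  have h3' : ∀ q r, ∑ p, ∑ i, OmU i p * n p q r i = -t3 * OmL q r := fun q r => by
    rw [h3 r q, OmL_antisymm r q]; ring
  -- The coefficients are chosen so that the ansatz has the same three partial traces as n; the 3×3
  -- system is invertible.
  obtain ⟨x, y, z, e1, e2, e3⟩ : ∃ x y z : ℂ, 4 * x + y - z = t1 ∧ x + 4 * y + z = t2 ∧
      -x + y + 4 * z = -t3 := by
    refine ⟨(3 * t1 - t2 - t3) / 10, (-t1 + 3 * t2 + t3) / 10, (t1 - t2 - 3 * t3) / 10,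
      ?_, ?_, ?_⟩ <;> ring
  refine ⟨x, y, z, ?_⟩
  set m : Fin 4 × Fin 4 × Fin 4 × Fin 4 → ℂ := fun v => n v.1 v.2.1 v.2.2.1 v.2.2.2 -
    (x * (OmL v.1 v.2.1 * OmL v.2.2.1 v.2.2.2) + y * (OmL v.1 v.2.2.1 * OmL v.2.1 v.2.2.2) +
      z * (OmL v.1 v.2.2.2 * OmL v.2.1 v.2.2.1)) with hm
  have key : ∀ c q r s, 5 * m (c, q, r, s) + m (q, c, r, s) + m (r, q, c, s) + m (s, q, r, c)
      = 0 := by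
    intro c q r s
    have h4 := invariant_rank_four_eq h c q r s
    rw [h1, h2, h3'] at h4
    simp only [hm]
    rw [OmL_antisymm q c, OmL_antisymm r c, OmL_antisymm s c] at h4 ⊢
    rw [OmL_antisymm r q, OmL_antisymm s q, OmL_antisymm s r]
    linear_combination h4 - OmL c q * OmL r s * e1 - OmL c r * OmL q s * e2 -
      OmL c s * OmL q r * e3
  -- For the difference m of n and the ansatz the trace terms have cancelled, so 5m is minus a sum
  -- of three permuted copies of m. At an entry of maximal norm this reads 5‖m‖ ≤ 3‖m‖, whence m =
  -- 0.
  obtain ⟨⟨c, q, r, s⟩, hmax⟩ := Finite.exists_max fun v => ‖m v‖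
  have h5 : ‖m (c, q, r, s)‖ ≤ 0 := by
    have e : (5 : ℂ) * m (c, q, r, s) =
        -(m (q, c, r, s) + m (r, q, c, s) + m (s, q, r, c)) := by
      linear_combination key c q r s
    have e' := congrArg norm e
    rw [norm_mul, norm_neg] at e'
    have e5 : ‖(5 : ℂ)‖ = 5 := by simp
    rw [e5] at e'
    have := norm_add₃_le (a := m (q, c, r, s)) (b := m (r, q, c, s)) (c := m (s, q, r, c))
    linarith [hmax (q, c, r, s), hmax (r, q, c, s), hmax (s, q, r, c)]
  intro p q' r' s'
  have h6 := (hmax (p, q', r', s')).trans h5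
  have h7 := norm_le_zero_iff.mp h6
  simp only [hm] at h7
  linear_combination h7

end Invariants

/-! ## Unitary trick -/

section Unitary

open scoped InnerProductSpace in
/-- Complete reducibility: if `φ` intertwines a family of operators on a finite-dimensional Hilbert
space that is closed under adjoints, then a vector whose image is invariant can be replaced by an
invariant vector. -/
theorem exists_invariant_preimage {V B ι : Type*} [NormedAddCommGroup V] [InnerProductSpace ℂ V]
    [FiniteDimensional ℂ V] [AddCommGroup B] [Module ℂ B] (φ : V →ₗ[ℂ] B)
    (ρ ρ' : ι → V → V) (hsub : ∀ a x y, ρ a (x - y) = ρ a x - ρ a y)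
    (hadj : ∀ a x y, ⟪ρ' a x, y⟫_ℂ = ⟪x, ρ a y⟫_ℂ)
    (hρ : ∀ a x, φ x = 0 → φ (ρ a x) = 0) (hρ' : ∀ a x, φ x = 0 → φ (ρ' a x) = 0)
    (v : V) (hv : ∀ a, φ (ρ a v) = 0) : ∃ w, (∀ a, ρ a w = 0) ∧ φ w = φ v := by
  -- The component w orthogonal to the kernel of `φ` is the invariant vector: `ρ a w` lies in the
  -- kernel, the adjoint operator maps it into the kernel again, and pairing the result with w gives
  -- the squared norm of `ρ a w`.
  obtain ⟨k, hk, w, hw, rfl⟩ := Submodule.exists_add_mem_mem_orthogonal (K := LinearMap.ker φ) v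
  rw [LinearMap.mem_ker] at hk
  refine ⟨w, fun a => ?_, by rw [map_add, hk, zero_add]⟩
  have h1 : φ (ρ a w) = 0 := by
    have : ρ a w = ρ a (k + w) - ρ a k := by rw [← hsub]; simp
    rw [this, map_sub, hv, hρ a k hk, sub_zero]
  have h2 : ⟪ρ a w, ρ a w⟫_ℂ = 0 := by
    rw [← hadj]
    exact hw _ (hρ' a _ h1)
  exact inner_self_eq_zero.mp h2

/-- A vector in the span of eigenvectors which is itself an eigenvector lies in the span of those
with the same eigenvalue. -/
theorem mem_span_eigenvectors {B ι : Type*} [AddCommGroup B] [Module ℂ B] (T : Module.End ℂ B)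
    (u : ι → B) (μ : ι → ℂ) (hu : ∀ s, T (u s) = μ s • u s) {f : B} {ν : ℂ}
    (hf : f ∈ Submodule.span ℂ (Set.range u)) (hT : T f = ν • f) :
    f ∈ Submodule.span ℂ (u '' {s | μ s = ν}) := by
  classical
  have hle : Submodule.span ℂ (Set.range u) ≤ Submodule.span ℂ (u '' {s | μ s = ν}) ⊔
      Submodule.span ℂ (u '' {s | μ s ≠ ν}) := by
    rw [← Submodule.span_union, ← Set.image_union]
    refine Submodule.span_mono ?_
    rintro _ ⟨s, rfl⟩
    exact ⟨s, em _, rfl⟩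
  obtain ⟨g, hg, k, hk, rfl⟩ := Submodule.mem_sup.mp (hle hf)
  have hgT : T g = ν • g := by
    have : Submodule.span ℂ (u '' {s | μ s = ν}) ≤ T.eigenspace ν := by
      rw [Submodule.span_le]
      rintro _ ⟨s, hs, rfl⟩
      rw [SetLike.mem_coe, Module.End.mem_eigenspace_iff, hu, hs]
    exact Module.End.mem_eigenspace_iff.mp (this hg)
  have hk1 : k ∈ T.eigenspace ν := by
    rw [Module.End.mem_eigenspace_iff]
    rw [map_add, smul_add, hgT] at hT
    exact add_left_cancel hT
  have hk2 : k ∈ ⨆ (c) (_ : c ≠ ν), T.eigenspace c := by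
    have : Submodule.span ℂ (u '' {s | μ s ≠ ν}) ≤ ⨆ (c) (_ : c ≠ ν), T.eigenspace c := by
      rw [Submodule.span_le]
      rintro _ ⟨s, hs, rfl⟩
      refine Submodule.mem_iSup_of_mem (μ s) (Submodule.mem_iSup_of_mem hs ?_)
      rw [Module.End.mem_eigenspace_iff, hu]
    exact this hk
  have hk0 : k = 0 := by
    have := (Module.End.eigenspaces_iSupIndep T ν)
    exact (Submodule.disjoint_def.mp this) k hk1 hk2
  rwa [hk0, add_zero]

theorem eq_zero_of_mem_span_eigenvectors {B ι : Type*} [AddCommGroup B] [Module ℂ B]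
    (T : Module.End ℂ B) (u : ι → B) (μ : ι → ℂ) (hu : ∀ s, T (u s) = μ s • u s) {f : B} {ν : ℂ}
    (hf : f ∈ Submodule.span ℂ (Set.range u)) (hT : T f = ν • f) (hν : ∀ s, μ s ≠ ν) : f = 0 := by
  have h := mem_span_eigenvectors T u μ hu hf hT
  have : {s | μ s = ν} = ∅ := by
    ext s; simp [hν s]
  rwa [this, Set.image_empty, Submodule.span_empty, Submodule.mem_bot] at h

end Unitary

end

/-! ### From invariants of `USp(4)` to contractions of fields -/

section

section Contractions

theorem sum_swap_first {M : Type*} [AddCommMonoid M]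
    (F : Fin 4 → Fin 4 → Fin 4 → Fin 4 → Fin 4 → M) :
    ∑ p, ∑ q, ∑ r, ∑ s, ∑ k, F p q r s k = ∑ p, ∑ q, ∑ r, ∑ s, ∑ k, F k q r s p := by
  have h : ∀ G : Fin 4 → Fin 4 → Fin 4 → Fin 4 → Fin 4 → M,
      ∑ p, ∑ q, ∑ r, ∑ s, ∑ k, G p q r s k = ∑ p, ∑ k, ∑ q, ∑ r, ∑ s, G p q r s k := by
    intro G
    refine Finset.sum_congr rfl fun p _ => ?_
    have h3 : ∀ q, ∑ r, ∑ s, ∑ k, G p q r s k = ∑ k, ∑ r, ∑ s, G p q r s k := by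
      intro q
      have h4 : ∀ r, ∑ s, ∑ k, G p q r s k = ∑ k, ∑ s, G p q r s k := fun r => Finset.sum_comm
      simp only [h4]
      exact Finset.sum_comm
    simp only [h3]
    exact Finset.sum_comm
  rw [h F, h fun p q r s k => F k q r s p, Finset.sum_comm]

theorem sum_swap_second {M : Type*} [AddCommMonoid M]
    (F : Fin 4 → Fin 4 → Fin 4 → Fin 4 → Fin 4 → M) :
    ∑ p, ∑ q, ∑ r, ∑ s, ∑ k, F p q r s k = ∑ p, ∑ q, ∑ r, ∑ s, ∑ k, F p k r s q := by
  rw [Finset.sum_comm, sum_swap_first fun q p r s k => F p q r s k, Finset.sum_comm]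

theorem sum_swap_third {M : Type*} [AddCommMonoid M]
    (F : Fin 4 → Fin 4 → Fin 4 → Fin 4 → Fin 4 → M) :
    ∑ p, ∑ q, ∑ r, ∑ s, ∑ k, F p q r s k = ∑ p, ∑ q, ∑ r, ∑ s, ∑ k, F p q k s r := by
  have h : ∀ G : Fin 4 → Fin 4 → Fin 4 → M,
      ∑ r, ∑ s, ∑ k, G r s k = ∑ r, ∑ k, ∑ s, G r s k := fun G =>
    Finset.sum_congr rfl fun r _ => Finset.sum_comm
  refine Finset.sum_congr rfl fun p _ => Finset.sum_congr rfl fun q _ => ?_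
  rw [h, h fun r s k => F p q k s r, Finset.sum_comm]

theorem sum_swap_fourth {M : Type*} [AddCommMonoid M]
    (F : Fin 4 → Fin 4 → Fin 4 → Fin 4 → Fin 4 → M) :
    ∑ p, ∑ q, ∑ r, ∑ s, ∑ k, F p q r s k = ∑ p, ∑ q, ∑ r, ∑ s, ∑ k, F p q r k s :=
  Finset.sum_congr rfl fun _ _ => Finset.sum_congr rfl fun _ _ =>
    Finset.sum_congr rfl fun _ _ => Finset.sum_comm

/-- `∑ n_{pqrs} u^{pqrs}` -/
def pair4 {B : Type*} [AddCommGroup B] [Module ℂ B] (n : Fin 4 → Fin 4 → Fin 4 → Fin 4 → ℂ)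
    (u : Fin 4 → Fin 4 → Fin 4 → Fin 4 → B) : B :=
  ∑ p, ∑ q, ∑ r, ∑ s, n p q r s • u p q r s

/-- The action on coefficients is the transpose of the action on the fields they multiply. -/
theorem pair4_jact {B : Type*} [AddCommGroup B] [Module ℂ B]
    (n : Fin 4 → Fin 4 → Fin 4 → Fin 4 → ℂ) (u : Fin 4 → Fin 4 → Fin 4 → Fin 4 → B)
    (a b : Fin 4) :
    pair4 (jact a b n) u = pair4 n fun p q r s =>
      jrot a b (fun k => u k q r s) p + jrot a b (fun k => u p k r s) q +
        jrot a b (fun k => u p q k s) r + jrot a b (fun k => u p q r k) s := by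
  have h1 : ∑ p, ∑ q, ∑ r, ∑ s, ∑ i, (jmat a b i p * n i q r s) • u p q r s =
      ∑ p, ∑ q, ∑ r, ∑ s, ∑ i, n p q r s • jmat a b p i • u i q r s := by
    rw [sum_swap_first]
    simp only [smul_smul, mul_comm]
  have h2 : ∑ p, ∑ q, ∑ r, ∑ s, ∑ i, (jmat a b i q * n p i r s) • u p q r s =
      ∑ p, ∑ q, ∑ r, ∑ s, ∑ i, n p q r s • jmat a b q i • u p i r s := by
    rw [sum_swap_second]
    simp only [smul_smul, mul_comm]
  have h3 : ∑ p, ∑ q, ∑ r, ∑ s, ∑ i, (jmat a b i r * n p q i s) • u p q r s =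
      ∑ p, ∑ q, ∑ r, ∑ s, ∑ i, n p q r s • jmat a b r i • u p q i s := by
    rw [sum_swap_third]
    simp only [smul_smul, mul_comm]
  have h4 : ∑ p, ∑ q, ∑ r, ∑ s, ∑ i, (jmat a b i s * n p q r i) • u p q r s =
      ∑ p, ∑ q, ∑ r, ∑ s, ∑ i, n p q r s • jmat a b s i • u p q r i := by
    rw [sum_swap_fourth]
    simp only [smul_smul, mul_comm]
  simp only [pair4, jact, add_smul, Finset.sum_smul, Finset.sum_add_distrib, jrot_eq_sum,
    smul_add, Finset.smul_sum]
  rw [h1, h2, h3, h4]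

theorem sum_jact_adjoint (x y : Fin 4 → Fin 4 → Fin 4 → Fin 4 → ℂ) (a b : Fin 4) {c : ℂ}
    (hc : ∀ i p, star (jmat a b p i) = c * jmat (jflip b) (jflip a) i p) :
    ∑ p, ∑ q, ∑ r, ∑ s, y p q r s * star (c * jact (jflip b) (jflip a) x p q r s) =
      ∑ p, ∑ q, ∑ r, ∑ s, jact a b y p q r s * star (x p q r s) := by
  have hc' : ∀ i p, star c * star (jmat (jflip b) (jflip a) i p) = jmat a b p i := fun i p => by
    rw [mul_comm, ← star_mul, ← hc, star_star]
  have e : ∀ f : Fin 4 → ℂ, ∀ k, star (c * ∑ i, jmat (jflip b) (jflip a) i k * f i) =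
      ∑ i, jmat a b k i * star (f i) := by
    intro f k
    rw [Finset.mul_sum, star_sum]
    refine Finset.sum_congr rfl fun i _ => ?_
    rw [star_mul', star_mul', ← mul_assoc, hc']
  have h1 : ∑ p, ∑ q, ∑ r, ∑ s, ∑ i, y p q r s * (jmat a b p i * star (x i q r s)) =
      ∑ p, ∑ q, ∑ r, ∑ s, ∑ i, jmat a b i p * y i q r s * star (x p q r s) := by
    rw [sum_swap_first]
    simp only [mul_left_comm, mul_assoc]
  have h2 : ∑ p, ∑ q, ∑ r, ∑ s, ∑ i, y p q r s * (jmat a b q i * star (x p i r s)) =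
      ∑ p, ∑ q, ∑ r, ∑ s, ∑ i, jmat a b i q * y p i r s * star (x p q r s) := by
    rw [sum_swap_second]
    simp only [mul_left_comm, mul_assoc]
  have h3 : ∑ p, ∑ q, ∑ r, ∑ s, ∑ i, y p q r s * (jmat a b r i * star (x p q i s)) =
      ∑ p, ∑ q, ∑ r, ∑ s, ∑ i, jmat a b i r * y p q i s * star (x p q r s) := by
    rw [sum_swap_third]
    simp only [mul_left_comm, mul_assoc]
  have h4 : ∑ p, ∑ q, ∑ r, ∑ s, ∑ i, y p q r s * (jmat a b s i * star (x p q r i)) =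
      ∑ p, ∑ q, ∑ r, ∑ s, ∑ i, jmat a b i s * y p q r i * star (x p q r s) := by
    rw [sum_swap_fourth]
    simp only [mul_left_comm, mul_assoc]
  simp only [jact, mul_add, star_add, e, Finset.sum_add_distrib, add_mul]
  simp only [Finset.mul_sum, Finset.sum_mul]
  rw [h1, h2, h3, h4]

/-- The first fundamental theorem at rank four, for fields. The fields may satisfy linear relations,
so invariance of f does not make its coefficients invariant. The coefficients form a Hilbert space
on which the family of J is closed under adjoints, and `exists_invariant_preimage` replaces them by
invariant ones; by `invariant_rank_four` only the three complete contractions remain. The type `κ`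
carries the spectator indices. -/
theorem mem_span_contractions {B κ : Type*} [AddCommGroup B] [Module ℂ B] [Fintype κ]
    (J : Fin 4 → Fin 4 → Module.End ℂ B) (u : κ → Fin 4 → Fin 4 → Fin 4 → Fin 4 → B)
    (hu : ∀ a b t p q r s, J a b (u t p q r s) =
      jrot a b (fun k => u t k q r s) p + jrot a b (fun k => u t p k r s) q +
        jrot a b (fun k => u t p q k s) r + jrot a b (fun k => u t p q r k) s)
    {f : B} (hf : f ∈ Submodule.span ℂ (Set.range fun v : κ × Fin 4 × Fin 4 × Fin 4 × Fin 4 =>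
      u v.1 v.2.1 v.2.2.1 v.2.2.2.1 v.2.2.2.2)) (hJ : ∀ a b, J a b f = 0) :
    f ∈ Submodule.span ℂ (Set.range fun v : κ × Fin 3 => pair4 (fun p q r s =>
      ![OmL p q * OmL r s, OmL p r * OmL q s, OmL p s * OmL q r] v.2) (u v.1)) := by
  let V := EuclideanSpace ℂ (κ × Fin 4 × Fin 4 × Fin 4 × Fin 4)
  let cur : V → κ → Fin 4 → Fin 4 → Fin 4 → Fin 4 → ℂ := fun x t p q r s => x (t, p, q, r, s)
  have hcur_inj : ∀ x y : V, cur x = cur y → x = y := by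
    intro x y h
    ext ⟨t, p, q, r, s⟩
    exact congrFun (congrFun (congrFun (congrFun (congrFun h t) p) q) r) s
  let mk : (κ → Fin 4 → Fin 4 → Fin 4 → Fin 4 → ℂ) → V := fun n =>
    WithLp.toLp 2 fun v => n v.1 v.2.1 v.2.2.1 v.2.2.2.1 v.2.2.2.2
  have hcm : ∀ n, cur (mk n) = n := fun n => rfl
  have hadd : ∀ (x y : V) t p q r s, cur (x + y) t p q r s = cur x t p q r s + cur y t p q r s :=
    fun _ _ _ _ _ _ _ => rfl
  have hsub : ∀ (x y : V) t p q r s, cur (x - y) t p q r s = cur x t p q r s - cur y t p q r s :=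
    fun _ _ _ _ _ _ _ => rfl
  have hsmul : ∀ (c : ℂ) (x : V) t p q r s, cur (c • x) t p q r s = c * cur x t p q r s :=
    fun _ _ _ _ _ _ _ => rfl
  let φ : V →ₗ[ℂ] B :=
    { toFun := fun x => ∑ t, pair4 (cur x t) (u t)
      map_add' := by
        intro x y
        simp only [pair4, hadd, add_smul, Finset.sum_add_distrib]
      map_smul' := by
        intro c x
        simp only [pair4, hsmul, mul_smul, ← Finset.smul_sum, RingHom.id_apply] }
  have hφ : ∀ x, φ x = ∑ t, pair4 (cur x t) (u t) := fun x => rfl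
  choose c hc using exists_jmat_adjoint
  let ρ : Fin 4 × Fin 4 → V → V := fun ab x => mk fun t => jact ab.1 ab.2 (cur x t)
  let ρ' : Fin 4 × Fin 4 → V → V := fun ab x =>
    mk fun t p q r s => c ab.1 ab.2 * jact (jflip ab.2) (jflip ab.1) (cur x t) p q r s
  have hJφ : ∀ a b x, J a b (φ x) = ∑ t, pair4 (jact a b (cur x t)) (u t) := by
    intro a b x
    rw [hφ, map_sum]
    refine Finset.sum_congr rfl fun t _ => ?_
    rw [pair4_jact]
    simp only [pair4, map_sum, map_smul, hu]
  have hφρ : ∀ ab x, φ (ρ ab x) = J ab.1 ab.2 (φ x) := fun ab x => by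
    rw [hJφ, hφ]
  have hφρ' : ∀ ab x, φ (ρ' ab x) = c ab.1 ab.2 • J (jflip ab.2) (jflip ab.1) (φ x) := by
    intro ab x
    rw [hJφ, Finset.smul_sum]
    simp only [pair4, Finset.smul_sum, smul_smul, hφ, ρ', hcm]
  have hmem : ∃ v, φ v = f := by
    obtain ⟨n, hn⟩ := (Submodule.mem_span_range_iff_exists_fun ℂ).mp hf
    refine ⟨WithLp.toLp 2 n, ?_⟩
    rw [← hn, hφ]
    simp only [pair4, cur, Fintype.sum_prod_type]
  obtain ⟨v, hv⟩ := hmem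
  obtain ⟨w, hw, hwv⟩ := exists_invariant_preimage φ ρ ρ'
    (by
      intro ab x y
      apply hcur_inj
      funext t p q r s
      simp only [hsub, ρ, hcm, jact, mul_sub, Finset.sum_sub_distrib]
      ring)
    (by
      intro ab x y
      rw [PiLp.inner_apply, PiLp.inner_apply]
      simp only [RCLike.inner_apply, Fintype.sum_prod_type]
      refine Finset.sum_congr rfl fun t _ => ?_
      exact sum_jact_adjoint (cur x t) (cur y t) ab.1 ab.2 (hc ab.1 ab.2))
    (fun ab x hx => by rw [hφρ, hx, map_zero])
    (fun ab x hx => by rw [hφρ', hx, map_zero, smul_zero])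
    v (fun ab => by rw [hφρ, hv, hJ])
  rw [← hv, ← hwv, hφ]
  refine Submodule.sum_mem _ fun t _ => ?_
  obtain ⟨x, y, z, hxyz⟩ := invariant_rank_four (n := cur w t) (by
    intro a b p q r s
    have := congrArg (fun X => cur X t p q r s) (hw (a, b))
    exact this)
  have e : pair4 (cur w t) (u t) =
      x • pair4 (fun p q r s => OmL p q * OmL r s) (u t) +
      y • pair4 (fun p q r s => OmL p r * OmL q s) (u t) +
      z • pair4 (fun p q r s => OmL p s * OmL q r) (u t) := by
    simp only [pair4, hxyz, Finset.smul_sum, ← Finset.sum_add_distrib, add_smul, smul_smul]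
  rw [e]
  refine add_mem (add_mem (Submodule.smul_mem _ _ (Submodule.subset_span ⟨(t, 0), rfl⟩))
    (Submodule.smul_mem _ _ (Submodule.subset_span ⟨(t, 1), rfl⟩)))
    (Submodule.smul_mem _ _ (Submodule.subset_span ⟨(t, 2), rfl⟩))

end Contractions

end

section

/-! ## Spinor form of the Lorentz generators -/

section SpinorRotations

variable {V : Type*} [AddCommGroup V] [Module ℂ V]

/-- The action of `M_α^β` on a lower spinor index. -/
def lrot (α β : Fin 4) (v : Fin 4 → V) (γ : Fin 4) : V :=
  (1 / 4 * kd α β) • v γ - kd β γ • v α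

/-- The action of `M_α^β` on an upper spinor index. -/
def urot (α β : Fin 4) (v : Fin 4 → V) (γ : Fin 4) : V :=
  kd α γ • v β - (1 / 4 * kd α β) • v γ

/-- The combination `-¼ (γ^{ab})_α^β F_{ab}`. -/
def mssSum (α β : Fin 4) (F : Fin 6 → Fin 6 → V) : V :=
  ∑ a, ∑ b, ∑ c, ∑ d, (-(1 / 4) * eta a c * eta b d * gam2 c d α β) • F a b

theorem mssSum_eq (α β : Fin 4) (F : Fin 6 → Fin 6 → V) :
    mssSum α β F = ∑ a, ∑ b, (-(1 / 4) * (eta a a * eta b b * gam2 a b α β)) • F a b := by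
  unfold mssSum
  refine Finset.sum_congr rfl fun a _ => Finset.sum_congr rfl fun b _ => ?_
  rw [Finset.sum_eq_single a, Finset.sum_eq_single b]
  · congr 1; ring
  · intro d _ h; simp [eta_of_ne h.symm]
  · simp
  · intro c _ h; simp [eta_of_ne h.symm]
  · simp

theorem mssSum_add (α β : Fin 4) (F H : Fin 6 → Fin 6 → V) :
    mssSum α β (fun a b => F a b + H a b) = mssSum α β F + mssSum α β H := by
  simp only [mssSum, smul_add, Finset.sum_add_distrib]

theorem mssSum_smul (α β : Fin 4) (x : ℂ) (F : Fin 6 → Fin 6 → V) :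
    mssSum α β (fun a b => x • F a b) = x • mssSum α β F := by
  simp only [mssSum, Finset.smul_sum, smul_comm x]

theorem mssSum_sum {ι : Type*} (s : Finset ι) (α β : Fin 4) (F : ι → Fin 6 → Fin 6 → V) :
    mssSum α β (fun a b => ∑ i ∈ s, F i a b) = ∑ i ∈ s, mssSum α β (F i) := by
  classical
  induction s using Finset.induction_on with
  | empty => simp [mssSum]
  | insert i s hi ih => simp only [Finset.sum_insert hi, mssSum_add, ih]

theorem mssSum_gam2 (α β γ δ : Fin 4) (v : V) :
    mssSum α β (fun a b => gam2 a b γ δ • v) =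
      (2 * (kd α δ * kd β γ - (1 / 4) * (kd α β * kd γ δ))) • v := by
  simp only [mssSum_eq, smul_smul, ← Finset.sum_smul]
  congr 1
  have := gam2_completeness α β γ δ
  rw [show 2 * (kd α δ * kd β γ - (1 / 4) * (kd α β * kd γ δ)) =
    -(1 / 4) * (-8 * (kd α δ * kd β γ - (1 / 4) * (kd α β * kd γ δ))) by ring, ← this]
  simp only [Finset.mul_sum]
  exact Finset.sum_congr rfl fun _ _ => Finset.sum_congr rfl fun _ _ => by ring

theorem mssSum_lower (α β γ : Fin 4) (v : Fin 4 → V) :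
    mssSum α β (fun a b => (-(1 / 2) : ℂ) • ∑ δ, gam2 a b γ δ • v δ) = lrot α β v γ := by
  rw [mssSum_smul, mssSum_sum]
  have h : ∀ δ, mssSum α β (fun a b => gam2 a b γ δ • v δ) =
      (2 * kd β γ) • (kd α δ • v δ) - (1 / 2 * kd α β) • (kd γ δ • v δ) := fun δ => by
    rw [mssSum_gam2]; module
  simp only [h, Finset.sum_sub_distrib, ← Finset.smul_sum, sum_kd_smul, lrot]
  module

theorem mssSum_upper (α β γ : Fin 4) (v : Fin 4 → V) :
    mssSum α β (fun a b => (-(1 / 2) : ℂ) • ∑ δ, gamt2 a b γ δ • v δ) = urot α β v γ := by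
  rw [mssSum_smul, mssSum_sum]
  have h : ∀ δ, mssSum α β (fun a b => gamt2 a b γ δ • v δ) =
      -((2 * kd α γ) • (kd β δ • v δ) - (1 / 2 * kd α β) • (kd γ δ • v δ)) := fun δ => by
    have h1 : mssSum α β (fun a b => gamt2 a b γ δ • v δ) =
        (-1 : ℂ) • mssSum α β (fun a b => gam2 a b δ γ • v δ) := by
      rw [← mssSum_smul]
      simp only [gamt2_eq, neg_smul, one_smul]
    rw [h1, mssSum_gam2, kd_comm δ γ]; module
  simp only [h, Finset.sum_sub_distrib, Finset.sum_neg_distrib, ← Finset.smul_sum, sum_kd_smul,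
    urot]
  module

/-- `gam2_gU` contracted with a vector: the bispinor of a rotated vector is the rotated bispinor. -/
theorem slash_vrot (a b : Fin 6) (v : Fin 6 → V) (α β : Fin 4) :
    ∑ c, gU c α β • vrot a b v c =
      (-(1 / 2) : ℂ) • ∑ z, gam2 a b α z • (∑ d, gU d z β • v d) +
      (-(1 / 2) : ℂ) • ∑ z, gam2 a b β z • (∑ d, gU d α z • v d) := by
  have h : ∀ d, ((-(1 / 2) : ℂ) * ∑ z, (gam2 a b α z * gU d z β + gam2 a b β z * gU d α z)) • v d =
      (eta a a * gU a α β * (if b = d then 1 else 0) -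
        eta b b * gU b α β * (if a = d then 1 else 0)) • v d := fun d => by rw [gam2_gU]
  have h2 := Finset.sum_congr rfl fun d (_ : d ∈ Finset.univ) => h d
  have e1 : ∑ c, gU c α β • vrot a b v c = ∑ d, (eta a a * gU a α β * (if b = d then 1 else 0) -
        eta b b * gU b α β * (if a = d then 1 else 0)) • v d := by
    simp only [vrot, smul_sub, sub_smul, Finset.sum_sub_distrib, mul_ite, mul_one, mul_zero,
      ite_smul, zero_smul, Finset.sum_ite_eq, Finset.mem_univ, if_true]
    rw [Finset.sum_eq_single a, Finset.sum_eq_single b]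
    · simp only [smul_smul, mul_comm]
    · intro c _ hc; simp [eta_of_ne hc]
    · simp
    · intro c _ hc; simp [eta_of_ne hc]
    · simp
  rw [e1, ← h2, ← smul_add, ← Finset.sum_add_distrib]
  simp only [mul_smul, ← Finset.smul_sum]
  congr 1
  simp only [Finset.sum_smul, Finset.smul_sum, ← Finset.sum_add_distrib, smul_smul, ← add_smul]
  exact Finset.sum_comm

theorem mssSum_vector (α β γ δ : Fin 4) (v : Fin 6 → V) :
    mssSum α β (fun a b => ∑ c, gU c γ δ • vrot a b v c) =
      lrot α β (fun z => ∑ d, gU d z δ • v d) γ + lrot α β (fun z => ∑ d, gU d γ z • v d) δ := by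
  simp only [slash_vrot, mssSum_add, mssSum_lower]

theorem sum_gU_eq_zero {v : Fin 6 → V} (h : ∀ α β, ∑ a, gU a α β • v a = 0) (b : Fin 6) :
    v b = 0 := by
  have h1 : ∑ α, ∑ β, gtL b α β • ∑ a, gU a α β • v a = 0 :=
    Finset.sum_eq_zero fun α _ => Finset.sum_eq_zero fun β _ => by rw [h, smul_zero]
  have h2 : ∑ α, ∑ β, gtL b α β • ∑ a, gU a α β • v a =
      ∑ a, (∑ α, ∑ β, gtL b α β * gU a α β) • v a := by
    simp only [Finset.smul_sum, Finset.sum_smul, smul_smul]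
    rw [Finset.sum_congr rfl fun α _ => Finset.sum_comm, Finset.sum_comm]
  rw [h2] at h1
  simp only [gtL_gU_trace, ite_smul, zero_smul, Finset.sum_ite_eq', Finset.mem_univ, if_true] at h1
  exact (smul_eq_zero_iff_right (by norm_num : (4 : ℂ) ≠ 0)).mp h1

end SpinorRotations

/-! ## Covariant fields of definite weight -/

section Operators

variable {A : Type*} [Ring A] [Algebra ℂ A]

theorem comm_apply (X Y : Module.End ℂ A) (f : A) : X (Y f) = Y (X f) + comm X Y f := by
  simp [comm]

theorem Gens.Mss_apply (G : Gens A) (α β : Fin 4) (f : A) :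
    G.Mss α β f = mssSum α β fun a b => G.M a b f := by
  simp [Gens.Mss, mssSum, LinearMap.sum_apply]

theorem comm_Mss (G : Gens A) (α β : Fin 4) (X : Module.End ℂ A) :
    comm (G.Mss α β) X = mssSum α β fun a b => comm (G.M a b) X := by
  simp only [comm, Gens.Mss, mssSum, Finset.sum_mul, Finset.mul_sum, smul_sub,
    Finset.sum_sub_distrib, smul_mul_assoc, mul_smul_comm]

/-- Covariant fields which are homogeneous of dimension `m / 2`. -/
inductive CovW (G : Gens A) (W : Fin 4 → Fin 4 → Fin 4 → Fin 4 → A) : ℤ → A → Prop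
  | zero (m : ℤ) : CovW G W m 0
  | weyl (α β i j : Fin 4) : CovW G W 2 (W α β i j)
  | add {m : ℤ} {f h : A} : CovW G W m f → CovW G W m h → CovW G W m (f + h)
  | smul (c : ℂ) {m : ℤ} {f : A} : CovW G W m f → CovW G W m (c • f)
  | mul {m n : ℤ} {f h : A} : CovW G W m f → CovW G W n h → CovW G W (m + n) (f * h)
  | nabla_vector (a : Fin 6) {m : ℤ} {f : A} : CovW G W m f → CovW G W (m + 2) (G.P a f)
  | nabla_spinor (α i : Fin 4) {m : ℤ} {f : A} : CovW G W m f → CovW G W (m + 1) (G.Q α i f)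

end Operators

section Superspace

variable {A : Type*} [Ring A] [StarRing A] [Algebra ℂ A] [StarModule ℂ A]
  {𝒜 : ZMod 2 → Submodule ℂ A} [GradedAlgebra 𝒜] (𝒮 : ConformalSuperspace 𝒜)

namespace ConformalSuperspace

/-- The space of covariant fields of dimension `m / 2`. -/
def cov (m : ℤ) : Submodule ℂ A where
  carrier := {f | CovW 𝒮.toGens 𝒮.W m f}
  add_mem' := CovW.add
  zero_mem' := CovW.zero m
  smul_mem' c _ := CovW.smul c

theorem W_mem_cov (α β i j : Fin 4) : 𝒮.W α β i j ∈ 𝒮.cov 2 := CovW.weyl α β i j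

theorem mul_mem_cov {m n : ℤ} {f h : A} (hf : f ∈ 𝒮.cov m) (hh : h ∈ 𝒮.cov n) :
    f * h ∈ 𝒮.cov (m + n) := CovW.mul hf hh

theorem P_mem_cov (a : Fin 6) {m : ℤ} {f : A} (hf : f ∈ 𝒮.cov m) : 𝒮.P a f ∈ 𝒮.cov (m + 2) :=
  CovW.nabla_vector a hf

theorem Q_mem_cov (α i : Fin 4) {m : ℤ} {f : A} (hf : f ∈ 𝒮.cov m) :
    𝒮.Q α i f ∈ 𝒮.cov (m + 1) := CovW.nabla_spinor α i hf

theorem isCov_of_mem {m : ℤ} {f : A} (hf : f ∈ 𝒮.cov m) : 𝒮.IsCov f := by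
  induction (show CovW 𝒮.toGens 𝒮.W m f from hf) with
  | zero m => exact zero_smul ℂ (𝒮.W 0 0 0 0) ▸ IsCovField.smul 0 (IsCovField.weyl 0 0 0 0)
  | weyl α β i j => exact IsCovField.weyl α β i j
  | add h1 h2 ih1 ih2 => exact IsCovField.add (ih1 h1) (ih2 h2)
  | smul c h1 ih => exact IsCovField.smul c (ih h1)
  | mul h1 h2 ih1 ih2 => exact IsCovField.mul (ih1 h1) (ih2 h2)
  | nabla_vector a h1 ih => exact IsCovField.nabla_vector a (ih h1)
  | nabla_spinor α i h1 ih => exact IsCovField.nabla_spinor α i (ih h1)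

/-- Statistics follow from dimension: `W` is even with m = 2, a spinor derivative adds 1 to m and
flips the parity, a vector derivative adds 2 and keeps it. -/
theorem cov_graded {m : ℤ} {f : A} (hf : f ∈ 𝒮.cov m) : f ∈ 𝒜 (m : ZMod 2) := by
  induction (show CovW 𝒮.toGens 𝒮.W m f from hf) with
  | zero m => exact zero_mem _
  | weyl α β i j => exact 𝒮.W_even α β i j
  | add h1 h2 ih1 ih2 => exact add_mem (ih1 h1) (ih2 h2)
  | smul c h1 ih => exact Submodule.smul_mem _ _ (ih h1)
  | mul h1 h2 ih1 ih2 =>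
    rw [Int.cast_add]
    exact SetLike.mul_mem_graded (ih1 h1) (ih2 h2)
  | @nabla_vector a m f h1 ih =>
    have : ((m + 2 : ℤ) : ZMod 2) = (m : ZMod 2) := by
      rw [Int.cast_add]; exact add_zero _
    rw [this]
    exact (𝒮.P_der a).map_mem _ _ (ih h1)
  | nabla_spinor α i h1 ih =>
    rw [Int.cast_add, Int.cast_one]
    exact (𝒮.Q_der α i).map_mem _ _ (ih h1)

theorem D_cov {m : ℤ} {f : A} (hf : f ∈ 𝒮.cov m) : 𝒮.D f = ((m : ℂ) / 2) • f := by
  induction (show CovW 𝒮.toGens 𝒮.W m f from hf) with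
  | zero m => simp
  | weyl α β i j => rw [𝒮.D_W]; norm_num
  | add h1 h2 ih1 ih2 => rw [map_add, ih1 h1, ih2 h2, smul_add]
  | smul c h1 ih => rw [map_smul, ih h1, smul_comm]
  | mul h1 h2 ih1 ih2 =>
    rw [𝒮.D_der.leibniz, ih1 h1, ih2 h2, smul_mul_assoc, mul_smul_comm, ← add_smul]
    push_cast; congr 1; ring
  | nabla_vector a h1 ih =>
    rw [comm_apply, ih h1, 𝒮.covariant.DP, map_smul]
    push_cast; module
  | nabla_spinor α i h1 ih =>
    rw [comm_apply, ih h1, 𝒮.covariant.DQ, map_smul, LinearMap.smul_apply]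
    push_cast; module

/-- Every covariant field is a sum of homogeneous ones, on which `D` acts by scalars; eigenspaces
for different scalars are independent, so an eigenvector involves only one degree. -/
theorem mem_cov_of_D {f : A} (hf : 𝒮.IsCov f) {m : ℤ} (hD : 𝒮.D f = ((m : ℂ) / 2) • f) :
    f ∈ 𝒮.cov m := by
  let u : (Σ n : ℤ, 𝒮.cov n) → A := fun s => s.2
  have h1 : f ∈ Submodule.span ℂ (Set.range u) := by
    have key : ∀ {n : ℤ} {h : A}, h ∈ 𝒮.cov n → h ∈ Submodule.span ℂ (Set.range u) :=
      fun {n h} hh => Submodule.subset_span ⟨⟨n, ⟨h, hh⟩⟩, rfl⟩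
    have hmap : ∀ T : Module.End ℂ A, (∀ n, ∀ h ∈ 𝒮.cov n, T h ∈ Submodule.span ℂ (Set.range u)) →
        ∀ h ∈ Submodule.span ℂ (Set.range u), T h ∈ Submodule.span ℂ (Set.range u) := by
      intro T hT h hh
      have : Submodule.span ℂ (Set.range u) ≤ (Submodule.span ℂ (Set.range u)).comap T := by
        refine Submodule.span_le.mpr ?_
        rintro _ ⟨⟨n, h⟩, rfl⟩
        exact hT n h h.2
      exact this hh
    have hf' : IsCovField 𝒮.toGens 𝒮.W f := hf
    clear hD hf
    induction hf' with
    | weyl α β i j => exact key (𝒮.W_mem_cov α β i j)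
    | add _ _ ih1 ih2 => exact add_mem ih1 ih2
    | smul c _ ih => exact Submodule.smul_mem _ _ ih
    | @mul f h _ _ ih1 ih2 =>
      refine hmap (LinearMap.mulLeft ℂ f) (fun n h hh => ?_) h ih2
      exact hmap (LinearMap.mulRight ℂ h) (fun n' f hf => key (𝒮.mul_mem_cov hf hh)) f ih1
    | nabla_vector a _ ih => exact hmap _ (fun n h hh => key (𝒮.P_mem_cov a hh)) _ ih
    | nabla_spinor α i _ ih => exact hmap _ (fun n h hh => key (𝒮.Q_mem_cov α i hh)) _ ih
  have h2 := mem_span_eigenvectors 𝒮.D u (fun s => (s.1 : ℂ) / 2) (fun s => 𝒮.D_cov s.2.2) h1 hD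
  refine Submodule.span_le.mpr ?_ h2
  rintro _ ⟨⟨n, h⟩, hs, rfl⟩
  have : n = m := by
    have h3 : (n : ℂ) / 2 = (m : ℂ) / 2 := hs
    have h4 : (n : ℂ) = m := by linear_combination 2 * h3
    exact_mod_cast h4
  subst this
  exact h.2

end ConformalSuperspace

end Superspace

end

section

/-! ## Quadratic Casimir operators of tensors -/

section Casimir

variable {V : Type*} [AddCommGroup V] [Module ℂ V] (m : Fin 4 → Fin 4 → Module.End ℂ V)

/-- The quadratic Casimir operator of the spinor rotations. -/
def casimir : Module.End ℂ V := ∑ α, ∑ β, m α β * m β α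

theorem casimir_apply (v : V) : casimir m v = ∑ α, ∑ β, m α β (m β α v) := by
  simp [casimir, LinearMap.sum_apply]

/-- In this and the following formulas each index contributes 15/4, a pair of indices of the same
position contributes twice their transposition minus 1/2, and a pair of opposite positions
contributes minus twice the trace part plus 1/2. -/
theorem casimir_upper_upper (t : Fin 4 → Fin 4 → V) (hm : ∀ α β p q, m α β (t p q) = urot α β (fun x => t x q) p + urot α β (fun x => t p x) q)
    (p q : Fin 4) : casimir m (t p q) = (7 : ℂ) • t p q + (2 : ℂ) • (t q p) := by
  rw [casimir_apply]
  simp only [hm, lrot, urot, map_add, map_sub, map_smul]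
  simp only [smul_add, smul_sub, Finset.sum_add_distrib, Finset.sum_sub_distrib, kd, ite_smul,
    mul_ite, mul_one, mul_zero, one_smul, zero_smul, smul_ite, smul_zero, Finset.sum_ite_eq,
    Finset.sum_ite_eq', Finset.mem_univ, if_true, smul_smul, ← Finset.smul_sum, Finset.sum_const,
    Finset.card_univ, Fintype.card_fin, Finset.sum_ite_irrel, Finset.sum_const_zero, ite_mul,
    one_mul, zero_mul]
  module

theorem casimir_lower_lower (t : Fin 4 → Fin 4 → V) (hm : ∀ α β p q, m α β (t p q) = lrot α β (fun x => t x q) p + lrot α β (fun x => t p x) q)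
    (p q : Fin 4) : casimir m (t p q) = (7 : ℂ) • t p q + (2 : ℂ) • (t q p) := by
  rw [casimir_apply]
  simp only [hm, lrot, urot, map_add, map_sub, map_smul]
  simp only [smul_add, smul_sub, Finset.sum_add_distrib, Finset.sum_sub_distrib, kd, ite_smul,
    mul_ite, mul_one, mul_zero, one_smul, zero_smul, smul_ite, smul_zero, Finset.sum_ite_eq,
    Finset.sum_ite_eq', Finset.mem_univ, if_true, smul_smul, ← Finset.smul_sum, Finset.sum_const,
    Finset.card_univ, Fintype.card_fin, Finset.sum_ite_irrel, Finset.sum_const_zero, ite_mul,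
    one_mul, zero_mul]
  module

theorem casimir_lower_upper_upper (t : Fin 4 → Fin 4 → Fin 4 → V) (hm : ∀ α β p q r, m α β (t p q r) = lrot α β (fun x => t x q r) p + urot α β (fun x => t p x r) q + urot α β (fun x => t p q x) r)
    (p q r : Fin 4) : casimir m (t p q r) = (47/4 : ℂ) • t p q r + (2 : ℂ) • (t p r q) - (2 : ℂ) • (kd q p • ∑ x, t x x r + kd r p • ∑ x, t x q x) := by
  rw [casimir_apply]
  simp only [hm, lrot, urot, map_add, map_sub, map_smul]
  simp only [smul_add, smul_sub, Finset.sum_add_distrib, Finset.sum_sub_distrib, kd, ite_smul,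
    mul_ite, mul_one, mul_zero, one_smul, zero_smul, smul_ite, smul_zero, Finset.sum_ite_eq,
    Finset.sum_ite_eq', Finset.mem_univ, if_true, smul_smul, ← Finset.smul_sum, Finset.sum_const,
    Finset.card_univ, Fintype.card_fin, Finset.sum_ite_irrel, Finset.sum_const_zero, ite_mul,
    one_mul, zero_mul]
  simp only [@eq_comm _ q p, @eq_comm _ r p]
  split_ifs <;> module

theorem casimir_lower_lower_lower (t : Fin 4 → Fin 4 → Fin 4 → V) (hm : ∀ α β p q r, m α β (t p q r) = lrot α β (fun x => t x q r) p + lrot α β (fun x => t p x r) q + lrot α β (fun x => t p q x) r)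
    (p q r : Fin 4) : casimir m (t p q r) = (39/4 : ℂ) • t p q r + (2 : ℂ) • (t q p r + t r q p + t p r q) := by
  rw [casimir_apply]
  simp only [hm, lrot, urot, map_add, map_sub, map_smul]
  simp only [smul_add, smul_sub, Finset.sum_add_distrib, Finset.sum_sub_distrib, kd, ite_smul,
    mul_ite, mul_one, mul_zero, one_smul, zero_smul, smul_ite, smul_zero, Finset.sum_ite_eq,
    Finset.sum_ite_eq', Finset.mem_univ, if_true, smul_smul, ← Finset.smul_sum, Finset.sum_const,
    Finset.card_univ, Fintype.card_fin, Finset.sum_ite_irrel, Finset.sum_const_zero, ite_mul,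
    one_mul, zero_mul]
  module

theorem casimir_lower_lower_upper_upper (t : Fin 4 → Fin 4 → Fin 4 → Fin 4 → V) (hm : ∀ α β p q r s, m α β (t p q r s) = lrot α β (fun x => t x q r s) p + lrot α β (fun x => t p x r s) q + urot α β (fun x => t p q x s) r + urot α β (fun x => t p q r x) s)
    (p q r s : Fin 4) : casimir m (t p q r s) = (16 : ℂ) • t p q r s + (2 : ℂ) • (t q p r s + t p q s r) - (2 : ℂ) • (kd r p • ∑ x, t x q x s + kd s p • ∑ x, t x q r x + kd r q • ∑ x, t p x x s + kd s q • ∑ x, t p x r x) := by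
  rw [casimir_apply]
  simp only [hm, lrot, urot, map_add, map_sub, map_smul]
  simp only [smul_add, smul_sub, Finset.sum_add_distrib, Finset.sum_sub_distrib, kd, ite_smul,
    mul_ite, mul_one, mul_zero, one_smul, zero_smul, smul_ite, smul_zero, Finset.sum_ite_eq,
    Finset.sum_ite_eq', Finset.mem_univ, if_true, smul_smul, ← Finset.smul_sum, Finset.sum_const,
    Finset.card_univ, Fintype.card_fin, Finset.sum_ite_irrel, Finset.sum_const_zero, ite_mul,
    one_mul, zero_mul]
  simp only [@eq_comm _ r p, @eq_comm _ s p, @eq_comm _ r q, @eq_comm _ s q]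
  split_ifs <;> module

theorem casimir_upper4 (t : Fin 4 → Fin 4 → Fin 4 → Fin 4 → V) (hm : ∀ α β p q r s, m α β (t p q r s) = urot α β (fun x => t x q r s) p + urot α β (fun x => t p x r s) q + urot α β (fun x => t p q x s) r + urot α β (fun x => t p q r x) s)
    (p q r s : Fin 4) : casimir m (t p q r s) = (12 : ℂ) • t p q r s + (2 : ℂ) • (t q p r s + t r q p s + t s q r p + t p r q s + t p s r q + t p q s r) := by
  rw [casimir_apply]
  simp only [hm, lrot, urot, map_add, map_sub, map_smul]
  simp only [smul_add, smul_sub, Finset.sum_add_distrib, Finset.sum_sub_distrib, kd, ite_smul,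
    mul_ite, mul_one, mul_zero, one_smul, zero_smul, smul_ite, smul_zero, Finset.sum_ite_eq,
    Finset.sum_ite_eq', Finset.mem_univ, if_true, smul_smul, ← Finset.smul_sum, Finset.sum_const,
    Finset.card_univ, Fintype.card_fin, Finset.sum_ite_irrel, Finset.sum_const_zero, ite_mul,
    one_mul, zero_mul]
  module

theorem casimir_lower4 (t : Fin 4 → Fin 4 → Fin 4 → Fin 4 → V) (hm : ∀ α β p q r s, m α β (t p q r s) = lrot α β (fun x => t x q r s) p + lrot α β (fun x => t p x r s) q + lrot α β (fun x => t p q x s) r + lrot α β (fun x => t p q r x) s)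
    (p q r s : Fin 4) : casimir m (t p q r s) = (12 : ℂ) • t p q r s + (2 : ℂ) • (t q p r s + t r q p s + t s q r p + t p r q s + t p s r q + t p q s r) := by
  rw [casimir_apply]
  simp only [hm, lrot, urot, map_add, map_sub, map_smul]
  simp only [smul_add, smul_sub, Finset.sum_add_distrib, Finset.sum_sub_distrib, kd, ite_smul,
    mul_ite, mul_one, mul_zero, one_smul, zero_smul, smul_ite, smul_zero, Finset.sum_ite_eq,
    Finset.sum_ite_eq', Finset.mem_univ, if_true, smul_smul, ← Finset.smul_sum, Finset.sum_const,
    Finset.card_univ, Fintype.card_fin, Finset.sum_ite_irrel, Finset.sum_const_zero, ite_mul,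
    one_mul, zero_mul]
  module

end Casimir

section Superspace

variable {A : Type*} [Ring A] [StarRing A] [Algebra ℂ A] [StarModule ℂ A]
  {𝒜 : ZMod 2 → Submodule ℂ A} [GradedAlgebra 𝒜] (𝒮 : ConformalSuperspace 𝒜)

namespace ConformalSuperspace

theorem jrot_apply (a b : Fin 4) (v : Fin 4 → Module.End ℂ A) (k : Fin 4) (f : A) :
    jrot a b v k f = jrot a b (fun l => v l f) k := by simp [jrot]

theorem map_jrot {V V' : Type*} [AddCommGroup V] [Module ℂ V] [AddCommGroup V'] [Module ℂ V']
    (T : V →ₗ[ℂ] V') (a b : Fin 4) (v : Fin 4 → V) (k : Fin 4) :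
    T (jrot a b v k) = jrot a b (fun l => T (v l)) k := by simp [jrot]

theorem lrot_apply (α β : Fin 4) (v : Fin 4 → Module.End ℂ A) (γ : Fin 4) (f : A) :
    lrot α β v γ f = lrot α β (fun l => v l f) γ := by simp [lrot]

theorem map_lrot {V V' : Type*} [AddCommGroup V] [Module ℂ V] [AddCommGroup V'] [Module ℂ V']
    (T : V →ₗ[ℂ] V') (α β : Fin 4) (v : Fin 4 → V) (γ : Fin 4) :
    T (lrot α β v γ) = lrot α β (fun l => T (v l)) γ := by simp [lrot]

theorem map_urot {V V' : Type*} [AddCommGroup V] [Module ℂ V] [AddCommGroup V'] [Module ℂ V']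
    (T : V →ₗ[ℂ] V') (α β : Fin 4) (v : Fin 4 → V) (γ : Fin 4) :
    T (urot α β v γ) = urot α β (fun l => T (v l)) γ := by simp [urot]

theorem Mss_W (α β γ δ i j : Fin 4) : 𝒮.Mss α β (𝒮.W γ δ i j) =
    urot α β (fun x => 𝒮.W x δ i j) γ + urot α β (fun x => 𝒮.W γ x i j) δ := by
  rw [Gens.Mss_apply]
  simp only [𝒮.M_W, Finset.sum_add_distrib, smul_add, mssSum_add, mssSum_upper]

theorem comm_Mss_Q (α β γ k : Fin 4) : comm (𝒮.Mss α β) (𝒮.Q γ k) =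
    lrot α β (fun x => 𝒮.Q x k) γ := by
  rw [comm_Mss]
  simp only [𝒮.covariant.MQ, mssSum_lower]

theorem Mss_Q (α β γ k : Fin 4) (f : A) : 𝒮.Mss α β (𝒮.Q γ k f) =
    lrot α β (fun x => 𝒮.Q x k f) γ + 𝒮.Q γ k (𝒮.Mss α β f) := by
  rw [comm_apply, comm_Mss_Q, lrot_apply, add_comm]

theorem J_Q (a b γ k : Fin 4) (f : A) : 𝒮.J a b (𝒮.Q γ k f) =
    jrot a b (fun x => 𝒮.Q γ x f) k + 𝒮.Q γ k (𝒮.J a b f) := by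
  rw [comm_apply, 𝒮.covariant.JQ, jrot_apply, add_comm]

theorem Mss_der (α β : Fin 4) (f h : A) :
    𝒮.Mss α β (f * h) = 𝒮.Mss α β f * h + f * 𝒮.Mss α β h := by
  simp only [Gens.Mss_apply, (𝒮.M_der _ _).leibniz, mssSum_add]
  simp only [mssSum, Finset.sum_mul, Finset.mul_sum, smul_mul_assoc, mul_smul_comm]

/-- K is an anticommutator of two S, and S annihilates `W`. The `USp(4)` indices 0 and 1 are used
because Ω does not vanish there. -/
theorem K_W (a : Fin 6) (α β i j : Fin 4) : 𝒮.K a (𝒮.W α β i j) = 0 := by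
  have h : ∀ γ δ, ∑ c, gtU c γ δ • 𝒮.K c (𝒮.W α β i j) = 0 := by
    intro γ δ
    have h1 := congrArg (fun T : Module.End ℂ A => T (𝒮.W α β i j)) (𝒮.special.SS γ 0 δ 1)
    simp only [acomm, LinearMap.add_apply, Module.End.mul_apply, 𝒮.S_W, map_zero, add_zero,
      LinearMap.smul_apply, LinearMap.sum_apply] at h1
    have h2 : (-2 * Complex.I * OmL 0 1 : ℂ) ≠ 0 := by simp [OmL, OmU]
    exact (smul_eq_zero_iff_right h2).mp h1.symm
  have h3 : ∑ γ, ∑ δ, gL a γ δ • ∑ c, gtU c γ δ • 𝒮.K c (𝒮.W α β i j) = 0 :=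
    Finset.sum_eq_zero fun γ _ => Finset.sum_eq_zero fun δ _ => by rw [h, smul_zero]
  have h4 : ∑ γ, ∑ δ, gL a γ δ • ∑ c, gtU c γ δ • 𝒮.K c (𝒮.W α β i j) =
      ∑ c, (eta a a * eta c c * ∑ γ, ∑ δ, gtL c γ δ * gU a γ δ) • 𝒮.K c (𝒮.W α β i j) := by
    simp only [Finset.smul_sum, Finset.sum_smul, smul_smul, Finset.mul_sum]
    rw [Finset.sum_congr rfl fun α _ => Finset.sum_comm, Finset.sum_comm]
    refine Finset.sum_congr rfl fun c _ => Finset.sum_congr rfl fun γ _ =>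
      Finset.sum_congr rfl fun δ _ => ?_
    congr 1
    rw [gL_apply, gtL_apply]
    linear_combination -eta a a * gtU c γ δ * gU a γ δ * eta_mul_self c
  rw [h4, Finset.sum_eq_single a] at h3
  · rw [gtL_gU_trace, if_pos rfl, eta_mul_self] at h3
    exact (smul_eq_zero_iff_right (by norm_num)).mp h3
  · intro c _ hc
    rw [gtL_gU_trace, if_neg hc.symm, mul_zero, zero_smul]
  · simp

/-- The fields `∇_δ^i W^{βγ jk}`. -/
def gradField (v : Fin 4 × Fin 4 × Fin 4) (i j k : Fin 4) : A := 𝒮.Q v.1 i (𝒮.W v.2.1 v.2.2 j k)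

/-- The fields `∇_δ^i ∇_α^j W^{βγ kl}` and `W^{αβ ij} W^{γδ kl}`. -/
def quadField (v : (Fin 4 × Fin 4 × Fin 4 × Fin 4) ⊕ (Fin 4 × Fin 4 × Fin 4 × Fin 4))
    (i j k l : Fin 4) : A :=
  match v with
  | .inl v => 𝒮.Q v.1 i (𝒮.Q v.2.1 j (𝒮.W v.2.2.1 v.2.2.2 k l))
  | .inr v => 𝒮.W v.1 v.2.1 i j * 𝒮.W v.2.2.1 v.2.2.2 k l

theorem curvQQ_W (α i β j γ δ k l : Fin 4) : curvQQ 𝒮.toGens 𝒮.W α i β j (𝒮.W γ δ k l) =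
    ∑ x, ∑ y, ∑ z, (-(1 / 2) * lc α β x z) • (𝒮.W x y i j * 𝒮.Mss y z (𝒮.W γ δ k l)) := by
  simp only [curvQQ, LinearMap.add_apply, LinearMap.sum_apply, LinearMap.smul_apply, Gens.Kup,
    upV, 𝒮.S_W, 𝒮.K_W, smul_zero, mul_zero, Finset.sum_const_zero, add_zero, smul_eq_mul]

/-- The vector derivative is redundant. As Ω^{ij} = 1 for the indices 0, 1, it is read off from one
anticommutator of spinor derivatives. This eliminates vector derivatives of fields, and later
reduces closure of the algebra to Jacobi identities. -/
theorem Pss_eq (α β : Fin 4) : 𝒮.Pss α β = (Complex.I / 2) •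
    (acomm (𝒮.Q α 0) (𝒮.Q β 1) - curvQQ 𝒮.toGens 𝒮.W α 0 β 1) := by
  rw [𝒮.QQ, add_sub_cancel_right, Gens.flatQQ, smul_smul]
  have : Complex.I / 2 * (-2 * Complex.I * OmU 0 1) = 1 := by
    simp only [OmU]; simp
    linear_combination -Complex.I_mul_I
  rw [this, one_smul]

theorem P_eq (a : Fin 6) : 𝒮.P a = (1 / 4 : ℂ) • ∑ α, ∑ β, gtL a α β • 𝒮.Pss α β := by
  have : ∑ α, ∑ β, gtL a α β • 𝒮.Pss α β =
      ∑ c, (∑ α, ∑ β, gtL a α β * gU c α β) • 𝒮.P c := by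
    simp only [Gens.Pss, Finset.smul_sum, Finset.sum_smul, smul_smul]
    rw [Finset.sum_congr rfl fun α _ => Finset.sum_comm, Finset.sum_comm]
  rw [this]
  simp only [gtL_gU_trace, ite_smul, zero_smul, Finset.sum_ite_eq', Finset.mem_univ, if_true]
  module

theorem W_mul_W_mem (α β γ δ i j k l : Fin 4) : 𝒮.W α β i j * 𝒮.W γ δ k l ∈
    Submodule.span ℂ (Set.range fun v : _ × Fin 4 × Fin 4 × Fin 4 × Fin 4 =>
      𝒮.quadField v.1 v.2.1 v.2.2.1 v.2.2.2.1 v.2.2.2.2) :=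
  Submodule.subset_span ⟨(.inr (α, β, γ, δ), i, j, k, l), rfl⟩

theorem QW_mem (α β γ i j k : Fin 4) : 𝒮.Q α i (𝒮.W β γ j k) ∈
    Submodule.span ℂ (Set.range fun v : _ × Fin 4 × Fin 4 × Fin 4 =>
      𝒮.gradField v.1 v.2.1 v.2.2.1 v.2.2.2) :=
  Submodule.subset_span ⟨((α, β, γ), i, j, k), rfl⟩

theorem QQW_mem (α β γ δ i j k l : Fin 4) : 𝒮.Q α i (𝒮.Q β j (𝒮.W γ δ k l)) ∈
    Submodule.span ℂ (Set.range fun v : _ × Fin 4 × Fin 4 × Fin 4 × Fin 4 =>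
      𝒮.quadField v.1 v.2.1 v.2.2.1 v.2.2.2.1 v.2.2.2.2) :=
  Submodule.subset_span ⟨(.inl (α, β, γ, δ), i, j, k, l), rfl⟩

theorem W_mul_Mss_W_mem (α β γ δ i j k l x y : Fin 4) : 𝒮.W α β i j * 𝒮.Mss x y (𝒮.W γ δ k l) ∈
    Submodule.span ℂ (Set.range fun v : _ × Fin 4 × Fin 4 × Fin 4 × Fin 4 =>
      𝒮.quadField v.1 v.2.1 v.2.2.1 v.2.2.2.1 v.2.2.2.2) := by
  rw [Mss_W]
  simp only [urot, mul_add, mul_sub, mul_smul_comm]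
  refine add_mem (sub_mem ?_ ?_) (sub_mem ?_ ?_) <;>
    exact Submodule.smul_mem _ _ (𝒮.W_mul_W_mem _ _ _ _ _ _ _ _)

theorem P_W_mem (a : Fin 6) (γ δ k l : Fin 4) : 𝒮.P a (𝒮.W γ δ k l) ∈
    Submodule.span ℂ (Set.range fun v : _ × Fin 4 × Fin 4 × Fin 4 × Fin 4 =>
      𝒮.quadField v.1 v.2.1 v.2.2.1 v.2.2.2.1 v.2.2.2.2) := by
  rw [P_eq]
  simp only [LinearMap.smul_apply, LinearMap.sum_apply]
  refine Submodule.smul_mem _ _ (Submodule.sum_mem _ fun α _ => Submodule.sum_mem _ fun β _ =>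
    Submodule.smul_mem _ _ ?_)
  rw [Pss_eq, LinearMap.smul_apply, LinearMap.sub_apply, curvQQ_W]
  refine Submodule.smul_mem _ _ (sub_mem (add_mem (𝒮.QQW_mem _ _ _ _ _ _ _ _)
    (𝒮.QQW_mem _ _ _ _ _ _ _ _)) ?_)
  exact Submodule.sum_mem _ fun x _ => Submodule.sum_mem _ fun y _ => Submodule.sum_mem _ fun z _ =>
    Submodule.smul_mem _ _ (𝒮.W_mul_Mss_W_mem _ _ _ _ _ _ _ _ _ _)

theorem map_mem_of_mem_span {V V' ι : Type*} [AddCommGroup V] [Module ℂ V] [AddCommGroup V']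
    [Module ℂ V'] (T : V →ₗ[ℂ] V') {u : ι → V} {N : Submodule ℂ V'} (h : ∀ s, T (u s) ∈ N) {f : V}
    (hf : f ∈ Submodule.span ℂ (Set.range u)) : T f ∈ N := by
  have : Submodule.span ℂ (Set.range u) ≤ N.comap T := by
    refine Submodule.span_le.mpr ?_
    rintro _ ⟨s, rfl⟩
    exact h s
  exact this hf

/-- Every factor has dimension at least 1 and every derivative raises the dimension, so only a few
words in `W` and derivatives fit below dimension two. The single candidate with a vector derivative,
applied to `W`, is rewritten by `Pss_eq`; `W` is primary, so only the Lorentz part of the curvature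
acts on it and yields products of two `W`. -/
theorem cov_classification {m : ℤ} {f : A} (hf : f ∈ 𝒮.cov m) :
    (m < 2 → f = 0) ∧
    (m = 2 → f ∈ Submodule.span ℂ (Set.range fun v : Fin 4 × Fin 4 × Fin 4 × Fin 4 =>
      𝒮.W v.1 v.2.1 v.2.2.1 v.2.2.2)) ∧
    (m = 3 → f ∈ Submodule.span ℂ (Set.range fun v : _ × Fin 4 × Fin 4 × Fin 4 =>
      𝒮.gradField v.1 v.2.1 v.2.2.1 v.2.2.2)) ∧
    (m = 4 → f ∈ Submodule.span ℂ (Set.range fun v : _ × Fin 4 × Fin 4 × Fin 4 × Fin 4 =>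
      𝒮.quadField v.1 v.2.1 v.2.2.1 v.2.2.2.1 v.2.2.2.2)) := by
  induction (show CovW 𝒮.toGens 𝒮.W m f from hf) with
  | zero m => exact ⟨fun _ => rfl, fun _ => zero_mem _, fun _ => zero_mem _, fun _ => zero_mem _⟩
  | weyl α β i j =>
    exact ⟨fun h => by omega, fun _ => Submodule.subset_span ⟨(α, β, i, j), rfl⟩,
      fun h => by omega, fun h => by omega⟩
  | add h1 h2 ih1 ih2 =>
    obtain ⟨a1, b1, c1, d1⟩ := ih1 h1
    obtain ⟨a2, b2, c2, d2⟩ := ih2 h2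
    exact ⟨fun h => by rw [a1 h, a2 h, add_zero], fun h => add_mem (b1 h) (b2 h),
      fun h => add_mem (c1 h) (c2 h), fun h => add_mem (d1 h) (d2 h)⟩
  | smul c h1 ih1 =>
    obtain ⟨a1, b1, c1, d1⟩ := ih1 h1
    exact ⟨fun h => by rw [a1 h, smul_zero], fun h => Submodule.smul_mem _ _ (b1 h),
      fun h => Submodule.smul_mem _ _ (c1 h), fun h => Submodule.smul_mem _ _ (d1 h)⟩
  | @mul m n f h h1 h2 ih1 ih2 =>
    obtain ⟨a1, b1, -, -⟩ := ih1 h1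
    obtain ⟨a2, b2, -, -⟩ := ih2 h2
    rcases lt_or_ge m 2 with hm | hm
    · rw [a1 hm, zero_mul]
      exact ⟨fun _ => rfl, fun _ => zero_mem _, fun _ => zero_mem _, fun _ => zero_mem _⟩
    rcases lt_or_ge n 2 with hn | hn
    · rw [a2 hn, mul_zero]
      exact ⟨fun _ => rfl, fun _ => zero_mem _, fun _ => zero_mem _, fun _ => zero_mem _⟩
    refine ⟨fun h => by omega, fun h => by omega, fun h => by omega, fun hmn => ?_⟩
    refine map_mem_of_mem_span (LinearMap.mulLeft ℂ f) (fun s => ?_) (b2 (by omega))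
    refine map_mem_of_mem_span (LinearMap.mulRight ℂ (𝒮.W s.1 s.2.1 s.2.2.1 s.2.2.2))
      (fun t => ?_) (b1 (by omega))
    exact 𝒮.W_mul_W_mem _ _ _ _ _ _ _ _
  | @nabla_vector a m f h1 ih1 =>
    obtain ⟨a1, b1, -, -⟩ := ih1 h1
    rcases lt_or_ge m 2 with hm | hm
    · rw [a1 hm, map_zero]
      exact ⟨fun _ => rfl, fun _ => zero_mem _, fun _ => zero_mem _, fun _ => zero_mem _⟩
    exact ⟨fun h => by omega, fun h => by omega, fun h => by omega, fun h =>
      map_mem_of_mem_span (𝒮.P a) (fun s => 𝒮.P_W_mem a _ _ _ _) (b1 (by omega))⟩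
  | @nabla_spinor α i m f h1 ih1 =>
    obtain ⟨a1, b1, c1, -⟩ := ih1 h1
    rcases lt_or_ge m 2 with hm | hm
    · rw [a1 hm, map_zero]
      exact ⟨fun _ => rfl, fun _ => zero_mem _, fun _ => zero_mem _, fun _ => zero_mem _⟩
    exact ⟨fun h => by omega, fun h => by omega, fun h =>
      map_mem_of_mem_span (𝒮.Q α i)
        (fun s => 𝒮.QW_mem _ _ _ _ _ _)
        (b1 (by omega)), fun h =>
      map_mem_of_mem_span (𝒮.Q α i) (fun s => 𝒮.QQW_mem _ _ _ _ _ _ _ _) (c1 (by omega))⟩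

end ConformalSuperspace

end Superspace

end

/-! ### Tensors that do not occur in dimensions 1 and 3/2 -/

section

section Contractions

variable {V : Type*} [AddCommGroup V] [Module ℂ V]

theorem jrot_OmU (a b i j : Fin 4) (x : V) :
    jrot a b (fun k => OmU k j • x) i + jrot a b (fun k => OmU i k • x) j = 0 := by
  simp only [jrot]
  rw [OmU_antisymm b j, OmU_antisymm a j]
  module

theorem jrot_smul (a b : Fin 4) (c : ℂ) (v : Fin 4 → V) (k : Fin 4) :
    jrot a b (fun l => c • v l) k = c • jrot a b v k := by
  simp only [jrot]; module

theorem sum_OmL_OmU_left (i n : Fin 4) : ∑ m, OmL m i * OmU m n = -kd i n := by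
  rw [← OmL_mul_OmU, ← Finset.sum_neg_distrib]
  exact Finset.sum_congr rfl fun m _ => by rw [OmL_antisymm m i]; ring

theorem sum_rotate_four (F : Fin 4 → Fin 4 → Fin 4 → Fin 4 → V) :
    ∑ p, ∑ q, ∑ r, ∑ s, F p q r s = ∑ r, ∑ s, ∑ p, ∑ q, F p q r s := by
  have h : ∀ F : Fin 4 → Fin 4 → Fin 4 → V,
      ∑ q, ∑ r, ∑ s, F q r s = ∑ r, ∑ s, ∑ q, F q r s := by
    intro F
    rw [Finset.sum_comm]
    exact Finset.sum_congr rfl fun _ _ => Finset.sum_comm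
  exact (Finset.sum_congr rfl fun p _ => h (F p)).trans (h fun p r s => ∑ q, F p q r s)

theorem eq_zero_of_eq_neg {x : V} (h : x = -x) : x = 0 := by
  have : (2 : ℂ) • x = 0 := by rw [two_smul]; nth_rw 2 [h]; exact add_neg_cancel x
  exact (smul_eq_zero_iff_right two_ne_zero).mp this

theorem eigen_of_mem_span {ι : Type*} (T : V →ₗ[ℂ] V) (c : ℂ) {u : ι → V}
    (hu : ∀ s, T (u s) = c • u s) {f : V} (hf : f ∈ Submodule.span ℂ (Set.range u)) :
    T f = c • f := by
  induction hf using Submodule.span_induction with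
  | mem x hx => obtain ⟨s, rfl⟩ := hx; exact hu s
  | zero => simp
  | add x y _ _ hx hy => rw [map_add, hx, hy, smul_add]
  | smul a x _ hx => rw [map_smul, hx, smul_comm]

theorem pair4_first (g : Fin 4 → Fin 4 → Fin 4 → V) (n : Fin 4) :
    pair4 (fun p q r s => OmL p q * OmL r s) (fun p q r s => OmU p n • g q r s) =
      -∑ r, ∑ s, OmL r s • g n r s := by
  unfold pair4
  rw [Finset.sum_comm]
  have h : ∀ q, ∑ p, ∑ r, ∑ s, (OmL p q * OmL r s) • OmU p n • g q r s =
      -(kd q n • ∑ r, ∑ s, OmL r s • g q r s) := by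
    intro q
    rw [← neg_smul, ← sum_OmL_OmU_left, Finset.sum_smul]
    simp only [Finset.smul_sum, smul_smul]
    exact Finset.sum_congr rfl fun _ _ => Finset.sum_congr rfl fun _ _ =>
      Finset.sum_congr rfl fun _ _ => by congr 1; ring
  simp only [h, Finset.sum_neg_distrib]
  rw [sum_kd_smul' n fun q => ∑ r, ∑ s, OmL r s • g q r s]

theorem pair4_second (g : Fin 4 → Fin 4 → Fin 4 → V) (n : Fin 4) :
    pair4 (fun p q r s => OmL p r * OmL q s) (fun p q r s => OmU p n • g q r s) =
      -∑ q, ∑ s, OmL q s • g q n s := by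
  rw [← pair4_first (fun r q s => g q r s)]
  unfold pair4
  exact Finset.sum_congr rfl fun _ _ => Finset.sum_comm

theorem pair4_third (g : Fin 4 → Fin 4 → Fin 4 → V) (n : Fin 4) :
    pair4 (fun p q r s => OmL p s * OmL q r) (fun p q r s => OmU p n • g q r s) =
      -∑ q, ∑ r, OmL q r • g q r n := by
  rw [← pair4_second (fun q s r => g q r s)]
  unfold pair4
  exact Finset.sum_congr rfl fun _ _ => Finset.sum_congr rfl fun _ _ => Finset.sum_comm

end Contractions

section Superspace

variable {A : Type*} [Ring A] [StarRing A] [Algebra ℂ A] [StarModule ℂ A]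
  {𝒜 : ZMod 2 → Submodule ℂ A} [GradedAlgebra 𝒜] (𝒮 : ConformalSuperspace 𝒜)

namespace ConformalSuperspace

theorem mem_cov_two {f : A} (hf : f ∈ 𝒮.cov 2) :
    f ∈ Submodule.span ℂ (Set.range fun v : Fin 4 × Fin 4 × Fin 4 × Fin 4 =>
      𝒮.W v.1 v.2.1 v.2.2.1 v.2.2.2) := (𝒮.cov_classification hf).2.1 rfl

theorem mem_cov_three {f : A} (hf : f ∈ 𝒮.cov 3) :
    f ∈ Submodule.span ℂ (Set.range fun v : _ × Fin 4 × Fin 4 × Fin 4 =>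
      𝒮.gradField v.1 v.2.1 v.2.2.1 v.2.2.2) := (𝒮.cov_classification hf).2.2.1 rfl

theorem mem_cov_four {f : A} (hf : f ∈ 𝒮.cov 4) :
    f ∈ Submodule.span ℂ (Set.range fun v : _ × Fin 4 × Fin 4 × Fin 4 × Fin 4 =>
      𝒮.quadField v.1 v.2.1 v.2.2.1 v.2.2.2.1 v.2.2.2.2) := (𝒮.cov_classification hf).2.2.2 rfl

theorem cov_eq_zero {m : ℤ} (hm : m < 2) {f : A} (hf : f ∈ 𝒮.cov m) : f = 0 :=
  (𝒮.cov_classification hf).1 hm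

/-- There is no `USp(4)` singlet among the covariant fields of dimension one. -/
theorem cov_two_singlet {f : A} (hf : f ∈ 𝒮.cov 2) (hJ : ∀ a b, 𝒮.J a b f = 0) : f = 0 := by
  -- The rank two tensor `W` is padded by the invariant Ω^{pq}, so that the rank four theorem
  -- applies.
  have h := mem_span_contractions 𝒮.J
    (fun (v : Fin 4 × Fin 4) p q r s => OmU p q • 𝒮.W v.1 v.2 r s) (by
      intro a b v p q r s
      rw [map_smul, 𝒮.J_W, jrot_OmU, zero_add, jrot_smul, jrot_smul, smul_add]) (f := f) (by
      refine map_mem_of_mem_span LinearMap.id (fun v => ?_) (𝒮.mem_cov_two hf)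
      refine Submodule.subset_span ⟨((v.1, v.2.1), 0, 1, v.2.2.1, v.2.2.2), ?_⟩
      simp [OmU]) hJ
  -- Each of the three contractions of Ω^{pq} W^{rs} reduces to a multiple of the Ω-trace of `W`,
  -- which is zero.
  have key : ∀ (n : Fin 4 → Fin 4 → Fin 4 → Fin 4 → ℂ) (c : ℂ),
      (∀ r s, ∑ p, ∑ q, n p q r s * OmU p q = c * OmL r s) → ∀ α β,
      pair4 n (fun p q r s => OmU p q • 𝒮.W α β r s) = 0 := by
    intro n c hn α β
    have e : pair4 n (fun p q r s => OmU p q • 𝒮.W α β r s) =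
        ∑ r, ∑ s, (∑ p, ∑ q, n p q r s * OmU p q) • 𝒮.W α β r s := by
      simp only [pair4, Finset.sum_smul, smul_smul]
      exact sum_rotate_four _
    simp only [e, hn, mul_smul, ← Finset.smul_sum]
    rw [𝒮.W_traceless, smul_zero]
  refine (Submodule.mem_bot ℂ).mp ((Submodule.span_le.mpr ?_) h)
  rintro _ ⟨⟨⟨α, β⟩, t⟩, rfl⟩
  rw [SetLike.mem_coe, Submodule.mem_bot]
  fin_cases t
  · refine key _ (-4) (fun r s => ?_) α β
    have : ∑ p, ∑ q, OmL p q * OmU p q = -4 := by simp [Fin.sum_univ_four, OmL, OmU]; norm_num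
    rw [← this]
    simp only [Finset.sum_mul]
    exact Finset.sum_congr rfl fun _ _ => Finset.sum_congr rfl fun _ _ => by simp; ring
  · refine key _ (-1) (fun r s => ?_) α β
    have h1 : ∀ p, ∑ q, OmL p r * OmL q s * OmU p q = OmL p r * kd p s := fun p => by
      rw [← OmU_mul_OmL, Finset.mul_sum]
      exact Finset.sum_congr rfl fun q _ => by ring
    have h2 : ∑ p, OmL p r * kd p s = OmL s r := by simp [kd]
    simpa [h1, h2] using OmL_antisymm s r
  · refine key _ 1 (fun r s => ?_) α β
    have h1 : ∀ p, ∑ q, OmL p s * OmL q r * OmU p q = OmL p s * kd p r := fun p => by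
      rw [← OmU_mul_OmL, Finset.mul_sum]
      exact Finset.sum_congr rfl fun q _ => by ring
    have h2 : ∑ p, OmL p s * kd p r = OmL r s := by simp [kd]
    simp [h1, h2]

/-- Weights of `J^{01}` and `J^{23}`. -/
theorem cov_two_weight {f : A} (hf : f ∈ 𝒮.cov 2) {a b : Fin 4} (hab : (a, b) = (0, 1) ∨
    (a, b) = (2, 3)) (hJ : 𝒮.J a b f = f ∨ 𝒮.J a b f = -f) : f = 0 := by
  set w : Fin 4 → ℂ := fun k => if k = a then 1 / 2 else if k = b then -(1 / 2) else 0 with hw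
  have hj : ∀ (v : Fin 4 → A) k, jrot a b v k = w k • v k := by
    intro v k
    rcases hab with h | h <;> simp only [Prod.mk.injEq] at h <;> obtain ⟨rfl, rfl⟩ := h <;>
      fin_cases k <;> simp [jrot, OmU, hw]
  -- Weight ±1 would need two equal indices, where the antisymmetric `W` vanishes; on the diagonal
  -- the eigenvalue may therefore be declared to be 0.
  have hu : ∀ v : Fin 4 × Fin 4 × Fin 4 × Fin 4, 𝒮.J a b (𝒮.W v.1 v.2.1 v.2.2.1 v.2.2.2) =
      (if v.2.2.1 = v.2.2.2 then 0 else w v.2.2.1 + w v.2.2.2) •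
        𝒮.W v.1 v.2.1 v.2.2.1 v.2.2.2 := by
    rintro ⟨α, β, k, l⟩
    rw [𝒮.J_W, hj, hj]
    dsimp only
    split_ifs with h
    · have h0 : 𝒮.W α β k l = 0 := by
        rw [h]
        exact eq_zero_of_eq_neg (𝒮.W_antisymm α β l l)
      rw [h0]; simp
    · rw [add_smul]
  have hμ : ∀ (s : ℂ), s = 1 ∨ s = -1 → ∀ v : Fin 4 × Fin 4 × Fin 4 × Fin 4,
      (if v.2.2.1 = v.2.2.2 then 0 else w v.2.2.1 + w v.2.2.2) ≠ s := by
    rintro s hs ⟨α, β, k, l⟩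
    simp only [hw]
    have hne : a ≠ b := by
      rcases hab with h | h <;> simp only [Prod.mk.injEq] at h <;> obtain ⟨rfl, rfl⟩ := h <;> decide
    rcases hs with rfl | rfl <;> split_ifs <;> first | (exfalso; simp_all; done) | norm_num
  rcases hJ with hJ | hJ
  · exact eq_zero_of_mem_span_eigenvectors _ _ _ hu (𝒮.mem_cov_two hf) (ν := 1)
      (by rw [hJ, one_smul]) (hμ 1 (Or.inl rfl))
  · exact eq_zero_of_mem_span_eigenvectors _ _ _ hu (𝒮.mem_cov_two hf) (ν := -1)
      (by rw [hJ, neg_one_smul]) (hμ (-1) (Or.inr rfl))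

/-- There is no adjoint of `USp(4)` among the covariant fields of dimension one. -/
theorem cov_two_adjoint {t : Fin 4 → Fin 4 → A} (ht : ∀ k l, t k l ∈ 𝒮.cov 2)
    (hs : ∀ k l, t k l = t l k)
    (hJ : ∀ a b k l, 𝒮.J a b (t k l) = jrot a b (fun x => t x l) k + jrot a b (fun x => t k x) l)
    (k l : Fin 4) : t k l = 0 := by
  -- A diagonal component of a symmetric tensor has weight ±1 under J^{01} or J^{23}.
  have hd : ∀ k, t k k = 0 := by
    intro k
    fin_cases k
    · refine 𝒮.cov_two_weight (ht 0 0) (Or.inl rfl) (Or.inl ?_)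
      simp [hJ, jrot, OmU]; module
    · refine 𝒮.cov_two_weight (ht 1 1) (Or.inl rfl) (Or.inr ?_)
      simp [hJ, jrot, OmU]; module
    · refine 𝒮.cov_two_weight (ht 2 2) (Or.inr rfl) (Or.inl ?_)
      simp [hJ, jrot, OmU]; module
    · refine 𝒮.cov_two_weight (ht 3 3) (Or.inr rfl) (Or.inr ?_)
      simp [hJ, jrot, OmU]; module
  -- The action of J^{ab} on the vanishing diagonal components gives relations for the others.
  have h1 : ∀ a b k, OmU k a • t b k + OmU k b • t a k = 0 := by
    intro a b k
    have h2 := hJ a b k k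
    rw [hd, map_zero] at h2
    simp only [jrot, hs k] at h2
    rw [← smul_right_injective A (two_ne_zero (α := ℂ)) |>.eq_iff]
    have h3 : (2 : ℂ) • (OmU k a • t b k + OmU k b • t a k) =
      (2 : ℂ) • ((1 / 2 : ℂ) • (OmU k a • t b k + OmU k b • t a k) +
        (1 / 2 : ℂ) • (OmU k a • t b k + OmU k b • t a k)) := by module
    rw [h3, ← h2]
  by_cases hkl : k = l
  · rw [hkl, hd]
  have h4 := h1 (jflip k) l k
  by_cases h5 : l = jflip k
  · subst h5
    rw [hs]
    fin_cases k <;> simp [jflip, OmU] at h4 ⊢ <;> exact eq_zero_of_eq_neg (by first | exact eq_neg_of_add_eq_zero_left h4 | (have := congrArg Neg.neg h4; simp at this; exact eq_neg_of_add_eq_zero_left this))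
  · rw [hs]
    fin_cases k <;> fin_cases l <;> simp_all [jflip, OmU]

/-- The fields of dimension one contain no tensor with two lower spinor indices. -/
theorem cov_two_lower_lower {t : Fin 4 → Fin 4 → A} (ht : ∀ γ δ, t γ δ ∈ 𝒮.cov 2)
    (hM : ∀ α β γ δ, 𝒮.Mss α β (t γ δ) =
      lrot α β (fun x => t x δ) γ + lrot α β (fun x => t γ x) δ) (γ δ : Fin 4) : t γ δ = 0 := by
  have hcW : ∀ v : Fin 4 × Fin 4 × Fin 4 × Fin 4, casimir 𝒮.Mss (𝒮.W v.1 v.2.1 v.2.2.1 v.2.2.2) =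
      (9 : ℂ) • 𝒮.W v.1 v.2.1 v.2.2.1 v.2.2.2 := by
    rintro ⟨α, β, i, j⟩
    have := casimir_upper_upper 𝒮.Mss (fun x y => 𝒮.W x y i j)
      (fun x y z w => 𝒮.Mss_W x y z w i j) α β
    rw [𝒮.W_symm β α] at this
    rw [this]; module
  -- All fields of dimension 1 have Casimir 9, while on two lower indices the Casimir is 7 plus
  -- twice the transposition.
  have hs : ∀ γ δ, t γ δ = t δ γ := by
    intro γ δ
    have h1 := casimir_lower_lower 𝒮.Mss t hM γ δ
    have h2 : casimir 𝒮.Mss (t γ δ) = (9 : ℂ) • t γ δ :=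
      eigen_of_mem_span _ _ hcW (𝒮.mem_cov_two (ht γ δ))
    rw [h2] at h1
    have h3 : (2 : ℂ) • (t γ δ - t δ γ) = 0 := by
      rw [← sub_eq_zero] at h1
      rw [← h1]; module
    exact sub_eq_zero.mp ((smul_eq_zero_iff_right two_ne_zero).mp h3)
  -- The two pairs of indices are told apart by weights: M_γ^γ has eigenvalue -3/2 on `t γ γ`, but
  -- only -1/2, 1/2 and 3/2 on the components of `W`.
  have hd : ∀ γ, t γ γ = 0 := by
    intro γ
    refine eq_zero_of_mem_span_eigenvectors (𝒮.Mss γ γ) _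
      (fun v : Fin 4 × Fin 4 × Fin 4 × Fin 4 => kd γ v.1 + kd γ v.2.1 - 1 / 2) ?_
      (𝒮.mem_cov_two (ht γ γ)) (ν := -(3 / 2)) ?_ ?_
    · rintro ⟨α, β, i, j⟩
      rw [Mss_W]
      have e : ∀ v : Fin 4 → A, ∀ x, urot γ γ v x = (kd γ x - 1 / 4) • v x := by
        intro v x
        unfold urot kd
        by_cases h : γ = x
        · subst h; simp; module
        · simp [h]
      rw [e, e]; module
    · rw [hM]
      simp only [lrot, kd]; simp; module
    · rintro ⟨α, β, i, j⟩
      simp only [kd]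
      split_ifs <;> norm_num
  by_cases hne : γ = δ
  · rw [hne, hd]
  -- M_γ^δ turns the lower index δ into γ, so acting on the vanishing `t δ δ` gives minus twice the
  -- off-diagonal component.
  have h := hM γ δ δ δ
  rw [hd, map_zero] at h
  simp only [lrot, kd, if_neg hne, if_true, mul_zero, zero_smul, zero_sub, one_smul, hs δ γ] at h
  have : (2 : ℂ) • t γ δ = 0 := by
    rw [two_smul, ← neg_eq_zero, neg_add]; exact h.symm
  exact (smul_eq_zero_iff_right two_ne_zero).mp this

theorem X36_eq (α β γ i : Fin 4) : X36 𝒮.toGens 𝒮.W α β γ i =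
    ∑ j, ∑ k, OmL j k • 𝒮.gradField (α, β, γ) j i k := by
  simp only [X36, low, map_sum, map_smul, gradField]

theorem gradField_antisymm (v i j k) : 𝒮.gradField v i j k = -𝒮.gradField v i k j := by
  simp only [gradField]; rw [𝒮.W_antisymm, map_neg]

theorem gradField_traceless (v i) : ∑ j, ∑ k, OmL j k • 𝒮.gradField v i j k = 0 := by
  have := congrArg (𝒮.Q v.1 i) (𝒮.W_traceless v.2.1 v.2.2)
  simpa only [map_sum, map_smul, map_zero, gradField] using this

theorem J_gradField (a b v i j k) : 𝒮.J a b (𝒮.gradField v i j k) =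
    jrot a b (fun x => 𝒮.gradField v x j k) i + jrot a b (fun x => 𝒮.gradField v i x k) j +
      jrot a b (fun x => 𝒮.gradField v i j x) k := by
  simp only [gradField, J_Q, 𝒮.J_W, map_add, map_jrot, add_assoc]

theorem X36_symm (α β γ i : Fin 4) :
    X36 𝒮.toGens 𝒮.W α β γ i = X36 𝒮.toGens 𝒮.W α γ β i := by
  simp only [X36, 𝒮.W_symm β γ]

theorem X36_trace (γ i : Fin 4) : ∑ α, X36 𝒮.toGens 𝒮.W α α γ i = 0 :=
  𝒮.constraint_trace γ i

theorem Mss_X36 (α β p q r i : Fin 4) : 𝒮.Mss α β (X36 𝒮.toGens 𝒮.W p q r i) =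
    lrot α β (fun x => X36 𝒮.toGens 𝒮.W x q r i) p + urot α β (fun x => X36 𝒮.toGens 𝒮.W p x r i) q
      + urot α β (fun x => X36 𝒮.toGens 𝒮.W p q x i) r := by
  simp only [X36_eq, gradField, map_sum, map_smul, Mss_Q, Mss_W, map_add, map_sub, map_urot, lrot, urot,
    Finset.smul_sum, ← Finset.sum_add_distrib, ← Finset.sum_sub_distrib]
  refine Finset.sum_congr rfl fun j _ => Finset.sum_congr rfl fun k _ => ?_
  module

/-- X is symmetric in its upper indices and all its traces vanish by the superspace constraint, so
the general formula collapses to 47/4 + 2. -/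
theorem casimir_X36 (p q r i : Fin 4) : casimir 𝒮.Mss (X36 𝒮.toGens 𝒮.W p q r i) =
    (55 / 4 : ℂ) • X36 𝒮.toGens 𝒮.W p q r i := by
  rw [casimir_lower_upper_upper 𝒮.Mss (fun x y z => X36 𝒮.toGens 𝒮.W x y z i)
    (fun a b x y z => 𝒮.Mss_X36 a b x y z i) p q r]
  have h : ∀ x, ∑ y, X36 𝒮.toGens 𝒮.W y x y i = 0 := fun x => by
    rw [← 𝒮.X36_trace x i]
    exact Finset.sum_congr rfl fun y _ => 𝒮.X36_symm y x y i
  rw [𝒮.X36_trace, h, 𝒮.X36_symm p r q]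
  module

/-- A `USp(4)` vector of covariant fields of dimension `3/2` is built from `X_α^{βγ i}`. -/
theorem cov_three_vector {t : Fin 4 → A} (ht : ∀ n, t n ∈ 𝒮.cov 3)
    (hJ : ∀ a b n, 𝒮.J a b (t n) = jrot a b t n) (n : Fin 4) :
    t n ∈ Submodule.span ℂ (Set.range fun v : Fin 4 × Fin 4 × Fin 4 =>
      X36 𝒮.toGens 𝒮.W v.1 v.2.1 v.2.2 n) := by
  -- The free index n is absorbed by passing to families `Fin 4 → A` and subtracting its rotation
  -- from J. A covariant family is then an invariant vector, to which the theorem on singlets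
  -- applies.
  let 𝒥 : Fin 4 → Fin 4 → Module.End ℂ (Fin 4 → A) := fun a b =>
    LinearMap.pi fun m => (𝒮.J a b) ∘ₗ (LinearMap.proj m) - ∑ p, jmat a b m p • LinearMap.proj p
  have h𝒥 : ∀ a b (s : Fin 4 → A) m, 𝒥 a b s m = 𝒮.J a b (s m) - jrot a b s m := by
    intro a b s m
    rw [jrot_eq_sum]
    simp [𝒥, LinearMap.sum_apply]
  -- The factor Ω^{mm'} supplies the fourth index that makes the gradient of `W` a tensor of rank
  -- four.
  let up : A →ₗ[ℂ] Fin 4 → Fin 4 → A :=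
    LinearMap.pi fun m => LinearMap.pi fun m' => OmU m m' • LinearMap.id
  have hup : ∀ x m m', up x m m' = OmU m m' • x := fun x m m' => by simp [up]
  have h := mem_span_contractions 𝒥
    (fun (v : Fin 4 × Fin 4 × Fin 4) p q r s => up (𝒮.gradField v q r s) p) (by
      intro a b v p q r s
      funext m
      rw [h𝒥]
      simp only [Pi.add_apply, hup, map_smul, J_gradField]
      have e : ∀ (F : Fin 4 → Fin 4 → A) k, jrot a b (fun x => (F x : Fin 4 → A)) k m =
          jrot a b (fun x => F x m) k := fun F k => by simp [jrot]
      have e2 : jrot a b (up (𝒮.gradField v q r s) p) m =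
          jrot a b (fun x => OmU p x • 𝒮.gradField v q r s) m := by
        congr 1
      rw [e2, e, e, e, e]
      simp only [hup, jrot_smul]
      rw [sub_eq_iff_eq_add]
      have h0 := jrot_OmU a b p m (𝒮.gradField v q r s)
      have h1 : ∀ X Y Z : A, X + Y = 0 → Z = X + Z + Y := by
        intro X Y Z h; rw [add_right_comm, h, zero_add]
      simp only [smul_add]
      refine (h1 _ _ _ h0).trans ?_
      simp only [add_assoc]) (f := t) (by
      have e : t = ∑ m', ∑ m, OmL m' m • up (t m') m := by
        funext m''
        simp only [Finset.sum_apply, Pi.smul_apply, hup, smul_smul, ← Finset.sum_smul, OmL_mul_OmU]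
        rw [sum_kd_smul' m'' t]
      rw [e]
      refine Submodule.sum_mem _ fun m' _ => Submodule.sum_mem _ fun m _ =>
        Submodule.smul_mem _ _ ?_
      refine map_mem_of_mem_span (LinearMap.proj m ∘ₗ up) (fun s => ?_) (𝒮.mem_cov_three (ht m'))
      exact Submodule.subset_span ⟨(s.1, m, s.2.1, s.2.2.1, s.2.2.2), rfl⟩) (by
      intro a b
      funext m
      rw [h𝒥, hJ, sub_self]; rfl)
  refine map_mem_of_mem_span (LinearMap.proj n) (fun s => ?_) h
  obtain ⟨v, k⟩ := s
  have hsum : ∀ c : Fin 4 → Fin 4 → Fin 4 → Fin 4 → ℂ,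
      (LinearMap.proj n : (Fin 4 → A) →ₗ[ℂ] A) (pair4 c fun p q r s => up (𝒮.gradField v q r s) p) =
      pair4 c fun p q r s => OmU p n • 𝒮.gradField v q r s := by
    intro c
    simp only [pair4, map_sum, map_smul, LinearMap.proj_apply, hup]
  rw [hsum]
  have hX : X36 𝒮.toGens 𝒮.W v.1 v.2.1 v.2.2 n ∈ Submodule.span ℂ
      (Set.range fun v : Fin 4 × Fin 4 × Fin 4 => X36 𝒮.toGens 𝒮.W v.1 v.2.1 v.2.2 n) :=
    Submodule.subset_span ⟨v, rfl⟩
  rw [X36_eq] at hX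
  -- Of the three contractions the first is the Ω-trace of `W` and vanishes; the other two are -X
  -- and X.
  fin_cases k
  · have := pair4_first (𝒮.gradField v) n
    rw [gradField_traceless, neg_zero] at this
    exact this ▸ zero_mem _
  · have := pair4_second (𝒮.gradField v) n
    exact this ▸ neg_mem hX
  · have := pair4_third (𝒮.gradField v) n
    simp only [𝒮.gradField_antisymm v _ _ n, smul_neg, Finset.sum_neg_distrib, neg_neg] at this
    exact this ▸ hX

/-- There is no gamma-vector-spinor of dimension `3/2`. -/
theorem cov_three_vector_spinor {t : Fin 6 → Fin 4 → Fin 4 → A} (ht : ∀ a γ i, t a γ i ∈ 𝒮.cov 3)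
    (hJ : ∀ a b c γ i, 𝒮.J a b (t c γ i) = jrot a b (t c γ) i)
    (hM : ∀ a b c γ i, 𝒮.M a b (t c γ i) = vrot a b (fun d => t d γ i) c +
      (-(1 / 2) : ℂ) • ∑ δ, gam2 a b γ δ • t c δ i) (a : Fin 6) (γ i : Fin 4) : t a γ i = 0 := by
  set T : Fin 4 → Fin 4 → Fin 4 → A := fun p q r => ∑ c, gU c p q • t c r i with hT
  have hTM : ∀ α β p q r, 𝒮.Mss α β (T p q r) = lrot α β (fun x => T x q r) p +
      lrot α β (fun x => T p x r) q + lrot α β (fun x => T p q x) r := by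
    intro α β p q r
    rw [Gens.Mss_apply]
    simp only [hT, map_sum, map_smul, hM, smul_add, Finset.sum_add_distrib]
    rw [mssSum_add, mssSum_vector]
    congr 1
    have e : ∀ a b, ∑ c, gU c p q • (-(1 / 2) : ℂ) • ∑ δ, gam2 a b r δ • t c δ i =
        (-(1 / 2) : ℂ) • ∑ δ, gam2 a b r δ • ∑ c, gU c p q • t c δ i := by
      intro a b
      simp only [Finset.smul_sum]
      rw [Finset.sum_comm]
      exact Finset.sum_congr rfl fun _ _ => Finset.sum_congr rfl fun _ _ => by
        simp only [smul_smul]; congr 1; ring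
    simp only [e, mssSum_lower]
  have hanti : ∀ p q r, T p q r = -T q p r := by
    intro p q r
    simp only [hT, gU_antisymm _ p q, neg_smul, Finset.sum_neg_distrib]
  have hc : ∀ p q r, casimir 𝒮.Mss (T p q r) = (55 / 4 : ℂ) • T p q r := by
    intro p q r
    have h1 : T p q r ∈ Submodule.span ℂ (Set.range fun v : Fin 4 × Fin 4 × Fin 4 =>
        X36 𝒮.toGens 𝒮.W v.1 v.2.1 v.2.2 i) :=
      Submodule.sum_mem _ fun c _ => Submodule.smul_mem _ _
        (𝒮.cov_three_vector (ht c r) (fun a b n => hJ a b c r n) i)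
    exact eigen_of_mem_span _ _ (fun s => 𝒮.casimir_X36 _ _ _ i) h1
  -- As a spinor tensor, a vector-spinor has three lower indices, antisymmetric in the first two;
  -- the possible Casimirs are 15/4 and 39/4. The value 55/4 inherited from X is not among them, and
  -- the resulting cyclic linear system is nondegenerate.
  have h0 : ∀ p q r, (3 : ℂ) • T p q r + T q r p + T r p q = 0 := by
    intro p q r
    have h1 := casimir_lower_lower_lower 𝒮.Mss T hTM p q r
    rw [hc, hanti q p r, hanti r q p, hanti p r q, ← sub_eq_zero] at h1
    have h2 : (2 : ℂ) • ((3 : ℂ) • T p q r + T q r p + T r p q) = 0 := by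
      rw [← h1]; module
    exact (smul_eq_zero_iff_right two_ne_zero).mp h2
  have hz : ∀ p q r, T p q r = 0 := by
    intro p q r
    have h1 := h0 p q r
    have h2 := h0 q r p
    have h3 := h0 r p q
    have h4 : (10 : ℂ) • T p q r = 0 := by
      have : (10 : ℂ) • T p q r = (4 : ℂ) • ((3 : ℂ) • T p q r + T q r p + T r p q) -
        ((3 : ℂ) • T q r p + T r p q + T p q r) - ((3 : ℂ) • T r p q + T p q r + T q r p) := by
          module
      rw [this, h1, h2, h3]; simp
    exact (smul_eq_zero_iff_right (by norm_num)).mp h4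
  exact sum_gU_eq_zero (v := fun c => t c γ i) (fun p q => hz p q γ) a

end ConformalSuperspace

end Superspace

end

/-! ### The bilinear invariants of the super-Weyl tensor -/

section

section Contractions

variable {V : Type*} [AddCommGroup V] [Module ℂ V]

/-- Invariance of Ω, as a statement about contracted fields: the rotations of the two contracted
indices cancel. -/
theorem sum_OmL_jrot (a b : Fin 4) (v : Fin 4 → Fin 4 → V) :
    ∑ p, ∑ r, OmL p r • (jrot a b (fun x => v x r) p + jrot a b (fun x => v p x) r) = 0 := by
  have h1 : ∀ c d r, ∑ p, (OmL p r * OmU p c) • v d r = -(kd r c • v d r) := fun c d r => by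
    rw [← Finset.sum_smul, sum_OmL_OmU_left, neg_smul]
  have h2 : ∀ c d p, ∑ r, (OmL p r * OmU r c) • v p d = kd p c • v p d := fun c d p => by
    rw [← Finset.sum_smul, OmL_mul_OmU]
  have e : ∑ p, ∑ r, OmL p r • (jrot a b (fun x => v x r) p + jrot a b (fun x => v p x) r) =
      (1 / 2 : ℂ) • (∑ r, ∑ p, ((OmL p r * OmU p a) • v b r + (OmL p r * OmU p b) • v a r)) +
      (1 / 2 : ℂ) • ∑ p, ∑ r, ((OmL p r * OmU r a) • v p b + (OmL p r * OmU r b) • v p a) := by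
    rw [Finset.sum_comm (f := fun r p => _ + _)]
    simp only [Finset.smul_sum, ← Finset.sum_add_distrib]
    refine Finset.sum_congr rfl fun p _ => Finset.sum_congr rfl fun r _ => ?_
    simp only [jrot]; module
  rw [e]
  simp only [Finset.sum_add_distrib, h1, h2, Finset.sum_neg_distrib]
  rw [sum_kd_smul' a fun r => v b r, sum_kd_smul' b fun r => v a r, sum_kd_smul' a fun p => v p b,
    sum_kd_smul' b fun p => v p a]
  module

/-- The counterpart of `slash_vrot` for a contraction with upper spinor indices. -/
theorem sum_gL_gamt2 (a b c : Fin 6) (u : Fin 4 → Fin 4 → V) :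
    ∑ α, ∑ β, gL c α β • ((-(1 / 2) : ℂ) • ∑ z, gamt2 a b α z • u z β +
      (-(1 / 2) : ℂ) • ∑ z, gamt2 a b β z • u α z) =
    vrot a b (fun d => ∑ α, ∑ β, gL d α β • u α β) c := by
  have e : ∑ α, ∑ β, gL c α β • ((-(1 / 2) : ℂ) • ∑ z, gamt2 a b α z • u z β +
      (-(1 / 2) : ℂ) • ∑ z, gamt2 a b β z • u α z) =
      ∑ x, ∑ y, (-(eta c c) * ((-(1 / 2) : ℂ) *
        ∑ z, (gam2 a b x z * gU c z y + gam2 a b y z * gU c x z))) • u x y := by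
    simp only [smul_add, Finset.sum_add_distrib, Finset.mul_sum, Finset.sum_smul, Finset.smul_sum,
      smul_smul, mul_add, add_smul]
    congr 1
    · rw [Finset.sum_comm]
      refine (Finset.sum_congr rfl fun y _ => Finset.sum_comm).trans ?_
      rw [Finset.sum_comm]
      refine Finset.sum_congr rfl fun x _ => Finset.sum_congr rfl fun y _ =>
        Finset.sum_congr rfl fun z _ => ?_
      rw [gamt2_eq, gL_apply]; congr 1; ring
    · refine Finset.sum_congr rfl fun x _ => ?_
      rw [Finset.sum_comm]
      refine Finset.sum_congr rfl fun y _ => Finset.sum_congr rfl fun z _ => ?_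
      rw [gamt2_eq, gL_apply]; congr 1; ring
  rw [e]
  simp only [gam2_gU, vrot, Finset.smul_sum, ← Finset.sum_sub_distrib, smul_smul, ← sub_smul]
  refine Finset.sum_congr rfl fun x _ => Finset.sum_congr rfl fun y _ => ?_
  congr 1
  rw [gL_apply, gL_apply]
  by_cases h1 : b = c
  · subst h1
    by_cases h2 : a = b
    · subst h2; simp
    · simp [h2, eta_of_ne (Ne.symm h2)]
      try ring
  · by_cases h2 : a = c
    · subst h2; simp [h1, eta_of_ne (Ne.symm h1)]
      try ring
    · simp [h1, h2, eta_of_ne (Ne.symm h1), eta_of_ne (Ne.symm h2)]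

end Contractions

section Superspace

variable {A : Type*} [Ring A] [StarRing A] [Algebra ℂ A] [StarModule ℂ A]
  {𝒜 : ZMod 2 → Submodule ℂ A} [GradedAlgebra 𝒜] (𝒮 : ConformalSuperspace 𝒜)

namespace ConformalSuperspace

/-- `W^{αβ ij} W^{γδ}_{ij}`. -/
def bil (α β γ δ : Fin 4) : A := ∑ i, ∑ j, 𝒮.W α β i j * low2 (𝒮.W γ δ) i j

theorem bil_eq_pair4 (α β γ δ : Fin 4) : 𝒮.bil α β γ δ =
    pair4 (fun p q r s => OmL p r * OmL q s) fun p q r s => 𝒮.W α β p q * 𝒮.W γ δ r s := by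
  simp only [bil, low2, pair4, Finset.mul_sum, mul_smul_comm]

theorem bil_symm_left (α β γ δ : Fin 4) : 𝒮.bil α β γ δ = 𝒮.bil β α γ δ := by
  simp only [bil, 𝒮.W_symm α β]

theorem bil_symm_right (α β γ δ : Fin 4) : 𝒮.bil α β γ δ = 𝒮.bil α β δ γ := by
  have : 𝒮.W γ δ = 𝒮.W δ γ := funext fun i => funext fun j => 𝒮.W_symm γ δ i j
  simp only [bil, this]

/-- The fields are even, and the signs of the two antisymmetric Ω cancel. -/
theorem bil_exchange (α β γ δ : Fin 4) : 𝒮.bil α β γ δ = 𝒮.bil γ δ α β := by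
  simp only [bil_eq_pair4, pair4]
  rw [sum_rotate_four]
  refine Finset.sum_congr rfl fun r _ => Finset.sum_congr rfl fun s _ =>
    Finset.sum_congr rfl fun p _ => Finset.sum_congr rfl fun q _ => ?_
  rw [OmL_antisymm p r, OmL_antisymm q s, 𝒮.even_comm _ (𝒮.W_even α β p q), neg_mul_neg]

theorem J_bil (a b α β γ δ : Fin 4) : 𝒮.J a b (𝒮.bil α β γ δ) = 0 := by
  simp only [bil_eq_pair4, pair4, map_sum, map_smul, (𝒮.J_der a b).leibniz, 𝒮.J_W]
  set w := 𝒮.W α β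
  set x := 𝒮.W γ δ
  have h1 : ∀ q s, ∑ p, ∑ r, OmL p r • (jrot a b (fun m => w m q * x r s) p +
      jrot a b (fun m => w p q * x m s) r) = 0 := fun q s =>
    sum_OmL_jrot a b fun p r => w p q * x r s
  have h2 : ∀ p r, ∑ q, ∑ s, OmL q s • (jrot a b (fun m => w p m * x r s) q +
      jrot a b (fun m => w p q * x r m) s) = 0 := fun p r =>
    sum_OmL_jrot a b fun q s => w p q * x r s
  have e : ∀ p q r s, (OmL p r * OmL q s) •
      ((jrot a b (fun m => w m q) p + jrot a b (fun m => w p m) q) * x r s +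
        w p q * (jrot a b (fun m => x m s) r + jrot a b (fun m => x r m) s)) =
      OmL q s • OmL p r • (jrot a b (fun m => w m q * x r s) p +
        jrot a b (fun m => w p q * x m s) r) +
      OmL p r • OmL q s • (jrot a b (fun m => w p m * x r s) q +
        jrot a b (fun m => w p q * x r m) s) := by
    intro p q r s
    simp only [jrot, add_mul, mul_add, smul_mul_assoc, mul_smul_comm]
    module
  simp only [e, Finset.sum_add_distrib]
  have e1 : ∀ F : Fin 4 → Fin 4 → Fin 4 → Fin 4 → A, ∑ p, ∑ q, ∑ r, ∑ s, F p q r s =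
      ∑ q, ∑ s, ∑ p, ∑ r, F p q r s := by
    intro F
    rw [Finset.sum_comm]
    refine Finset.sum_congr rfl fun q _ => ?_
    rw [Finset.sum_comm (γ := Fin 4) (f := fun s p => ∑ r, F p q r s)]
    exact Finset.sum_congr rfl fun p _ => Finset.sum_comm
  rw [e1]
  have e2 : ∀ F : Fin 4 → Fin 4 → Fin 4 → Fin 4 → A, ∑ p, ∑ q, ∑ r, ∑ s, F p q r s =
      ∑ p, ∑ r, ∑ q, ∑ s, F p q r s := fun F =>
    Finset.sum_congr rfl fun p _ => Finset.sum_comm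
  rw [e2 fun p q r s => OmL p r • OmL q s • _]
  simp only [← Finset.smul_sum, h1, h2, smul_zero, Finset.sum_const_zero, add_zero]

theorem bil_mem_cov (α β γ δ : Fin 4) : 𝒮.bil α β γ δ ∈ 𝒮.cov 4 := by
  rw [bil_eq_pair4]
  exact Submodule.sum_mem _ fun _ _ => Submodule.sum_mem _ fun _ _ => Submodule.sum_mem _ fun _ _ =>
    Submodule.sum_mem _ fun _ _ => Submodule.smul_mem _ _
      (𝒮.mul_mem_cov (𝒮.W_mem_cov _ _ _ _) (𝒮.W_mem_cov _ _ _ _))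

theorem Mss_bil (x y α β γ δ : Fin 4) : 𝒮.Mss x y (𝒮.bil α β γ δ) =
    urot x y (fun z => 𝒮.bil z β γ δ) α + urot x y (fun z => 𝒮.bil α z γ δ) β +
      urot x y (fun z => 𝒮.bil α β z δ) γ + urot x y (fun z => 𝒮.bil α β γ z) δ := by
  simp only [bil_eq_pair4, pair4, map_sum, map_smul, Mss_der, Mss_W, urot, Finset.smul_sum,
    ← Finset.sum_add_distrib, ← Finset.sum_sub_distrib]
  refine Finset.sum_congr rfl fun _ _ => Finset.sum_congr rfl fun _ _ =>
    Finset.sum_congr rfl fun _ _ => Finset.sum_congr rfl fun _ _ => ?_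
  simp only [add_mul, sub_mul, mul_add, mul_sub, smul_mul_assoc, mul_smul_comm]
  module

theorem M_bil (a b : Fin 6) (α β γ δ : Fin 4) : 𝒮.M a b (𝒮.bil α β γ δ) =
    ((-(1 / 2) : ℂ) • ∑ z, gamt2 a b α z • 𝒮.bil z β γ δ +
      (-(1 / 2) : ℂ) • ∑ z, gamt2 a b γ z • 𝒮.bil α β z δ) +
    ((-(1 / 2) : ℂ) • ∑ z, gamt2 a b β z • 𝒮.bil α z γ δ +
      (-(1 / 2) : ℂ) • ∑ z, gamt2 a b δ z • 𝒮.bil α β γ z) := by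
  simp only [bil_eq_pair4, pair4, map_sum, map_smul, (𝒮.M_der a b).leibniz, 𝒮.M_W]
  have e1 : ∀ (c : Fin 4 → ℂ) (F : Fin 4 → Fin 4 → Fin 4 → Fin 4 → Fin 4 → A),
      (-(1 / 2) : ℂ) • ∑ z, c z • ∑ p, ∑ q, ∑ r, ∑ s, F z p q r s =
      ∑ p, ∑ q, ∑ r, ∑ s, (-(1 / 2) : ℂ) • ∑ z, c z • F z p q r s := by
    intro c F
    simp only [Finset.smul_sum]
    rw [Finset.sum_comm]
    refine Finset.sum_congr rfl fun p _ => ?_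
    rw [Finset.sum_comm]
    refine Finset.sum_congr rfl fun q _ => ?_
    rw [Finset.sum_comm]
    refine Finset.sum_congr rfl fun r _ => Finset.sum_comm
  simp only [e1, ← Finset.sum_add_distrib]
  refine Finset.sum_congr rfl fun p _ => Finset.sum_congr rfl fun q _ =>
    Finset.sum_congr rfl fun r _ => Finset.sum_congr rfl fun s _ => ?_
  simp only [smul_mul_assoc, mul_smul_comm, Finset.sum_mul, Finset.mul_sum, add_mul, mul_add,
    smul_add, Finset.sum_add_distrib, Finset.smul_sum]
  simp only [smul_smul]
  have e2 : ∀ (c d : ℂ) (x : A), (OmL p r * OmL q s * (c * d)) • x =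
    (c * (d * (OmL p r * OmL q s))) • x := fun c d x => by congr 1; ring
  simp only [e2]
  abel

theorem WW_eq (a b : Fin 6) : WW 𝒮.W a b =
    ∑ α, ∑ β, gL a α β • ∑ γ, ∑ δ, gL b γ δ • 𝒮.bil α γ β δ := by
  simp only [WW, bil, Finset.smul_sum, smul_smul]

theorem WW_mem_cov (a b : Fin 6) : WW 𝒮.W a b ∈ 𝒮.cov 4 := by
  rw [WW_eq]
  exact Submodule.sum_mem _ fun _ _ => Submodule.sum_mem _ fun _ _ => Submodule.smul_mem _ _ <|
    Submodule.sum_mem _ fun _ _ => Submodule.sum_mem _ fun _ _ => Submodule.smul_mem _ _ <|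
      𝒮.bil_mem_cov _ _ _ _

theorem J_WW (i j : Fin 4) (a b : Fin 6) : 𝒮.J i j (WW 𝒮.W a b) = 0 := by
  simp only [WW_eq, map_sum, map_smul, J_bil, smul_zero, Finset.sum_const_zero]

/-- Symmetry of each `W` in its spinor pair exchanges the two gamma matrices. An antisymmetric
multiple of `WW` is thereby excluded, which later removes the dilatation curvature. -/
theorem WW_comm (a b : Fin 6) : WW 𝒮.W a b = WW 𝒮.W b a := by
  simp only [WW_eq, Finset.smul_sum]
  rw [sum_rotate_four]
  refine Finset.sum_congr rfl fun γ _ => Finset.sum_congr rfl fun δ _ =>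
    Finset.sum_congr rfl fun α _ => Finset.sum_congr rfl fun β _ => ?_
  rw [smul_comm, 𝒮.bil_symm_left, 𝒮.bil_symm_right]

theorem M_WW (a b c d : Fin 6) : 𝒮.M a b (WW 𝒮.W c d) =
    vrot a b (fun e => WW 𝒮.W e d) c + vrot a b (fun e => WW 𝒮.W c e) d := by
  have e2 : ∀ c, vrot a b (fun e => WW 𝒮.W c e) d = ∑ α, ∑ β, gL c α β •
      vrot a b (fun e => ∑ γ, ∑ δ, gL e γ δ • 𝒮.bil α γ β δ) d := by
    intro c
    simp only [vrot, WW_eq, smul_sub, Finset.sum_sub_distrib, Finset.smul_sum]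
    congr 1 <;>
    exact Finset.sum_congr rfl fun _ _ => Finset.sum_congr rfl fun _ _ =>
      Finset.sum_congr rfl fun _ _ => Finset.sum_congr rfl fun _ _ => smul_comm _ _ _
  rw [e2]
  simp only [WW_eq, map_sum, map_smul, M_bil]
  rw [← sum_gL_gamt2, ← Finset.sum_add_distrib]
  refine Finset.sum_congr rfl fun α _ => ?_
  rw [← Finset.sum_add_distrib]
  refine Finset.sum_congr rfl fun β _ => ?_
  rw [← smul_add]
  congr 1
  rw [← sum_gL_gamt2]
  have e1 : ∀ (k : Fin 4 → ℂ) (F : Fin 4 → Fin 4 → Fin 4 → A),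
      (-(1 / 2) : ℂ) • ∑ z, k z • ∑ γ, ∑ δ, gL d γ δ • F z γ δ =
      ∑ γ, ∑ δ, gL d γ δ • (-(1 / 2) : ℂ) • ∑ z, k z • F z γ δ := by
    intro c F
    simp only [Finset.smul_sum]
    rw [Finset.sum_comm]
    refine Finset.sum_congr rfl fun p _ => ?_
    rw [Finset.sum_comm]
    refine Finset.sum_congr rfl fun q _ => Finset.sum_congr rfl fun z _ => ?_
    module
  simp only [e1, ← Finset.sum_add_distrib, ← smul_add]

end ConformalSuperspace

end Superspace

end

/-! ### `USp(4)` singlets of dimension two and their Casimir eigenvalues -/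

section

section Contractions

variable {V : Type*} [AddCommGroup V] [Module ℂ V]

theorem pair4_eq_zero {u : Fin 4 → Fin 4 → Fin 4 → Fin 4 → V}
    (h : ∀ p q, ∑ r, ∑ s, OmL r s • u p q r s = 0) :
    pair4 (fun p q r s => OmL p q * OmL r s) u = 0 := by
  refine Finset.sum_eq_zero fun p _ => Finset.sum_eq_zero fun q _ => ?_
  simp only [mul_smul, ← Finset.smul_sum, h, smul_zero]

theorem pair4_swap {u : Fin 4 → Fin 4 → Fin 4 → Fin 4 → V}
    (h : ∀ p q r s, u p q r s = -u p q s r) :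
    pair4 (fun p q r s => OmL p s * OmL q r) u = -pair4 (fun p q r s => OmL p r * OmL q s) u := by
  simp only [pair4, ← Finset.sum_neg_distrib]
  refine Finset.sum_congr rfl fun p _ => Finset.sum_congr rfl fun q _ => ?_
  rw [Finset.sum_comm]
  exact Finset.sum_congr rfl fun r _ => Finset.sum_congr rfl fun s _ => by
    rw [h p q s r, smul_neg]

theorem pair4_flip (u : Fin 4 → Fin 4 → Fin 4 → Fin 4 → V) :
    pair4 (fun p q r s => OmL p r * OmL q s) u =
      pair4 (fun p q r s => OmL p r * OmL q s) fun p q r s => u q p s r := by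
  simp only [pair4]
  rw [Finset.sum_comm]
  refine Finset.sum_congr rfl fun p _ => Finset.sum_congr rfl fun q _ => ?_
  rw [Finset.sum_comm]
  exact Finset.sum_congr rfl fun r _ => Finset.sum_congr rfl fun s _ => by rw [mul_comm]

theorem pair4_add (n : Fin 4 → Fin 4 → Fin 4 → Fin 4 → ℂ) (u v : Fin 4 → Fin 4 → Fin 4 → Fin 4 → V) :
    pair4 n (fun p q r s => u p q r s + v p q r s) = pair4 n u + pair4 n v := by
  simp only [pair4, smul_add, Finset.sum_add_distrib]

theorem pair4_neg (n : Fin 4 → Fin 4 → Fin 4 → Fin 4 → ℂ) (u : Fin 4 → Fin 4 → Fin 4 → Fin 4 → V) :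
    pair4 n (fun p q r s => -u p q r s) = -pair4 n u := by
  simp only [pair4, smul_neg, Finset.sum_neg_distrib]

theorem pair4_smul (n : Fin 4 → Fin 4 → Fin 4 → Fin 4 → ℂ) (c : ℂ)
    (u : Fin 4 → Fin 4 → Fin 4 → Fin 4 → V) :
    pair4 n (fun p q r s => c • u p q r s) = c • pair4 n u := by
  simp only [pair4, Finset.smul_sum, smul_comm c]

theorem pair4_sum {ι : Type*} (t : Finset ι) (n : Fin 4 → Fin 4 → Fin 4 → Fin 4 → ℂ)
    (u : ι → Fin 4 → Fin 4 → Fin 4 → Fin 4 → V) :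
    pair4 n (fun p q r s => ∑ x ∈ t, u x p q r s) = ∑ x ∈ t, pair4 n (u x) := by
  classical
  induction t using Finset.induction_on with
  | empty => simp [pair4]
  | insert x t hx ih => simp only [Finset.sum_insert hx, pair4_add, ih]

end Contractions

section Superspace

variable {A : Type*} [Ring A] [StarRing A] [Algebra ℂ A] [StarModule ℂ A]
  {𝒜 : ZMod 2 → Submodule ℂ A} [GradedAlgebra 𝒜] (𝒮 : ConformalSuperspace 𝒜)

namespace ConformalSuperspace

/-- The `USp(4)` singlet in `∇_δ^i ∇_α^j W^{βγ kl}`. -/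
def quadSinglet (δ α β γ : Fin 4) : A :=
  pair4 (fun p q r s => OmL p r * OmL q s) fun p q r s => 𝒮.Q δ p (𝒮.Q α q (𝒮.W β γ r s))

/-- The span of the fields `W^{αβ ij} W^{γδ}_{ij}`. -/
def bilSpan : Submodule ℂ A :=
  Submodule.span ℂ (Set.range fun v : Fin 4 × Fin 4 × Fin 4 × Fin 4 =>
    𝒮.bil v.1 v.2.1 v.2.2.1 v.2.2.2)

theorem bil_mem (α β γ δ : Fin 4) : 𝒮.bil α β γ δ ∈ 𝒮.bilSpan :=
  Submodule.subset_span ⟨(α, β, γ, δ), rfl⟩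

/-- The `USp(4)` singlets of dimension two. -/
theorem cov_four_singlet {f : A} (hf : f ∈ 𝒮.cov 4) (hJ : ∀ a b, 𝒮.J a b f = 0) :
    f ∈ Submodule.span ℂ (Set.range fun v : Fin 4 × Fin 4 × Fin 4 × Fin 4 =>
      𝒮.quadSinglet v.1 v.2.1 v.2.2.1 v.2.2.2) ⊔ 𝒮.bilSpan := by
  have h := mem_span_contractions 𝒮.J 𝒮.quadField (by
    intro a b v p q r s
    rcases v with v | v
    · simp only [quadField, J_Q, 𝒮.J_W, map_add, map_jrot, add_assoc]
    · simp only [quadField, (𝒮.J_der a b).leibniz, 𝒮.J_W, jrot, add_mul, mul_add, smul_mul_assoc,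
        mul_smul_comm]
      module) (𝒮.mem_cov_four hf) hJ
  refine Submodule.span_le.mpr ?_ h
  rintro _ ⟨⟨v, k⟩, rfl⟩
  have htr : ∀ p q, ∑ r, ∑ s, OmL r s • 𝒮.quadField v p q r s = 0 := by
    intro p q
    rcases v with v | v
    · have := congrArg (fun x => 𝒮.Q v.1 p (𝒮.Q v.2.1 q x)) (𝒮.W_traceless v.2.2.1 v.2.2.2)
      simpa only [map_sum, map_smul, map_zero, quadField] using this
    · have := congrArg (fun x => 𝒮.W v.1 v.2.1 p q * x) (𝒮.W_traceless v.2.2.1 v.2.2.2)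
      simpa only [Finset.mul_sum, mul_smul_comm, mul_zero, quadField] using this
  have hanti : ∀ p q r s, 𝒮.quadField v p q r s = -𝒮.quadField v p q s r := by
    intro p q r s
    rcases v with v | v
    · simp only [quadField]; rw [𝒮.W_antisymm _ _ r s, map_neg, map_neg]
    · simp only [quadField]; rw [𝒮.W_antisymm _ _ r s, mul_neg]
  have hmain : pair4 (fun p q r s => OmL p r * OmL q s) (𝒮.quadField v) ∈
      Submodule.span ℂ (Set.range fun v : Fin 4 × Fin 4 × Fin 4 × Fin 4 =>
        𝒮.quadSinglet v.1 v.2.1 v.2.2.1 v.2.2.2) ⊔ 𝒮.bilSpan := by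
    rcases v with v | v
    · exact Submodule.mem_sup_left (Submodule.subset_span ⟨v, rfl⟩)
    · refine Submodule.mem_sup_right ?_
      have := 𝒮.bil_mem v.1 v.2.1 v.2.2.1 v.2.2.2
      rwa [bil_eq_pair4] at this
  fin_cases k
  · change pair4 (fun p q r s => OmL p q * OmL r s) (𝒮.quadField v) ∈ _
    rw [pair4_eq_zero htr]
    exact zero_mem _
  · exact hmain
  · change pair4 (fun p q r s => OmL p s * OmL q r) (𝒮.quadField v) ∈ _
    rw [pair4_swap hanti]
    exact neg_mem hmain

theorem Mss_quadSinglet (x y δ α β γ : Fin 4) : 𝒮.Mss x y (𝒮.quadSinglet δ α β γ) =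
    lrot x y (fun z => 𝒮.quadSinglet z α β γ) δ + lrot x y (fun z => 𝒮.quadSinglet δ z β γ) α +
      urot x y (fun z => 𝒮.quadSinglet δ α z γ) β + urot x y (fun z => 𝒮.quadSinglet δ α β z) γ := by
  simp only [quadSinglet, pair4, map_sum, map_smul, Mss_Q, Mss_W, map_add, map_urot, map_lrot]
  simp only [lrot, urot, Finset.smul_sum, ← Finset.sum_add_distrib, ← Finset.sum_sub_distrib]
  refine Finset.sum_congr rfl fun _ _ => Finset.sum_congr rfl fun _ _ =>
    Finset.sum_congr rfl fun _ _ => Finset.sum_congr rfl fun _ _ => ?_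
  module

theorem pair4_W_mul_Mss_W (x y a b β γ : Fin 4) :
    pair4 (fun p q r s => OmL p r * OmL q s)
      (fun p q r s => 𝒮.W x y p q * 𝒮.Mss a b (𝒮.W β γ r s)) =
    urot a b (fun z => 𝒮.bil x y z γ) β + urot a b (fun z => 𝒮.bil x y β z) γ := by
  simp only [bil_eq_pair4, Mss_W, urot, mul_add, mul_sub, mul_smul_comm]
  simp only [pair4, Finset.smul_sum, ← Finset.sum_add_distrib, ← Finset.sum_sub_distrib]
  refine Finset.sum_congr rfl fun _ _ => Finset.sum_congr rfl fun _ _ =>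
    Finset.sum_congr rfl fun _ _ => Finset.sum_congr rfl fun _ _ => ?_
  module

theorem urot_bil_mem (a b x : Fin 4) {v : Fin 4 → A} (hv : ∀ z, v z ∈ 𝒮.bilSpan) :
    urot a b v x ∈ 𝒮.bilSpan :=
  sub_mem (Submodule.smul_mem _ _ (hv _)) (Submodule.smul_mem _ _ (hv _))

/-- Exchanging the lower indices produces an anticommutator of spinor derivatives. Its torsion part
contracts Ω^{pq} into `W` and gives the vanishing Ω-trace; its curvature part rotates `W` and gives
bilinears. -/
theorem quadSinglet_sub_mem (δ α β γ : Fin 4) :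
    𝒮.quadSinglet δ α β γ - 𝒮.quadSinglet α δ β γ ∈ 𝒮.bilSpan := by
  have e1 : -𝒮.quadSinglet α δ β γ = pair4 (fun p q r s => OmL p r * OmL q s)
      fun p q r s => 𝒮.Q α q (𝒮.Q δ p (𝒮.W β γ r s)) := by
    rw [quadSinglet, pair4_flip, ← pair4_neg]
    congr 1
    funext p q r s
    rw [𝒮.W_antisymm _ _ s r, map_neg, map_neg, neg_neg]
  have e2 : 𝒮.quadSinglet δ α β γ - 𝒮.quadSinglet α δ β γ =
      pair4 (fun p q r s => OmL p r * OmL q s)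
        (fun p q r s => (𝒮.flatQQ δ p α q) (𝒮.W β γ r s)) +
      pair4 (fun p q r s => OmL p r * OmL q s)
        (fun p q r s => (curvQQ 𝒮.toGens 𝒮.W δ p α q) (𝒮.W β γ r s)) := by
    rw [sub_eq_add_neg, e1, quadSinglet, ← pair4_add, ← pair4_add]
    congr 1
    funext p q r s
    have := congrArg (fun T : Module.End ℂ A => T (𝒮.W β γ r s)) (𝒮.QQ δ p α q)
    simpa only [acomm, LinearMap.add_apply, Module.End.mul_apply] using this
  rw [e2]
  refine add_mem ?_ ?_
  · have h0 : pair4 (fun p q r s => OmL p r * OmL q s)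
        (fun p q r s => (𝒮.flatQQ δ p α q) (𝒮.W β γ r s)) =
        (-2 * Complex.I) • 𝒮.Pss δ α (pair4 (fun p q r s => OmL p r * OmL q s)
          (fun p q r s => OmU p q • 𝒮.W β γ r s)) := by
      simp only [pair4, Gens.flatQQ, LinearMap.smul_apply, map_sum, map_smul, Finset.smul_sum]
      refine Finset.sum_congr rfl fun _ _ => Finset.sum_congr rfl fun _ _ =>
        Finset.sum_congr rfl fun _ _ => Finset.sum_congr rfl fun _ _ => ?_
      module
    have h1 : pair4 (fun p q r s => OmL p r * OmL q s)
        (fun p q r s => OmU p q • 𝒮.W β γ r s) = 0 := by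
      simp only [pair4, smul_smul]
      rw [sum_rotate_four]
      have h2 : ∀ r s, ∑ p, ∑ q, (OmL p r * OmL q s * OmU p q) = -OmL r s := by
        intro r s
        have h3 : ∀ p, ∑ q, OmL p r * OmL q s * OmU p q = OmL p r * kd p s := fun p => by
          rw [← OmU_mul_OmL, Finset.mul_sum]
          exact Finset.sum_congr rfl fun q _ => by ring
        have h4 : ∑ p, OmL p r * kd p s = OmL s r := by simp [kd]
        simpa [h3, h4] using OmL_antisymm s r
      simp only [← Finset.sum_smul, h2, neg_smul, Finset.sum_neg_distrib, 𝒮.W_traceless, neg_zero]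
    rw [h0, h1, map_zero, smul_zero]
    exact zero_mem _
  · simp only [curvQQ_W, pair4_sum, pair4_smul, pair4_W_mul_Mss_W]
    exact Submodule.sum_mem _ fun _ _ => Submodule.sum_mem _ fun _ _ => Submodule.sum_mem _
      fun _ _ => Submodule.smul_mem _ _ (add_mem (𝒮.urot_bil_mem _ _ _ fun _ => 𝒮.bil_mem _ _ _ _)
        (𝒮.urot_bil_mem _ _ _ fun _ => 𝒮.bil_mem _ _ _ _))

/-- The inner derivative is contracted with `W` both in its spinor and in its `USp(4)` index, which
is the superspace constraint. -/
theorem quadSinglet_trace (δ γ : Fin 4) : ∑ x, 𝒮.quadSinglet δ x x γ = 0 := by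
  have h := fun r => 𝒮.constraint_trace γ r
  simp only [low, map_sum, map_smul] at h
  have e : ∑ x, 𝒮.quadSinglet δ x x γ = ∑ p, ∑ r, OmL p r •
      𝒮.Q δ p (∑ x, ∑ q, ∑ s, OmL q s • 𝒮.Q x q (𝒮.W x γ r s)) := by
    simp only [quadSinglet, pair4, map_sum, map_smul, Finset.smul_sum, smul_smul]
    rw [Finset.sum_comm]
    refine Finset.sum_congr rfl fun p _ => ?_
    rw [Finset.sum_congr rfl fun x _ => Finset.sum_comm, Finset.sum_comm]
  rw [e]
  simp only [h, map_zero, smul_zero, Finset.sum_const_zero]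

theorem quadSinglet_symm (δ α β γ : Fin 4) :
    𝒮.quadSinglet δ α β γ = 𝒮.quadSinglet δ α γ β := by
  simp only [quadSinglet, 𝒮.W_symm β γ]

/-- Modulo bilinears this tensor is symmetric in the lower pair and traceless, and it is symmetric
in the upper pair; the Casimir of this irreducible type is 16 + 2 + 2 = 20. -/
theorem casimir_quadSinglet (δ α β γ : Fin 4) :
    casimir 𝒮.Mss (𝒮.quadSinglet δ α β γ) - (20 : ℂ) • 𝒮.quadSinglet δ α β γ ∈ 𝒮.bilSpan := by
  rw [casimir_lower_lower_upper_upper 𝒮.Mss 𝒮.quadSinglet 𝒮.Mss_quadSinglet,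
    𝒮.quadSinglet_symm δ α γ β]
  have t1 : ∀ d c, ∑ x, 𝒮.quadSinglet d x c x = 0 := fun d c => by
    rw [← 𝒮.quadSinglet_trace d c]
    exact Finset.sum_congr rfl fun x _ => 𝒮.quadSinglet_symm _ _ _ _
  have t2 : ∀ d c, ∑ x, 𝒮.quadSinglet x d x c ∈ 𝒮.bilSpan := fun d c => by
    have := Submodule.sum_mem 𝒮.bilSpan (t := Finset.univ)
      fun x _ => 𝒮.quadSinglet_sub_mem x d x c
    rwa [Finset.sum_sub_distrib, quadSinglet_trace, sub_zero] at this
  have t3 : ∀ d c, ∑ x, 𝒮.quadSinglet x d c x ∈ 𝒮.bilSpan := fun d c => by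
    rw [Finset.sum_congr rfl fun x _ => 𝒮.quadSinglet_symm x d c x]
    exact t2 d c
  rw [t1, quadSinglet_trace]
  have h1 := 𝒮.quadSinglet_sub_mem α δ β γ
  have e : (16 : ℂ) • 𝒮.quadSinglet δ α β γ + (2 : ℂ) • (𝒮.quadSinglet α δ β γ +
      𝒮.quadSinglet δ α β γ) - (2 : ℂ) • (kd β δ • ∑ x, 𝒮.quadSinglet x α x γ +
        kd γ δ • ∑ x, 𝒮.quadSinglet x α β x + kd β α • (0 : A) + kd γ α • (0 : A)) -
      (20 : ℂ) • 𝒮.quadSinglet δ α β γ =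
      (2 : ℂ) • (𝒮.quadSinglet α δ β γ - 𝒮.quadSinglet δ α β γ) -
      (2 : ℂ) • (kd β δ • ∑ x, 𝒮.quadSinglet x α x γ +
        kd γ δ • ∑ x, 𝒮.quadSinglet x α β x) := by module
  rw [e]
  exact sub_mem (Submodule.smul_mem _ _ h1) (Submodule.smul_mem _ _ (add_mem
    (Submodule.smul_mem _ _ (t2 _ _)) (Submodule.smul_mem _ _ (t3 _ _))))

theorem casimir_bil (α β γ δ : Fin 4) : casimir 𝒮.Mss (𝒮.bil α β γ δ) =
    (16 : ℂ) • 𝒮.bil α β γ δ + (4 : ℂ) • 𝒮.bil α γ β δ + (4 : ℂ) • 𝒮.bil α δ β γ := by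
  rw [casimir_upper4 𝒮.Mss 𝒮.bil 𝒮.Mss_bil, 𝒮.bil_symm_left β α γ δ, 𝒮.bil_symm_right α β δ γ,
    𝒮.bil_symm_left γ β α δ, 𝒮.bil_exchange β γ α δ, 𝒮.bil_symm_left δ β γ α,
    𝒮.bil_exchange β δ γ α, 𝒮.bil_symm_left γ α β δ, 𝒮.bil_symm_right α δ γ β]
  module

/-- `W^{αβ ij} W^{γδ}_{ij} - W^{αγ ij} W^{βδ}_{ij}`. -/
def mixedBil (α β γ δ : Fin 4) : A := 𝒮.bil α β γ δ - 𝒮.bil α γ β δ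

/-- The symmetric square of a symmetric spinor pair has two irreducible parts: the totally symmetric
one with Casimir 24 and the mixed one with Casimir 12. Subtracting 24 leaves only mixed terms. -/
theorem casimir_bil_sub (α β γ δ : Fin 4) :
    casimir 𝒮.Mss (𝒮.bil α β γ δ) - (24 : ℂ) • 𝒮.bil α β γ δ =
      (-4 : ℂ) • (𝒮.mixedBil α β γ δ + 𝒮.mixedBil α β δ γ) := by
  rw [casimir_bil, mixedBil, mixedBil, 𝒮.bil_symm_right α β δ γ]; module

theorem mixedBil_antisymm (α β γ δ : Fin 4) : 𝒮.mixedBil α β γ δ = -𝒮.mixedBil α γ β δ := by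
  rw [mixedBil, mixedBil, neg_sub]

theorem mixedBil_antisymm' (α β γ δ : Fin 4) : 𝒮.mixedBil α β γ δ = -𝒮.mixedBil δ β γ α := by
  rw [mixedBil, mixedBil, 𝒮.bil_exchange δ β γ α, 𝒮.bil_symm_left γ α, 𝒮.bil_symm_right α γ δ β,
    𝒮.bil_exchange δ γ β α, 𝒮.bil_symm_left β α, 𝒮.bil_symm_right α β δ γ]
  module

end ConformalSuperspace

end Superspace

end

/-! ### Uniqueness of the singlet with two vector indices -/

section

/-- Two antisymmetric pairs of lower spinor indices, that is two vector indices. -/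
structure IsBispinor {V : Type*} [AddCommGroup V] [Module ℂ V] (m : Fin 4 → Fin 4 → Module.End ℂ V)
    (F : Fin 4 → Fin 4 → Fin 4 → Fin 4 → V) : Prop where
  rot : ∀ α β p q r s, m α β (F p q r s) = lrot α β (fun x => F x q r s) p +
    lrot α β (fun x => F p x r s) q + lrot α β (fun x => F p q x s) r +
    lrot α β (fun x => F p q r x) s
  left : ∀ p q r s, F p q r s = -F q p r s
  right : ∀ p q r s, F p q r s = -F p q s r

namespace IsBispinor

variable {V : Type*} [AddCommGroup V] [Module ℂ V] {m : Fin 4 → Fin 4 → Module.End ℂ V}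
  {F : Fin 4 → Fin 4 → Fin 4 → Fin 4 → V}

theorem casimir_eq (hF : IsBispinor m F) (p q r s : Fin 4) : casimir m (F p q r s) =
    (8 : ℂ) • F p q r s + (2 : ℂ) • (F p r q s + F q s p r - F p s q r - F q r p s) := by
  rw [casimir_lower4 m F hF.rot, hF.left q p, hF.left r q, hF.left s q, hF.right p s,
    hF.right p q s r, hF.right q s r p]
  module

theorem both (hF : IsBispinor m F) (p q r s : Fin 4) : F p q r s = F q p s r := by
  rw [hF.left, hF.right, neg_neg]

/-- The product of two vectors splits into scalar, antisymmetric and traceless symmetric parts, with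
Casimirs 0, 8 and 12; the identity is x(x - 8)(x - 12) = 0. -/
theorem casimir_cubic (hF : IsBispinor m F) (p q r s : Fin 4) :
    casimir m (casimir m (casimir m (F p q r s))) =
      (20 : ℂ) • casimir m (casimir m (F p q r s)) - (96 : ℂ) • casimir m (F p q r s) := by
  have c1 := hF.casimir_eq p q r s
  have c1' := hF.casimir_eq r s p q
  rw [hF.both r p s q, hF.both s q r p, hF.both r q s p, hF.both s p r q] at c1'
  have c2 := hF.casimir_eq p r q s
  rw [hF.right p s r q, hF.left r q p s] at c2
  have c2' := hF.casimir_eq q s p r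
  rw [hF.both q p s r, hF.both s r q p, hF.right q r s p, hF.left s p q r] at c2'
  have c3 := hF.casimir_eq p s q r
  rw [hF.right p q s r, hF.left s r p q, hF.right p r s q, hF.left s q p r] at c3
  have c3' := hF.casimir_eq q r p s
  rw [hF.left q p r s, hF.right r s q p, hF.right q s r p, hF.left r p q s] at c3'
  simp only [c1, map_add, map_sub, map_neg, map_smul, c1', c2, c2', c3, c3']
  module

/-- The hypothesis is (x - 12)(x - 20)(x - 24) = 0. Its only common root with x(x - 8)(x - 12) is
12. -/
theorem casimir_twelve (hF : IsBispinor m F) (p q r s : Fin 4)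
    (h : casimir m (casimir m (casimir m (F p q r s))) -
      (56 : ℂ) • casimir m (casimir m (F p q r s)) + (1008 : ℂ) • casimir m (F p q r s) -
      (5760 : ℂ) • F p q r s = 0) : casimir m (F p q r s) = (12 : ℂ) • F p q r s := by
  have h1 := hF.casimir_cubic p q r s
  generalize F p q r s = x at *
  have h3 := congrArg (casimir m) h
  simp only [map_sub, map_add, map_smul, map_zero, h1] at h h3
  set y := casimir m x
  set z := casimir m y
  -- Bézout: modulo the cubic identity, 7680(x - 12) equals 16 + 3x times the polynomial of the
  -- hypothesis.
  have h4 : (7680 : ℂ) • (y - (12 : ℂ) • x) =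
      (16 : ℂ) • ((20 : ℂ) • z - (96 : ℂ) • y - (56 : ℂ) • z + (1008 : ℂ) • y - (5760 : ℂ) • x) +
      (3 : ℂ) • ((20 : ℂ) • ((20 : ℂ) • z - (96 : ℂ) • y) - (96 : ℂ) • z -
        (56 : ℂ) • ((20 : ℂ) • z - (96 : ℂ) • y) + (1008 : ℂ) • z - (5760 : ℂ) • y) := by
    module
  rw [h, h3, smul_zero, smul_zero, add_zero] at h4
  exact sub_eq_zero.mp ((smul_eq_zero_iff_right (by norm_num)).mp h4)

/-- The Casimir 12 singles out an irreducible representation, which is generated by its extremal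
component F_{0101}. For distinct c and b the operator M_c^b replaces a lower index b by c, so all
components can be reached from this one. -/
theorem eq_zero_of_corner (hF : IsBispinor m F)
    (hc : ∀ p q r s, casimir m (F p q r s) = (12 : ℂ) • F p q r s) (h0 : F 0 1 0 1 = 0)
    (p q r s : Fin 4) : F p q r s = 0 := by
  have two : ∀ {x : V}, (2 : ℂ) • x = 0 → x = 0 := fun h =>
    (smul_eq_zero_iff_right two_ne_zero).mp h
  have hl : ∀ p r s, F p p r s = 0 := fun p r s => eq_zero_of_eq_neg (hF.left p p r s)
  have hr : ∀ p q r, F p q r r = 0 := fun p q r => eq_zero_of_eq_neg (hF.right p q r r)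
  have lower1 : ∀ a b c, c ≠ b → F a b a b = 0 → F a c a b + F a b a c = 0 := by
    intro a b c hcb h
    by_cases hab : a = b
    · subst hab; rw [hl, hr, add_zero]
    have h1 := hF.rot c b a b a b
    rw [h, map_zero] at h1
    simp only [lrot, kd, if_neg hcb, if_neg (Ne.symm hab), if_true, mul_zero, zero_smul, zero_sub,
      sub_zero, one_smul, neg_zero, zero_add, add_zero] at h1
    rw [← neg_eq_zero, neg_add]; exact h1.symm
  have lower2 : ∀ a b c, a ≠ b → c ≠ b → F a b a b = 0 → F a c a c = 0 := by
    intro a b c hab hcb h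
    have h1 := hF.rot c b a c a b
    have h2 := hF.rot c b a b a c
    simp only [lrot, kd, if_neg hcb, if_neg (Ne.symm hab), if_neg (Ne.symm hcb), if_true, mul_zero,
      zero_smul, zero_sub, sub_zero, one_smul, neg_zero, zero_add, add_zero] at h1 h2
    have h3 := congrArg (m c b) (lower1 a b c hcb h)
    rw [map_add, h1, h2, map_zero] at h3
    exact two (by rw [two_smul, ← neg_eq_zero, neg_add]; exact h3)
  have hP0 : ∀ b, F 0 b 0 b = 0 := by
    intro b
    by_cases hb : b = 1
    · rw [hb, h0]
    · exact lower2 0 1 b (by decide) hb h0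
  have hP : ∀ a b, F a b a b = 0 := by
    intro a b
    by_cases ha : a = 0
    · rw [ha, hP0]
    by_cases hb : b = 0
    · rw [hF.both, hb, hP0]
    · exact lower2 a 0 b ha hb (by rw [hF.both, hP0])
  have hA : ∀ a b c, F a c a b + F a b a c = 0 := by
    intro a b c
    by_cases h : c = b
    · rw [h, hP, add_zero]
    · exact lower1 a b c h (hP a b)
  -- On these components the permuted terms cancel and the Casimir formula gives 8 instead of 12.
  have hB : ∀ a b c, F a b a c = 0 := by
    intro a b c
    have h1 := hF.casimir_eq a b a c
    have h2 : F a c b a + F b a a c = 0 := by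
      rw [hF.right a c b a, hF.left b a a c, ← neg_add, hA, neg_zero]
    rw [hc, hl, hr, zero_add, zero_sub, sub_eq_add_neg, ← neg_add, h2, neg_zero, smul_zero,
      add_zero, ← sub_eq_zero, ← sub_smul] at h1
    exact (smul_eq_zero_iff_right (by norm_num)).mp h1
  -- M_d^a is applied to the vanishing components with a repeated index a.
  have hS : ∀ a b c d, F d b a c = -F a b d c := by
    intro a b c d
    rw [← add_eq_zero_iff_eq_neg]
    by_cases h : d = a
    · rw [h, hB, add_zero]
    have h1 := hF.rot d a a b a c
    simp only [hB, map_zero, lrot, kd, if_neg h, if_true, mul_zero, zero_smul, zero_sub, one_smul,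
      smul_zero, neg_zero, add_zero] at h1
    rw [← neg_eq_zero, neg_add]; exact h1.symm
  -- The exchange relation makes each of the four permuted terms contribute -F, so the formula gives
  -- 8 - 8 = 0 instead of 12.
  have h1 := hF.casimir_eq p q r s
  have e1 : F p r q s = -F p q r s := by rw [hF.left p r, hS q, hF.left q p]; simp
  have e2 : F q s p r = -F p q r s := by rw [hF.left q s, hS p, hF.right p q s r]; simp
  have e3 : F p s q r = F p q r s := by rw [hF.left p s, hS q, hF.left q p, hF.right p q]; simp
  have e4 : F q r p s = F p q r s := by rw [hF.left q r, hS p]; simp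
  rw [hc, e1, e2, e3, e4] at h1
  have h2 : (12 : ℂ) • F p q r s = 0 := by rw [h1]; module
  exact (smul_eq_zero_iff_right (by norm_num)).mp h2

end IsBispinor

section Slash

variable {V : Type*} [AddCommGroup V] [Module ℂ V]

/-- The bispinor components of a tensor with two vector indices. -/
def slash2 (f : Fin 6 → Fin 6 → V) (p q r s : Fin 4) : V :=
  ∑ c, gU c p q • ∑ d, gU d r s • f c d

theorem slash2_eq_zero {f : Fin 6 → Fin 6 → V} (h : ∀ p q r s, slash2 f p q r s = 0) (c d : Fin 6) :
    f c d = 0 :=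
  sum_gU_eq_zero (v := f c) (fun r s =>
    sum_gU_eq_zero (v := fun c => ∑ d, gU d r s • f c d) (fun p q => h p q r s) c) d

theorem sum_smul_sum_sum_comm {ι κ κ' : Type*} [Fintype ι] [Fintype κ] [Fintype κ'] (g : ι → ℂ)
    (h : κ → κ' → ℂ) (u : ι → κ → κ' → V) :
    ∑ d, g d • ∑ α, ∑ β, h α β • u d α β = ∑ α, ∑ β, h α β • ∑ d, g d • u d α β := by
  simp only [Finset.smul_sum]
  rw [Finset.sum_comm]
  refine Finset.sum_congr rfl fun α _ => ?_
  rw [Finset.sum_comm]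
  exact Finset.sum_congr rfl fun _ _ => Finset.sum_congr rfl fun _ _ => smul_comm _ _ _

theorem sum_gU_sum_gL (p q : Fin 4) (u : Fin 4 → Fin 4 → V) :
    ∑ c, gU c p q • ∑ α, ∑ β, gL c α β • u α β = ∑ α, ∑ β, (2 * lc p q α β) • u α β := by
  simp only [← gU_completeness, Finset.sum_smul, Finset.smul_sum, smul_smul]
  rw [Finset.sum_comm]
  exact Finset.sum_congr rfl fun α _ => Finset.sum_comm

theorem sum_lc_zero_one (u : Fin 4 → Fin 4 → V) :
    ∑ α, ∑ β, (2 * lc 0 1 α β) • u α β = (2 : ℂ) • (u 2 3 - u 3 2) := by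
  have h : ∀ α β, lc 0 1 α β = if (α, β) = (2, 3) then 1 else if (α, β) = (3, 2) then -1 else 0 := by
    intro α β
    fin_cases α <;> fin_cases β <;> simp [lc] <;> norm_num
  simp [h, Fin.sum_univ_four, Prod.ext_iff]
  module

end Slash

section Superspace

variable {A : Type*} [Ring A] [StarRing A] [Algebra ℂ A] [StarModule ℂ A]
  {𝒜 : ZMod 2 → Submodule ℂ A} [GradedAlgebra 𝒜] (𝒮 : ConformalSuperspace 𝒜)

namespace ConformalSuperspace

theorem isBispinor_slash2 {f : Fin 6 → Fin 6 → A} (hM : ∀ a b c d, 𝒮.M a b (f c d) =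
    vrot a b (fun e => f e d) c + vrot a b (fun e => f c e) d) :
    IsBispinor 𝒮.Mss (slash2 f) where
  left p q r s := by
    simp only [slash2, gU_antisymm _ p q, neg_smul, Finset.sum_neg_distrib]
  right p q r s := by
    simp only [slash2, gU_antisymm _ r s, neg_smul, Finset.sum_neg_distrib, smul_neg]
  rot α β p q r s := by
    rw [Gens.Mss_apply]
    have e : ∀ a b, 𝒮.M a b (slash2 f p q r s) =
        (∑ c, gU c p q • vrot a b (fun e => ∑ d, gU d r s • f e d) c) +
        ∑ c, gU c p q • ∑ d, gU d r s • vrot a b (fun e => f c e) d := by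
      intro a b
      simp only [slash2, map_sum, map_smul, hM, smul_add, Finset.sum_add_distrib]
      congr 1
      refine Finset.sum_congr rfl fun c _ => ?_
      simp only [vrot, Finset.smul_sum, ← Finset.sum_sub_distrib]
      exact Finset.sum_congr rfl fun d _ => by module
    simp only [e, mssSum_add, mssSum_vector, mssSum_sum, mssSum_smul]
    have e2 : ∀ x (v : Fin 6 → Fin 4 → A), ∑ c, gU c p q • lrot α β (v c) x =
        lrot α β (fun z => ∑ c, gU c p q • v c z) x := by
      intro x v
      simp only [lrot, Finset.smul_sum, ← Finset.sum_sub_distrib]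
      exact Finset.sum_congr rfl fun c _ => by module
    simp only [smul_add, Finset.sum_add_distrib, e2, ← add_assoc, slash2]

/-- The span of the fields `W^{αβ ij} W^{γδ}_{ij} - W^{αγ ij} W^{βδ}_{ij}`. -/
def mixedSpan : Submodule ℂ A :=
  Submodule.span ℂ (Set.range fun v : Fin 4 × Fin 4 × Fin 4 × Fin 4 =>
    𝒮.mixedBil v.1 v.2.1 v.2.2.1 v.2.2.2)

theorem mixedBil_mem (α β γ δ : Fin 4) : 𝒮.mixedBil α β γ δ ∈ 𝒮.mixedSpan :=
  Submodule.subset_span ⟨(α, β, γ, δ), rfl⟩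

theorem casimir_mixedBil (α β γ δ : Fin 4) :
    casimir 𝒮.Mss (𝒮.mixedBil α β γ δ) = (12 : ℂ) • 𝒮.mixedBil α β γ δ := by
  rw [mixedBil, map_sub, casimir_bil, casimir_bil, 𝒮.bil_exchange α δ γ β, 𝒮.bil_symm_left γ β,
    𝒮.bil_symm_right β γ α δ, 𝒮.bil_exchange β γ δ α, 𝒮.bil_symm_left δ α]
  module

theorem casimir_of_mem_mixedSpan {f : A} (hf : f ∈ 𝒮.mixedSpan) :
    casimir 𝒮.Mss f = (12 : ℂ) • f :=
  eigen_of_mem_span _ _ (fun _ => 𝒮.casimir_mixedBil _ _ _ _) hf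

theorem casimir_sub_of_mem_bilSpan {f : A} (hf : f ∈ 𝒮.bilSpan) :
    casimir 𝒮.Mss f - (24 : ℂ) • f ∈ 𝒮.mixedSpan := by
  have : (casimir 𝒮.Mss - (24 : ℂ) • (1 : Module.End ℂ A) : Module.End ℂ A) f ∈ 𝒮.mixedSpan := by
    refine map_mem_of_mem_span _ (fun v => ?_) hf
    have := 𝒮.casimir_bil_sub v.1 v.2.1 v.2.2.1 v.2.2.2
    simp only [LinearMap.sub_apply, LinearMap.smul_apply, Module.End.one_apply, this]
    exact Submodule.smul_mem _ _ (add_mem (𝒮.mixedBil_mem _ _ _ _) (𝒮.mixedBil_mem _ _ _ _))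
  simpa using this

theorem mixedSpan_le_bilSpan : 𝒮.mixedSpan ≤ 𝒮.bilSpan := by
  refine Submodule.span_le.mpr ?_
  rintro _ ⟨v, rfl⟩
  exact sub_mem (𝒮.bil_mem _ _ _ _) (𝒮.bil_mem _ _ _ _)

/-- The first link of a chain: C - 20 maps singlets of dimension two to bilinears, C - 24 maps
bilinears to mixed ones, and C - 12 annihilates the mixed ones. -/
theorem casimir_sub_of_singlet {f : A} (hf : f ∈ 𝒮.cov 4) (hJ : ∀ a b, 𝒮.J a b f = 0) :
    casimir 𝒮.Mss f - (20 : ℂ) • f ∈ 𝒮.bilSpan := by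
  have h : Submodule.span ℂ (Set.range fun v : Fin 4 × Fin 4 × Fin 4 × Fin 4 =>
      𝒮.quadSinglet v.1 v.2.1 v.2.2.1 v.2.2.2) ⊔ 𝒮.bilSpan ≤
      𝒮.bilSpan.comap (casimir 𝒮.Mss - (20 : ℂ) • (1 : Module.End ℂ A)) := by
    refine sup_le (Submodule.span_le.mpr ?_) fun g hg => ?_
    · rintro _ ⟨v, rfl⟩
      have := 𝒮.casimir_quadSinglet v.1 v.2.1 v.2.2.1 v.2.2.2
      simpa only [SetLike.mem_coe, Submodule.mem_comap, LinearMap.sub_apply, LinearMap.smul_apply,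
        Module.End.one_apply] using this
    · have := 𝒮.mixedSpan_le_bilSpan (𝒮.casimir_sub_of_mem_bilSpan hg)
      have h4 := add_mem this (Submodule.smul_mem _ (4 : ℂ) hg)
      have e : casimir 𝒮.Mss g - (24 : ℂ) • g + (4 : ℂ) • g =
        (casimir 𝒮.Mss - (20 : ℂ) • (1 : Module.End ℂ A) : Module.End ℂ A) g := by
          simp only [LinearMap.sub_apply, LinearMap.smul_apply, Module.End.one_apply]; module
      rwa [e] at h4
  exact h (𝒮.cov_four_singlet hf hJ)

section VectorTensor

variable {f : Fin 6 → Fin 6 → A} (hf : ∀ a b, f a b ∈ 𝒮.cov 4)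
  (hJ : ∀ i j a b, 𝒮.J i j (f a b) = 0)
  (hM : ∀ a b c d, 𝒮.M a b (f c d) = vrot a b (fun e => f e d) c + vrot a b (fun e => f c e) d)
include hf hJ hM

/-- The spectra 12, 20, 24 of singlets and 0, 8, 12 of two-vector tensors meet only in 12. There C -
20 and C - 24 act as -8 and -12, so dividing by these numbers carries the field first into the
bilinears and then into the mixed ones. -/
theorem casimir_slash2 (p q r s : Fin 4) : casimir 𝒮.Mss (slash2 f p q r s) =
    (12 : ℂ) • slash2 f p q r s ∧ slash2 f p q r s ∈ 𝒮.mixedSpan := by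
  have hF := 𝒮.isBispinor_slash2 hM
  have h0 : slash2 f p q r s ∈ 𝒮.cov 4 := Submodule.sum_mem _ fun _ _ => Submodule.smul_mem _ _ <|
    Submodule.sum_mem _ fun _ _ => Submodule.smul_mem _ _ (hf _ _)
  have h1 := 𝒮.casimir_sub_of_singlet h0 fun i j => by
    simp only [slash2, map_sum, map_smul, hJ, smul_zero, Finset.sum_const_zero]
  have h2 := 𝒮.casimir_sub_of_mem_bilSpan h1
  have h3 := 𝒮.casimir_of_mem_mixedSpan h2
  have h4 := hF.casimir_twelve p q r s (by
    simp only [map_sub, map_smul] at h3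
    rw [← sub_eq_zero] at h3
    rw [← h3]
    module)
  refine ⟨h4, ?_⟩
  rw [h4] at h1
  have h5 : slash2 f p q r s ∈ 𝒮.bilSpan := by
    have := Submodule.smul_mem _ (-(1 / 8) : ℂ) h1
    have e : (-(1 / 8) : ℂ) • ((12 : ℂ) • slash2 f p q r s - (20 : ℂ) • slash2 f p q r s) =
      slash2 f p q r s := by module
    rwa [e] at this
  have h6 := 𝒮.casimir_sub_of_mem_bilSpan h5
  rw [h4] at h6
  have := Submodule.smul_mem _ (-(1 / 12) : ℂ) h6
  have e : (-(1 / 12) : ℂ) • ((12 : ℂ) • slash2 f p q r s - (24 : ℂ) • slash2 f p q r s) =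
    slash2 f p q r s := by module
  rwa [e] at this

/-- M_0^0 + M_1^1 has eigenvalue -2 on this component, and on a bilinear the number of indices in
{0, 1} minus 2. All four spinor indices must then lie in {2, 3}, where the symmetries leave one
mixed bilinear up to sign. -/
theorem slash2_corner : ∃ c : ℂ, slash2 f 0 1 0 1 = c • 𝒮.mixedBil 2 2 3 3 := by
  have h := (𝒮.casimir_slash2 hf hJ hM 0 1 0 1).2
  have hu : ∀ (v : Fin 4 → A) x, urot 0 0 v x + urot 1 1 v x =
      ((if x = 0 ∨ x = 1 then 1 else 0) - 1 / 2 : ℂ) • v x := by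
    intro v x
    fin_cases x <;> simp [urot, kd] <;> module
  set μ : Fin 4 × Fin 4 × Fin 4 × Fin 4 → ℂ := fun v =>
    (if v.1 = 0 ∨ v.1 = 1 then 1 else 0) + (if v.2.1 = 0 ∨ v.2.1 = 1 then 1 else 0) +
      (if v.2.2.1 = 0 ∨ v.2.2.1 = 1 then 1 else 0) +
      (if v.2.2.2 = 0 ∨ v.2.2.2 = 1 then 1 else 0) - 2 with hμ
  have hb : ∀ α β γ δ, (𝒮.Mss 0 0 + 𝒮.Mss 1 1) (𝒮.bil α β γ δ) =
      μ (α, β, γ, δ) • 𝒮.bil α β γ δ := by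
    intro α β γ δ
    rw [LinearMap.add_apply, Mss_bil, Mss_bil]
    have e : ∀ a1 a2 a3 a4 b1 b2 b3 b4 : A, a1 + a2 + a3 + a4 + (b1 + b2 + b3 + b4) =
      (a1 + b1) + (a2 + b2) + (a3 + b3) + (a4 + b4) := by intros; abel
    rw [e, hu, hu, hu, hu]
    simp only [hμ]; module
  have hm : ∀ v : Fin 4 × Fin 4 × Fin 4 × Fin 4, (𝒮.Mss 0 0 + 𝒮.Mss 1 1)
      (𝒮.mixedBil v.1 v.2.1 v.2.2.1 v.2.2.2) = μ v • 𝒮.mixedBil v.1 v.2.1 v.2.2.1 v.2.2.2 := by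
    rintro ⟨α, β, γ, δ⟩
    have e : μ (α, γ, β, δ) = μ (α, β, γ, δ) := by simp only [hμ]; ring
    rw [mixedBil, map_sub, hb, hb, e, smul_sub]
  have hT : (𝒮.Mss 0 0 + 𝒮.Mss 1 1) (slash2 f 0 1 0 1) = (-2 : ℂ) • slash2 f 0 1 0 1 := by
    have hF := 𝒮.isBispinor_slash2 hM
    rw [LinearMap.add_apply, hF.rot, hF.rot]
    simp [lrot, kd]
    module
  have h2 := mem_span_eigenvectors _ _ μ hm h hT
  obtain ⟨c, hc⟩ := Submodule.mem_span_singleton.mp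
    ((Submodule.span_le (p := Submodule.span ℂ {𝒮.mixedBil 2 2 3 3})).mpr (by
      rintro _ ⟨⟨α, β, γ, δ⟩, hv, rfl⟩
      have hall : ∀ x : Fin 4, ¬(x = 0 ∨ x = 1) → x = 2 ∨ x = 3 := by decide
      have hD := Submodule.mem_span_singleton_self (R := ℂ) (𝒮.mixedBil 2 2 3 3)
      have z1 : ∀ a b c, 𝒮.mixedBil a b c a = 0 := fun a b c =>
        eq_zero_of_eq_neg (𝒮.mixedBil_antisymm' a b c a)
      have z2 : ∀ a b d, 𝒮.mixedBil a b b d = 0 := fun a b d =>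
        eq_zero_of_eq_neg (𝒮.mixedBil_antisymm a b b d)
      have d1 : 𝒮.mixedBil 2 3 2 3 = -𝒮.mixedBil 2 2 3 3 := 𝒮.mixedBil_antisymm 2 3 2 3
      have d2 : 𝒮.mixedBil 3 2 3 2 = -𝒮.mixedBil 2 2 3 3 := 𝒮.mixedBil_antisymm' 3 2 3 2
      have d3 : 𝒮.mixedBil 3 3 2 2 = 𝒮.mixedBil 2 2 3 3 := by
        rw [𝒮.mixedBil_antisymm, d2, neg_neg]
      simp only [Set.mem_setOf_eq, hμ] at hv
      have hv' : (¬(α = 0 ∨ α = 1) ∧ ¬(β = 0 ∨ β = 1)) ∧ ¬(γ = 0 ∨ γ = 1) ∧ ¬(δ = 0 ∨ δ = 1) := by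
        split_ifs at hv <;> first | (exfalso; norm_num at hv; done) | (refine ⟨⟨?_, ?_⟩, ?_, ?_⟩ <;> assumption)
      dsimp only
      rcases hall _ hv'.1.1 with rfl | rfl <;> rcases hall _ hv'.1.2 with rfl | rfl <;>
        rcases hall _ hv'.2.1 with rfl | rfl <;> rcases hall _ hv'.2.2 with rfl | rfl <;>
        first
        | (rw [z1]; exact zero_mem _)
        | (rw [z2]; exact zero_mem _)
        | exact hD
        | (rw [d1]; exact neg_mem hD)
        | (rw [d2]; exact neg_mem hD)
        | (rw [d3]; exact hD)) h2)
  exact ⟨c, hc.symm⟩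

theorem eq_zero_of_slash2_corner (h0 : slash2 f 0 1 0 1 = 0) (a b : Fin 6) : f a b = 0 :=
  slash2_eq_zero (fun p q r s => (𝒮.isBispinor_slash2 hM).eq_zero_of_corner
    (fun p q r s => (𝒮.casimir_slash2 hf hJ hM p q r s).1) h0 p q r s) a b

end VectorTensor

/-- The nonzero factor 8 is what allows the extremal component of any competitor to be cancelled by
a multiple of `WW`. -/
theorem slash2_WW : slash2 (WW 𝒮.W) 0 1 0 1 = (8 : ℂ) • 𝒮.mixedBil 2 2 3 3 := by
  have e : slash2 (WW 𝒮.W) 0 1 0 1 = ∑ c, gU c 0 1 • ∑ α, ∑ β, gL c α β •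
      ∑ d, gU d 0 1 • ∑ γ, ∑ δ, gL d γ δ • 𝒮.bil α γ β δ := by
    simp only [slash2, WW_eq]
    refine Finset.sum_congr rfl fun c _ => ?_
    congr 1
    exact sum_smul_sum_sum_comm _ _ _
  rw [e, sum_gU_sum_gL, sum_lc_zero_one]
  simp only [sum_gU_sum_gL, sum_lc_zero_one]
  rw [mixedBil, 𝒮.bil_symm_left 3 2 2 3, 𝒮.bil_symm_right 2 3 3 2,
    𝒮.bil_exchange 3 3 2 2]
  module

/-- A tensor with two vector indices among the singlets of dimension two is a multiple of
`(γ_a)_{αβ} (γ_b)_{γδ} W^{αγ ij} W^{βδ}_{ij}`. -/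
theorem exists_eq_smul_WW {f : Fin 6 → Fin 6 → A} (hf : ∀ a b, f a b ∈ 𝒮.cov 4)
    (hJ : ∀ i j a b, 𝒮.J i j (f a b) = 0) (hM : ∀ a b c d, 𝒮.M a b (f c d) =
      vrot a b (fun e => f e d) c + vrot a b (fun e => f c e) d) :
    ∃ c : ℂ, ∀ a b, f a b = c • WW 𝒮.W a b := by
  obtain ⟨c, hc⟩ := 𝒮.slash2_corner hf hJ hM
  refine ⟨c / 8, fun a b => sub_eq_zero.mp ?_⟩
  refine 𝒮.eq_zero_of_slash2_corner (f := fun a b => f a b - (c / 8) • WW 𝒮.W a b)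
    (fun a b => sub_mem (hf a b) (Submodule.smul_mem _ _ (𝒮.WW_mem_cov a b)))
    (fun i j a b => by rw [map_sub, map_smul, hJ, J_WW, smul_zero, sub_zero])
    (fun a b c' d => by
      rw [map_sub, map_smul, hM, M_WW]
      simp only [vrot]; module) ?_ a b
  have e : slash2 (fun a b => f a b - (c / 8) • WW 𝒮.W a b) 0 1 0 1 =
      slash2 f 0 1 0 1 - (c / 8) • slash2 (WW 𝒮.W) 0 1 0 1 := by
    simp only [slash2, smul_sub, Finset.sum_sub_distrib, Finset.smul_sum]
    congr 1
    exact Finset.sum_congr rfl fun _ _ => Finset.sum_congr rfl fun _ _ => by module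
  rw [e, hc, slash2_WW]
  module

end ConformalSuperspace

end Superspace

end

/-! ### Components of operators with respect to the generators -/

section

/-- The kinds of generators. -/
inductive Kind : Type
  | P | Q | M | D | J | S | K

/-- Labels of all components of the generators; unlike `GenIx`, these are redundant. -/
inductive Slot : Type
  | P (a : Fin 6)
  | Q (α i : Fin 4)
  | M (a b : Fin 6)
  | D
  | J (i j : Fin 4)
  | S (α i : Fin 4)
  | K (a : Fin 6)

def Slot.kind : Slot → Kind
  | .P _ => .P
  | .Q _ _ => .Q
  | .M _ _ => .M
  | .D => .D
  | .J _ _ => .J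
  | .S _ _ => .S
  | .K _ => .K

def GenIx.kind : GenIx → Kind
  | .P _ => .P
  | .Q _ _ => .Q
  | .M _ _ _ => .M
  | .D => .D
  | .J _ _ _ => .J
  | .S _ _ => .S
  | .K _ => .K

/-- Components which have the symmetries of the generators. -/
structure Balanced {A : Type*} [AddGroup A] (x : Slot → A) : Prop where
  M : ∀ a b, x (.M a b) = -x (.M b a)
  J : ∀ i j, x (.J i j) = x (.J j i)

section Operators

variable {A : Type*} [Ring A] [Algebra ℂ A]

namespace Gens

variable (G : Gens A)

/-- The operator with the given components. -/
def expand : (Slot → A) →ₗ[A] Module.End ℂ A where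
  toFun x := (∑ a, x (.P a) • G.P a) + (∑ α, ∑ i, x (.Q α i) • G.Q α i) +
    (∑ a, ∑ b, x (.M a b) • (1 / 2 : ℂ) • G.M a b) + x .D • G.D + (∑ i, ∑ j, x (.J i j) • G.J i j) +
    (∑ α, ∑ i, x (.S α i) • G.S α i) + ∑ a, x (.K a) • G.K a
  map_add' x y := by
    simp only [Pi.add_apply, add_smul, Finset.sum_add_distrib]
    abel
  map_smul' f x := by
    simp only [Pi.smul_apply, smul_eq_mul, mul_smul, RingHom.id_apply, smul_add, Finset.smul_sum]

theorem expand_apply (x : Slot → A) : G.expand x =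
    (∑ a, x (.P a) • G.P a) + (∑ α, ∑ i, x (.Q α i) • G.Q α i) +
    (∑ a, ∑ b, x (.M a b) • (1 / 2 : ℂ) • G.M a b) + x .D • G.D + (∑ i, ∑ j, x (.J i j) • G.J i j) +
    (∑ α, ∑ i, x (.S α i) • G.S α i) + ∑ a, x (.K a) • G.K a := rfl

open Classical in
/-- The components with respect to the independent generators. -/
def indep (x : Slot → A) : GenIx →₀ A :=
  (∑ a, Finsupp.single (GenIx.P a) (x (.P a))) +
  (∑ α, ∑ i, Finsupp.single (GenIx.Q α i) (x (.Q α i))) +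
  (∑ a, ∑ b, if h : a < b then Finsupp.single (GenIx.M a b h) (x (.M a b)) else 0) +
  Finsupp.single GenIx.D (x .D) +
  -- `expand` counts an off-diagonal J^{ij} twice, whence the factor 2; for M_{ab} the factor 1/2 in
  -- `expand` already compensates.
  (∑ i, ∑ j, if h : i ≤ j then Finsupp.single (GenIx.J i j h)
    ((if i = j then 1 else 2 : ℂ) • x (.J i j)) else 0) +
  (∑ α, ∑ i, Finsupp.single (GenIx.S α i) (x (.S α i))) +
  ∑ a, Finsupp.single (GenIx.K a) (x (.K a))

theorem sum_antisymm_lt {V : Type*} [AddCommGroup V] [Module ℂ V] (F : Fin 6 → Fin 6 → V)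
    (h : ∀ a b, F a b = F b a) (h0 : ∀ a, F a a = 0) :
    ∑ a, ∑ b, (1 / 2 : ℂ) • F a b = ∑ a, ∑ b, if a < b then F a b else 0 := by
  have e : ∀ a b, (1 / 2 : ℂ) • F a b = (1 / 2 : ℂ) • (if a < b then F a b else 0) +
      (1 / 2 : ℂ) • (if b < a then F b a else 0) := by
    intro a b
    rcases lt_trichotomy a b with hab | hab | hab
    · rw [if_pos hab, if_neg hab.not_gt, smul_zero, add_zero]
    · subst hab; simp [h0]
    · rw [if_neg hab.not_gt, if_pos hab, smul_zero, zero_add, h a b]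
  simp only [e, Finset.sum_add_distrib, ← Finset.smul_sum]
  rw [Finset.sum_comm (f := fun a b => if b < a then F b a else 0), ← add_smul]
  norm_num

theorem sum_symm_le {V : Type*} [AddCommGroup V] [Module ℂ V] (F : Fin 4 → Fin 4 → V)
    (h : ∀ a b, F a b = F b a) :
    ∑ a, ∑ b, F a b = ∑ a, ∑ b, if a ≤ b then (if a = b then 1 else 2 : ℂ) • F a b else 0 := by
  have e : ∀ a b, F a b =
      (1 / 2 : ℂ) • (if a ≤ b then (if a = b then 1 else 2 : ℂ) • F a b else 0) +
      (1 / 2 : ℂ) • (if b ≤ a then (if b = a then 1 else 2 : ℂ) • F b a else 0) := by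
    intro a b
    rcases lt_trichotomy a b with hab | hab | hab
    · rw [if_pos hab.le, if_neg hab.not_ge, if_neg hab.ne]; module
    · subst hab; simp only [le_refl, if_true]; module
    · rw [if_neg hab.not_ge, if_pos hab.le, if_neg hab.ne, h a b]; module
  refine (Finset.sum_congr rfl fun a _ => Finset.sum_congr rfl fun b _ => e a b).trans ?_
  simp only [Finset.sum_add_distrib, ← Finset.smul_sum]
  rw [Finset.sum_comm (f := fun a b => if b ≤ a then (if b = a then 1 else 2 : ℂ) • F b a else 0),
    ← add_smul]
  norm_num

theorem linearCombination_indep (hM : ∀ a b, G.M a b = -G.M b a) (hJ : ∀ i j, G.J i j = G.J j i)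
    {x : Slot → A} (hx : Balanced x) :
    Finsupp.linearCombination A G.gen (indep x) = G.expand x := by
  have eM : ∑ a, ∑ b, x (.M a b) • (1 / 2 : ℂ) • G.M a b =
      ∑ a, ∑ b, if a < b then x (.M a b) • G.M a b else 0 := by
    rw [← sum_antisymm_lt (fun a b => x (.M a b) • G.M a b)
      (fun a b => by rw [hx.M, hM, smul_neg, neg_smul, neg_neg])
      (fun a => by rw [eq_zero_of_eq_neg (hM a a), smul_zero])]
    exact Finset.sum_congr rfl fun a _ => Finset.sum_congr rfl fun b _ => smul_comm _ _ _
  have eJ := sum_symm_le (fun i j => x (.J i j) • G.J i j) (fun i j => by rw [hx.J, hJ])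
  rw [expand_apply, eM, eJ]
  simp only [indep, map_add, map_sum, Finsupp.linearCombination_single, gen]
  have fM : ∀ a b, Finsupp.linearCombination A G.gen (if h : a < b then
      Finsupp.single (GenIx.M a b h) (x (.M a b)) else 0) =
      if a < b then x (.M a b) • G.M a b else 0 := by
    intro a b
    split_ifs with h
    · rw [Finsupp.linearCombination_single]; rfl
    · rw [map_zero]
  have fJ : ∀ a b, Finsupp.linearCombination A G.gen (if h : a ≤ b then
      Finsupp.single (GenIx.J a b h) ((if a = b then 1 else 2 : ℂ) • x (.J a b)) else 0) =
      if a ≤ b then (if a = b then 1 else 2 : ℂ) • x (.J a b) • G.J a b else 0 := by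
    intro a b
    by_cases h : a ≤ b
    · rw [dif_pos h, if_pos h, Finsupp.linearCombination_single, smul_assoc]; rfl
    · rw [dif_neg h, if_neg h, map_zero]
  simp only [fM, fJ]

/-- The labels are redundant, but components with the symmetries of M and J are determined by the
independent ones, so linear independence of the generators suffices. -/
theorem eq_zero_of_expand_eq_zero (hM : ∀ a b, G.M a b = -G.M b a)
    (hJ : ∀ i j, G.J i j = G.J j i) (hG : LinearIndependent A G.gen) {x : Slot → A}
    (hx : Balanced x) (h : G.expand x = 0) (s : Slot) : x s = 0 := by
  classical
  have h1 : indep x = 0 := by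
    rw [linearIndependent_iff] at hG
    exact hG _ (by rw [linearCombination_indep G hM hJ hx, h])
  have h2 : ∀ g, indep x g = 0 := fun g => by rw [h1]; rfl
  have d1 : ∀ a b (g : GenIx), ((if h : a < b then Finsupp.single (GenIx.M a b h) (x (.M a b)) else 0 :
      GenIx →₀ A) g) = if h : a < b then Finsupp.single (GenIx.M a b h) (x (.M a b)) g else 0 := by
    intro a b g; split_ifs <;> rfl
  have d2 : ∀ i j (g : GenIx), ((if h : i ≤ j then Finsupp.single (GenIx.J i j h)
      ((if i = j then 1 else 2 : ℂ) • x (.J i j)) else 0 : GenIx →₀ A) g) =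
      if h : i ≤ j then Finsupp.single (GenIx.J i j h)
        ((if i = j then 1 else 2 : ℂ) • x (.J i j)) g else 0 := by
    intro a b g; split_ifs <;> rfl
  simp only [indep, Finsupp.add_apply, Finsupp.finset_sum_apply, d1, d2, Finsupp.single_apply] at h2
  have hlt : ∀ a b, a < b → x (.M a b) = 0 := by
    intro a b hab
    have := h2 (.M a b hab)
    simp only [reduceCtorEq, if_false, Finset.sum_const_zero, add_zero, zero_add, GenIx.M.injEq,
      dite_eq_ite, ite_self, dite_false] at this
    rw [Finset.sum_eq_single a, Finset.sum_eq_single b] at this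
    · simpa [hab] using this
    · intro c _ hc; simp [hc]
    · simp
    · intro c _ hc; simp [hc]
    · simp
  have hle : ∀ i j, i ≤ j → x (.J i j) = 0 := by
    intro a b hab
    have := h2 (.J a b hab)
    simp only [reduceCtorEq, if_false, Finset.sum_const_zero, add_zero, zero_add, GenIx.J.injEq,
      dite_eq_ite, ite_self, dite_false] at this
    rw [Finset.sum_eq_single a, Finset.sum_eq_single b] at this
    · simp only [hab, and_self, if_true] at this
      refine (smul_eq_zero_iff_right ?_).mp this
      split_ifs <;> norm_num
    · intro c _ hc; simp [hc]
    · simp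
    · intro c _ hc; simp [hc]
    · simp
  rcases s with a | ⟨α, i⟩ | ⟨a, b⟩ | _ | ⟨i, j⟩ | ⟨α, i⟩ | a
  · simpa using h2 (.P a)
  · have := h2 (.Q α i)
    simpa [ite_and] using this
  · rcases lt_trichotomy a b with hab | hab | hab
    · exact hlt a b hab
    · subst hab; exact eq_zero_of_eq_neg (hx.M a a)
    · rw [hx.M, hlt b a hab, neg_zero]
  · simpa using h2 .D
  · rcases le_total i j with hij | hij
    · exact hle i j hij
    · rw [hx.J, hle j i hij]
  · have := h2 (.S α i)
    simpa [ite_and] using this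
  · simpa using h2 (.K a)

/-- The operators whose components of each kind lie in given subspaces. -/
def opSpan (N : Kind → Submodule ℂ A) : Submodule ℂ (Module.End ℂ A) where
  carrier := {T | ∃ x : Slot → A, (∀ s, x s ∈ N s.kind) ∧ Balanced x ∧ T = G.expand x}
  zero_mem' := ⟨0, fun s => zero_mem _, ⟨fun a b => by simp, fun i j => rfl⟩, by simp⟩
  add_mem' := by
    rintro _ _ ⟨x, hx, bx, rfl⟩ ⟨y, hy, by', rfl⟩
    refine ⟨x + y, fun s => add_mem (hx s) (hy s), ⟨fun a b => ?_, fun i j => ?_⟩, (map_add _ _ _).symm⟩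
    · simp only [Pi.add_apply]; rw [bx.M, by'.M, neg_add]
    · simp only [Pi.add_apply]; rw [bx.J, by'.J]
  smul_mem' := by
    rintro c _ ⟨x, hx, bx, rfl⟩
    refine ⟨c • x, fun s => Submodule.smul_mem _ _ (hx s), ⟨fun a b => ?_, fun i j => ?_⟩,
      (LinearMap.map_smul_of_tower _ _ _).symm⟩
    · simp only [Pi.smul_apply]; rw [bx.M, smul_neg]
    · simp only [Pi.smul_apply]; rw [bx.J]

end Gens

end Operators

end

/-! ### Generators multiplied by fields, and Leibniz rules for brackets -/

section

namespace Slot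

variable {A : Type*} [Zero A]

def ofP (p : Fin 6 → A) : Slot → A
  | .P a => p a
  | _ => 0

def ofQ (q : Fin 4 → Fin 4 → A) : Slot → A
  | .Q α i => q α i
  | _ => 0

def ofM (m : Fin 6 → Fin 6 → A) : Slot → A
  | .M a b => m a b
  | _ => 0

def ofD (d : A) : Slot → A
  | .D => d
  | _ => 0

def ofJ (j : Fin 4 → Fin 4 → A) : Slot → A
  | .J i k => j i k
  | _ => 0

def ofS (q : Fin 4 → Fin 4 → A) : Slot → A
  | .S α i => q α i
  | _ => 0

def ofK (p : Fin 6 → A) : Slot → A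
  | .K a => p a
  | _ => 0

end Slot

/-- Twice the dimension, so that all dimension counting takes place in the integers. -/
def Kind.wt : Kind → ℤ
  | .P => 2
  | .Q => 1
  | .M => 0
  | .D => 0
  | .J => 0
  | .S => -1
  | .K => -2

section Operators

variable {A : Type*} [Ring A] [Algebra ℂ A]

namespace Gens

variable (G : Gens A)

theorem expand_ofP (p : Fin 6 → A) : G.expand (Slot.ofP p) = ∑ a, p a • G.P a := by
  simp [expand_apply, Slot.ofP]

theorem expand_ofQ (q : Fin 4 → Fin 4 → A) :
    G.expand (Slot.ofQ q) = ∑ α, ∑ i, q α i • G.Q α i := by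
  simp [expand_apply, Slot.ofQ]

theorem expand_ofM (m : Fin 6 → Fin 6 → A) :
    G.expand (Slot.ofM m) = ∑ a, ∑ b, m a b • (1 / 2 : ℂ) • G.M a b := by
  simp [expand_apply, Slot.ofM]

theorem expand_ofD (d : A) : G.expand (Slot.ofD d) = d • G.D := by
  simp [expand_apply, Slot.ofD]

theorem expand_ofJ (j : Fin 4 → Fin 4 → A) :
    G.expand (Slot.ofJ j) = ∑ i, ∑ k, j i k • G.J i k := by
  simp [expand_apply, Slot.ofJ]

theorem expand_ofS (q : Fin 4 → Fin 4 → A) :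
    G.expand (Slot.ofS q) = ∑ α, ∑ i, q α i • G.S α i := by
  simp [expand_apply, Slot.ofS]

theorem expand_ofK (p : Fin 6 → A) : G.expand (Slot.ofK p) = ∑ a, p a • G.K a := by
  simp [expand_apply, Slot.ofK]

variable {G} {N : Kind → Submodule ℂ A}

theorem sum_single_smul {ι : Type*} [Fintype ι] [DecidableEq ι] (X : ι → Module.End ℂ A) (i : ι)
    (f : A) : ∑ j, (if j = i then f else 0) • X j = f • X i := by
  simp [ite_smul]

theorem smul_P_mem {f : A} (hf : f ∈ N .P) (a : Fin 6) : f • G.P a ∈ G.opSpan N := by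
  refine ⟨Slot.ofP fun b => if b = a then f else 0, fun s => ?_, ⟨fun _ _ => by simp [Slot.ofP], fun _ _ => rfl⟩, ?_⟩
  · cases s <;> simp only [Slot.ofP, zero_mem] <;> split_ifs <;> simp [Slot.kind, hf]
  · rw [expand_ofP, sum_single_smul]

theorem smul_K_mem {f : A} (hf : f ∈ N .K) (a : Fin 6) : f • G.K a ∈ G.opSpan N := by
  refine ⟨Slot.ofK fun b => if b = a then f else 0, fun s => ?_, ⟨fun _ _ => by simp [Slot.ofK], fun _ _ => rfl⟩, ?_⟩
  · cases s <;> simp only [Slot.ofK, zero_mem] <;> split_ifs <;> simp [Slot.kind, hf]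
  · rw [expand_ofK, sum_single_smul]

theorem smul_D_mem {f : A} (hf : f ∈ N .D) : f • G.D ∈ G.opSpan N := by
  refine ⟨Slot.ofD f, fun s => ?_, ⟨fun _ _ => by simp [Slot.ofD], fun _ _ => rfl⟩, ?_⟩
  · cases s <;> simp [Slot.ofD, Slot.kind, hf]
  · rw [expand_ofD]

theorem smul_Q_mem {f : A} (hf : f ∈ N .Q) (α i : Fin 4) : f • G.Q α i ∈ G.opSpan N := by
  refine ⟨Slot.ofQ fun β j => if β = α then if j = i then f else 0 else 0, fun s => ?_,
    ⟨fun _ _ => by simp [Slot.ofQ], fun _ _ => rfl⟩, ?_⟩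
  · cases s <;> simp only [Slot.ofQ, zero_mem] <;> split_ifs <;> simp [Slot.kind, hf]
  · rw [expand_ofQ]; simp [ite_smul]

theorem smul_S_mem {f : A} (hf : f ∈ N .S) (α i : Fin 4) : f • G.S α i ∈ G.opSpan N := by
  refine ⟨Slot.ofS fun β j => if β = α then if j = i then f else 0 else 0, fun s => ?_,
    ⟨fun _ _ => by simp [Slot.ofS], fun _ _ => rfl⟩, ?_⟩
  · cases s <;> simp only [Slot.ofS, zero_mem] <;> split_ifs <;> simp [Slot.kind, hf]
  · rw [expand_ofS]; simp [ite_smul]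

theorem smul_M_mem (hG : G.IsBosonic) {f : A} (hf : f ∈ N .M) (a b : Fin 6) :
    f • G.M a b ∈ G.opSpan N := by
  refine ⟨Slot.ofM fun c d => (if c = a then if d = b then f else 0 else 0) -
    (if d = a then if c = b then f else 0 else 0), fun s => ?_,
    ⟨fun _ _ => by simp [Slot.ofM], fun _ _ => rfl⟩, ?_⟩
  · cases s <;> simp only [Slot.ofM, zero_mem]
    refine sub_mem ?_ ?_ <;> split_ifs <;> simp [Slot.kind, hf]
  · rw [expand_ofM]
    have e : ∑ c, ∑ d, ((if c = a then if d = b then f else 0 else 0) -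
        (if d = a then if c = b then f else 0 else 0)) • (1 / 2 : ℂ) • G.M c d =
        f • (1 / 2 : ℂ) • G.M a b - f • (1 / 2 : ℂ) • G.M b a := by
      have h : ∀ c d, ((if c = a then if d = b then f else 0 else 0) -
          (if d = a then if c = b then f else 0 else 0)) • (1 / 2 : ℂ) • G.M c d =
          (if c = a then if d = b then f else 0 else 0) • (1 / 2 : ℂ) • G.M c d -
          (if d = a then if c = b then f else 0 else 0) • (1 / 2 : ℂ) • G.M c d :=
        fun c d => LinearMap.ext fun h => sub_mul _ _ _
      simp only [h, Finset.sum_sub_distrib]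
      congr 1 <;> simp [ite_smul, Finset.sum_ite_irrel]
    rw [e, hG.M_antisymm b a, smul_neg, smul_neg, sub_neg_eq_add, ← smul_add, ← add_smul]
    norm_num

theorem smul_J_mem (hG : G.IsBosonic) {f : A} (hf : f ∈ N .J) (i j : Fin 4) :
    f • G.J i j ∈ G.opSpan N := by
  refine ⟨Slot.ofJ fun k l => (1 / 2 : ℂ) • ((if k = i then if l = j then f else 0 else 0) +
    (if l = i then if k = j then f else 0 else 0)), fun s => ?_,
    ⟨fun _ _ => by simp [Slot.ofJ], fun _ _ => by simp only [Slot.ofJ]; rw [add_comm]⟩, ?_⟩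
  · cases s <;> simp only [Slot.ofJ, zero_mem]
    refine Submodule.smul_mem _ _ (add_mem ?_ ?_) <;> split_ifs <;> simp [Slot.kind, hf]
  · rw [expand_ofJ]
    simp only [smul_assoc, ← Finset.smul_sum]
    have e : ∑ k, ∑ l, ((if k = i then if l = j then f else 0 else 0) +
        (if l = i then if k = j then f else 0 else 0)) • G.J k l = f • G.J i j + f • G.J j i := by
      simp [add_smul, ite_smul, Finset.sum_add_distrib, Finset.sum_ite_irrel]
    rw [e, hG.J_symm j i, ← two_smul ℂ, smul_smul]
    norm_num

theorem smul_gen_mem (hG : G.IsBosonic) (g : GenIx) {f : A} (hf : f ∈ N g.kind) :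
    f • G.gen g ∈ G.opSpan N := by
  rcases g with a | ⟨α, i⟩ | ⟨a, b, h⟩ | _ | ⟨i, j, h⟩ | ⟨α, i⟩ | a
  exacts [smul_P_mem hf a, smul_Q_mem hf α i, smul_M_mem hG hf a b, smul_D_mem hf,
    smul_J_mem hG hf i j, smul_S_mem hf α i, smul_K_mem hf a]

theorem fieldSpan_le_opSpan (hG : G.IsBosonic) {F : A → Prop} {s : Set GenIx}
    (h : ∀ g ∈ s, ∀ f, F f → f ∈ N g.kind) : fieldSpan F G s ≤ G.opSpan N := by
  refine Submodule.span_le.mpr ?_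
  rintro _ ⟨f, hf, g, hg, rfl⟩
  exact smul_gen_mem hG g (h g hg f hf)

theorem expand_mem {x : Slot → A} {V : Submodule ℂ (Module.End ℂ A)}
    (hP : ∀ a, x (.P a) • G.P a ∈ V) (hQ : ∀ α i, x (.Q α i) • G.Q α i ∈ V)
    (hM : ∀ a b, x (.M a b) • G.M a b ∈ V) (hD : x .D • G.D ∈ V)
    (hJ : ∀ i j, x (.J i j) • G.J i j ∈ V) (hS : ∀ α i, x (.S α i) • G.S α i ∈ V)
    (hK : ∀ a, x (.K a) • G.K a ∈ V) : G.expand x ∈ V := by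
  rw [expand_apply]
  refine add_mem (add_mem (add_mem (add_mem (add_mem (add_mem ?_ ?_) ?_) hD) ?_) ?_) ?_
  · exact Submodule.sum_mem _ fun a _ => hP a
  · exact Submodule.sum_mem _ fun a _ => Submodule.sum_mem _ fun b _ => hQ a b
  · refine Submodule.sum_mem _ fun a _ => Submodule.sum_mem _ fun b _ => ?_
    rw [smul_comm]
    exact Submodule.smul_mem _ _ (hM a b)
  · exact Submodule.sum_mem _ fun a _ => Submodule.sum_mem _ fun b _ => hJ a b
  · exact Submodule.sum_mem _ fun a _ => Submodule.sum_mem _ fun b _ => hS a b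
  · exact Submodule.sum_mem _ fun a _ => hK a

theorem opSpan_le_fieldSpan (hG : G.IsBosonic) {F : A → Prop} {s : Set GenIx}
    (h : ∀ g, ∀ f ∈ N g.kind, (g ∈ s ∧ F f) ∨ f = 0) : G.opSpan N ≤ fieldSpan F G s := by
  have key : ∀ g, ∀ f ∈ N g.kind, f • G.gen g ∈ fieldSpan F G s := by
    intro g f hf
    rcases h g f hf with h | rfl
    · exact Submodule.subset_span ⟨f, h.2, g, h.1, rfl⟩
    · rw [zero_smul]; exact zero_mem _
  rintro _ ⟨x, hx, -, rfl⟩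
  refine expand_mem (fun a => key (.P a) _ (hx (.P a))) (fun α i => key (.Q α i) _ (hx (.Q α i)))
    (fun a b => ?_) (key .D _ (hx .D)) (fun i j => ?_) (fun α i => key (.S α i) _ (hx (.S α i)))
    (fun a => key (.K a) _ (hx (.K a)))
  · rcases lt_trichotomy a b with hab | hab | hab
    · exact key (.M a b hab) _ (hx (.M a b))
    · subst hab; rw [eq_zero_of_eq_neg (hG.M_antisymm a a), smul_zero]; exact zero_mem _
    · rw [hG.M_antisymm, smul_neg]
      exact neg_mem (key (.M b a hab) _ (hx (.M a b)))
  · rcases le_total i j with hij | hij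
    · exact key (.J i j hij) _ (hx (.J i j))
    · rw [hG.J_symm]; exact key (.J j i hij) _ (hx (.J i j))

theorem smul_mem_opSpan {N' : Kind → Submodule ℂ A} {f : A} (h : ∀ k, ∀ g ∈ N k, f * g ∈ N' k)
    {T : Module.End ℂ A} (hT : T ∈ G.opSpan N) : f • T ∈ G.opSpan N' := by
  obtain ⟨x, hx, bx, rfl⟩ := hT
  refine ⟨f • x, fun s => h _ _ (hx s), ⟨fun a b => ?_, fun i j => ?_⟩, (map_smul _ _ _).symm⟩
  · simp only [Pi.smul_apply]; rw [bx.M, smul_neg]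
  · simp only [Pi.smul_apply]; rw [bx.J]

end Gens

theorem comm_sub_right (X Y Z : Module.End ℂ A) : comm X (Y - Z) = comm X Y - comm X Z := by
  simp only [comm, mul_sub, sub_mul]; abel

theorem comm_add_right (X Y Z : Module.End ℂ A) : comm X (Y + Z) = comm X Y + comm X Z := by
  simp only [comm, mul_add, add_mul]; abel

theorem comm_sum_right {ι : Type*} (s : Finset ι) (X : Module.End ℂ A) (Y : ι → Module.End ℂ A) :
    comm X (∑ i ∈ s, Y i) = ∑ i ∈ s, comm X (Y i) := by
  simp only [comm, Finset.mul_sum, Finset.sum_mul, Finset.sum_sub_distrib]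

theorem comm_smul_right (c : ℂ) (X Y : Module.End ℂ A) : comm X (c • Y) = c • comm X Y := by
  simp only [comm, mul_smul_comm, smul_mul_assoc, smul_sub]

theorem comm_swap (X Y : Module.End ℂ A) : comm X Y = -comm Y X := by
  simp only [comm]; abel

theorem acomm_swap (X Y : Module.End ℂ A) : acomm X Y = acomm Y X := by
  simp only [acomm]; abel

theorem acomm_add_right (X Y Z : Module.End ℂ A) : acomm X (Y + Z) = acomm X Y + acomm X Z := by
  simp only [acomm, mul_add, add_mul]; abel

theorem acomm_sum_right {ι : Type*} (s : Finset ι) (X : Module.End ℂ A) (Y : ι → Module.End ℂ A) :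
    acomm X (∑ i ∈ s, Y i) = ∑ i ∈ s, acomm X (Y i) := by
  simp only [acomm, Finset.mul_sum, Finset.sum_mul, Finset.sum_add_distrib]

theorem IsEvenDer.comm_smul {𝒜 : ZMod 2 → Submodule ℂ A} {X : Module.End ℂ A} (hX : IsEvenDer 𝒜 X)
    (f : A) (Y : Module.End ℂ A) : comm X (f • Y) = X f • Y + f • comm X Y := by
  ext h
  simp only [comm, LinearMap.sub_apply, Module.End.mul_apply, LinearMap.smul_apply, smul_eq_mul,
    LinearMap.add_apply, hX.leibniz, mul_sub]
  abel

namespace IsOddDer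

variable {𝒜 : ZMod 2 → Submodule ℂ A} {X : Module.End ℂ A} (hX : IsOddDer 𝒜 X) {f : A}
include hX

theorem comm_smul_even (hf : f ∈ 𝒜 0) (Y : Module.End ℂ A) :
    comm X (f • Y) = X f • Y + f • comm X Y := by
  ext h
  simp only [comm, LinearMap.sub_apply, Module.End.mul_apply, LinearMap.smul_apply, smul_eq_mul,
    LinearMap.add_apply, hX.leibniz_even f hf, mul_sub]
  abel

theorem acomm_smul_even (hf : f ∈ 𝒜 0) (Y : Module.End ℂ A) :
    acomm X (f • Y) = X f • Y + f • acomm X Y := by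
  ext h
  simp only [acomm, Module.End.mul_apply, LinearMap.smul_apply, smul_eq_mul,
    LinearMap.add_apply, hX.leibniz_even f hf, mul_add]
  abel

theorem comm_smul_odd (hf : f ∈ 𝒜 1) (Y : Module.End ℂ A) :
    comm X (f • Y) = X f • Y - f • acomm X Y := by
  ext h
  simp only [comm, acomm, LinearMap.sub_apply, Module.End.mul_apply, LinearMap.smul_apply,
    smul_eq_mul, LinearMap.add_apply, hX.leibniz_odd f hf, mul_add]
  abel

theorem acomm_smul_odd (hf : f ∈ 𝒜 1) (Y : Module.End ℂ A) :
    acomm X (f • Y) = X f • Y - f • comm X Y := by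
  ext h
  simp only [comm, acomm, LinearMap.sub_apply, Module.End.mul_apply, LinearMap.smul_apply,
    smul_eq_mul, LinearMap.add_apply, hX.leibniz_odd f hf, mul_sub]
  abel

end IsOddDer

end Operators

end

/-! ### Covariance under `M`, `D`, `J` in components -/

section

section Operators

variable {A : Type*} [Ring A] [Algebra ℂ A]

theorem sum_smul_matrix {ι κ : Type*} [Fintype ι] [Fintype κ] (f : ι → A) (c : ι → κ → ℂ)
    (X : κ → Module.End ℂ A) :
    ∑ i, f i • ∑ p, c i p • X p = ∑ p, (∑ i, c i p • f i) • X p := by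
  simp only [Finset.smul_sum, Finset.sum_smul]
  rw [Finset.sum_comm]
  refine Finset.sum_congr rfl fun p _ => Finset.sum_congr rfl fun i _ => ?_
  rw [smul_comm, smul_assoc]

/-- The matrix of `M_{ab}` on a lower vector index. -/
def vmat (a b c d : Fin 6) : ℂ :=
  eta c a * (if d = b then 1 else 0) - eta c b * (if d = a then 1 else 0)

theorem vrot_eq_sum {V : Type*} [AddCommGroup V] [Module ℂ V] (a b : Fin 6) (w : Fin 6 → V)
    (c : Fin 6) : vrot a b w c = ∑ d, vmat a b c d • w d := by
  simp [vrot, vmat, sub_smul, mul_smul, ite_smul, Finset.sum_sub_distrib]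

/-- The even operator `X` acts linearly on the indices of the generators. -/
structure ActsBy (G : Gens A) (X : Module.End ℂ A) (V Vk Vm : Fin 6 → Fin 6 → ℂ)
    (Sp St U Ut Uj : Fin 4 → Fin 4 → ℂ) : Prop where
  P : ∀ c, comm X (G.P c) = ∑ d, V c d • G.P d
  Q : ∀ α i, comm X (G.Q α i) = ∑ β, Sp α β • G.Q β i + ∑ j, U i j • G.Q α j
  M : ∀ a b, comm X (G.M a b) = ∑ c, Vm a c • G.M c b + ∑ c, Vm b c • G.M a c
  D : comm X G.D = 0
  J : ∀ i j, comm X (G.J i j) = ∑ k, Uj i k • G.J k j + ∑ k, Uj j k • G.J i k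
  S : ∀ α i, comm X (G.S α i) = ∑ β, St α β • G.S β i + ∑ j, Ut i j • G.S α j
  K : ∀ c, comm X (G.K c) = ∑ d, Vk c d • G.K d

/-- The components of `[X, T]` in terms of those of `T`. -/
def act (X : Module.End ℂ A) (V Vk Vm : Fin 6 → Fin 6 → ℂ) (Sp St U Ut Uj : Fin 4 → Fin 4 → ℂ)
    (x : Slot → A) : Slot → A
  | .P d => X (x (.P d)) + ∑ c, V c d • x (.P c)
  | .Q β j => X (x (.Q β j)) + (∑ α, Sp α β • x (.Q α j) + ∑ i, U i j • x (.Q β i))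
  | .M c d => X (x (.M c d)) + (∑ a, Vm a c • x (.M a d) + ∑ b, Vm b d • x (.M c b))
  | .D => X (x .D)
  | .J k l => X (x (.J k l)) + (∑ i, Uj i k • x (.J i l) + ∑ j, Uj j l • x (.J k j))
  | .S β j => X (x (.S β j)) + (∑ α, St α β • x (.S α j) + ∑ i, Ut i j • x (.S β i))
  | .K d => X (x (.K d)) + ∑ c, Vk c d • x (.K c)

theorem Balanced.act {X : Module.End ℂ A} {V Vk Vm : Fin 6 → Fin 6 → ℂ}
    {Sp St U Ut Uj : Fin 4 → Fin 4 → ℂ} {x : Slot → A} (hx : Balanced x) :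
    Balanced (act X V Vk Vm Sp St U Ut Uj x) where
  M a b := by
    simp only [SixD.act]
    rw [hx.M a b, map_neg, neg_add, neg_add, add_comm (-∑ c, _)]
    simp only [← Finset.sum_neg_distrib, ← smul_neg]
    congr 2 <;> exact Finset.sum_congr rfl fun c _ => by rw [hx.M]
  J i j := by
    simp only [SixD.act]
    rw [hx.J i j, add_comm (∑ c, _)]
    congr 2 <;> exact Finset.sum_congr rfl fun c _ => by rw [hx.J]

theorem sum_smul_matrix_two {ι κ : Type*} [Fintype ι] [Fintype κ] (f : ι → κ → A)
    (c : ι → ι → ℂ) (d : κ → κ → ℂ) (X : ι → κ → Module.End ℂ A) :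
    ∑ i, ∑ k, f i k • (∑ p, c i p • X p k + ∑ p, d k p • X i p) =
      ∑ i, ∑ k, (∑ p, c p i • f p k + ∑ p, d p k • f i p) • X i k := by
  simp only [smul_add, add_smul, Finset.sum_add_distrib, sum_smul_matrix]
  congr 1
  rw [Finset.sum_comm, Finset.sum_comm (f := fun i k => (∑ p, c p i • f p k) • X i k)]
  exact Finset.sum_congr rfl fun k _ => sum_smul_matrix (fun i => f i k) c fun p => X p k

theorem ActsBy.comm_expand {𝒜 : ZMod 2 → Submodule ℂ A} {G : Gens A} {X : Module.End ℂ A}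
    {V Vk Vm : Fin 6 → Fin 6 → ℂ} {Sp St U Ut Uj : Fin 4 → Fin 4 → ℂ} (hX : IsEvenDer 𝒜 X)
    (h : ActsBy G X V Vk Vm Sp St U Ut Uj) (x : Slot → A) :
    comm X (G.expand x) = G.expand (act X V Vk Vm Sp St U Ut Uj x) := by
  have hM : ∀ a b, comm X ((1 / 2 : ℂ) • G.M a b) = ∑ c, Vm a c • (1 / 2 : ℂ) • G.M c b +
      ∑ c, Vm b c • (1 / 2 : ℂ) • G.M a c := by
    intro a b
    rw [comm_smul_right, h.M, smul_add, Finset.smul_sum, Finset.smul_sum]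
    simp only [smul_comm (1 / 2 : ℂ)]
  simp only [Gens.expand_apply, comm_add_right, comm_sum_right, hX.comm_smul, h.P, h.Q, hM, h.D,
    h.J, h.S, h.K, smul_zero, add_zero, act, Finset.sum_add_distrib, add_smul _ (_ + _)]
  simp only [sum_smul_matrix, sum_smul_matrix_two, add_smul, Finset.sum_add_distrib]

theorem low_raise (v : Fin 4 → A) (i : Fin 4) : low (raise v) i = v i := by
  simp only [low, raise, Finset.smul_sum, smul_smul]
  rw [Finset.sum_comm]
  simp only [← Finset.sum_smul, OmL_mul_OmU]
  simp [kd]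

theorem jrot_raise (a b : Fin 4) (x : Fin 4 → A) (k : Fin 4) :
    jrot a b (raise x) k = -∑ p, OmU k p • ∑ m, jmat a b m p • x m := by
  rw [jrot_eq_sum]
  simp only [raise, Finset.smul_sum, smul_smul]
  rw [Finset.sum_comm, Finset.sum_comm (f := fun p m => (OmU k p * jmat a b m p) • x m),
    ← Finset.sum_neg_distrib]
  refine Finset.sum_congr rfl fun m _ => ?_
  rw [← Finset.sum_smul, ← Finset.sum_smul, ← neg_smul]
  congr 1
  simp only [jmat, mul_add, add_mul, Finset.sum_add_distrib]
  have e1 : ∀ c d, ∑ p, OmU k p * (1 / 2 * (OmU m c * kd p d)) = 1 / 2 * (OmU k d * OmU m c) := by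
    intro c d; simp [kd]; ring
  have e2 : ∀ c d, ∑ p, 1 / 2 * (OmU k c * kd p d) * OmU p m = 1 / 2 * (OmU k c * OmU d m) := by
    intro c d; simp [kd]; ring
  rw [e1, e1, e2, e2, OmU_antisymm b m, OmU_antisymm a m]
  ring

/-- A lower `USp(4)` index can be raised. -/
theorem map_raise_of_covector (J : Module.End ℂ A) (a b : Fin 4) {x : Fin 4 → A}
    (h : ∀ p, J (x p) + ∑ m, jmat a b m p • x m = 0) (k : Fin 4) :
    J (raise x k) = jrot a b (raise x) k := by
  have h1 : ∀ p, J (x p) = -∑ m, jmat a b m p • x m := fun p => eq_neg_of_add_eq_zero_left (h p)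
  rw [jrot_raise]
  simp only [raise, map_sum, map_smul, h1, smul_neg, Finset.sum_neg_distrib]

theorem eq_zero_of_raise_eq_zero {x : Fin 4 → A} (h : ∀ k, raise x k = 0) (i : Fin 4) : x i = 0 := by
  rw [← low_raise x i]
  simp only [low, h, smul_zero, Finset.sum_const_zero]

end Operators

section Superspace

variable {A : Type*} [Ring A] [StarRing A] [Algebra ℂ A] [StarModule ℂ A]
  {𝒜 : ZMod 2 → Submodule ℂ A} [GradedAlgebra 𝒜] (𝒮 : ConformalSuperspace 𝒜)

namespace ConformalSuperspace

theorem sum_ite_smul_fin {ι : Type*} [Fintype ι] [DecidableEq ι] (c : ℂ) (i : ι)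
    (X : ι → Module.End ℂ A) : ∑ j, (if i = j then c else 0) • X j = c • X i := by
  simp [ite_smul]

theorem D_actsBy : ActsBy 𝒮.toGens 𝒮.D (fun c d => if c = d then 1 else 0)
    (fun c d => if c = d then -1 else 0) 0 (fun c d => if c = d then 1 / 2 else 0)
    (fun c d => if c = d then -(1 / 2) else 0) 0 0 0 where
  P c := by rw [𝒮.covariant.DP, sum_ite_smul_fin, one_smul]
  Q α i := by
    rw [𝒮.covariant.DQ, sum_ite_smul_fin (1 / 2) α fun β => 𝒮.Q β i]; simp
  M a b := by rw [comm_swap, 𝒮.bosonic.MD]; simp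
  D := by simp [comm]
  J i j := by rw [𝒮.bosonic.DJ]; simp
  S α i := by
    rw [𝒮.covariant.DS, sum_ite_smul_fin (-(1 / 2)) α fun β => 𝒮.S β i]; simp
  K c := by
    rw [𝒮.covariant.DK, sum_ite_smul_fin]
    ext f; simp

theorem J_actsBy (i j : Fin 4) : ActsBy 𝒮.toGens (𝒮.J i j) 0 0 0 0 0 (jmat i j)
    (fun k l => -jmat i j l k) (jmat i j) where
  P c := by rw [𝒮.covariant.JP]; simp
  Q α k := by rw [𝒮.covariant.JQ, jrot_eq_sum]; simp
  M a b := by rw [comm_swap, 𝒮.bosonic.MJ]; simp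
  D := by rw [comm_swap, 𝒮.bosonic.DJ]; simp
  J k l := by
    rw [𝒮.bosonic.JJ, jrot_eq_sum, jrot_eq_sum]
    simp only [𝒮.bosonic.J_symm _ k]
  S α k := by
    rw [𝒮.covariant.JS]
    simp only [Gens.Sup, raise, Pi.zero_apply, zero_smul, Finset.sum_const_zero, zero_add,
      Finset.smul_sum, ← Finset.sum_add_distrib, smul_smul, ← add_smul]
    refine Finset.sum_congr rfl fun l _ => ?_
    congr 1
    simp only [jmat]
    rw [OmU_antisymm l i, OmU_antisymm l j]
    ring
  K c := by rw [𝒮.covariant.JK]; simp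

theorem M_actsBy (a b : Fin 6) : ActsBy 𝒮.toGens (𝒮.M a b) (vmat a b) (vmat a b) (vmat a b)
    (fun γ δ => -(1 / 2) * gam2 a b γ δ) (fun γ δ => -(1 / 2) * gamt2 a b γ δ) 0 0 0 where
  P c := by rw [𝒮.covariant.MP, vrot_eq_sum]
  Q α k := by
    rw [𝒮.covariant.MQ, Finset.smul_sum]
    simp only [smul_smul, Pi.zero_apply, zero_smul, Finset.sum_const_zero, add_zero]
  M c d := by
    rw [𝒮.bosonic.MM, vrot_eq_sum, vrot_eq_sum, sub_eq_add_neg, ← Finset.sum_neg_distrib]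
    congr 1
    refine Finset.sum_congr rfl fun e _ => ?_
    rw [𝒮.bosonic.M_antisymm c e]
    ext f; simp
  D := 𝒮.bosonic.MD a b
  J k l := by rw [𝒮.bosonic.MJ]; simp
  S α k := by
    rw [𝒮.covariant.MS, Finset.smul_sum]
    simp only [smul_smul, Pi.zero_apply, zero_smul, Finset.sum_const_zero, add_zero]
  K c := by rw [𝒮.covariant.MK, vrot_eq_sum]

theorem expand_injective {x y : Slot → A} (hx : Balanced x) (hy : Balanced y)
    (h : 𝒮.expand x = 𝒮.expand y) : x = y := by
  funext s
  refine sub_eq_zero.mp (𝒮.toGens.eq_zero_of_expand_eq_zero 𝒮.bosonic.M_antisymm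
    𝒮.bosonic.J_symm 𝒮.independent (x := x - y) ⟨fun a b => ?_, fun i j => ?_⟩ ?_ s)
  · simp only [Pi.sub_apply]; rw [hx.M, hy.M]; abel
  · simp only [Pi.sub_apply]; rw [hx.J, hy.J]
  · rw [map_sub, h, sub_self]

/-- The covariant fields of dimension `(m - wt k) / 2`, to multiply generators of kind `k`. -/
def grade (m : ℤ) (k : Kind) : Submodule ℂ A := 𝒮.cov (m - k.wt)

/-- The submodule of covariant fields. -/
def covAll : Submodule ℂ A where
  carrier := {f | 𝒮.IsCov f}
  add_mem' := IsCovField.add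
  zero_mem' := 𝒮.isCov_of_mem (zero_mem (𝒮.cov 0))
  smul_mem' c _ := IsCovField.smul c

theorem comm_D_expand (x : Slot → A) : comm 𝒮.D (𝒮.expand x) =
    𝒮.expand fun s => 𝒮.D (x s) + ((s.kind.wt : ℂ) / 2) • x s := by
  rw [𝒮.D_actsBy.comm_expand 𝒮.D_der]
  congr 1
  funext s
  cases s <;> simp [act, Slot.kind, Kind.wt, ite_smul]
  module

/-- The eigenvalue equation for [D, T], compared component by component, makes every component an
eigenvector of `D`; `mem_cov_of_D` then gives its exact dimension. -/
theorem mem_opSpan_grade {T : Module.End ℂ A} (hT : T ∈ fieldSpan 𝒮.IsCov 𝒮.toGens Set.univ)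
    (m : ℤ) (hD : comm 𝒮.D T = ((m : ℂ) / 2) • T) : T ∈ 𝒮.opSpan (𝒮.grade m) := by
  obtain ⟨x, hx, bx, rfl⟩ := Gens.fieldSpan_le_opSpan (N := fun _ => 𝒮.covAll) 𝒮.bosonic
    (fun g _ f hf => hf) hT
  refine ⟨x, fun s => ?_, bx, rfl⟩
  rw [comm_D_expand, ← LinearMap.map_smul_of_tower] at hD
  have h := 𝒮.expand_injective ⟨fun a b => ?_, fun i j => ?_⟩ ⟨fun a b => ?_, fun i j => ?_⟩ hD
  · refine 𝒮.mem_cov_of_D (hx s) ?_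
    have := congrFun h s
    simp only [Pi.smul_apply] at this
    rw [eq_sub_of_add_eq this, ← sub_smul]
    push_cast; congr 1; ring
  · rw [bx.M]; simp [Slot.kind, add_comm]
  · rw [bx.J]; simp [Slot.kind]
  · simp only [Pi.smul_apply]; rw [bx.M, smul_neg]
  · simp only [Pi.smul_apply]; rw [bx.J]

/-- The coefficient of largest dimension is that of K, and twice its dimension is m + 2 < 2, below
the dimension of `W`. This alone makes `S` and `K` rigid. -/
theorem eq_zero_of_mem_opSpan {m : ℤ} (hm : m < 0) {T : Module.End ℂ A}
    (hT : T ∈ 𝒮.opSpan (𝒮.grade m)) : T = 0 := by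
  obtain ⟨x, hx, bx, rfl⟩ := hT
  have : x = 0 := funext fun s => 𝒮.cov_eq_zero (by
    cases s <;> simp only [Slot.kind, Kind.wt] <;> omega) (hx s)
  rw [this, map_zero]

end ConformalSuperspace

end Superspace

end

/-! ### Rigidity of the covariant derivatives -/

section

theorem sum_vmat_smul {V : Type*} [AddCommGroup V] [Module ℂ V] (a b d : Fin 6) (p : Fin 6 → V) :
    eta d d • ∑ c, vmat a b c d • p c = -vrot a b (fun e => eta e e • p e) d := by
  have h : ∀ c, (vmat a b c d) • p c = (if d = b then 1 else 0 : ℂ) • (eta c a • p c) -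
      (if d = a then 1 else 0 : ℂ) • (eta c b • p c) := fun c => by simp only [vmat]; module
  have h2 : ∀ e, ∑ c, eta c e • p c = eta e e • p e := fun e => by
    rw [Finset.sum_eq_single e (fun c _ hc => by rw [eta_of_ne hc, zero_smul]) (by simp)]
  simp only [h, Finset.sum_sub_distrib, ← Finset.smul_sum, h2, vrot]
  by_cases h1 : d = b
  · by_cases h3 : d = a
    · subst h1; subst h3; simp
    · subst h1; simp [h3, eta_of_ne h3]
  · by_cases h3 : d = a
    · subst h3; simp [h1, eta_of_ne h1]
    · simp [h1, h3, eta_of_ne h1, eta_of_ne h3]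

section Superspace

variable {A : Type*} [Ring A] [StarRing A] [Algebra ℂ A] [StarModule ℂ A]
  {𝒜 : ZMod 2 → Submodule ℂ A} [GradedAlgebra 𝒜] (𝒮 : ConformalSuperspace 𝒜)

theorem Balanced.sum_smul {ι : Type*} (t : Finset ι) (c : ι → ℂ) {x : ι → Slot → A}
    (hx : ∀ i, Balanced (x i)) : Balanced (∑ i ∈ t, c i • x i) where
  M a b := by
    simp only [Finset.sum_apply, Pi.smul_apply, ← Finset.sum_neg_distrib]
    exact Finset.sum_congr rfl fun i _ => by rw [(hx i).M, smul_neg]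
  J a b := by
    simp only [Finset.sum_apply, Pi.smul_apply]
    exact Finset.sum_congr rfl fun i _ => by rw [(hx i).J]

theorem Balanced.zero : Balanced (0 : Slot → A) := ⟨fun _ _ => by simp, fun _ _ => rfl⟩

namespace ConformalSuperspace

theorem expand_sum_smul {ι : Type*} [Fintype ι] (c : ι → ℂ) (x : ι → Slot → A) :
    𝒮.expand (∑ i, c i • x i) = ∑ i, c i • 𝒮.expand (x i) := by
  simp only [map_sum, LinearMap.map_smul_of_tower]

section Vector

variable {x : Fin 6 → Slot → A} (bx : ∀ c, Balanced (x c))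
include bx

theorem J_slot_vector
    (hJ : ∀ i j c, comm (𝒮.J i j) (𝒮.expand (x c)) = 0) (i j : Fin 4) (c : Fin 6) (s : Slot) :
    act (𝒮.J i j) 0 0 0 0 0 (jmat i j) (fun k l => -jmat i j l k) (jmat i j) (x c) s = 0 := by
  have h := hJ i j c
  rw [(𝒮.J_actsBy i j).comm_expand (𝒮.J_der i j)] at h
  rw [← map_zero 𝒮.expand] at h
  exact congrFun (𝒮.expand_injective (bx c).act Balanced.zero h) s

theorem M_slot_vector
    (hM : ∀ a b c, comm (𝒮.M a b) (𝒮.expand (x c)) = vrot a b (fun d => 𝒮.expand (x d)) c)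
    (a b c : Fin 6) (s : Slot) : act (𝒮.M a b) (vmat a b) (vmat a b) (vmat a b)
      (fun γ δ => -(1 / 2) * gam2 a b γ δ) (fun γ δ => -(1 / 2) * gamt2 a b γ δ) 0 0 0 (x c) s =
      vrot a b (fun d => x d s) c := by
  have h := hM a b c
  rw [(𝒮.M_actsBy a b).comm_expand (𝒮.M_der a b), vrot_eq_sum, ← expand_sum_smul] at h
  have h2 := congrFun (𝒮.expand_injective (bx c).act (Balanced.sum_smul _ _ bx) h) s
  rw [h2, vrot_eq_sum]
  simp only [Finset.sum_apply, Pi.smul_apply]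

end Vector

/-- The component along S^α is a covector for the upper spinor index, hence transforms like a lower
spinor index. -/
theorem spinor_transfer (a b : Fin 6) (δ : Fin 4) (t : Fin 4 → A) :
    ∑ α, (-(1 / 2) * gamt2 a b α δ) • t α = -((-(1 / 2) : ℂ) • ∑ α, gam2 a b δ α • t α) := by
  rw [Finset.smul_sum, ← Finset.sum_neg_distrib]
  exact Finset.sum_congr rfl fun α _ => by rw [gamt2_eq]; module

/-- Each component is a tensor of known dimension: those along P and Q are too light, those along M
and D are singlets of dimension 1, the one along J is an adjoint of dimension 1, the one along S is
a vector-spinor of dimension 3/2. All of these vanish. The one along K is a two-vector singlet of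
dimension 2, hence a multiple of `WW`. -/
theorem vector_rigidity {T : Fin 6 → Module.End ℂ A} (hT : ∀ a, T a ∈ 𝒮.opSpan (𝒮.grade 2))
    (hM : ∀ a b c, comm (𝒮.M a b) (T c) = vrot a b T c) (hJ : ∀ i j c, comm (𝒮.J i j) (T c) = 0) :
    ∃ c : ℂ, ∀ a, T a = c • ∑ b, WW 𝒮.W a b • 𝒮.Kup b := by
  choose x hx bx ex using hT
  obtain rfl : T = fun c => 𝒮.expand (x c) := funext ex
  have J := 𝒮.J_slot_vector bx hJ
  have M := 𝒮.M_slot_vector bx hM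
  have zM : ∀ c a b, x c (.M a b) = 0 := fun c a b => 𝒮.cov_two_singlet (hx c (.M a b))
    fun i j => by simpa [act] using J i j c (.M a b)
  have zD : ∀ c, x c .D = 0 := fun c => 𝒮.cov_two_singlet (hx c .D)
    fun i j => by simpa [act] using J i j c .D
  have zP : ∀ c a, x c (.P a) = 0 := fun c a =>
    𝒮.cov_eq_zero (m := 2 - 2) (by norm_num) (hx c (.P a))
  have zQ : ∀ c α i, x c (.Q α i) = 0 := fun c α i =>
    𝒮.cov_eq_zero (m := 2 - 1) (by norm_num) (hx c (.Q α i))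
  have zJ : ∀ c k l, x c (.J k l) = 0 := by
    intro c k l
    have h := fun i j k l => J i j c (.J k l)
    simp only [act] at h
    have h0 : ∀ k l, raise (fun k => raise (fun l => x c (.J k l)) l) k = 0 := by
      -- The components along J^{kl} carry lower indices; raising both turns them into the symmetric
      -- upper tensor excluded in dimension 1.
      refine fun k l => 𝒮.cov_two_adjoint (t := fun k l => raise (fun k => raise (fun l => x c (.J k l)) l) k)
        (fun k l => ?_) (fun k l => ?_) (fun i j k l => ?_) k l
      · exact Submodule.sum_mem _ fun p _ => Submodule.smul_mem _ _ <|
          Submodule.sum_mem _ fun q _ => Submodule.smul_mem _ _ (hx c (.J p q))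
      · simp only [raise, Finset.smul_sum]
        rw [Finset.sum_comm]
        exact Finset.sum_congr rfl fun p _ => Finset.sum_congr rfl fun q _ => by
          rw [(bx c).J, smul_comm]
      · have e : 𝒮.J i j (raise (fun k => raise (fun l => x c (.J k l)) l) k) =
            -(∑ p, OmU k p • ∑ q, OmU l q • ∑ m, jmat i j m p • x c (.J m q)) -
            ∑ p, OmU k p • ∑ q, OmU l q • ∑ m, jmat i j m q • x c (.J p m) := by
          have h1 : ∀ p q, 𝒮.J i j (x c (.J p q)) = -(∑ m, jmat i j m p • x c (.J m q)) -
              ∑ m, jmat i j m q • x c (.J p m) := fun p q => by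
            rw [eq_neg_of_add_eq_zero_left (h i j p q)]; abel
          simp only [raise, map_sum, map_smul, h1, smul_sub, smul_neg, Finset.sum_sub_distrib,
            Finset.sum_neg_distrib]
        rw [e]
        rw [jrot_raise]
        have f2 : jrot i j (fun m => raise (fun k => raise (fun l => x c (.J k l)) m) k) l =
            raise (fun p => jrot i j (raise fun l => x c (.J p l)) l) k := by
          simp only [raise, jrot_eq_sum, Finset.smul_sum]
          rw [Finset.sum_comm]
          refine Finset.sum_congr rfl fun p _ => Finset.sum_congr rfl fun q _ =>
            Finset.sum_congr rfl fun r _ => smul_comm _ _ _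
        rw [f2]
        simp only [jrot_raise]
        simp only [raise, smul_neg, Finset.sum_neg_distrib, Finset.smul_sum]
        rw [sub_eq_add_neg]
        congr 2
        refine Finset.sum_congr rfl fun p _ => ?_
        rw [Finset.sum_comm]
        refine Finset.sum_congr rfl fun q _ => Finset.sum_congr rfl fun r _ => ?_
        module
    exact eq_zero_of_raise_eq_zero (x := fun l => x c (.J k l))
      (fun l => eq_zero_of_raise_eq_zero (x := fun k => raise (fun l => x c (.J k l)) l)
        (fun k => h0 k l) k) l
  have zS : ∀ c α i, x c (.S α i) = 0 := by
    intro c α i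
    refine 𝒮.cov_three_vector_spinor (t := fun c α i => x c (.S α i)) (fun c α i => hx c (.S α i))
      (fun i j c γ k => ?_) (fun a b c γ k => ?_) c α i
    · have h := J i j c (.S γ k)
      simp only [act, Pi.zero_apply, zero_smul, Finset.sum_const_zero, zero_add, neg_smul,
        Finset.sum_neg_distrib] at h
      rw [jrot_eq_sum]
      exact sub_eq_zero.mp (by rw [sub_eq_add_neg]; exact h)
    · have h := M a b c (.S γ k)
      simp only [act, Pi.zero_apply, zero_smul, Finset.sum_const_zero, add_zero,
        spinor_transfer] at h
      rw [← h]; abel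
  -- Multiplying the component along K_d by the diagonal entry of η lowers its vector index.
  have hK : ∃ r : ℂ, ∀ c d, eta d d • x c (.K d) = r • WW 𝒮.W c d := by
    refine 𝒮.exists_eq_smul_WW (f := fun c d => eta d d • x c (.K d))
      (fun c d => Submodule.smul_mem _ _ (hx c (.K d))) (fun i j c d => ?_) (fun a b c d => ?_)
    · have h := J i j c (.K d)
      simp only [act, Pi.zero_apply, zero_smul, Finset.sum_const_zero, add_zero] at h
      rw [map_smul, h, smul_zero]
    · have h := congrArg (eta d d • ·) (M a b c (.K d))
      simp only [act, smul_add, sum_vmat_smul] at h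
      rw [map_smul, ← sub_eq_iff_eq_add, sub_eq_add_neg, h]
      simp only [vrot]; module
  obtain ⟨r, hr⟩ := hK
  refine ⟨r, fun c => ?_⟩
  have e : ∀ d, x c (.K d) • 𝒮.K d = r • WW 𝒮.W c d • 𝒮.Kup d := by
    intro d
    have e1 : 𝒮.Kup d = eta d d • 𝒮.K d := by
      rw [Gens.Kup, upV, Finset.sum_eq_single d (fun b _ hb => by
        rw [eta_of_ne hb.symm, zero_smul]) (by simp)]
    rw [e1, ← smul_assoc r, ← hr, smul_assoc, smul_comm (x c (.K d)) (eta d d), smul_smul,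
      eta_mul_self, one_smul]
  dsimp only
  rw [Gens.expand_apply]
  simp only [zP, zQ, zM, zD, zJ, zS, zero_smul, Finset.sum_const_zero, zero_add, e,
    ← Finset.smul_sum]

/-- Only two components are heavy enough. The one along S would have two lower spinor indices in
dimension 1, the one along K would be a vector-spinor in dimension 3/2; neither exists. -/
theorem spinor_rigidity {T : Fin 4 → Fin 4 → Module.End ℂ A}
    (hT : ∀ α i, T α i ∈ 𝒮.opSpan (𝒮.grade 1))
    (hM : ∀ a b γ k, comm (𝒮.M a b) (T γ k) = (-(1 / 2) : ℂ) • ∑ δ, gam2 a b γ δ • T δ k)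
    (hJ : ∀ i j γ k, comm (𝒮.J i j) (T γ k) = jrot i j (T γ) k) (α i : Fin 4) : T α i = 0 := by
  choose x hx bx ex using hT
  obtain rfl : T = fun α i => 𝒮.expand (x α i) := funext fun α => funext fun i => ex α i
  have J : ∀ i j γ k s, act (𝒮.J i j) 0 0 0 0 0 (jmat i j) (fun k l => -jmat i j l k) (jmat i j)
      (x γ k) s = jrot i j (fun l => x γ l s) k := by
    intro i j γ k s
    have h := hJ i j γ k
    rw [(𝒮.J_actsBy i j).comm_expand (𝒮.J_der i j), jrot_eq_sum, ← expand_sum_smul] at h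
    have h2 := congrFun (𝒮.expand_injective (bx γ k).act (Balanced.sum_smul _ _ (bx γ)) h) s
    rw [h2, jrot_eq_sum]
    simp only [Finset.sum_apply, Pi.smul_apply]
  have M : ∀ a b γ k s, act (𝒮.M a b) (vmat a b) (vmat a b) (vmat a b)
      (fun γ δ => -(1 / 2) * gam2 a b γ δ) (fun γ δ => -(1 / 2) * gamt2 a b γ δ) 0 0 0 (x γ k) s =
      (-(1 / 2) : ℂ) • ∑ δ, gam2 a b γ δ • x δ k s := by
    intro a b γ k s
    have h := hM a b γ k
    rw [(𝒮.M_actsBy a b).comm_expand (𝒮.M_der a b), Finset.smul_sum] at h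
    simp only [smul_smul] at h
    rw [← 𝒮.expand_sum_smul (fun δ => -(1 / 2) * gam2 a b γ δ) (fun δ => x δ k)] at h
    have h2 := congrFun (𝒮.expand_injective (bx γ k).act
      (Balanced.sum_smul _ _ fun δ => bx δ k) h) s
    rw [h2, Finset.smul_sum]
    simp only [Finset.sum_apply, Pi.smul_apply, smul_smul]
  have zP : ∀ α i a, x α i (.P a) = 0 := fun α i a =>
    𝒮.cov_eq_zero (m := 1 - 2) (by norm_num) (hx α i (.P a))
  have zQ : ∀ α i β j, x α i (.Q β j) = 0 := fun α i β j =>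
    𝒮.cov_eq_zero (m := 1 - 1) (by norm_num) (hx α i (.Q β j))
  have zM : ∀ α i a b, x α i (.M a b) = 0 := fun α i a b =>
    𝒮.cov_eq_zero (m := 1 - 0) (by norm_num) (hx α i (.M a b))
  have zD : ∀ α i, x α i .D = 0 := fun α i =>
    𝒮.cov_eq_zero (m := 1 - 0) (by norm_num) (hx α i .D)
  have zJ : ∀ α i k l, x α i (.J k l) = 0 := fun α i k l =>
    𝒮.cov_eq_zero (m := 1 - 0) (by norm_num) (hx α i (.J k l))
  have zS : ∀ α i β j, x α i (.S β j) = 0 := by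
    intro α i β j
    refine 𝒮.cov_two_lower_lower (t := fun α β => x α i (.S β j)) (fun α β => hx α i (.S β j))
      (fun γ δ α β => ?_) α β
    have h : ∀ a b, 𝒮.M a b (x α i (.S β j)) =
        (-(1 / 2) : ℂ) • ∑ δ, gam2 a b α δ • x δ i (.S β j) +
        (-(1 / 2) : ℂ) • ∑ δ, gam2 a b β δ • x α i (.S δ j) := by
      intro a b
      have h := M a b α i (.S β j)
      simp only [act, Pi.zero_apply, zero_smul, Finset.sum_const_zero, add_zero,
        spinor_transfer] at h
      rw [← h]; abel
    rw [Gens.Mss_apply]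
    simp only [h, mssSum_add, mssSum_lower]
  have zK : ∀ α i d, x α i (.K d) = 0 := by
    intro α i d
    have h0 := 𝒮.cov_three_vector_spinor (t := fun d α i => eta d d • x α i (.K d))
      (fun d α i => Submodule.smul_mem _ _ (hx α i (.K d))) (fun i j d γ k => by
        have h := J i j γ k (.K d)
        simp only [act, Pi.zero_apply, zero_smul, Finset.sum_const_zero, add_zero] at h
        rw [map_smul, h, jrot_smul]) (fun a b d γ k => by
        have h := congrArg (eta d d • ·) (M a b γ k (.K d))
        simp only [act, smul_add, sum_vmat_smul] at h
        rw [map_smul, ← sub_eq_iff_eq_add', sub_eq_add_neg, h]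
        simp only [Finset.smul_sum]
        exact Finset.sum_congr rfl fun δ _ => by module) d α i
    have : eta d d • eta d d • x α i (.K d) = 0 := by rw [h0, smul_zero]
    rwa [smul_smul, eta_mul_self, one_smul] at this
  dsimp only
  rw [Gens.expand_apply]
  simp only [zP, zQ, zM, zD, zJ, zS, zK, zero_smul, Finset.sum_const_zero, zero_add]

end ConformalSuperspace

end Superspace

end

/-! ### Brackets of operators of definite dimension -/

section

section Operators

variable {A : Type*} [Ring A] [Algebra ℂ A]

/-- The generator with the given label. -/
def Gens.slot (G : Gens A) : Slot → Module.End ℂ A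
  | .P a => G.P a
  | .Q α i => G.Q α i
  | .M a b => G.M a b
  | .D => G.D
  | .J i j => G.J i j
  | .S α i => G.S α i
  | .K a => G.K a

/-- The sum over all labels (with each `M_{ab}` counted once) of `x s • y s`. -/
def mix (y : Slot → Module.End ℂ A) (x : Slot → A) : Module.End ℂ A :=
  (∑ a, x (.P a) • y (.P a)) + (∑ α, ∑ i, x (.Q α i) • y (.Q α i)) +
    (∑ a, ∑ b, x (.M a b) • (1 / 2 : ℂ) • y (.M a b)) + x .D • y .D +
    (∑ i, ∑ j, x (.J i j) • y (.J i j)) + (∑ α, ∑ i, x (.S α i) • y (.S α i)) +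
    ∑ a, x (.K a) • y (.K a)

theorem expand_eq_mix (G : Gens A) (x : Slot → A) : G.expand x = mix G.slot x := rfl

theorem mix_mem {y : Slot → Module.End ℂ A} {x : Slot → A} {V : Submodule ℂ (Module.End ℂ A)}
    (h : ∀ s, x s • y s ∈ V) : mix y x ∈ V := by
  refine add_mem (add_mem (add_mem (add_mem (add_mem (add_mem ?_ ?_) ?_) (h _)) ?_) ?_) ?_
  · exact Submodule.sum_mem _ fun a _ => h _
  · exact Submodule.sum_mem _ fun a _ => Submodule.sum_mem _ fun b _ => h _
  · refine Submodule.sum_mem _ fun a _ => Submodule.sum_mem _ fun b _ => ?_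
    rw [smul_comm]
    exact Submodule.smul_mem _ _ (h _)
  · exact Submodule.sum_mem _ fun a _ => Submodule.sum_mem _ fun b _ => h _
  · exact Submodule.sum_mem _ fun a _ => Submodule.sum_mem _ fun b _ => h _
  · exact Submodule.sum_mem _ fun a _ => h _

theorem IsEvenDer.comm_expand {𝒜 : ZMod 2 → Submodule ℂ A} {X : Module.End ℂ A}
    (hX : IsEvenDer 𝒜 X) (G : Gens A) (x : Slot → A) : comm X (G.expand x) =
      G.expand (fun s => X (x s)) + mix (fun s => comm X (G.slot s)) x := by
  simp only [expand_eq_mix, mix, comm_add_right, comm_sum_right, hX.comm_smul, comm_smul_right,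
    Finset.sum_add_distrib, Gens.slot]
  abel

/-- The graded bracket of an odd operator with a generator, with a sign for odd generators. -/
def Gens.oddBr (G : Gens A) (X : Module.End ℂ A) : Slot → Module.End ℂ A
  | .P a => comm X (G.P a)
  | .Q α i => -acomm X (G.Q α i)
  | .M a b => comm X (G.M a b)
  | .D => comm X G.D
  | .J i j => comm X (G.J i j)
  | .S α i => -acomm X (G.S α i)
  | .K a => comm X (G.K a)

/-- Here a coefficient has the parity of its generator. Moving the odd operator past an odd
coefficient costs a sign and leaves an anticommutator with an odd generator; `oddBr` absorbs both.
-/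
theorem IsOddDer.comm_expand {𝒜 : ZMod 2 → Submodule ℂ A} {X : Module.End ℂ A}
    (hX : IsOddDer 𝒜 X) (G : Gens A) {x : Slot → A} (hx : ∀ s, x s ∈ 𝒜 (s.kind.wt : ZMod 2)) :
    comm X (G.expand x) = G.expand (fun s => X (x s)) + mix (G.oddBr X) x := by
  have e1 : ((2 : ℤ) : ZMod 2) = 0 := rfl
  have e2 : ((1 : ℤ) : ZMod 2) = 1 := rfl
  have e3 : ((0 : ℤ) : ZMod 2) = 0 := rfl
  have e4 : ((-1 : ℤ) : ZMod 2) = 1 := rfl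
  have e5 : ((-2 : ℤ) : ZMod 2) = 0 := rfl
  have hP := fun a (Y : Module.End ℂ A) => hX.comm_smul_even (e1 ▸ hx (.P a)) Y
  have hQ := fun a i (Y : Module.End ℂ A) => hX.comm_smul_odd (e2 ▸ hx (.Q a i)) Y
  have hM := fun a b (Y : Module.End ℂ A) => hX.comm_smul_even (e3 ▸ hx (.M a b)) Y
  have hD := fun (Y : Module.End ℂ A) => hX.comm_smul_even (e3 ▸ hx .D) Y
  have hJ := fun a i (Y : Module.End ℂ A) => hX.comm_smul_even (e3 ▸ hx (.J a i)) Y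
  have hS := fun a i (Y : Module.End ℂ A) => hX.comm_smul_odd (e4 ▸ hx (.S a i)) Y
  have hK := fun a (Y : Module.End ℂ A) => hX.comm_smul_even (e5 ▸ hx (.K a)) Y
  simp only [expand_eq_mix, mix, comm_add_right, comm_sum_right, hP, hQ, hM, hD, hJ, hS, hK,
    comm_smul_right, Finset.sum_add_distrib, Finset.sum_sub_distrib, Gens.slot, Gens.oddBr, smul_neg,
    Finset.sum_neg_distrib]
  abel

theorem IsOddDer.acomm_expand {𝒜 : ZMod 2 → Submodule ℂ A} {X : Module.End ℂ A}
    (hX : IsOddDer 𝒜 X) (G : Gens A) {x : Slot → A}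
    (hx : ∀ s, x s ∈ 𝒜 ((1 + s.kind.wt : ℤ) : ZMod 2)) :
    acomm X (G.expand x) = G.expand (fun s => X (x s)) - mix (G.oddBr X) x := by
  have e1 : ((1 + 2 : ℤ) : ZMod 2) = 1 := rfl
  have e2 : ((1 + 1 : ℤ) : ZMod 2) = 0 := rfl
  have e3 : ((1 + 0 : ℤ) : ZMod 2) = 1 := rfl
  have e4 : ((1 + -1 : ℤ) : ZMod 2) = 0 := rfl
  have e5 : ((1 + -2 : ℤ) : ZMod 2) = 1 := rfl
  have hP := fun a (Y : Module.End ℂ A) => hX.acomm_smul_odd (e1 ▸ hx (.P a)) Y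
  have hQ := fun a i (Y : Module.End ℂ A) => hX.acomm_smul_even (e2 ▸ hx (.Q a i)) Y
  have hM := fun a b (Y : Module.End ℂ A) => hX.acomm_smul_odd (e3 ▸ hx (.M a b)) Y
  have hD := fun (Y : Module.End ℂ A) => hX.acomm_smul_odd (e3 ▸ hx .D) Y
  have hJ := fun a i (Y : Module.End ℂ A) => hX.acomm_smul_odd (e3 ▸ hx (.J a i)) Y
  have hS := fun a i (Y : Module.End ℂ A) => hX.acomm_smul_even (e4 ▸ hx (.S a i)) Y
  have hK := fun a (Y : Module.End ℂ A) => hX.acomm_smul_odd (e5 ▸ hx (.K a)) Y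
  have hc : ∀ c : ℂ, ∀ Y, comm X (c • Y) = c • comm X Y := fun c Y => comm_smul_right c X Y
  simp only [expand_eq_mix, mix, acomm_add_right, acomm_sum_right, hP, hQ, hM, hD, hJ, hS, hK,
    hc, Finset.sum_add_distrib, Finset.sum_sub_distrib, Gens.slot, Gens.oddBr, smul_neg,
    Finset.sum_neg_distrib]
  abel

end Operators

section Superspace

variable {A : Type*} [Ring A] [StarRing A] [Algebra ℂ A] [StarModule ℂ A]
  {𝒜 : ZMod 2 → Submodule ℂ A} [GradedAlgebra 𝒜] (𝒮 : ConformalSuperspace 𝒜)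

namespace ConformalSuperspace

/-- The operators of dimension `n / 2` which may be multiplied by covariant fields. -/
def wtSpan (n : ℤ) : Submodule ℂ (Module.End ℂ A) where
  carrier := {T | ∀ k, ∀ f ∈ 𝒮.cov k, f • T ∈ 𝒮.opSpan (𝒮.grade (k + n))}
  zero_mem' k f _ := by rw [smul_zero]; exact zero_mem _
  add_mem' hS hT k f hf := by rw [smul_add]; exact add_mem (hS k f hf) (hT k f hf)
  smul_mem' c T hT k f hf := by rw [smul_comm]; exact Submodule.smul_mem _ _ (hT k f hf)

theorem slot_mem_wtSpan (s : Slot) : 𝒮.slot s ∈ 𝒮.wtSpan s.kind.wt := by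
  intro k f hf
  have h : f ∈ 𝒮.grade (k + s.kind.wt) s.kind := by
    rw [grade, add_sub_cancel_right]; exact hf
  rcases s with a | ⟨α, i⟩ | ⟨a, b⟩ | _ | ⟨i, j⟩ | ⟨α, i⟩ | a
  exacts [Gens.smul_P_mem h a, Gens.smul_Q_mem h α i, Gens.smul_M_mem 𝒮.bosonic h a b,
    Gens.smul_D_mem h, Gens.smul_J_mem 𝒮.bosonic h i j, Gens.smul_S_mem h α i,
    Gens.smul_K_mem h a]

theorem P_mem_wtSpan (a : Fin 6) : 𝒮.P a ∈ 𝒮.wtSpan 2 := 𝒮.slot_mem_wtSpan (.P a)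
theorem Q_mem_wtSpan (α i : Fin 4) : 𝒮.Q α i ∈ 𝒮.wtSpan 1 := 𝒮.slot_mem_wtSpan (.Q α i)
theorem M_mem_wtSpan (a b : Fin 6) : 𝒮.M a b ∈ 𝒮.wtSpan 0 := 𝒮.slot_mem_wtSpan (.M a b)
theorem D_mem_wtSpan : 𝒮.D ∈ 𝒮.wtSpan 0 := 𝒮.slot_mem_wtSpan .D
theorem J_mem_wtSpan (i j : Fin 4) : 𝒮.J i j ∈ 𝒮.wtSpan 0 := 𝒮.slot_mem_wtSpan (.J i j)
theorem S_mem_wtSpan (α i : Fin 4) : 𝒮.S α i ∈ 𝒮.wtSpan (-1) := 𝒮.slot_mem_wtSpan (.S α i)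
theorem K_mem_wtSpan (a : Fin 6) : 𝒮.K a ∈ 𝒮.wtSpan (-2) := 𝒮.slot_mem_wtSpan (.K a)

theorem smul_mem_grade {k m : ℤ} {f : A} (hf : f ∈ 𝒮.cov k) {T : Module.End ℂ A}
    (hT : T ∈ 𝒮.opSpan (𝒮.grade m)) : f • T ∈ 𝒮.opSpan (𝒮.grade (k + m)) := by
  refine Gens.smul_mem_opSpan (fun c g hg => ?_) hT
  have := 𝒮.mul_mem_cov hf hg
  rw [← add_sub_assoc] at this
  exact this

theorem opSpan_le_wtSpan (m : ℤ) : 𝒮.opSpan (𝒮.grade m) ≤ 𝒮.wtSpan m :=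
  fun _ hT _ _ hf => 𝒮.smul_mem_grade hf hT

theorem map_expand_mem {X : Module.End ℂ A} {m n : ℤ} (hX : ∀ k, ∀ f ∈ 𝒮.cov k, X f ∈ 𝒮.cov (k + n))
    {x : Slot → A} (hx : ∀ s, x s ∈ 𝒮.grade m s.kind) (bx : Balanced x) :
    𝒮.expand (fun s => X (x s)) ∈ 𝒮.opSpan (𝒮.grade (m + n)) := by
  refine ⟨_, fun s => ?_, ⟨fun a b => ?_, fun i j => ?_⟩, rfl⟩
  · have := hX _ _ (hx s)
    rw [sub_add_eq_add_sub] at this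
    exact this
  · rw [bx.M, map_neg]
  · rw [bx.J]

/-- Brackets with P are needed only when 4 ≤ m, because below that the coefficients of P have
dimension less than 1 and vanish. This avoids circularity when [Q, P] and [P, P] are derived from
other brackets. -/
theorem mix_mem_grade {y : Slot → Module.End ℂ A} {m n : ℤ} {x : Slot → A}
    (hx : ∀ s, x s ∈ 𝒮.grade m s.kind) (hP : 4 ≤ m → ∀ a, y (.P a) ∈ 𝒮.wtSpan (2 + n))
    (hy : ∀ s, s.kind ≠ .P → y s ∈ 𝒮.wtSpan (s.kind.wt + n)) :
    mix y x ∈ 𝒮.opSpan (𝒮.grade (m + n)) := by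
  refine mix_mem fun s => ?_
  have e : m + n = m - s.kind.wt + (s.kind.wt + n) := by ring
  by_cases hs : s.kind = .P
  · by_cases hm : 4 ≤ m
    · obtain ⟨a, rfl⟩ : ∃ a, s = .P a := by cases s <;> simp_all [Slot.kind]
      rw [e]; exact hP hm a _ _ (hx _)
    · have : x s = 0 := 𝒮.cov_eq_zero (m := m - s.kind.wt)
        (by rw [hs]; simp only [Kind.wt]; omega) (hx s)
      rw [this, zero_smul]; exact zero_mem _
  · rw [e]; exact hy s hs _ _ (hx s)

theorem Mss_mem_wtSpan (α β : Fin 4) : 𝒮.Mss α β ∈ 𝒮.wtSpan 0 :=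
  Submodule.sum_mem _ fun _ _ => Submodule.sum_mem _ fun _ _ => Submodule.sum_mem _ fun _ _ =>
    Submodule.sum_mem _ fun _ _ => Submodule.smul_mem _ _ (𝒮.M_mem_wtSpan _ _)

theorem Pss_mem_wtSpan (α β : Fin 4) : 𝒮.Pss α β ∈ 𝒮.wtSpan 2 :=
  Submodule.sum_mem _ fun _ _ => Submodule.smul_mem _ _ (𝒮.P_mem_wtSpan _)

theorem Kup_mem_wtSpan (a : Fin 6) : 𝒮.Kup a ∈ 𝒮.wtSpan (-2) :=
  Submodule.sum_mem _ fun _ _ => Submodule.smul_mem _ _ (𝒮.K_mem_wtSpan _)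

theorem Sup_mem_wtSpan (α i : Fin 4) : 𝒮.Sup α i ∈ 𝒮.wtSpan (-1) :=
  Submodule.sum_mem _ fun _ _ => Submodule.smul_mem _ _ (𝒮.S_mem_wtSpan _ _)

theorem Jmix_mem_wtSpan (i j : Fin 4) : 𝒮.Jmix i j ∈ 𝒮.wtSpan 0 :=
  Submodule.sum_mem _ fun _ _ => Submodule.smul_mem _ _ (𝒮.J_mem_wtSpan _ _)

theorem X36_mem_cov (α β γ i : Fin 4) : X36 𝒮.toGens 𝒮.W α β γ i ∈ 𝒮.cov 3 :=
  Submodule.sum_mem _ fun _ _ => 𝒮.Q_mem_cov _ _ (m := 2) <|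
    Submodule.sum_mem _ fun _ _ => Submodule.smul_mem _ _ (𝒮.W_mem_cov _ _ _ _)

theorem X16_mem_cov (α i j k : Fin 4) : X16 𝒮.toGens 𝒮.W α i j k ∈ 𝒮.cov 3 :=
  Submodule.sum_mem _ fun _ _ => 𝒮.Q_mem_cov _ _ (m := 2) (𝒮.W_mem_cov _ _ _ _)

theorem Y15_mem_cov (α β i j : Fin 4) : Y15 𝒮.toGens 𝒮.W α β i j ∈ 𝒮.cov 4 :=
  Submodule.smul_mem _ _ <| Submodule.sum_mem _ fun _ _ => 𝒮.Q_mem_cov _ _ (m := 3) <| add_mem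
    (Submodule.sum_mem _ fun _ _ => Submodule.smul_mem _ _ (𝒮.X16_mem_cov _ _ _ _))
    (Submodule.sum_mem _ fun _ _ => Submodule.smul_mem _ _ (𝒮.X16_mem_cov _ _ _ _))

theorem Pss_mem_cov (α β : Fin 4) {m : ℤ} {f : A} (hf : f ∈ 𝒮.cov m) :
    𝒮.Pss α β f ∈ 𝒮.cov (m + 2) := by
  have h : 𝒮.Pss α β f = ∑ a, gU a α β • 𝒮.P a f := by simp [Gens.Pss]
  rw [h]
  exact Submodule.sum_mem _ fun _ _ => Submodule.smul_mem _ _ (𝒮.P_mem_cov _ hf)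

/-- The coefficients of `K^a` in `{∇_α^i, ∇_β^j}`. -/
def curvK (α i β j : Fin 4) (a : Fin 6) : A :=
  ((3 / 80 : ℂ) • ∑ γ, ∑ δ, (gL a γ α • 𝒮.Pss β δ (𝒮.W δ γ i j) -
    gL a γ β • 𝒮.Pss α δ (𝒮.W δ γ i j))) +
  ((-Complex.I / 960) • ∑ γ, (gL a γ α • Y15 𝒮.toGens 𝒮.W β γ i j +
    gL a γ β • Y15 𝒮.toGens 𝒮.W α γ i j))

theorem curvK_mem_cov (α i β j : Fin 4) (a : Fin 6) : 𝒮.curvK α i β j a ∈ 𝒮.cov 4 := by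
  refine add_mem (Submodule.smul_mem _ _ ?_) (Submodule.smul_mem _ _ ?_)
  · exact Submodule.sum_mem _ fun _ _ => Submodule.sum_mem _ fun _ _ => sub_mem
      (Submodule.smul_mem _ _ (𝒮.Pss_mem_cov _ _ (m := 2) (𝒮.W_mem_cov _ _ _ _)))
      (Submodule.smul_mem _ _ (𝒮.Pss_mem_cov _ _ (m := 2) (𝒮.W_mem_cov _ _ _ _)))
  · exact Submodule.sum_mem _ fun _ _ => add_mem
      (Submodule.smul_mem _ _ (𝒮.Y15_mem_cov _ _ _ _))
      (Submodule.smul_mem _ _ (𝒮.Y15_mem_cov _ _ _ _))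

theorem curvQQ_eq (α i β j : Fin 4) : curvQQ 𝒮.toGens 𝒮.W α i β j =
    (∑ γ, ∑ δ, ∑ ε, (-(1 / 2) * lc α β γ ε) • (𝒮.W γ δ i j • 𝒮.Mss δ ε)) +
    (∑ γ, ∑ δ, ∑ k, ((1 / 40) * lc α β γ δ) • (X16 𝒮.toGens 𝒮.W γ k i j • 𝒮.S δ k)) +
    ∑ a, 𝒮.curvK α i β j a • 𝒮.Kup a := by
  have h : ∀ a, 𝒮.curvK α i β j a • 𝒮.Kup a =
      ((3 / 80 : ℂ) • ∑ γ, ∑ δ, (gL a γ α • 𝒮.Pss β δ (𝒮.W δ γ i j) -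
        gL a γ β • 𝒮.Pss α δ (𝒮.W δ γ i j))) • 𝒮.Kup a +
      ((-Complex.I / 960) • ∑ γ, (gL a γ α • Y15 𝒮.toGens 𝒮.W β γ i j +
        gL a γ β • Y15 𝒮.toGens 𝒮.W α γ i j)) • 𝒮.Kup a :=
    fun a => LinearMap.ext fun h => add_mul _ _ _
  rw [Finset.sum_congr rfl fun a _ => h a, Finset.sum_add_distrib, ← add_assoc]
  rfl

theorem curvQQ_mem (α i β j : Fin 4) : curvQQ 𝒮.toGens 𝒮.W α i β j ∈ 𝒮.opSpan (𝒮.grade 2) := by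
  rw [curvQQ_eq]
  refine add_mem (add_mem ?_ ?_) ?_
  · exact Submodule.sum_mem _ fun _ _ => Submodule.sum_mem _ fun _ _ => Submodule.sum_mem _
      fun _ _ => Submodule.smul_mem _ _ (𝒮.Mss_mem_wtSpan _ _ 2 _ (𝒮.W_mem_cov _ _ _ _))
  · exact Submodule.sum_mem _ fun _ _ => Submodule.sum_mem _ fun _ _ => Submodule.sum_mem _
      fun _ _ => Submodule.smul_mem _ _ (𝒮.S_mem_wtSpan _ _ 3 _ (𝒮.X16_mem_cov _ _ _ _))
  · exact Submodule.sum_mem _ fun _ _ => 𝒮.Kup_mem_wtSpan _ 4 _ (𝒮.curvK_mem_cov _ _ _ _ _)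

end ConformalSuperspace

end Superspace

end

/-! ### Jacobi identities and closure of the covariant derivatives -/

section

section Operators

variable {A : Type*} [Ring A] [Algebra ℂ A]

theorem comm_acomm (X Y Z : Module.End ℂ A) :
    comm X (acomm Y Z) = acomm (comm X Y) Z + acomm Y (comm X Z) := by
  ext f
  simp only [comm, acomm, LinearMap.sub_apply, LinearMap.add_apply, Module.End.mul_apply, map_sub,
    map_add]
  abel

theorem comm_comm (X Y Z : Module.End ℂ A) :
    comm X (comm Y Z) = comm (comm X Y) Z + comm Y (comm X Z) := by
  ext f
  simp only [comm, LinearMap.sub_apply, LinearMap.add_apply, Module.End.mul_apply, map_sub]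
  abel

theorem acomm_jacobi (X Y Z : Module.End ℂ A) :
    comm X (acomm Y Z) + comm Y (acomm Z X) + comm Z (acomm X Y) = 0 := by
  ext f
  simp only [comm, acomm, LinearMap.sub_apply, LinearMap.add_apply, Module.End.mul_apply,
    map_add, LinearMap.zero_apply]
  abel

theorem neg_smul_end (c : ℂ) (X : Module.End ℂ A) : (-c) • X = -(c • X) :=
  LinearMap.ext fun f => neg_smul c (X f)

/-- The contraction `Ω_{ij} F^{ij}`. -/
def omTrace {V : Type*} [AddCommGroup V] [Module ℂ V] (F : Fin 4 → Fin 4 → V) : V :=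
  ∑ i, ∑ j, OmL i j • F i j

section OmTrace

variable {V : Type*} [AddCommGroup V] [Module ℂ V]

theorem omTrace_add (F H : Fin 4 → Fin 4 → V) :
    omTrace (fun i j => F i j + H i j) = omTrace F + omTrace H := by
  simp only [omTrace, smul_add, Finset.sum_add_distrib]

theorem omTrace_sub (F H : Fin 4 → Fin 4 → V) :
    omTrace (fun i j => F i j - H i j) = omTrace F - omTrace H := by
  simp only [omTrace, smul_sub, Finset.sum_sub_distrib]

theorem omTrace_smul (c : ℂ) (F : Fin 4 → Fin 4 → V) :
    omTrace (fun i j => c • F i j) = c • omTrace F := by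
  simp only [omTrace, smul_comm (OmL _ _) c, ← Finset.smul_sum]

theorem omTrace_sum {κ : Type*} (s : Finset κ) (F : Fin 4 → Fin 4 → κ → V) :
    omTrace (fun i j => ∑ x ∈ s, F i j x) = ∑ x ∈ s, omTrace fun i j => F i j x := by
  simp only [omTrace, Finset.smul_sum]
  rw [Finset.sum_congr rfl fun i _ => Finset.sum_comm, Finset.sum_comm]

theorem omTrace_map {V' : Type*} [AddCommGroup V'] [Module ℂ V'] (T : V →ₗ[ℂ] V')
    (F : Fin 4 → Fin 4 → V) : omTrace (fun i j => T (F i j)) = T (omTrace F) := by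
  simp only [omTrace, map_sum, map_smul]

theorem omTrace_eq_zero_of_symm {F : Fin 4 → Fin 4 → V} (h : ∀ i j, F i j = F j i) :
    omTrace F = 0 := by
  refine eq_zero_of_eq_neg ?_
  simp only [omTrace]
  conv_lhs => rw [Finset.sum_comm]
  simp only [← Finset.sum_neg_distrib]
  exact Finset.sum_congr rfl fun i _ => Finset.sum_congr rfl fun j _ => by
    rw [OmL_antisymm j i, neg_smul, h]

theorem omTrace_smul_right (f : Fin 4 → Fin 4 → A) (T : Module.End ℂ A) :
    omTrace (fun i j => f i j • T) = omTrace f • T := by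
  simp only [omTrace, Finset.sum_smul, smul_assoc]

end OmTrace

end Operators

section Superspace

variable {A : Type*} [Ring A] [StarRing A] [Algebra ℂ A] [StarModule ℂ A]
  {𝒜 : ZMod 2 → Submodule ℂ A} [GradedAlgebra 𝒜] (𝒮 : ConformalSuperspace 𝒜)

namespace ConformalSuperspace

theorem acomm_QQ_mem (α i β j : Fin 4) : acomm (𝒮.Q α i) (𝒮.Q β j) ∈ 𝒮.wtSpan 2 := by
  rw [𝒮.QQ]
  exact add_mem (Submodule.smul_mem _ _ (𝒮.Pss_mem_wtSpan _ _))
    (𝒮.opSpan_le_wtSpan _ (𝒮.curvQQ_mem _ _ _ _))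

theorem acomm_SQ_mem (α i β j : Fin 4) : acomm (𝒮.S α i) (𝒮.Q β j) ∈ 𝒮.wtSpan 0 := by
  rw [𝒮.structureFunctions.SQ]
  refine add_mem (add_mem (sub_mem ?_ ?_) ?_) (𝒮.opSpan_le_wtSpan _ ?_)
  · exact Submodule.smul_mem _ _ 𝒮.D_mem_wtSpan
  · exact Submodule.smul_mem _ _ (𝒮.Mss_mem_wtSpan _ _)
  · exact Submodule.smul_mem _ _ (𝒮.Jmix_mem_wtSpan _ _)
  · exact Submodule.sum_mem _ fun _ _ => 𝒮.Kup_mem_wtSpan _ 2 _ <| Submodule.smul_mem _ _ <|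
      Submodule.sum_mem _ fun _ _ => Submodule.smul_mem _ _ <|
        Submodule.sum_mem _ fun _ _ => Submodule.smul_mem _ _ (𝒮.W_mem_cov _ _ _ _)

theorem comm_SupP_mem (α i : Fin 4) (b : Fin 6) : comm (𝒮.Sup α i) (𝒮.P b) ∈ 𝒮.wtSpan 1 := by
  rw [𝒮.structureFunctions.SP]
  refine add_mem (add_mem ?_ (𝒮.opSpan_le_wtSpan _ ?_)) (𝒮.opSpan_le_wtSpan _ ?_)
  · exact Submodule.smul_mem _ _ <| Submodule.sum_mem _ fun _ _ =>
      Submodule.smul_mem _ _ (𝒮.Q_mem_wtSpan _ _)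
  · exact Submodule.sum_mem _ fun _ _ => Submodule.sum_mem _ fun _ _ => Submodule.sum_mem _
      fun _ _ => Submodule.smul_mem _ _ (𝒮.S_mem_wtSpan _ _ 2 _ (𝒮.W_mem_cov _ _ _ _))
  · exact Submodule.sum_mem _ fun _ _ => 𝒮.Kup_mem_wtSpan _ 3 _ <| Submodule.smul_mem _ _ <|
      Submodule.sum_mem _ fun _ _ => Submodule.sum_mem _ fun _ _ =>
        Submodule.smul_mem _ _ (𝒮.X36_mem_cov _ _ _ _)

theorem comm_KQ_mem (a : Fin 6) (α i : Fin 4) : comm (𝒮.K a) (𝒮.Q α i) ∈ 𝒮.wtSpan (-1) := by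
  rw [𝒮.structureFunctions.KQ]
  exact Submodule.smul_mem _ _ <| Submodule.sum_mem _ fun _ _ =>
    Submodule.smul_mem _ _ (𝒮.Sup_mem_wtSpan _ _)

theorem oddBr_Q_mem (α i : Fin 4) (s : Slot) (hs : s.kind ≠ .P) :
    𝒮.oddBr (𝒮.Q α i) s ∈ 𝒮.wtSpan (s.kind.wt + 1) := by
  rcases s with a | ⟨β, j⟩ | ⟨a, b⟩ | _ | ⟨k, l⟩ | ⟨β, j⟩ | a
  · exact absurd rfl hs
  · exact neg_mem (𝒮.acomm_QQ_mem _ _ _ _)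
  · simp only [Gens.oddBr]
    rw [comm_swap, 𝒮.covariant.MQ]
    exact neg_mem <| Submodule.smul_mem _ _ <| Submodule.sum_mem _ fun _ _ =>
      Submodule.smul_mem _ _ (𝒮.Q_mem_wtSpan _ _)
  · simp only [Gens.oddBr]
    rw [comm_swap, 𝒮.covariant.DQ]
    exact neg_mem <| Submodule.smul_mem _ _ (𝒮.Q_mem_wtSpan _ _)
  · simp only [Gens.oddBr]
    rw [comm_swap, 𝒮.covariant.JQ]
    exact neg_mem <| Submodule.smul_mem _ _ <| add_mem
      (Submodule.smul_mem _ _ (𝒮.Q_mem_wtSpan _ _)) (Submodule.smul_mem _ _ (𝒮.Q_mem_wtSpan _ _))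
  · simp only [Gens.oddBr]
    rw [acomm_swap]
    exact neg_mem (𝒮.acomm_SQ_mem _ _ _ _)
  · simp only [Gens.oddBr]
    rw [comm_swap]
    exact neg_mem (𝒮.comm_KQ_mem _ _ _)

theorem grade_parity {m : ℤ} {x : Slot → A} (hx : ∀ s, x s ∈ 𝒮.grade m s.kind) (hm : Even m)
    (s : Slot) : x s ∈ 𝒜 (s.kind.wt : ZMod 2) := by
  have h := 𝒮.cov_graded (hx s)
  have e : ((m - s.kind.wt : ℤ) : ZMod 2) = ((s.kind.wt : ℤ) : ZMod 2) := by
    refine (ZMod.intCast_eq_intCast_iff_dvd_sub _ _ 2).mpr ?_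
    obtain ⟨k, rfl⟩ := hm
    exact ⟨s.kind.wt - k, by push_cast; ring⟩
  rwa [e] at h

theorem grade_parity_odd {m : ℤ} {x : Slot → A} (hx : ∀ s, x s ∈ 𝒮.grade m s.kind) (hm : Odd m)
    (s : Slot) : x s ∈ 𝒜 ((1 + s.kind.wt : ℤ) : ZMod 2) := by
  have h := 𝒮.cov_graded (hx s)
  have e : ((m - s.kind.wt : ℤ) : ZMod 2) = ((1 + s.kind.wt : ℤ) : ZMod 2) := by
    refine (ZMod.intCast_eq_intCast_iff_dvd_sub _ _ 2).mpr ?_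
    obtain ⟨k, rfl⟩ := hm
    exact ⟨s.kind.wt - k, by push_cast; ring⟩
  rwa [e] at h

theorem comm_Q_mem {m : ℤ} (hm : Even m) {T : Module.End ℂ A} (hT : T ∈ 𝒮.opSpan (𝒮.grade m))
    (α i : Fin 4) (hP : 4 ≤ m → ∀ a, comm (𝒮.Q α i) (𝒮.P a) ∈ 𝒮.wtSpan 3) :
    comm (𝒮.Q α i) T ∈ 𝒮.opSpan (𝒮.grade (m + 1)) := by
  obtain ⟨x, hx, bx, rfl⟩ := hT
  rw [(𝒮.Q_der α i).comm_expand 𝒮.toGens (𝒮.grade_parity hx hm)]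
  exact add_mem (𝒮.map_expand_mem (fun k f hf => 𝒮.Q_mem_cov α i hf) hx bx)
    (𝒮.mix_mem_grade hx hP (𝒮.oddBr_Q_mem α i))

theorem acomm_Q_mem {m : ℤ} (hm : Odd m) {T : Module.End ℂ A} (hT : T ∈ 𝒮.opSpan (𝒮.grade m))
    (α i : Fin 4) (hP : 4 ≤ m → ∀ a, comm (𝒮.Q α i) (𝒮.P a) ∈ 𝒮.wtSpan 3) :
    acomm (𝒮.Q α i) T ∈ 𝒮.opSpan (𝒮.grade (m + 1)) := by
  obtain ⟨x, hx, bx, rfl⟩ := hT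
  rw [(𝒮.Q_der α i).acomm_expand 𝒮.toGens (𝒮.grade_parity_odd hx hm)]
  exact sub_mem (𝒮.map_expand_mem (fun k f hf => 𝒮.Q_mem_cov α i hf) hx bx)
    (𝒮.mix_mem_grade hx hP (𝒮.oddBr_Q_mem α i))

/-- `Ω_{jk} [∇_β^j, C_{γα}^{ki}]`, where `C` is the curvature operator of `{∇_γ^k, ∇_α^i}`. -/
def curvDer (β γ α i : Fin 4) : Module.End ℂ A :=
  ∑ j, ∑ k, OmL j k • comm (𝒮.Q β j) (curvQQ 𝒮.toGens 𝒮.W γ k α i)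

theorem curvDer_mem (β γ α i : Fin 4) : 𝒮.curvDer β γ α i ∈ 𝒮.opSpan (𝒮.grade 3) :=
  Submodule.sum_mem _ fun _ _ => Submodule.sum_mem _ fun _ _ => Submodule.smul_mem _ _ <|
    𝒮.comm_Q_mem ⟨1, rfl⟩ (𝒮.curvQQ_mem _ _ _ _) _ _ (fun h => absurd h (by norm_num))

theorem Pss_antisymm (α β : Fin 4) : 𝒮.Pss α β = -𝒮.Pss β α := by
  simp only [Gens.Pss, ← Finset.sum_neg_distrib]
  exact Finset.sum_congr rfl fun a _ => by rw [gU_antisymm, neg_smul_end]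

theorem curvQQ_symm (α i β j : Fin 4) :
    curvQQ 𝒮.toGens 𝒮.W α i β j = curvQQ 𝒮.toGens 𝒮.W β j α i := by
  have h := 𝒮.QQ α i β j
  rw [acomm_swap, 𝒮.QQ β j α i] at h
  have e : 𝒮.flatQQ α i β j = 𝒮.flatQQ β j α i := by
    simp only [Gens.flatQQ]
    rw [𝒮.Pss_antisymm, OmU_antisymm i j, smul_neg, ← neg_smul_end]
    congr 1; ring
  rw [e] at h
  exact (add_left_cancel h).symm

theorem omTrace_W (α β : Fin 4) : omTrace (𝒮.W α β) = 0 := 𝒮.W_traceless α β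

theorem omTrace_X16 (δ l : Fin 4) : omTrace (X16 𝒮.toGens 𝒮.W δ l) = 0 := by
  have h : X16 𝒮.toGens 𝒮.W δ l = fun i j => ∑ β, 𝒮.Q β l (𝒮.W δ β i j) := rfl
  simp only [h, omTrace_sum, omTrace_map, omTrace_W, map_zero, Finset.sum_const_zero]

theorem omTrace_Y15 (α β : Fin 4) : omTrace (Y15 𝒮.toGens 𝒮.W α β) = 0 :=
  omTrace_eq_zero_of_symm fun i j => by
    simp only [Y15]
    congr 1
    exact Finset.sum_congr rfl fun k _ => by rw [add_comm]

theorem omTrace_curvK (α β : Fin 4) (a : Fin 6) :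
    omTrace (fun i j => 𝒮.curvK α i β j a) = 0 := by
  simp only [curvK, omTrace_add, omTrace_sub, omTrace_sum, omTrace_smul, omTrace_map, omTrace_W,
    omTrace_Y15, map_zero, smul_zero, Finset.sum_const_zero, sub_zero, add_zero]

/-- The coefficients are built from `W`, from X^{α k,ij} (Ω-traceless in ij) and from Y^{ij}
(symmetric in ij), so contracting with Ω isolates the torsion in the anticommutator. -/
theorem omTrace_curvQQ (α β : Fin 4) :
    omTrace (fun i j => curvQQ 𝒮.toGens 𝒮.W α i β j) = 0 := by
  simp only [curvQQ_eq, omTrace_add, omTrace_sum, omTrace_smul, omTrace_smul_right, omTrace_W,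
    omTrace_X16, omTrace_curvK, zero_smul, smul_zero, Finset.sum_const_zero, add_zero]

/-- The Jacobi identity of `∇_α^i`, `∇_β^j`, `∇_γ^k`, contracted with `Ω_{jk}`. -/
theorem jacobi_QQQ (α β γ i : Fin 4) :
    (2 * Complex.I) • (comm (𝒮.Q β i) (𝒮.Pss γ α) + comm (𝒮.Q γ i) (𝒮.Pss α β) -
      (4 : ℂ) • comm (𝒮.Q α i) (𝒮.Pss β γ)) =
      𝒮.curvDer β γ α i - 𝒮.curvDer γ β α i := by
  have h : ∑ j, ∑ k, OmL j k • (comm (𝒮.Q β j) (acomm (𝒮.Q γ k) (𝒮.Q α i)) +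
      comm (𝒮.Q γ k) (acomm (𝒮.Q α i) (𝒮.Q β j)) + comm (𝒮.Q α i) (acomm (𝒮.Q β j) (𝒮.Q γ k))) = 0 :=
    Finset.sum_eq_zero fun j _ => Finset.sum_eq_zero fun k _ => by rw [acomm_jacobi, smul_zero]
  simp only [𝒮.QQ, comm_add_right, smul_add, Finset.sum_add_distrib] at h
  have e1 : ∑ j, ∑ k, OmL j k • comm (𝒮.Q β j) (𝒮.flatQQ γ k α i) =
      (-2 * Complex.I) • comm (𝒮.Q β i) (𝒮.Pss γ α) := by
    simp only [Gens.flatQQ, comm_smul_right, smul_smul]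
    have : ∀ j, ∑ k, (OmL j k * (-2 * Complex.I * OmU k i)) • comm (𝒮.Q β j) (𝒮.Pss γ α) =
        kd j i • (-2 * Complex.I) • comm (𝒮.Q β j) (𝒮.Pss γ α) := fun j => by
      rw [← Finset.sum_smul, smul_smul, ← OmL_mul_OmU, Finset.sum_mul]
      congr 1
      exact Finset.sum_congr rfl fun k _ => by ring
    simp only [this, kd, ite_smul, one_smul, zero_smul, Finset.sum_ite_eq', Finset.mem_univ, if_true]
  have e2 : ∑ j, ∑ k, OmL j k • comm (𝒮.Q γ k) (𝒮.flatQQ α i β j) =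
      (-2 * Complex.I) • comm (𝒮.Q γ i) (𝒮.Pss α β) := by
    simp only [Gens.flatQQ, comm_smul_right, smul_smul]
    rw [Finset.sum_comm]
    have : ∀ k, ∑ j, (OmL j k * (-2 * Complex.I * OmU i j)) • comm (𝒮.Q γ k) (𝒮.Pss α β) =
        kd i k • (-2 * Complex.I) • comm (𝒮.Q γ k) (𝒮.Pss α β) := fun k => by
      rw [← Finset.sum_smul, smul_smul, ← OmU_mul_OmL, Finset.sum_mul]
      congr 1
      exact Finset.sum_congr rfl fun k _ => by ring
    simp only [this, kd, ite_smul, one_smul, zero_smul, Finset.sum_ite_eq, Finset.mem_univ, if_true]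
  have e3 : ∑ j, ∑ k, OmL j k • comm (𝒮.Q α i) (𝒮.flatQQ β j γ k) =
      (8 * Complex.I) • comm (𝒮.Q α i) (𝒮.Pss β γ) := by
    simp only [Gens.flatQQ, comm_smul_right, smul_smul, ← Finset.sum_smul]
    congr 1
    simp [Fin.sum_univ_four, OmL, OmU]; ring
  have e4 : ∑ j, ∑ k, OmL j k • comm (𝒮.Q γ k) (curvQQ 𝒮.toGens 𝒮.W α i β j) =
      -𝒮.curvDer γ β α i := by
    rw [Finset.sum_comm, curvDer]
    simp only [← Finset.sum_neg_distrib]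
    exact Finset.sum_congr rfl fun k _ => Finset.sum_congr rfl fun j _ => by
      rw [OmL_antisymm, neg_smul_end, 𝒮.curvQQ_symm]
  have e5 : ∑ j, ∑ k, OmL j k • comm (𝒮.Q α i) (curvQQ 𝒮.toGens 𝒮.W β j γ k) = 0 := by
    simp only [← comm_smul_right, ← comm_sum_right]
    have := 𝒮.omTrace_curvQQ β γ
    simp only [omTrace] at this
    rw [this]
    simp [comm]
  rw [e1, e2, e3, e4, e5, ← curvDer] at h
  rw [← sub_eq_zero, ← neg_eq_zero, ← h]
  module

/-- `[∇_α^i, ∇_{βγ}]` in terms of the curvature operator. -/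
theorem comm_Q_Pss (α β γ i : Fin 4) : comm (𝒮.Q α i) (𝒮.Pss β γ) =
    (Complex.I / 20) • ((3 : ℂ) • (𝒮.curvDer β γ α i - 𝒮.curvDer γ β α i) +
      (𝒮.curvDer γ α β i - 𝒮.curvDer α γ β i) + (𝒮.curvDer α β γ i - 𝒮.curvDer β α γ i)) := by
  -- The three cyclic forms of the Jacobi identity are a linear system for the three commutators;
  -- the weights 3, 1, 1 solve it with determinant factor -10.
  rw [← 𝒮.jacobi_QQQ α β γ, ← 𝒮.jacobi_QQQ β γ α, ← 𝒮.jacobi_QQQ γ α β]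
  simp only [smul_add, smul_sub, smul_smul]
  have e : ∀ c : ℂ, Complex.I / 20 * (c * (2 * Complex.I)) = -c / 10 := fun c => by
    linear_combination (c / 10) * Complex.I_mul_I
  have e2 : ∀ c d : ℂ, Complex.I / 20 * (c * (2 * Complex.I * d)) = -(c * d) / 10 := fun c d => by
    linear_combination (c * d / 10) * Complex.I_mul_I
  have e3 : ∀ d : ℂ, Complex.I / 20 * (2 * Complex.I * d) = - d / 10 := fun d => by
    linear_combination (d / 10) * Complex.I_mul_I
  have e4 : Complex.I / 20 * (2 * Complex.I) = - 1 / 10 := by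
    linear_combination (1 / 10) * Complex.I_mul_I
  simp only [mul_assoc] at e e2 e3 ⊢
  simp only [e, e2, e3, e4]
  module

theorem comm_Q_Pss_mem (α β γ i : Fin 4) :
    comm (𝒮.Q α i) (𝒮.Pss β γ) ∈ 𝒮.opSpan (𝒮.grade 3) := by
  rw [comm_Q_Pss]
  have h := 𝒮.curvDer_mem
  exact Submodule.smul_mem _ _ <| add_mem (add_mem
    (Submodule.smul_mem _ _ (sub_mem (h _ _ _ _) (h _ _ _ _))) (sub_mem (h _ _ _ _) (h _ _ _ _)))
    (sub_mem (h _ _ _ _) (h _ _ _ _))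

theorem comm_P_eq (X : Module.End ℂ A) (a : Fin 6) :
    comm X (𝒮.P a) = (1 / 4 : ℂ) • ∑ α, ∑ β, gtL a α β • comm X (𝒮.Pss α β) := by
  conv_lhs => rw [𝒮.P_eq]
  simp only [comm_smul_right, comm_sum_right]

theorem comm_QP_mem (α i : Fin 4) (a : Fin 6) :
    comm (𝒮.Q α i) (𝒮.P a) ∈ 𝒮.opSpan (𝒮.grade 3) := by
  rw [comm_P_eq]
  exact Submodule.smul_mem _ _ <| Submodule.sum_mem _ fun _ _ => Submodule.sum_mem _ fun _ _ =>
    Submodule.smul_mem _ _ (𝒮.comm_Q_Pss_mem _ _ _ _)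

theorem S_eq_Sup (α i : Fin 4) : 𝒮.S α i = ∑ j, OmL i j • 𝒮.Sup α j := by
  simp only [Gens.Sup, raise, Finset.smul_sum, smul_smul]
  rw [Finset.sum_comm]
  simp only [← Finset.sum_smul, OmL_mul_OmU, sum_kd_smul]

theorem comm_SP_mem (α i : Fin 4) (b : Fin 6) : comm (𝒮.S α i) (𝒮.P b) ∈ 𝒮.wtSpan 1 := by
  rw [𝒮.S_eq_Sup, comm_swap]
  simp only [comm_sum_right, comm_smul_right]
  refine neg_mem <| Submodule.sum_mem _ fun j _ => Submodule.smul_mem _ _ ?_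
  rw [comm_swap]
  exact neg_mem (𝒮.comm_SupP_mem _ _ _)

theorem comm_P_slot_mem (a : Fin 6) (s : Slot) (hs : s.kind ≠ .P) :
    comm (𝒮.P a) (𝒮.slot s) ∈ 𝒮.wtSpan (s.kind.wt + 2) := by
  rw [comm_swap]
  refine neg_mem ?_
  rcases s with b | ⟨β, j⟩ | ⟨b, c⟩ | _ | ⟨k, l⟩ | ⟨β, j⟩ | b
  · exact absurd rfl hs
  · exact 𝒮.opSpan_le_wtSpan _ (𝒮.comm_QP_mem β j a)
  · simp only [Gens.slot]
    rw [𝒮.covariant.MP]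
    exact sub_mem (Submodule.smul_mem _ _ (𝒮.P_mem_wtSpan _))
      (Submodule.smul_mem _ _ (𝒮.P_mem_wtSpan _))
  · simp only [Gens.slot]
    rw [𝒮.covariant.DP]
    exact 𝒮.P_mem_wtSpan _
  · simp only [Gens.slot]
    rw [𝒮.covariant.JP]
    exact zero_mem _
  · exact 𝒮.comm_SP_mem _ _ _
  · simp only [Gens.slot]
    rw [𝒮.structureFunctions.KP]
    exact add_mem (Submodule.smul_mem _ _ 𝒮.D_mem_wtSpan)
      (Submodule.smul_mem _ _ (𝒮.M_mem_wtSpan _ _))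

theorem comm_P_mem {m : ℤ} (hm : m < 4) {T : Module.End ℂ A} (hT : T ∈ 𝒮.opSpan (𝒮.grade m))
    (a : Fin 6) : comm (𝒮.P a) T ∈ 𝒮.opSpan (𝒮.grade (m + 2)) := by
  obtain ⟨x, hx, bx, rfl⟩ := hT
  rw [(𝒮.P_der a).comm_expand 𝒮.toGens]
  exact add_mem (𝒮.map_expand_mem (fun k f hf => 𝒮.P_mem_cov a hf) hx bx)
    (𝒮.mix_mem_grade hx (fun h => absurd h (by omega)) (𝒮.comm_P_slot_mem a))

/-- The second derivative is replaced by an anticommutator of spinor derivatives minus curvature.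
The operators met on the way have grade 3 or 2, hence contain no P, so only brackets already known
occur. -/
theorem comm_PP_mem (a b : Fin 6) : comm (𝒮.P a) (𝒮.P b) ∈ 𝒮.opSpan (𝒮.grade 4) := by
  rw [comm_P_eq]
  refine Submodule.smul_mem _ _ <| Submodule.sum_mem _ fun α _ => Submodule.sum_mem _ fun β _ =>
    Submodule.smul_mem _ _ ?_
  rw [𝒮.Pss_eq, comm_smul_right, comm_sub_right, comm_acomm]
  have hQ : ∀ α i, comm (𝒮.P a) (𝒮.Q α i) ∈ 𝒮.opSpan (𝒮.grade 3) := fun α i => by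
    rw [comm_swap]; exact neg_mem (𝒮.comm_QP_mem _ _ _)
  refine Submodule.smul_mem _ _ (sub_mem (add_mem ?_ ?_) ?_)
  · rw [acomm_swap]
    exact 𝒮.acomm_Q_mem ⟨1, rfl⟩ (hQ _ _) _ _ (fun h => absurd h (by norm_num))
  · exact 𝒮.acomm_Q_mem ⟨1, rfl⟩ (hQ _ _) _ _ (fun h => absurd h (by norm_num))
  · exact 𝒮.comm_P_mem (by norm_num) (𝒮.curvQQ_mem _ _ _ _) a

end ConformalSuperspace

end Superspace

end

/-! ### The square of T in terms of `WW`, and its reality -/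

section

section Gamma

theorem gL_gtL_clifford (a b : Fin 6) : gL a * gtL b + gL b * gtL a = (-2 * eta a b) • 1 := by
  have h : ∀ (a b : Fin 6) (α β : Fin 4), ∑ γ, (etaZ a * gammaZ a α γ) * (etaZ b * gammatZ b γ β) +
      ∑ γ, (etaZ b * gammaZ b α γ) * (etaZ a * gammatZ a γ β) =
      -2 * (if a = b then etaZ a else 0) * kdZ α β := by decide +kernel
  ext α β
  have h2 := congrArg GaussianInt.toComplex (h a b α β)
  simp only [map_sum, map_mul, map_add, map_neg, map_ofNat, apply_ite GaussianInt.toComplex,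
    map_zero, ← eta_eq_toComplex, ← kd_eq_toComplex] at h2
  have h3 : ∑ γ, gL a α γ * gtL b γ β + ∑ γ, gL b α γ * gtL a γ β = -2 * eta a b * kd α β := by
    simp only [gL_eq_toComplex, gtL_eq_toComplex, map_mul]
    exact h2
  have h4 : (gL a * gtL b + gL b * gtL a) α β = -2 * eta a b * kd α β := by
    rw [Matrix.add_apply, Matrix.mul_apply, Matrix.mul_apply]
    exact h3
  rw [h4]
  simp [kd, Matrix.one_apply]

theorem gtL_gL_clifford (a b : Fin 6) : gtL a * gL b + gtL b * gL a = (-2 * eta a b) • 1 := by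
  have h : ∀ (a b : Fin 6) (α β : Fin 4), ∑ γ, (etaZ a * gammatZ a α γ) * (etaZ b * gammaZ b γ β) +
      ∑ γ, (etaZ b * gammatZ b α γ) * (etaZ a * gammaZ a γ β) =
      -2 * (if a = b then etaZ a else 0) * kdZ α β := by decide +kernel
  ext α β
  have h2 := congrArg GaussianInt.toComplex (h a b α β)
  simp only [map_sum, map_mul, map_add, map_neg, map_ofNat, apply_ite GaussianInt.toComplex,
    map_zero, ← eta_eq_toComplex, ← kd_eq_toComplex] at h2
  have h3 : ∑ γ, gtL a α γ * gL b γ β + ∑ γ, gtL b α γ * gL a γ β = -2 * eta a b * kd α β := by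
    simp only [gL_eq_toComplex, gtL_eq_toComplex, map_mul]
    exact h2
  have h4 : (gtL a * gL b + gtL b * gL a) α β = -2 * eta a b * kd α β := by
    rw [Matrix.add_apply, Matrix.mul_apply, Matrix.mul_apply]
    exact h3
  rw [h4]
  simp [kd, Matrix.one_apply]

theorem gam3_eq (a b c : Fin 6) :
    gam3 a b c = (1 / 2 : ℂ) • (gL a * gtL b * gL c - gL c * gtL b * gL a) := by
  have h1 : gL b * gtL c * gL a = (-2 * eta b c) • gL a - gL c * gtL b * gL a := by
    rw [eq_sub_iff_add_eq, ← add_mul, gL_gtL_clifford, smul_mul_assoc, one_mul]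
  have h2 : gL a * gtL c * gL b = (-2 * eta b c) • gL a - gL a * gtL b * gL c := by
    rw [eq_sub_iff_add_eq, mul_assoc, mul_assoc, ← mul_add, gtL_gL_clifford, mul_smul_comm, mul_one,
      eta_comm]
  have h3 : gL c * gtL a * gL b = (-2 * eta a b) • gL c - gL c * gtL b * gL a := by
    rw [eq_sub_iff_add_eq, mul_assoc, mul_assoc, ← mul_add, gtL_gL_clifford, mul_smul_comm, mul_one]
  have h4 : gL b * gtL a * gL c = (-2 * eta a b) • gL c - gL a * gtL b * gL c := by
    rw [eq_sub_iff_add_eq, ← add_mul, gL_gtL_clifford, smul_mul_assoc, one_mul, eta_comm]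
  rw [gam3, h1, h2, h3, h4]
  module

theorem gL_mul_gtL_mul_gL_transpose (a b c : Fin 6) (α β : Fin 4) :
    (gL a * gtL b * gL c) α β = -(gL c * gtL b * gL a) β α := by
  simp only [Matrix.mul_apply, Finset.sum_mul, ← Finset.sum_neg_distrib]
  rw [Finset.sum_comm]
  refine Finset.sum_congr rfl fun κ _ => Finset.sum_congr rfl fun μ _ => ?_
  rw [gL_antisymm a α κ, gtL_antisymm b κ μ, gL_antisymm c μ β]
  ring

theorem lc_mul_lc (α β γ δ : Fin 4) : ∑ μ, ∑ ν, lc α μ γ ν * lc μ β ν δ =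
    2 * (kd α β * kd γ δ - kd α δ * kd γ β) := by
  have h : ∀ α β γ δ : Fin 4, ∑ μ, ∑ ν, ((lcZ α μ γ ν : ℤ) : GaussianInt) * ((lcZ μ β ν δ : ℤ) : GaussianInt) =
      2 * (kdZ α β * kdZ γ δ - kdZ α δ * kdZ γ β) := by decide +kernel
  have h2 := congrArg GaussianInt.toComplex (h α β γ δ)
  simpa only [map_sum, map_mul, map_sub, map_ofNat, lc_eq_toComplex, kd_eq_toComplex] using h2

theorem sum_eta_smul {V : Type*} [AddCommGroup V] [Module ℂ V] (a : Fin 6) (v : Fin 6 → V) :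
    ∑ b, eta a b • v b = eta a a • v a :=
  Finset.sum_eq_single a (fun b _ hb => by rw [eta_of_ne hb.symm, zero_smul]) (by simp)

/-- Completeness replaces the sums over e and f by two Levi-Civita symbols, whose contraction is a
difference of Kronecker deltas. -/
theorem sum_gam_product (a c : Fin 6) (α β γ δ : Fin 4) :
    ∑ e, ∑ f, (eta e e * eta f f) * ((gL a * gtL e * gL f) α β * (gL c * gtL e * gL f) γ δ) =
    8 * (gL a α β * gL c γ δ - gL a α δ * gL c γ β) := by
  have h1 : ∀ κ μ κ' μ', ∑ e, eta e e * (gtL e κ μ * gtL e κ' μ') = 2 * lc κ μ κ' μ' := by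
    intro κ μ κ' μ'
    rw [← gtU_completeness]
    refine Finset.sum_congr rfl fun e _ => ?_
    rw [gtL_apply e κ μ]
    linear_combination (gtU e κ μ * gtL e κ' μ') * eta_mul_self e
  have h2 : ∀ κ μ κ' μ', ∑ e, eta e e * (gL e κ μ * gL e κ' μ') = 2 * lc κ μ κ' μ' := by
    intro κ μ κ' μ'
    rw [← gU_completeness]
    refine Finset.sum_congr rfl fun e _ => ?_
    rw [gL_apply e κ μ]
    linear_combination (gU e κ μ * gL e κ' μ') * eta_mul_self e
  have h0 : ∀ a e f α β, (gL a * gtL e * gL f) α β =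
      ∑ x : Fin 4 × Fin 4, gL a α x.1 * gtL e x.1 x.2 * gL f x.2 β := by
    intro a e f α β
    simp only [Matrix.mul_apply, Fintype.sum_prod_type, Finset.sum_mul]
    exact Finset.sum_comm
  have h3 : ∀ e f, (eta e e * eta f f) * ((gL a * gtL e * gL f) α β * (gL c * gtL e * gL f) γ δ) =
      ∑ x : Fin 4 × Fin 4, ∑ y : Fin 4 × Fin 4, (gL a α x.1 * gL c γ y.1) *
        ((eta e e * (gtL e x.1 x.2 * gtL e y.1 y.2)) *
          (eta f f * (gL f x.2 β * gL f y.2 δ))) := by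
    intro e f
    rw [h0, h0, Finset.sum_mul_sum]
    simp only [Finset.mul_sum]
    exact Finset.sum_congr rfl fun _ _ => Finset.sum_congr rfl fun _ _ => by ring
  have comm2 : ∀ F : Fin 6 → Fin 6 → Fin 4 × Fin 4 → Fin 4 × Fin 4 → ℂ,
      ∑ e, ∑ f, ∑ x, ∑ y, F e f x y = ∑ x, ∑ y, ∑ e, ∑ f, F e f x y := by
    intro F
    rw [Finset.sum_congr rfl fun e _ => Finset.sum_comm, Finset.sum_comm]
    refine Finset.sum_congr rfl fun x _ => ?_
    rw [Finset.sum_congr rfl fun e _ => Finset.sum_comm, Finset.sum_comm]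
  simp only [h3]
  rw [comm2]
  simp only [← Finset.mul_sum, ← Finset.sum_mul, h1, h2, Fintype.sum_prod_type]
  rw [Finset.sum_congr rfl fun κ _ => Finset.sum_comm]
  have h4 : ∀ κ κ', ∑ μ, (gL a α κ * gL c γ κ') *
      ∑ μ', 2 * lc κ μ κ' μ' * (2 * lc μ β μ' δ) =
      8 * ((gL a α κ * gL c γ κ') * (kd κ β * kd κ' δ)) -
      8 * ((gL a α κ * gL c γ κ') * (kd κ δ * kd κ' β)) := by
    intro κ κ'
    have h5 := lc_mul_lc κ β κ' δ
    have h6 : ∀ μ μ', (gL a α κ * gL c γ κ') * (2 * lc κ μ κ' μ' * (2 * lc μ β μ' δ)) =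
        (4 * (gL a α κ * gL c γ κ')) * (lc κ μ κ' μ' * lc μ β μ' δ) := fun μ μ' => by ring
    simp only [Finset.mul_sum, h6]
    simp only [← Finset.mul_sum]
    rw [h5]; ring
  rw [Finset.sum_congr rfl fun κ _ => Finset.sum_congr rfl fun κ' _ => h4 κ κ']
  have h5 : ∀ (p q : Fin 4), ∑ κ, ∑ κ', 8 * ((gL a α κ * gL c γ κ') * (kd κ p * kd κ' q)) =
      8 * (gL a α p * gL c γ q) := fun p q => by simp [kd]
  rw [Finset.sum_congr rfl fun κ _ => Finset.sum_sub_distrib _ _, Finset.sum_sub_distrib, h5, h5]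
  ring

end Gamma

section Superspace

variable {A : Type*} [Ring A] [StarRing A] [Algebra ℂ A] [StarModule ℂ A]
  {𝒜 : ZMod 2 → Submodule ℂ A} [GradedAlgebra 𝒜] (𝒮 : ConformalSuperspace 𝒜)

theorem sum_smul_sum_smul {ι κ V : Type*} [Fintype ι] [Fintype κ] [AddCommGroup V] [Module ℂ V]
    (c : ι → ℂ) (d : ι → κ → ℂ) (v : κ → V) :
    ∑ x, c x • ∑ k, d x k • v k = ∑ k, (∑ x, c x * d x k) • v k := by
  simp only [Finset.smul_sum, Finset.sum_smul, smul_smul]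
  exact Finset.sum_comm

/-- `F^{ij} H_{ij}`. -/
def omPair (F H : Fin 4 → Fin 4 → A) : A := ∑ i, ∑ j, F i j * low2 H i j

omit [StarRing A] [StarModule ℂ A] in
theorem omPair_eq (F H : Fin 4 → Fin 4 → A) :
    omPair F H = pair4 (fun p q r s => OmL p r * OmL q s) fun p q r s => F p q * H r s := by
  simp only [omPair, low2, pair4, Finset.mul_sum, mul_smul_comm]

omit [StarRing A] [StarModule ℂ A] in
theorem low2_low2 (F : Fin 4 → Fin 4 → A) : low2 (low2 F) = F := by
  have h : ∀ (F : Fin 4 → Fin 4 → A) i j, low2 F i j =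
      ∑ x : Fin 4 × Fin 4, (OmL i x.1 * OmL j x.2) • F x.1 x.2 := fun F i j => by
    rw [low2, Fintype.sum_prod_type]
  have h2 : ∀ i k, ∑ j, OmL i j * OmL j k = -kd i k := fun i k => by
    rw [← OmL_mul_OmU, ← Finset.sum_neg_distrib]
    exact Finset.sum_congr rfl fun j _ => by rw [OmL, OmL]; ring
  funext i j
  rw [h]
  simp only [h F]
  rw [sum_smul_sum_smul (fun x : Fin 4 × Fin 4 => OmL i x.1 * OmL j x.2)
    (fun x y : Fin 4 × Fin 4 => OmL x.1 y.1 * OmL x.2 y.2) fun y => F y.1 y.2]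
  have h3 : ∀ y : Fin 4 × Fin 4, ∑ x : Fin 4 × Fin 4,
      OmL i x.1 * OmL j x.2 * (OmL x.1 y.1 * OmL x.2 y.2) = kd i y.1 * kd j y.2 := by
    intro y
    rw [Fintype.sum_prod_type, ← neg_mul_neg, ← h2, ← h2, Finset.sum_mul_sum]
    exact Finset.sum_congr rfl fun _ _ => Finset.sum_congr rfl fun _ _ => by ring
  simp only [h3, Fintype.sum_prod_type, mul_smul, ← Finset.smul_sum, sum_kd_smul]

namespace ConformalSuperspace

theorem Wvec_eq (a b c : Fin 6) (i j : Fin 4) : Wvec 𝒮.W a b c i j =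
    ∑ v : Fin 4 × Fin 4, (1 / 8 * (gL a * gtL b * gL c) v.1 v.2) • 𝒮.W v.1 v.2 i j := by
  have h : ∑ α, ∑ β, (gL c * gtL b * gL a) α β • 𝒮.W α β i j =
      -∑ α, ∑ β, (gL a * gtL b * gL c) α β • 𝒮.W α β i j := by
    rw [Finset.sum_comm]
    simp only [← Finset.sum_neg_distrib]
    refine Finset.sum_congr rfl fun α _ => Finset.sum_congr rfl fun β _ => ?_
    rw [gL_mul_gtL_mul_gL_transpose, neg_smul, 𝒮.W_symm]
  rw [Wvec, Fintype.sum_prod_type]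
  simp only [gam3_eq, Matrix.smul_apply, Matrix.sub_apply, smul_eq_mul, mul_smul, sub_smul,
    ← Finset.smul_sum, Finset.sum_sub_distrib, h]
  module

theorem omPair_sum_W (c d : Fin 4 × Fin 4 → ℂ) :
    omPair (fun i j => ∑ v, c v • 𝒮.W v.1 v.2 i j) (fun i j => ∑ v, d v • 𝒮.W v.1 v.2 i j) =
    ∑ v : (Fin 4 × Fin 4) × Fin 4 × Fin 4, (c v.1 * d v.2) • 𝒮.bil v.1.1 v.1.2 v.2.1 v.2.2 := by
  have h : ∀ i j, low2 (fun i j => ∑ v, d v • 𝒮.W v.1 v.2 i j) i j =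
      ∑ v : Fin 4 × Fin 4, d v • low2 (𝒮.W v.1 v.2) i j := by
    intro i j
    simp only [low2, Finset.smul_sum]
    rw [Finset.sum_congr rfl fun i _ => Finset.sum_comm, Finset.sum_comm]
    exact Finset.sum_congr rfl fun _ _ => Finset.sum_congr rfl fun _ _ =>
      Finset.sum_congr rfl fun _ _ => smul_comm _ _ _
  simp only [omPair, h, Finset.sum_mul_sum, smul_mul_smul_comm, bil]
  rw [Fintype.sum_prod_type]
  simp only [Finset.smul_sum]
  rw [Finset.sum_congr rfl fun i _ => Finset.sum_comm, Finset.sum_comm]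
  refine Finset.sum_congr rfl fun v _ => ?_
  rw [Finset.sum_congr rfl fun i _ => Finset.sum_comm, Finset.sum_comm]

/-- `T_{aef}^{ij} T^{cef}_{ij}` in terms of `(γ_a)_{αβ} (γ_b)_{γδ} W^{αγ ij} W^{βδ}_{ij}`. -/
theorem TT_eq (a c : Fin 6) : TT 𝒮.W a c = (-(1 / 32) * eta c c) • WW 𝒮.W a c := by
  have hT : ∀ a e f, Tvec 𝒮.W a e f = fun i j => ∑ v : Fin 4 × Fin 4,
      (Complex.I / 16 * (gL a * gtL e * gL f) v.1 v.2) • 𝒮.W v.1 v.2 i j := by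
    intro a e f; funext i j
    rw [Tvec, Wvec_eq, Finset.smul_sum]
    exact Finset.sum_congr rfl fun v _ => by rw [smul_smul]; congr 1; ring
  have h1 : TT 𝒮.W a c = eta c c • ∑ x : Fin 6 × Fin 6, (eta x.1 x.1 * eta x.2 x.2) •
      omPair (Tvec 𝒮.W a x.1 x.2) (Tvec 𝒮.W c x.1 x.2) := by
    have e1 : ∀ c' e e' f f', ∑ i, ∑ j, (eta c c' * eta e e' * eta f f') •
        (Tvec 𝒮.W a e f i j * low2 (Tvec 𝒮.W c' e' f') i j) =
        eta c c' • eta e e' • eta f f' • omPair (Tvec 𝒮.W a e f) (Tvec 𝒮.W c' e' f') := by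
      intro c' e e' f f'
      simp only [omPair, Finset.smul_sum, smul_smul, mul_assoc]
    simp only [TT, e1]
    simp only [← Finset.smul_sum, sum_eta_smul]
    rw [Fintype.sum_prod_type]
    simp only [Finset.smul_sum, smul_smul]
  rw [h1]
  simp only [hT, omPair_sum_W]
  rw [sum_smul_sum_smul]
  have h2 : ∀ v : (Fin 4 × Fin 4) × Fin 4 × Fin 4, ∑ x : Fin 6 × Fin 6,
      eta x.1 x.1 * eta x.2 x.2 * (Complex.I / 16 * (gL a * gtL x.1 * gL x.2) v.1.1 v.1.2 *
        (Complex.I / 16 * (gL c * gtL x.1 * gL x.2) v.2.1 v.2.2)) =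
      -(1 / 32) * (gL a v.1.1 v.1.2 * gL c v.2.1 v.2.2 - gL a v.1.1 v.2.2 * gL c v.2.1 v.1.2) := by
    intro v
    rw [Fintype.sum_prod_type]
    have h3 := sum_gam_product a c v.1.1 v.1.2 v.2.1 v.2.2
    have h4 : ∀ e f, eta e e * eta f f * (Complex.I / 16 * (gL a * gtL e * gL f) v.1.1 v.1.2 *
        (Complex.I / 16 * (gL c * gtL e * gL f) v.2.1 v.2.2)) = -(1 / 256) *
        ((eta e e * eta f f) * ((gL a * gtL e * gL f) v.1.1 v.1.2 *
          (gL c * gtL e * gL f) v.2.1 v.2.2)) := by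
      intro e f
      linear_combination (1 / 256 * ((eta e e * eta f f) * ((gL a * gtL e * gL f) v.1.1 v.1.2 *
          (gL c * gtL e * gL f) v.2.1 v.2.2))) * Complex.I_mul_I
    simp only [h4, ← Finset.mul_sum]
    rw [h3]; ring
  simp only [h2, mul_sub, sub_smul, Finset.sum_sub_distrib]
  -- The first Fierz term contracts an antisymmetric gamma matrix with a symmetric spinor pair of
  -- `W`.
  have h5 : ∑ v : (Fin 4 × Fin 4) × Fin 4 × Fin 4,
      (-(1 / 32) * (gL a v.1.1 v.1.2 * gL c v.2.1 v.2.2)) • 𝒮.bil v.1.1 v.1.2 v.2.1 v.2.2 = 0 := by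
    refine eq_zero_of_eq_neg ?_
    simp only [Fintype.sum_prod_type]
    conv_lhs => rw [Finset.sum_comm]
    simp only [← Finset.sum_neg_distrib]
    refine Finset.sum_congr rfl fun β _ => Finset.sum_congr rfl fun α _ =>
      Finset.sum_congr rfl fun γ _ => Finset.sum_congr rfl fun δ _ => ?_
    rw [gL_antisymm a α β, 𝒮.bil_symm_left α β]; module
  rw [h5, zero_sub, WW_eq]
  simp only [Fintype.sum_prod_type, Finset.smul_sum, ← Finset.sum_neg_distrib]
  refine Finset.sum_congr rfl fun α _ => ?_
  rw [Finset.sum_congr rfl fun β _ => Finset.sum_comm, Finset.sum_comm]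
  refine Finset.sum_congr rfl fun δ _ => Finset.sum_congr rfl fun β _ =>
    Finset.sum_congr rfl fun γ _ => ?_
  rw [gL_antisymm c γ β, 𝒮.bil_symm_right α β γ δ]
  module

theorem WW_even (a b : Fin 6) : WW 𝒮.W a b ∈ 𝒜 0 := 𝒮.cov_graded (𝒮.WW_mem_cov a b)

theorem star_low2 (F : Fin 4 → Fin 4 → A) (i j : Fin 4) :
    star (low2 F i j) = low2 (fun i j => star (F i j)) i j := by
  have h : ∀ i j, star (OmL i j) = OmL i j := by
    intro i j; fin_cases i <;> fin_cases j <;> simp [OmL, OmU]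
  simp only [low2, star_sum, star_smul, star_mul', h]

theorem star_Tvec (a b c : Fin 6) : (fun i j => star (Tvec 𝒮.W a b c i j)) =
    low2 (Tvec 𝒮.W a b c) := by
  have h : star (Complex.I / 2) = -(Complex.I / 2) := by
    apply Complex.ext <;> simp <;> norm_num
  funext i j
  simp only [Tvec, star_smul, 𝒮.W_real, h, low2, Finset.smul_sum]
  simp only [smul_neg, neg_smul, neg_neg, Finset.smul_sum, smul_comm (Complex.I / 2),
    Finset.sum_neg_distrib]

theorem Tvec_even (a b c : Fin 6) (i j : Fin 4) : Tvec 𝒮.W a b c i j ∈ 𝒜 0 :=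
  Submodule.smul_mem _ _ <| Submodule.smul_mem _ _ <| Submodule.sum_mem _ fun _ _ =>
    Submodule.sum_mem _ fun _ _ => Submodule.smul_mem _ _ (𝒮.W_even _ _ _ _)

/-- Conjugation lowers the `USp(4)` indices of T, so the conjugate of the contraction is the same
contraction with its factors exchanged, and these are even. -/
theorem star_TT (a c : Fin 6) : star (TT 𝒮.W a c) = TT 𝒮.W a c := by
  have h : ∀ a b, star (eta a b) = eta a b := by
    intro a b; unfold eta; split_ifs <;> simp
  simp only [TT, star_sum, star_smul, star_mul', star_mul, h]
  refine Finset.sum_congr rfl fun c' _ => Finset.sum_congr rfl fun e _ =>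
    Finset.sum_congr rfl fun e' _ => Finset.sum_congr rfl fun f _ =>
      Finset.sum_congr rfl fun f' _ => ?_
  simp only [← Finset.smul_sum]
  congr 1
  have e1 : ∀ i j, star (low2 (Tvec 𝒮.W c' e' f') i j) = Tvec 𝒮.W c' e' f' i j := by
    intro i j
    rw [star_low2, 𝒮.star_Tvec, low2_low2]
  have e2 : ∀ i j, star (Tvec 𝒮.W a e f i j) = low2 (Tvec 𝒮.W a e f) i j :=
    fun i j => congrFun (congrFun (𝒮.star_Tvec a e f) i) j
  simp only [e1, e2]
  change omPair _ _ = omPair _ _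
  simp only [omPair_eq, pair4]
  rw [sum_rotate_four]
  refine Finset.sum_congr rfl fun r _ => Finset.sum_congr rfl fun s _ =>
    Finset.sum_congr rfl fun p _ => Finset.sum_congr rfl fun q _ => ?_
  rw [OmL_antisymm p r, OmL_antisymm q s, 𝒮.even_comm _ (𝒮.Tvec_even _ _ _ p q), neg_mul_neg]

theorem WW_eq_TT (a c : Fin 6) : WW 𝒮.W a c = (-32 * eta c c) • TT 𝒮.W a c := by
  rw [TT_eq, smul_smul]
  have : -32 * eta c c * (-(1 / 32) * eta c c) = 1 := by linear_combination eta_mul_self c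
  rw [this, one_smul]

theorem star_WW (a c : Fin 6) : star (WW 𝒮.W a c) = WW 𝒮.W a c := by
  have h : star (-32 * eta c c) = -32 * eta c c := by
    unfold eta; split_ifs <;> simp
  rw [WW_eq_TT, star_smul, star_TT, h]

end ConformalSuperspace

end Superspace

end

/-! ### The one-parameter family of deformations -/

section

section Superspace

variable {A : Type*} [Ring A] [StarRing A] [Algebra ℂ A] [StarModule ℂ A]
  {𝒜 : ZMod 2 → Submodule ℂ A} [GradedAlgebra 𝒜] (𝒮 : ConformalSuperspace 𝒜)

namespace ConformalSuperspace

theorem opSpan_grade_le_fieldSpan (m : ℤ) :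
    𝒮.opSpan (𝒮.grade m) ≤ fieldSpan 𝒮.IsCov 𝒮.toGens Set.univ :=
  Gens.opSpan_le_fieldSpan 𝒮.bosonic fun _ _ hf => Or.inl ⟨Set.mem_univ _, 𝒮.isCov_of_mem hf⟩

/-- For m < 3 a coefficient of a covariant derivative would have dimension below 1. -/
theorem opSpan_grade_le_fieldSpan_hIx {m : ℤ} (hm : m < 3) :
    𝒮.opSpan (𝒮.grade m) ≤ fieldSpan 𝒮.IsCov 𝒮.toGens hIx := by
  refine Gens.opSpan_le_fieldSpan 𝒮.bosonic fun g f hf => ?_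
  rcases g with a | ⟨α, i⟩ | ⟨a, b, h⟩ | _ | ⟨i, j, h⟩ | ⟨α, i⟩ | a
  · exact Or.inr (𝒮.cov_eq_zero (m := m - 2) (by omega) hf)
  · exact Or.inr (𝒮.cov_eq_zero (m := m - 1) (by omega) hf)
  all_goals exact Or.inl ⟨⟨fun _ => nofun, fun _ _ => nofun⟩, 𝒮.isCov_of_mem hf⟩

theorem SQ_mem (α i β j : Fin 4) :
    acomm (𝒮.S α i) (𝒮.Q β j) - 𝒮.flatSQ α i β j ∈ 𝒮.opSpan (𝒮.grade 0) := by
  rw [𝒮.structureFunctions.SQ, add_sub_cancel_left]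
  exact Submodule.sum_mem _ fun _ _ => 𝒮.Kup_mem_wtSpan _ 2 _ <| Submodule.smul_mem _ _ <|
    Submodule.sum_mem _ fun _ _ => Submodule.smul_mem _ _ <|
      Submodule.sum_mem _ fun _ _ => Submodule.smul_mem _ _ (𝒮.W_mem_cov _ _ _ _)

theorem SP_mem (α i : Fin 4) (b : Fin 6) :
    comm (𝒮.Sup α i) (𝒮.P b) - 𝒮.flatSP α i b ∈ 𝒮.opSpan (𝒮.grade 1) := by
  rw [𝒮.structureFunctions.SP, add_assoc, add_sub_cancel_left]
  refine add_mem ?_ ?_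
  · exact Submodule.sum_mem _ fun _ _ => Submodule.sum_mem _ fun _ _ => Submodule.sum_mem _
      fun _ _ => Submodule.smul_mem _ _ (𝒮.S_mem_wtSpan _ _ 2 _ (𝒮.W_mem_cov _ _ _ _))
  · exact Submodule.sum_mem _ fun _ _ => 𝒮.Kup_mem_wtSpan _ 3 _ <| Submodule.smul_mem _ _ <|
      Submodule.sum_mem _ fun _ _ => Submodule.sum_mem _ fun _ _ =>
        Submodule.smul_mem _ _ (𝒮.X36_mem_cov _ _ _ _)

/-- The given generators form a gauged superconformal algebra. -/
theorem isGaugedAlgebra : IsGaugedAlgebra 𝒮.IsCov 𝒮.toGens where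
  bosonic := 𝒮.bosonic
  covariant := 𝒮.covariant
  special := 𝒮.special
  independent := 𝒮.independent
  KP a b := by rw [𝒮.structureFunctions.KP, sub_self]; exact zero_mem _
  KQ a α i := by rw [𝒮.structureFunctions.KQ, sub_self]; exact zero_mem _
  SQ α i β j := 𝒮.opSpan_grade_le_fieldSpan_hIx (by norm_num) (𝒮.SQ_mem α i β j)
  SP α i b := 𝒮.opSpan_grade_le_fieldSpan_hIx (by norm_num) (𝒮.SP_mem α i b)
  QQ α i β j := by
    rw [𝒮.QQ, add_sub_cancel_left]
    exact 𝒮.opSpan_grade_le_fieldSpan _ (𝒮.curvQQ_mem α i β j)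
  QP α i b := 𝒮.opSpan_grade_le_fieldSpan _ (𝒮.comm_QP_mem α i b)
  PP a b := 𝒮.opSpan_grade_le_fieldSpan _ (𝒮.comm_PP_mem a b)

theorem Kup_eq (b : Fin 6) : 𝒮.Kup b = eta b b • 𝒮.K b := by
  rw [Gens.Kup, upV, Finset.sum_eq_single b (fun c _ hc => by
    rw [eta_of_ne hc.symm, zero_smul]) (by simp)]

/-- The operator which is added to `∇_a`. -/
def shift (a : Fin 6) : Module.End ℂ A := ∑ b, WW 𝒮.W a b • 𝒮.Kup b

theorem hatP_eq (lam : ℝ) (a : Fin 6) : 𝒮.hatP lam a = 𝒮.P a - (lam : ℂ) • 𝒮.shift a := rfl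

theorem shift_mem (a : Fin 6) : 𝒮.shift a ∈ 𝒮.opSpan (𝒮.grade 2) :=
  Submodule.sum_mem _ fun _ _ => 𝒮.Kup_mem_wtSpan _ 4 _ (𝒮.WW_mem_cov _ _)

theorem K_WW (a b c : Fin 6) : 𝒮.K a (WW 𝒮.W b c) = 0 := by
  simp only [WW_eq, bil_eq_pair4, pair4, map_sum, map_smul, (𝒮.K_der a).leibniz, 𝒮.K_W, zero_mul,
    mul_zero, add_zero, smul_zero, Finset.sum_const_zero]

theorem S_WW (α i : Fin 4) (b c : Fin 6) : 𝒮.S α i (WW 𝒮.W b c) = 0 := by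
  simp only [WW_eq, bil_eq_pair4, pair4, map_sum, map_smul,
    (𝒮.S_der α i).leibniz_even _ (𝒮.W_even _ _ _ _), 𝒮.S_W, zero_mul,
    mul_zero, add_zero, smul_zero, Finset.sum_const_zero]

theorem Kup_apply (b : Fin 6) (f : A) : 𝒮.Kup b f = eta b b • 𝒮.K b f := by
  rw [Kup_eq, LinearMap.smul_apply]

theorem shift_apply (a : Fin 6) (f : A) :
    𝒮.shift a f = ∑ b, eta b b • (WW 𝒮.W a b * 𝒮.K b f) := by
  simp only [shift, LinearMap.sum_apply, LinearMap.smul_apply, Kup_apply, smul_eq_mul,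
    mul_smul_comm]

theorem shift_der (a : Fin 6) : IsEvenDer 𝒜 (𝒮.shift a) where
  map_mem p f hf := by
    rw [shift_apply]
    refine Submodule.sum_mem _ fun b _ => Submodule.smul_mem _ _ ?_
    have := SetLike.mul_mem_graded (𝒮.WW_even a b) ((𝒮.K_der b).map_mem p f hf)
    rwa [zero_add] at this
  leibniz f h := by
    simp only [shift_apply, (𝒮.K_der _).leibniz, mul_add, smul_add, Finset.sum_add_distrib,
      Finset.sum_mul, Finset.mul_sum]
    congr 1
    · exact Finset.sum_congr rfl fun b _ => by rw [smul_mul_assoc, mul_assoc]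
    · refine Finset.sum_congr rfl fun b _ => ?_
      rw [mul_smul_comm, ← mul_assoc, 𝒮.even_comm _ (𝒮.WW_even a b) f, mul_assoc]

theorem comm_K_Kup (a b : Fin 6) : comm (𝒮.K a) (𝒮.Kup b) = 0 := by
  rw [Kup_eq, comm_smul_right, 𝒮.special.KK, smul_zero]

theorem comm_K_shift (a b : Fin 6) : comm (𝒮.K a) (𝒮.shift b) = 0 := by
  simp only [shift, comm_sum_right, (𝒮.K_der a).comm_smul, K_WW, comm_K_Kup, zero_smul, smul_zero,
    add_zero, Finset.sum_const_zero]

theorem comm_S_shift (α i : Fin 4) (b : Fin 6) : comm (𝒮.S α i) (𝒮.shift b) = 0 := by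
  simp only [shift, comm_sum_right, (𝒮.S_der α i).comm_smul_even (𝒮.WW_even _ _), S_WW, Kup_eq,
    comm_smul_right, 𝒮.special.SK, zero_smul, smul_zero, add_zero, Finset.sum_const_zero]

theorem comm_Sup_shift (α i : Fin 4) (b : Fin 6) : comm (𝒮.Sup α i) (𝒮.shift b) = 0 := by
  rw [Gens.Sup, raise, comm_swap]
  simp only [comm_sum_right, comm_smul_right]
  have h : ∀ j, comm (𝒮.shift b) (𝒮.S α j) = 0 := fun j => by
    rw [comm_swap, comm_S_shift, neg_zero]
  simp only [h, smul_zero, Finset.sum_const_zero, neg_zero]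

theorem shift_WW (a b c : Fin 6) : 𝒮.shift a (WW 𝒮.W b c) = 0 := by
  simp only [shift_apply, K_WW, mul_zero, smul_zero, Finset.sum_const_zero]

/-- The K commute with each other and annihilate `WW`. -/
theorem comm_shift_shift (a b : Fin 6) : comm (𝒮.shift a) (𝒮.shift b) = 0 := by
  have h : ∀ c, comm (𝒮.shift a) (𝒮.Kup c) = 0 := fun c => by
    rw [comm_swap, Kup_eq, comm_swap, neg_neg, comm_smul_right, comm_swap, comm_K_shift, neg_zero,
      smul_zero]
  conv_lhs => enter [2]; rw [shift]
  simp only [comm_sum_right, (𝒮.shift_der a).comm_smul, shift_WW, h, zero_smul, smul_zero,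
    add_zero, Finset.sum_const_zero]

theorem comm_D_shift (a : Fin 6) : comm 𝒮.D (𝒮.shift a) = 𝒮.shift a := by
  have h : ∀ b, 𝒮.D (WW 𝒮.W a b) = (2 : ℂ) • WW 𝒮.W a b := fun b => by
    rw [𝒮.D_cov (𝒮.WW_mem_cov a b)]; norm_num
  have h2 : ∀ b, comm 𝒮.D (𝒮.Kup b) = -𝒮.Kup b := fun b => by
    rw [Kup_eq, comm_smul_right, 𝒮.covariant.DK, smul_neg]
  simp only [shift, comm_sum_right, 𝒮.D_der.comm_smul, h, h2]
  refine Finset.sum_congr rfl fun b _ => LinearMap.ext fun f => ?_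
  simp only [LinearMap.add_apply, LinearMap.smul_apply, LinearMap.neg_apply, smul_eq_mul,
    smul_mul_assoc, mul_neg]
  module

theorem comm_J_shift (i j : Fin 4) (a : Fin 6) : comm (𝒮.J i j) (𝒮.shift a) = 0 := by
  simp only [shift, comm_sum_right, (𝒮.J_der i j).comm_smul, J_WW, Kup_eq, comm_smul_right,
    𝒮.covariant.JK, zero_smul, smul_zero, add_zero, Finset.sum_const_zero]

theorem shift_eq_expand (a : Fin 6) :
    𝒮.shift a = 𝒮.expand (Slot.ofK fun b => eta b b • WW 𝒮.W a b) := by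
  rw [Gens.expand_ofK, shift]
  exact Finset.sum_congr rfl fun b _ => by rw [Kup_eq, smul_comm, smul_assoc]

theorem comm_M_shift (a b c : Fin 6) : comm (𝒮.M a b) (𝒮.shift c) = vrot a b 𝒮.shift c := by
  have h : (act (𝒮.M a b) (vmat a b) (vmat a b) (vmat a b)
      (fun γ δ => -(1 / 2) * gam2 a b γ δ) (fun γ δ => -(1 / 2) * gamt2 a b γ δ) 0 0 0
      (Slot.ofK fun d => eta d d • WW 𝒮.W c d)) =
      Slot.ofK (fun d => vrot a b (fun c => eta d d • WW 𝒮.W c d) c) := by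
    funext s
    cases s <;> simp only [act, Slot.ofK, map_zero, smul_zero, Finset.sum_const_zero, add_zero]
    rename_i d
    have h2 := congrArg (eta d d • ·) (sum_vmat_smul a b d fun e => eta e e • WW 𝒮.W c e)
    simp only [smul_smul, eta_mul_self, one_smul] at h2
    simp only [smul_smul] at h2 ⊢
    rw [h2, map_smul, M_WW]
    simp only [vrot]; module
  rw [shift_eq_expand, (𝒮.M_actsBy a b).comm_expand (𝒮.M_der a b), h, Gens.expand_ofK]
  simp only [vrot, shift_eq_expand, Gens.expand_ofK, Finset.smul_sum, ← Finset.sum_sub_distrib]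
  refine Finset.sum_congr rfl fun d _ => LinearMap.ext fun f => ?_
  simp only [LinearMap.sub_apply, LinearMap.smul_apply, smul_eq_mul, sub_mul, smul_mul_assoc]

theorem comm_hatP (X : Module.End ℂ A) (lam : ℝ) (a : Fin 6) :
    comm X (𝒮.hatP lam a) = comm X (𝒮.P a) - (lam : ℂ) • comm X (𝒮.shift a) := by
  rw [hatP_eq, comm_sub_right, comm_smul_right]

theorem deformed_covariant (lam : ℝ) : (𝒮.deformed lam).IsCovariant where
  MP a b c := by
    change comm (𝒮.M a b) (𝒮.hatP lam c) = vrot a b (𝒮.hatP lam) c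
    rw [comm_hatP, comm_M_shift, 𝒮.covariant.MP]
    simp only [vrot, hatP_eq]; module
  DP c := by
    change comm 𝒮.D (𝒮.hatP lam c) = 𝒮.hatP lam c
    rw [comm_hatP, comm_D_shift, 𝒮.covariant.DP, hatP_eq]
  JP i j c := by
    change comm (𝒮.J i j) (𝒮.hatP lam c) = 0
    rw [comm_hatP, comm_J_shift, 𝒮.covariant.JP, smul_zero, sub_zero]
  MQ := 𝒮.covariant.MQ
  DQ := 𝒮.covariant.DQ
  JQ := 𝒮.covariant.JQ
  MS := 𝒮.covariant.MS
  DS := 𝒮.covariant.DS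
  JS := 𝒮.covariant.JS
  MK := 𝒮.covariant.MK
  DK := 𝒮.covariant.DK
  JK := 𝒮.covariant.JK

theorem deformed_structureFunctions (lam : ℝ) :
    HasStructureFunctions (𝒮.deformed lam) 𝒮.W where
  KP a b := by
    change comm (𝒮.K a) (𝒮.hatP lam b) = 𝒮.flatKP a b
    rw [comm_hatP, comm_K_shift, smul_zero, sub_zero, 𝒮.structureFunctions.KP]
  KQ := 𝒮.structureFunctions.KQ
  SQ := 𝒮.structureFunctions.SQ
  SP α i b := by
    change comm (𝒮.Sup α i) (𝒮.hatP lam b) = _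
    rw [comm_hatP, comm_Sup_shift, smul_zero, sub_zero]
    exact 𝒮.structureFunctions.SP α i b

/-- The change of generators is unitriangular: it adds multiples of K to P. A relation among the new
generators first loses its P coefficients, and then the correction with them. -/
theorem deformed_independent (lam : ℝ) : LinearIndependent A (𝒮.deformed lam).gen := by
  rw [linearIndependent_iff]
  intro l hl
  classical
  let u : Fin 6 → A := fun b => ∑ a, l (.P a) * ((lam : ℂ) • eta b b • WW 𝒮.W a b)
  let l' : GenIx →₀ A := l - ∑ b, Finsupp.single (GenIx.K b) (u b)
  have hgen : ∀ g, (𝒮.deformed lam).gen g = 𝒮.gen g -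
      ∑ a, (if g = .P a then (1 : A) else 0) • (lam : ℂ) • 𝒮.shift a := by
    intro g
    rcases g with a | ⟨α, i⟩ | ⟨a, b, h⟩ | _ | ⟨i, j, h⟩ | ⟨α, i⟩ | a
    · simp [ite_smul, Gens.gen, deformed, hatP_eq]
    all_goals simp [Gens.gen, deformed]
  have h1 : Finsupp.linearCombination A (𝒮.deformed lam).gen l =
      Finsupp.linearCombination A 𝒮.gen l - ∑ a, l (.P a) • (lam : ℂ) • 𝒮.shift a := by
    simp only [Finsupp.linearCombination_apply, Finsupp.sum, hgen, smul_sub,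
      Finset.sum_sub_distrib, Finset.smul_sum]
    congr 1
    rw [Finset.sum_comm]
    refine Finset.sum_congr rfl fun a _ => ?_
    rw [Finset.sum_eq_single (GenIx.P a)]
    · simp
    · intro g _ hg; simp [hg]
    · intro h; simp [Finsupp.notMem_support_iff.mp h]
  have h2 : ∑ a, l (.P a) • (lam : ℂ) • 𝒮.shift a = ∑ b, u b • 𝒮.K b := by
    simp only [u, Finset.sum_smul, shift, Finset.smul_sum, Kup_eq]
    rw [Finset.sum_comm]
    refine Finset.sum_congr rfl fun b _ => Finset.sum_congr rfl fun a _ =>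
      LinearMap.ext fun f => ?_
    simp only [LinearMap.smul_apply, smul_eq_mul, mul_smul_comm, smul_mul_assoc, mul_assoc]
  have h3 : Finsupp.linearCombination A 𝒮.gen l' = 0 := by
    rw [← hl, h1, h2]
    simp only [l', map_sub, map_sum, Finsupp.linearCombination_single]
    rfl
  have h4 : l' = 0 := (linearIndependent_iff.mp 𝒮.independent) l' h3
  have h5 : ∀ a, l (.P a) = 0 := fun a => by
    have := DFunLike.congr_fun h4 (GenIx.P a)
    simpa [l', Finsupp.single_apply] using this
  have h6 : ∀ b, u b = 0 := fun b => Finset.sum_eq_zero fun a _ => by rw [h5, zero_mul]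
  simpa only [l', h6, Finsupp.single_zero, Finset.sum_const_zero, sub_zero] using h4

theorem fieldSpan_hIx_deformed (lam : ℝ) :
    fieldSpan 𝒮.IsCov 𝒮.toGens hIx ≤ fieldSpan 𝒮.IsCov (𝒮.deformed lam) hIx := by
  refine Submodule.span_le.mpr ?_
  rintro _ ⟨f, hf, g, hg, rfl⟩
  refine Submodule.subset_span ⟨f, hf, g, hg, ?_⟩
  rcases g with a | ⟨α, i⟩ | ⟨a, b, h⟩ | _ | ⟨i, j, h⟩ | ⟨α, i⟩ | a
  · exact absurd rfl (hg.1 a)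
  all_goals rfl

theorem fieldSpan_univ_deformed (lam : ℝ) :
    fieldSpan 𝒮.IsCov 𝒮.toGens Set.univ ≤ fieldSpan 𝒮.IsCov (𝒮.deformed lam) Set.univ := by
  refine Submodule.span_le.mpr ?_
  rintro _ ⟨f, hf, g, hg, rfl⟩
  have key : ∀ g, f • (𝒮.deformed lam).gen g ∈ fieldSpan 𝒮.IsCov (𝒮.deformed lam) Set.univ :=
    fun g => Submodule.subset_span ⟨f, hf, g, Set.mem_univ _, rfl⟩
  rcases g with a | ⟨α, i⟩ | ⟨a, b, h⟩ | _ | ⟨i, j, h⟩ | ⟨α, i⟩ | a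
  · have e : 𝒮.P a = 𝒮.hatP lam a + (lam : ℂ) • 𝒮.shift a := by rw [hatP_eq, sub_add_cancel]
    have e2 : f • 𝒮.shift a = ∑ b, eta b b • (f * WW 𝒮.W a b) • 𝒮.K b := by
      simp only [shift, Finset.smul_sum, Kup_eq]
      refine Finset.sum_congr rfl fun b _ => LinearMap.ext fun h => ?_
      simp only [LinearMap.smul_apply, smul_eq_mul, mul_smul_comm, mul_assoc]
    change f • 𝒮.P a ∈ _
    rw [e, smul_add, smul_comm f]
    refine add_mem (key (.P a)) (Submodule.smul_mem _ _ ?_)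
    rw [e2]
    exact Submodule.sum_mem _ fun b _ => Submodule.smul_mem _ _ <| Submodule.subset_span
      ⟨_, IsCovField.mul hf (𝒮.isCov_of_mem (𝒮.WW_mem_cov a b)), .K b, Set.mem_univ _, rfl⟩
  exacts [key (.Q α i), key (.M a b h), key .D, key (.J i j h), key (.S α i), key (.K a)]

/-- There is no term quadratic in λ, because the corrections commute. -/
theorem comm_hatP_hatP (lam : ℝ) (a b : Fin 6) : comm (𝒮.hatP lam a) (𝒮.hatP lam b) =
    comm (𝒮.P a) (𝒮.P b) - (lam : ℂ) • (comm (𝒮.P a) (𝒮.shift b) - comm (𝒮.P b) (𝒮.shift a)) := by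
  have h1 : comm (𝒮.hatP lam a) (𝒮.P b) =
      comm (𝒮.P a) (𝒮.P b) + (lam : ℂ) • comm (𝒮.P b) (𝒮.shift a) := by
    rw [comm_swap, comm_hatP, comm_swap (𝒮.P b) (𝒮.P a)]; abel
  have h2 : comm (𝒮.hatP lam a) (𝒮.shift b) = comm (𝒮.P a) (𝒮.shift b) := by
    rw [comm_swap, comm_hatP, comm_shift_shift, smul_zero, sub_zero, ← comm_swap]
  rw [comm_hatP, h1, h2, smul_sub]; abel

theorem deformed_isGaugedAlgebra (lam : ℝ) :
    IsGaugedAlgebra 𝒮.IsCov (𝒮.deformed lam) where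
  bosonic := ⟨𝒮.bosonic.M_antisymm, 𝒮.bosonic.J_symm, 𝒮.bosonic.MM, 𝒮.bosonic.JJ, 𝒮.bosonic.MD,
    𝒮.bosonic.MJ, 𝒮.bosonic.DJ⟩
  covariant := 𝒮.deformed_covariant lam
  special := ⟨𝒮.special.SS, 𝒮.special.SK, 𝒮.special.KK⟩
  independent := 𝒮.deformed_independent lam
  KP a b := by rw [(𝒮.deformed_structureFunctions lam).KP, sub_self]; exact zero_mem _
  KQ a α i := 𝒮.fieldSpan_hIx_deformed lam (𝒮.isGaugedAlgebra.KQ a α i)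
  SQ α i β j := 𝒮.fieldSpan_hIx_deformed lam (𝒮.isGaugedAlgebra.SQ α i β j)
  SP α i b := by
    change comm (𝒮.Sup α i) (𝒮.hatP lam b) - 𝒮.flatSP α i b ∈ _
    rw [comm_hatP, comm_Sup_shift, smul_zero, sub_zero]
    exact 𝒮.fieldSpan_hIx_deformed lam (𝒮.isGaugedAlgebra.SP α i b)
  QQ α i β j := by
    have e : acomm (𝒮.Q α i) (𝒮.Q β j) - (𝒮.deformed lam).flatQQ α i β j =
        (acomm (𝒮.Q α i) (𝒮.Q β j) - 𝒮.flatQQ α i β j) +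
        (-2 * Complex.I * OmU i j) • ∑ a, gU a α β • (lam : ℂ) • 𝒮.shift a := by
      have e1 : (𝒮.deformed lam).Pss α β = 𝒮.Pss α β - ∑ a, gU a α β • (lam : ℂ) • 𝒮.shift a := by
        simp only [Gens.Pss, ← Finset.sum_sub_distrib]
        exact Finset.sum_congr rfl fun a _ => smul_sub _ _ _
      simp only [Gens.flatQQ]
      rw [e1, smul_sub]; abel
    change acomm (𝒮.Q α i) (𝒮.Q β j) - _ ∈ _
    rw [e]
    refine 𝒮.fieldSpan_univ_deformed lam (add_mem (𝒮.isGaugedAlgebra.QQ α i β j) ?_)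
    exact Submodule.smul_mem _ _ <| Submodule.sum_mem _ fun a _ => Submodule.smul_mem _ _ <|
      Submodule.smul_mem _ _ (𝒮.opSpan_grade_le_fieldSpan _ (𝒮.shift_mem a))
  QP α i b := by
    change comm (𝒮.Q α i) (𝒮.hatP lam b) ∈ _
    rw [comm_hatP]
    exact 𝒮.fieldSpan_univ_deformed lam (sub_mem (𝒮.isGaugedAlgebra.QP α i b)
      (Submodule.smul_mem _ _ (𝒮.opSpan_grade_le_fieldSpan _
        (𝒮.comm_Q_mem ⟨1, rfl⟩ (𝒮.shift_mem b) α i fun h => absurd h (by norm_num)))))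
  PP a b := by
    change comm (𝒮.hatP lam a) (𝒮.hatP lam b) ∈ _
    have h : ∀ a b, comm (𝒮.P a) (𝒮.shift b) ∈ fieldSpan 𝒮.IsCov 𝒮.toGens Set.univ := fun a b =>
      𝒮.opSpan_grade_le_fieldSpan _ (𝒮.comm_P_mem (by norm_num) (𝒮.shift_mem b) a)
    rw [comm_hatP_hatP]
    exact 𝒮.fieldSpan_univ_deformed lam (sub_mem (𝒮.isGaugedAlgebra.PP a b)
      (Submodule.smul_mem _ _ (sub_mem (h a b) (h b a))))

theorem star_shift (a : Fin 6) (f : A) : star (𝒮.shift a f) = 𝒮.shift a (star f) := by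
  have h : ∀ b, star (eta b b) = eta b b := by
    intro b; unfold eta; split_ifs <;> simp
  simp only [shift_apply, star_sum, star_smul, star_mul, h, star_WW, 𝒮.K_real]
  exact Finset.sum_congr rfl fun b _ => by rw [𝒮.even_comm _ (𝒮.WW_even a b)]

theorem deformed_isFieldDeformation (lam : ℝ) : 𝒮.IsFieldDeformation (𝒮.deformed lam) where
  M_eq := rfl
  D_eq := rfl
  J_eq := rfl
  P_sub a := by
    change 𝒮.hatP lam a - 𝒮.P a ∈ _
    rw [hatP_eq, sub_sub_cancel_left]
    exact neg_mem (Submodule.smul_mem _ _ (𝒮.opSpan_grade_le_fieldSpan _ (𝒮.shift_mem a)))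
  Q_sub α i := by
    change 𝒮.Q α i - 𝒮.Q α i ∈ _
    rw [sub_self]; exact zero_mem _
  S_sub α i := by
    change 𝒮.S α i - 𝒮.S α i ∈ _
    rw [sub_self]; exact zero_mem _
  K_sub a := by
    change 𝒮.K a - 𝒮.K a ∈ _
    rw [sub_self]; exact zero_mem _
  P_real a f := by
    change star (𝒮.hatP lam a f) = 𝒮.hatP lam a (star f)
    simp only [hatP_eq, LinearMap.sub_apply, LinearMap.smul_apply, star_sub, star_smul, 𝒮.P_real,
      star_shift, Complex.star_def, Complex.conj_ofReal]

end ConformalSuperspace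

end Superspace

end

/-! ### Rigidity of field deformations, and reality of λ -/

section

section Superspace

variable {A : Type*} [Ring A] [StarRing A] [Algebra ℂ A] [StarModule ℂ A]
  {𝒜 : ZMod 2 → Submodule ℂ A} [GradedAlgebra 𝒜] (𝒮 : ConformalSuperspace 𝒜)

namespace ConformalSuperspace

theorem WW_eq_zero_of_smul_shift_eq {r : ℂ} (h : ∀ a, r • 𝒮.shift a = 0) (a b : Fin 6) :
    r • WW 𝒮.W a b = 0 := by
  have h1 := h a
  rw [shift_eq_expand, ← LinearMap.map_smul_of_tower, ← map_zero 𝒮.expand] at h1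
  have h2 := 𝒮.expand_injective ⟨fun a b => ?_, fun i j => ?_⟩ Balanced.zero h1
  · have h3 := congrFun h2 (.K b)
    simp only [Pi.smul_apply, Slot.ofK, Pi.zero_apply] at h3
    have h4 := congrArg (eta b b • ·) h3
    simpa only [smul_comm (eta b b) r, smul_smul (eta b b) (eta b b), eta_mul_self, one_smul,
      smul_zero] using h4
  · simp [Slot.ofK]
  · rfl

/-- Differences of new and old generators transform covariantly with definite dimension, so the
dimension bound and the two rigidity statements apply. Of a gauged algebra nothing but covariance
under `M`, `D`, `J` is needed. -/
theorem deformation_eq_of_isCovariant {G : Gens A} (hG : 𝒮.IsFieldDeformation G)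
    (hc : G.IsCovariant) :
    ∃ lam : ℝ, G.S = 𝒮.S ∧ G.K = 𝒮.K ∧ G.Q = 𝒮.Q ∧ G.P = 𝒮.hatP lam := by
  have hM := hG.M_eq
  have hD := hG.D_eq
  have hJ := hG.J_eq
  have hS : ∀ α i, G.S α i - 𝒮.S α i = 0 := fun α i =>
    𝒮.eq_zero_of_mem_opSpan (m := -1) (by norm_num) <| 𝒮.mem_opSpan_grade (hG.S_sub α i) _ <| by
      have := hc.DS α i
      rw [hD] at this
      rw [comm_sub_right, this, 𝒮.covariant.DS]
      push_cast; module
  have hK : ∀ a, G.K a - 𝒮.K a = 0 := fun a =>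
    𝒮.eq_zero_of_mem_opSpan (m := -2) (by norm_num) <| 𝒮.mem_opSpan_grade (hG.K_sub a) _ <| by
      have := hc.DK a
      rw [hD] at this
      rw [comm_sub_right, this, 𝒮.covariant.DK]
      push_cast; module
  have hQ : ∀ α i, G.Q α i - 𝒮.Q α i = 0 := by
    refine 𝒮.spinor_rigidity (T := fun α i => G.Q α i - 𝒮.Q α i) (fun α i =>
      𝒮.mem_opSpan_grade (hG.Q_sub α i) _ ?_) (fun a b γ k => ?_) (fun i j γ k => ?_)
    · have := hc.DQ α i
      rw [hD] at this
      rw [comm_sub_right, this, 𝒮.covariant.DQ]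
      push_cast; module
    · have := hc.MQ a b γ k
      rw [hM] at this
      rw [comm_sub_right, this, 𝒮.covariant.MQ]
      simp only [smul_sub, Finset.sum_sub_distrib]
    · have := hc.JQ i j γ k
      rw [hJ] at this
      rw [comm_sub_right, this, 𝒮.covariant.JQ]
      simp only [jrot]; module
  obtain ⟨r, hr⟩ : ∃ r : ℂ, ∀ a, G.P a - 𝒮.P a = r • 𝒮.shift a := by
    refine 𝒮.vector_rigidity (T := fun a => G.P a - 𝒮.P a) (fun a =>
      𝒮.mem_opSpan_grade (hG.P_sub a) _ ?_) (fun a b c => ?_) (fun i j c => ?_)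
    · have := hc.DP a
      rw [hD] at this
      rw [comm_sub_right, this, 𝒮.covariant.DP]
      push_cast; module
    · have := hc.MP a b c
      rw [hM] at this
      rw [comm_sub_right, this, 𝒮.covariant.MP]
      simp only [vrot]; module
    · have := hc.JP i j c
      rw [hJ] at this
      rw [comm_sub_right, this, 𝒮.covariant.JP, sub_zero]
  -- Both the old derivative and `shift` are real, so reality of the new derivative compares r with
  -- its conjugate.
  have hreal : ∀ a, (star r - r) • 𝒮.shift a = 0 := by
    intro a
    refine LinearMap.ext fun f => ?_
    have h1 : ∀ f, G.P a f = 𝒮.P a f + r • 𝒮.shift a f := fun f => by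
      rw [← LinearMap.smul_apply, ← hr, LinearMap.sub_apply]; abel
    have h2 := hG.P_real a (star f)
    rw [h1, h1, star_add, 𝒮.P_real, star_smul, star_shift, star_star] at h2
    have h3 := add_left_cancel h2
    rw [LinearMap.smul_apply, sub_smul, h3, sub_self, LinearMap.zero_apply]
  -- Either r is real, or `shift` vanishes identically and λ = 0 serves.
  have hP : ∃ lam : ℝ, ∀ a, r • 𝒮.shift a = -((lam : ℂ) • 𝒮.shift a) := by
    by_cases h0 : star r - r = 0
    · obtain ⟨x, hx⟩ := Complex.conj_eq_iff_real.mp (sub_eq_zero.mp h0)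
      refine ⟨-x, fun a => ?_⟩
      rw [hx, Complex.ofReal_neg, neg_smul_end, neg_neg]
    · refine ⟨0, fun a => ?_⟩
      have : 𝒮.shift a = 0 := (smul_eq_zero.mp (hreal a)).resolve_left h0
      rw [this, smul_zero, smul_zero, neg_zero]
  obtain ⟨lam, hlam⟩ := hP
  refine ⟨lam, funext fun α => funext fun i => sub_eq_zero.mp (hS α i),
    funext fun a => sub_eq_zero.mp (hK a),
    funext fun α => funext fun i => sub_eq_zero.mp (hQ α i), funext fun a => ?_⟩
  rw [hatP_eq, eq_add_of_sub_eq (hr a), hlam]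
  abel

theorem eq_deformed {G : Gens A} (hG : 𝒮.IsFieldDeformation G) {lam : ℝ} (hS : G.S = 𝒮.S)
    (hK : G.K = 𝒮.K) (hQ : G.Q = 𝒮.Q) (hP : G.P = 𝒮.hatP lam) : G = 𝒮.deformed lam := by
  have hM := hG.M_eq
  have hD := hG.D_eq
  have hJ := hG.J_eq
  cases G
  simp only at hS hK hQ hP hM hD hJ
  subst hS hK hQ hP hM hD hJ
  rfl

theorem rigidity {G : Gens A} (hG : 𝒮.IsFieldDeformation G) :
    (IsGaugedAlgebra 𝒮.IsCov G ↔ ∃ lam : ℝ, G.S = 𝒮.S ∧ G.K = 𝒮.K ∧ G.Q = 𝒮.Q ∧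
      G.P = 𝒮.hatP lam) ∧
    (G.IsCovariant ↔ ∃ lam : ℝ, G.S = 𝒮.S ∧ G.K = 𝒮.K ∧ G.Q = 𝒮.Q ∧ G.P = 𝒮.hatP lam) := by
  refine ⟨⟨fun h => 𝒮.deformation_eq_of_isCovariant hG h.covariant, ?_⟩,
    ⟨fun h => 𝒮.deformation_eq_of_isCovariant hG h, ?_⟩⟩
  · rintro ⟨lam, hS, hK, hQ, hP⟩
    rw [𝒮.eq_deformed hG hS hK hQ hP]
    exact 𝒮.deformed_isGaugedAlgebra lam
  · rintro ⟨lam, hS, hK, hQ, hP⟩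
    rw [𝒮.eq_deformed hG hS hK hQ hP]
    exact 𝒮.deformed_covariant lam

end ConformalSuperspace

end Superspace

end

/-! ### Spinor components of brackets -/

section

section Operators

variable {A : Type*} [Ring A] [Algebra ℂ A]

/-- The sum over all labels (with each `M_{ab}` counted once) of `x s * w s`. -/
def mixC (w x : Slot → A) : A :=
  (∑ a, x (.P a) * w (.P a)) + (∑ α, ∑ i, x (.Q α i) * w (.Q α i)) +
    (∑ a, ∑ b, x (.M a b) * (1 / 2 : ℂ) • w (.M a b)) + x .D * w .D +
    (∑ i, ∑ j, x (.J i j) * w (.J i j)) + (∑ α, ∑ i, x (.S α i) * w (.S α i)) +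
    ∑ a, x (.K a) * w (.K a)

/-- The components of `T` with labels in `L` are given by `c`. -/
def Gens.Has (G : Gens A) (L : Set Slot) (T : Module.End ℂ A) (c : Slot → A) : Prop :=
  ∃ x, Balanced x ∧ T = G.expand x ∧ ∀ s ∈ L, x s = c s

namespace Gens.Has

variable {G : Gens A} {L : Set Slot} {T T' : Module.End ℂ A} {c c' : Slot → A}

theorem congr (h : G.Has L T c) (e : ∀ s ∈ L, c s = c' s) : G.Has L T c' := by
  obtain ⟨x, bx, rfl, hx⟩ := h
  exact ⟨x, bx, rfl, fun s hs => (hx s hs).trans (e s hs)⟩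

theorem zero : G.Has L 0 0 := ⟨0, ⟨fun _ _ => by simp, fun _ _ => rfl⟩, by simp, fun _ _ => rfl⟩

theorem add (h : G.Has L T c) (h' : G.Has L T' c') : G.Has L (T + T') (c + c') := by
  obtain ⟨x, bx, rfl, hx⟩ := h
  obtain ⟨y, hb, rfl, hy⟩ := h'
  refine ⟨x + y, ⟨fun a b => ?_, fun i j => ?_⟩, (map_add _ _ _).symm, fun s hs => ?_⟩
  · simp only [Pi.add_apply]; rw [bx.M, hb.M, neg_add]
  · simp only [Pi.add_apply]; rw [bx.J, hb.J]
  · simp only [Pi.add_apply]; rw [hx s hs, hy s hs]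

theorem smul (f : A) (h : G.Has L T c) : G.Has L (f • T) (f • c) := by
  obtain ⟨x, bx, rfl, hx⟩ := h
  refine ⟨f • x, ⟨fun a b => ?_, fun i j => ?_⟩, (map_smul _ _ _).symm, fun s hs => ?_⟩
  · simp only [Pi.smul_apply]; rw [bx.M, smul_neg]
  · simp only [Pi.smul_apply]; rw [bx.J]
  · simp only [Pi.smul_apply]; rw [hx s hs]

theorem smul_complex (r : ℂ) (h : G.Has L T c) : G.Has L (r • T) (r • c) := by
  have := h.smul (algebraMap ℂ A r)
  simpa only [algebraMap_smul] using this

theorem neg (h : G.Has L T c) : G.Has L (-T) (-c) := by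
  have := h.smul_complex (-1)
  rw [neg_smul_end, one_smul, neg_smul, one_smul] at this
  exact this

theorem sub (h : G.Has L T c) (h' : G.Has L T' c') : G.Has L (T - T') (c - c') := by
  rw [sub_eq_add_neg, sub_eq_add_neg]; exact h.add h'.neg

theorem sum {ι : Type*} (s : Finset ι) {T : ι → Module.End ℂ A} {c : ι → Slot → A}
    (h : ∀ i, G.Has L (T i) (c i)) : G.Has L (∑ i ∈ s, T i) (∑ i ∈ s, c i) := by
  classical
  induction s using Finset.induction_on with
  | empty => exact zero
  | insert i s hi ih => rw [Finset.sum_insert hi, Finset.sum_insert hi]; exact (h i).add ih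

theorem mix {y : Slot → Module.End ℂ A} {c : Slot → Slot → A} (h : ∀ s, G.Has L (y s) (c s))
    (x : Slot → A) : G.Has L (mix y x) (fun t => mixC (fun s => c s t) x) := by
  have e : (fun t => mixC (fun s => c s t) x) = (∑ a, x (.P a) • c (.P a)) +
      (∑ α, ∑ i, x (.Q α i) • c (.Q α i)) + (∑ a, ∑ b, x (.M a b) • (1 / 2 : ℂ) • c (.M a b)) +
      x .D • c .D + (∑ i, ∑ j, x (.J i j) • c (.J i j)) + (∑ α, ∑ i, x (.S α i) • c (.S α i)) +
      ∑ a, x (.K a) • c (.K a) := by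
    funext t
    simp only [mixC, Pi.add_apply, Finset.sum_apply, Pi.smul_apply, smul_eq_mul]
  rw [e]
  exact ((((((sum _ fun _ => (h _).smul _).add (sum _ fun _ => sum _ fun _ => (h _).smul _)).add
    (sum _ fun _ => sum _ fun _ => ((h _).smul_complex _).smul _)).add ((h _).smul _)).add
    (sum _ fun _ => sum _ fun _ => (h _).smul _)).add
    (sum _ fun _ => sum _ fun _ => (h _).smul _)).add (sum _ fun _ => (h _).smul _)

end Gens.Has

/-- The labels of `∇_α^i` and `S^α_i`. -/
def spinorSlots : Set Slot := {s | s.kind = .Q ∨ s.kind = .S}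

def Slot.singleQ (α i : Fin 4) : Slot → A :=
  Slot.ofQ fun β j => if β = α then if j = i then 1 else 0 else 0

def Slot.singleS (α i : Fin 4) : Slot → A :=
  Slot.ofS fun β j => if β = α then if j = i then 1 else 0 else 0

variable (G : Gens A) (L : Set Slot)

theorem Gens.has_Q (α i : Fin 4) : G.Has L (G.Q α i) (Slot.singleQ α i) := by
  refine ⟨Slot.singleQ α i, ⟨fun _ _ => ?_, fun _ _ => rfl⟩, ?_, fun _ _ => rfl⟩
  · simp [Slot.singleQ, Slot.ofQ]
  · rw [Slot.singleQ, Gens.expand_ofQ]; simp [ite_smul]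

theorem Gens.has_S (α i : Fin 4) : G.Has L (G.S α i) (Slot.singleS α i) := by
  refine ⟨Slot.singleS α i, ⟨fun _ _ => ?_, fun _ _ => rfl⟩, ?_, fun _ _ => rfl⟩
  · simp [Slot.singleS, Slot.ofS]
  · rw [Slot.singleS, Gens.expand_ofS]; simp [ite_smul]

theorem Gens.has_zero_of_mem {N : Kind → Submodule ℂ A} {T : Module.End ℂ A} (hT : T ∈ G.opSpan N)
    (hN : ∀ s ∈ L, N s.kind = ⊥) : G.Has L T 0 := by
  obtain ⟨x, hx, bx, rfl⟩ := hT
  refine ⟨x, bx, rfl, fun s hs => ?_⟩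
  have := hx s
  rw [hN s hs] at this
  exact this

end Operators

section Superspace

variable {A : Type*} [Ring A] [StarRing A] [Algebra ℂ A] [StarModule ℂ A]
  {𝒜 : ZMod 2 → Submodule ℂ A} [GradedAlgebra 𝒜] (𝒮 : ConformalSuperspace 𝒜)

namespace ConformalSuperspace

theorem has_unique {L : Set Slot} {T : Module.End ℂ A} {c c' : Slot → A} (h : 𝒮.Has L T c)
    (h' : 𝒮.Has L T c') {s : Slot} (hs : s ∈ L) : c s = c' s := by
  obtain ⟨x, bx, ex, hx⟩ := h
  obtain ⟨y, hb, ey, hy⟩ := h'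
  have := 𝒮.expand_injective bx hb (ex.symm.trans ey)
  rw [← hx s hs, ← hy s hs, this]

/-- The coefficients which vanish on `∇_α^i` and `S^α_i`. -/
def nonSpinor : Kind → Submodule ℂ A
  | .Q => ⊥
  | .S => ⊥
  | _ => ⊤

theorem one_smul_mem {N : Kind → Submodule ℂ A} {T : Module.End ℂ A}
    (h : (1 : A) • T ∈ 𝒮.opSpan N) : T ∈ 𝒮.opSpan N := by rwa [one_smul] at h

theorem has_zero {L : Set Slot} (hL : L ⊆ spinorSlots) {T : Module.End ℂ A}
    (hT : T ∈ 𝒮.opSpan (nonSpinor (A := A))) : 𝒮.Has L T 0 := by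
  refine Gens.has_zero_of_mem _ _ hT fun s hs => ?_
  rcases hL hs with h | h <;> rw [h] <;> rfl

theorem P_nonSpinor (a : Fin 6) : 𝒮.P a ∈ 𝒮.opSpan (nonSpinor (A := A)) :=
  𝒮.one_smul_mem (Gens.smul_P_mem (show (1 : A) ∈ nonSpinor .P from Submodule.mem_top) a)

theorem M_nonSpinor (a b : Fin 6) : 𝒮.M a b ∈ 𝒮.opSpan (nonSpinor (A := A)) :=
  𝒮.one_smul_mem (Gens.smul_M_mem 𝒮.bosonic (show (1 : A) ∈ nonSpinor .M from Submodule.mem_top) a b)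

theorem D_nonSpinor : 𝒮.D ∈ 𝒮.opSpan (nonSpinor (A := A)) :=
  𝒮.one_smul_mem (Gens.smul_D_mem (show (1 : A) ∈ nonSpinor .D from Submodule.mem_top))

theorem J_nonSpinor (i j : Fin 4) : 𝒮.J i j ∈ 𝒮.opSpan (nonSpinor (A := A)) :=
  𝒮.one_smul_mem (Gens.smul_J_mem 𝒮.bosonic (show (1 : A) ∈ nonSpinor .J from Submodule.mem_top) i j)

theorem K_nonSpinor (a : Fin 6) : 𝒮.K a ∈ 𝒮.opSpan (nonSpinor (A := A)) :=
  𝒮.one_smul_mem (Gens.smul_K_mem (show (1 : A) ∈ nonSpinor .K from Submodule.mem_top) a)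

theorem Kup_nonSpinor (a : Fin 6) : 𝒮.Kup a ∈ 𝒮.opSpan (nonSpinor (A := A)) := by
  rw [Kup_eq]; exact Submodule.smul_mem _ _ (𝒮.K_nonSpinor a)

theorem Mss_nonSpinor (α β : Fin 4) : 𝒮.Mss α β ∈ 𝒮.opSpan (nonSpinor (A := A)) :=
  Submodule.sum_mem _ fun _ _ => Submodule.sum_mem _ fun _ _ => Submodule.sum_mem _ fun _ _ =>
    Submodule.sum_mem _ fun _ _ => Submodule.smul_mem _ _ (𝒮.M_nonSpinor _ _)

theorem Pss_nonSpinor (α β : Fin 4) : 𝒮.Pss α β ∈ 𝒮.opSpan (nonSpinor (A := A)) :=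
  Submodule.sum_mem _ fun _ _ => Submodule.smul_mem _ _ (𝒮.P_nonSpinor _)

theorem smul_nonSpinor (f : A) {T : Module.End ℂ A} (hT : T ∈ 𝒮.opSpan (nonSpinor (A := A))) :
    f • T ∈ 𝒮.opSpan (nonSpinor (A := A)) := by
  refine Gens.smul_mem_opSpan (fun k g hg => ?_) hT
  cases k <;> first
    | exact trivial
    | (rw [show g = 0 from hg, mul_zero]; exact zero_mem _)

theorem acomm_SQ_nonSpinor (α i β j : Fin 4) :
    acomm (𝒮.S α i) (𝒮.Q β j) ∈ 𝒮.opSpan (nonSpinor (A := A)) := by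
  rw [𝒮.structureFunctions.SQ]
  refine add_mem (add_mem (sub_mem ?_ ?_) ?_) ?_
  · exact Submodule.smul_mem _ _ 𝒮.D_nonSpinor
  · exact Submodule.smul_mem _ _ (𝒮.Mss_nonSpinor _ _)
  · refine Submodule.smul_mem _ _ ?_
    rw [Gens.Jmix, low]
    exact Submodule.sum_mem _ fun _ _ => Submodule.smul_mem _ _ (𝒮.J_nonSpinor _ _)
  · exact Submodule.sum_mem _ fun _ _ => 𝒮.smul_nonSpinor _ (𝒮.Kup_nonSpinor _)

theorem comm_Q_Kup (β j : Fin 4) (a : Fin 6) : comm (𝒮.Q β j) (𝒮.Kup a) =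
    Complex.I • ∑ δ, gU a β δ • ∑ l, OmU j l • 𝒮.S δ l := by
  have h : ∀ δ, gL a β δ = eta a a * gU a β δ := fun δ => gL_apply a β δ
  rw [comm_swap, Kup_eq, comm_swap, neg_neg, comm_smul_right, comm_swap, 𝒮.structureFunctions.KQ,
    Gens.flatKQ]
  simp only [Finset.smul_sum, ← Finset.sum_neg_distrib, h, Gens.Sup, raise]
  refine Finset.sum_congr rfl fun δ _ => Finset.sum_congr rfl fun l _ => ?_
  rw [← neg_smul_end]
  simp only [smul_smul]
  congr 1
  linear_combination (Complex.I * gU a β δ * OmU j l) * eta_mul_self a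

theorem comm_Q_Mss (β j y z : Fin 4) : comm (𝒮.Q β j) (𝒮.Mss y z) =
    kd z β • 𝒮.Q y j - (1 / 4 * kd y z) • 𝒮.Q β j := by
  rw [comm_swap, comm_Mss_Q, lrot, neg_sub]

/-- The components of `[∇_β^j, {∇_γ^k, ∇_α^i}]` apart from the torsion term. -/
theorem has_comm_Q_curvQQ {L : Set Slot} (hL : L ⊆ spinorSlots) (β j γ k α i : Fin 4) :
    𝒮.Has L (comm (𝒮.Q β j) (curvQQ 𝒮.toGens 𝒮.W γ k α i))
      (Slot.ofQ (fun y l => (-(1 / 2) * kd l j) • ∑ x, lc γ α x β • 𝒮.W x y k i) +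
        Slot.ofS fun δ l => (1 / 40 : ℂ) • ∑ x, lc γ α x δ • 𝒮.Q β j (X16 𝒮.toGens 𝒮.W x l k i) +
          (Complex.I * OmU j l) • ∑ a, gU a β δ • 𝒮.curvK γ k α i a) := by
  have hX : ∀ x l, X16 𝒮.toGens 𝒮.W x l k i ∈ 𝒜 1 := fun x l => 𝒮.cov_graded (𝒮.X16_mem_cov x l k i)
  have hK : ∀ a, 𝒮.curvK γ k α i a ∈ 𝒜 0 := fun a => 𝒮.cov_graded (𝒮.curvK_mem_cov γ k α i a)
  have h1 : 𝒮.Has L (∑ x, ∑ y, ∑ z, (-(1 / 2) * lc γ α x z) •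
      (𝒮.Q β j (𝒮.W x y k i) • 𝒮.Mss y z + 𝒮.W x y k i • comm (𝒮.Q β j) (𝒮.Mss y z)))
      (∑ x, ∑ y, ∑ z, (-(1 / 2) * lc γ α x z) •
        (𝒮.Q β j (𝒮.W x y k i) • (0 : Slot → A) + 𝒮.W x y k i • (kd z β • Slot.singleQ y j -
          (1 / 4 * kd y z) • Slot.singleQ β j))) := by
    refine .sum _ fun x => .sum _ fun y => .sum _ fun z => .smul_complex _ <| .add
      (.smul _ (𝒮.has_zero hL (𝒮.Mss_nonSpinor _ _))) (.smul _ ?_)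
    rw [comm_Q_Mss]
    exact ((𝒮.has_Q L _ _).smul_complex _).sub ((𝒮.has_Q L _ _).smul_complex _)
  have h2 : 𝒮.Has L (∑ x, ∑ δ, ∑ l, ((1 / 40) * lc γ α x δ) •
      (𝒮.Q β j (X16 𝒮.toGens 𝒮.W x l k i) • 𝒮.S δ l -
        X16 𝒮.toGens 𝒮.W x l k i • acomm (𝒮.Q β j) (𝒮.S δ l)))
      (∑ x, ∑ δ, ∑ l, ((1 / 40) * lc γ α x δ) •
        (𝒮.Q β j (X16 𝒮.toGens 𝒮.W x l k i) • Slot.singleS δ l -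
          X16 𝒮.toGens 𝒮.W x l k i • (0 : Slot → A))) := by
    refine .sum _ fun x => .sum _ fun y => .sum _ fun z => .smul_complex _ <| .sub
      ((𝒮.has_S L _ _).smul _) (.smul _ (𝒮.has_zero hL ?_))
    rw [acomm_swap]
    exact 𝒮.acomm_SQ_nonSpinor _ _ _ _
  have h3 : 𝒮.Has L (∑ a, (𝒮.Q β j (𝒮.curvK γ k α i a) • 𝒮.Kup a +
      𝒮.curvK γ k α i a • comm (𝒮.Q β j) (𝒮.Kup a)))
      (∑ a, (𝒮.Q β j (𝒮.curvK γ k α i a) • (0 : Slot → A) + 𝒮.curvK γ k α i a •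
        Complex.I • ∑ δ, gU a β δ • ∑ l, OmU j l • Slot.singleS δ l)) := by
    refine .sum _ fun a => .add (.smul _ (𝒮.has_zero hL (𝒮.Kup_nonSpinor _))) (.smul _ ?_)
    rw [comm_Q_Kup]
    exact .smul_complex _ <| .sum _ fun _ => .smul_complex _ <| .sum _ fun _ =>
      .smul_complex _ (𝒮.has_S L _ _)
  rw [curvQQ_eq, comm_add_right, comm_add_right]
  simp only [comm_sum_right, comm_smul_right,
    (𝒮.Q_der β j).comm_smul_even (𝒮.W_even _ _ _ _), (𝒮.Q_der β j).comm_smul_odd (hX _ _),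
    (𝒮.Q_der β j).comm_smul_even (hK _)]
  refine ((h1.add h2).add h3).congr fun s hs => ?_
  -- The trace part of the rotation by M meets ε contracted with the symmetric pair of `W`.
  have hlc : ∑ x, ∑ y, lc γ α x y • 𝒮.W x y k i = 0 := by
    refine eq_zero_of_eq_neg ?_
    conv_lhs => rw [Finset.sum_comm]
    simp only [← Finset.sum_neg_distrib]
    refine Finset.sum_congr rfl fun x _ => Finset.sum_congr rfl fun y _ => ?_
    have : lc γ α y x = -lc γ α x y := by simp only [lc]; push_cast; ring
    rw [this, 𝒮.W_symm, neg_smul]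
  cases s with
  | Q y l =>
    simp only [Pi.add_apply, Finset.sum_apply, Pi.smul_apply, Pi.sub_apply, Pi.zero_apply,
      Slot.singleQ, Slot.singleS, Slot.ofQ, Slot.ofS, smul_zero, sub_zero, zero_add, add_zero,
      Finset.sum_const_zero]
    by_cases hl : l = j
    · subst hl
      have h2 : ∑ x, ∑ c, ∑ d, (-(1 / 2) * lc γ α x d) • (𝒮.W x c k i • ((1 / 4 * kd c d) •
          if y = β then (1 : A) else 0)) = 0 := by
        have : ∀ x c, ∑ d, (-(1 / 2) * lc γ α x d) • (𝒮.W x c k i • ((1 / 4 * kd c d) •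
          if y = β then (1 : A) else 0)) = (-(1 / 8) : ℂ) •
            ((lc γ α x c • 𝒮.W x c k i) * if y = β then (1 : A) else 0) := by
          intro x c
          rw [Finset.sum_eq_single c]
          · rw [show kd c c = 1 from if_pos rfl, smul_eq_mul, mul_smul_comm, smul_mul_assoc,
              smul_smul, smul_smul]
            congr 1; ring
          · intro d _ hd
            rw [show kd c d = 0 from if_neg hd.symm, mul_zero, zero_smul, smul_zero, smul_zero]
          · simp
        simp only [this, ← Finset.smul_sum, ← Finset.sum_mul, hlc, zero_mul, smul_zero]
      simp only [if_true, smul_sub, Finset.sum_sub_distrib]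
      rw [h2, sub_zero, show kd l l = 1 from if_pos rfl, mul_one, Finset.smul_sum]
      refine Finset.sum_congr rfl fun x _ => ?_
      rw [Finset.sum_eq_single y, Finset.sum_eq_single β]
      · rw [show kd β β = 1 from if_pos rfl, if_pos rfl, one_smul, smul_eq_mul, mul_one, smul_smul]
      · intro d _ hd
        rw [show kd d β = 0 from if_neg hd, zero_smul, smul_zero, smul_zero]
      · simp
      · intro c _ hc
        simp only [if_neg hc.symm, smul_zero, Finset.sum_const_zero]
      · simp
    · simp only [if_neg hl, ite_self, smul_zero, sub_zero, Finset.sum_const_zero,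
        show kd l j = 0 from if_neg hl, mul_zero, zero_smul]
  | S δ l =>
    simp only [Pi.add_apply, Finset.sum_apply, Pi.smul_apply, Pi.sub_apply, Pi.zero_apply,
      Slot.singleQ, Slot.singleS, Slot.ofQ, Slot.ofS, smul_zero, sub_zero, zero_add, add_zero,
      Finset.sum_const_zero]
    congr 1
    · rw [Finset.smul_sum]
      refine Finset.sum_congr rfl fun x _ => ?_
      rw [Finset.sum_eq_single δ, Finset.sum_eq_single l]
      · rw [if_pos rfl, if_pos rfl, smul_eq_mul, mul_one, smul_smul]
      · intro d _ hd
        rw [if_pos rfl, if_neg hd.symm, smul_zero, smul_zero]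
      · simp
      · intro c _ hc
        simp only [if_neg hc.symm, smul_zero, Finset.sum_const_zero]
      · simp
    · rw [Finset.smul_sum]
      refine Finset.sum_congr rfl fun a _ => ?_
      rw [Finset.sum_eq_single δ, Finset.sum_eq_single l]
      · rw [if_pos rfl, if_pos rfl, smul_comm (𝒮.curvK γ k α i a), smul_comm (𝒮.curvK γ k α i a),
          smul_comm (𝒮.curvK γ k α i a), smul_eq_mul, mul_one, smul_smul, smul_smul, smul_smul]
        congr 1; ring
      · intro d _ hd
        rw [if_pos rfl, if_neg hd.symm, smul_zero]
      · simp
      · intro c _ hc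
        simp only [if_neg hc.symm, smul_zero, Finset.sum_const_zero]
      · simp
  | P a => exact (hL hs).elim nofun nofun
  | M a b => exact (hL hs).elim nofun nofun
  | D => exact (hL hs).elim nofun nofun
  | J a b => exact (hL hs).elim nofun nofun
  | K a => exact (hL hs).elim nofun nofun

end ConformalSuperspace

end Superspace

end

/-! ### Torsion and S-curvature in the commutator of `Q` and `P` -/

section

theorem omTrace_raise {V : Type*} [AddCommGroup V] [Module ℂ V] (G : Fin 4 → Fin 4 → V) :
    ∑ j, ∑ k, OmL j k • omTrace (fun l i => OmU j l • G k i) = -omTrace G := by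
  simp only [omTrace, Finset.smul_sum, smul_smul]
  rw [Finset.sum_comm, ← Finset.sum_neg_distrib]
  refine Finset.sum_congr rfl fun k _ => ?_
  rw [Finset.sum_comm]
  have : ∀ l, ∑ j, ∑ i, (OmL j k * (OmL l i * OmU j l)) • G k i = -kd k l • ∑ i, OmL l i • G k i := by
    intro l
    rw [← sum_OmL_OmU_left, Finset.sum_smul]
    simp only [Finset.smul_sum, smul_smul]
    exact Finset.sum_congr rfl fun _ _ => Finset.sum_congr rfl fun _ _ => by congr 1; ring
  simp only [this]
  rw [Finset.sum_eq_single k]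
  · rw [show kd k k = 1 from if_pos rfl, neg_smul, one_smul]
  · intro l _ hl
    rw [show kd k l = 0 from if_neg hl.symm, neg_zero, zero_smul]
  · simp

variable {A : Type*} [Ring A] [StarRing A] [Algebra ℂ A] [StarModule ℂ A]
  {𝒜 : ZMod 2 → Submodule ℂ A} [GradedAlgebra 𝒜] (𝒮 : ConformalSuperspace 𝒜)

namespace ConformalSuperspace

/-- The derivative is contracted with `W` in both kinds of indices: this is the superspace
constraint again. -/
theorem omTrace_X16_left (δ k : Fin 4) : omTrace (fun l i => X16 𝒮.toGens 𝒮.W δ l k i) = 0 := by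
  have h := 𝒮.constraint_trace δ k
  simp only [low, map_sum, map_smul] at h
  have e : omTrace (fun l i => X16 𝒮.toGens 𝒮.W δ l k i) =
      ∑ β, ∑ l, ∑ i, OmL l i • 𝒮.Q β l (𝒮.W β δ k i) := by
    simp only [X16, omTrace_sum, 𝒮.W_symm δ]
    rfl
  rw [e, h]

/-- The `∇_y^l`-component of `curvDer`. -/
def curvDerQ (β γ α i y l : Fin 4) : A :=
  ∑ x, ∑ k, (-(1 / 2) * lc γ α x β * OmL l k) • 𝒮.W x y k i

/-- The `S^δ_l`-component of `curvDer`. -/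
def curvDerS (β γ α i δ l : Fin 4) : A :=
  ∑ j, ∑ k, OmL j k • ((1 / 40 : ℂ) • (∑ x, lc γ α x δ • 𝒮.Q β j (X16 𝒮.toGens 𝒮.W x l k i)) +
    OmU j l • Complex.I • ∑ a, gU a β δ • 𝒮.curvK γ k α i a)

/-- The X terms drop by the superspace constraint, the K terms by tracelessness of `curvK`. The
explicit S-curvature is therefore not needed in the traced Bianchi identity. -/
theorem omTrace_curvDerS (β γ α δ : Fin 4) :
    omTrace (fun l i => 𝒮.curvDerS β γ α i δ l) = 0 := by
  simp only [curvDerS, omTrace_sum, omTrace_smul, omTrace_add, omTrace_map, omTrace_X16_left,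
    map_zero, smul_zero, Finset.sum_const_zero, zero_add]
  rw [omTrace_raise (fun k i => Complex.I • ∑ a, gU a β δ • 𝒮.curvK γ k α i a)]
  simp only [omTrace_sum, omTrace_smul, omTrace_curvK, smul_zero, Finset.sum_const_zero, neg_zero]

theorem has_curvDer {L : Set Slot} (hL : L ⊆ spinorSlots) (β γ α i : Fin 4) :
    𝒮.Has L (𝒮.curvDer β γ α i)
      (Slot.ofQ (𝒮.curvDerQ β γ α i) + Slot.ofS (𝒮.curvDerS β γ α i)) := by
  refine (Gens.Has.sum _ fun j => .sum _ fun k => .smul_complex (OmL j k)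
    (𝒮.has_comm_Q_curvQQ hL β j γ k α i)).congr fun s hs => ?_
  cases s with
  | Q y l =>
    simp only [Pi.add_apply, Finset.sum_apply, Pi.smul_apply, Slot.ofQ, Slot.ofS, add_zero,
      curvDerQ]
    rw [Finset.sum_comm]
    conv_rhs => rw [Finset.sum_comm]
    refine Finset.sum_congr rfl fun k _ => ?_
    rw [Finset.sum_eq_single l]
    · rw [show kd l l = 1 from if_pos rfl, smul_smul, Finset.smul_sum]
      simp only [smul_smul]
      exact Finset.sum_congr rfl fun _ _ => by congr 1; ring
    · intro j _ hj
      rw [show kd l j = 0 from if_neg hj.symm, mul_zero, zero_smul, smul_zero]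
    · simp
  | S δ l =>
    simp only [Pi.add_apply, Finset.sum_apply, Pi.smul_apply, Slot.ofQ, Slot.ofS, zero_add,
      curvDerS]
    refine Finset.sum_congr rfl fun j _ => Finset.sum_congr rfl fun k _ => ?_
    rw [smul_smul (OmU j l), mul_comm (OmU j l)]
  | P a => exact (hL hs).elim nofun nofun
  | M a b => exact (hL hs).elim nofun nofun
  | D => exact (hL hs).elim nofun nofun
  | J a b => exact (hL hs).elim nofun nofun
  | K a => exact (hL hs).elim nofun nofun

/-- The `∇_y^l`-component of `[∇_α^i, ∇_b]`. -/
def torsQ (b : Fin 6) (α i y l : Fin 4) : A :=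
  ∑ x, ∑ k, (Complex.I / 8 * gL b α x * OmL l k) • 𝒮.W x y k i

/-- The `S^δ_l`-component of `[∇_α^i, ∇_b]`. -/
def curvS (b : Fin 6) (α i δ l : Fin 4) : A :=
  (1 / 4 : ℂ) • ∑ β, ∑ γ, gtL b β γ • (Complex.I / 20) • ((3 : ℂ) • (𝒮.curvDerS β γ α i δ l -
    𝒮.curvDerS γ β α i δ l) + (𝒮.curvDerS γ α β i δ l - 𝒮.curvDerS α γ β i δ l) +
    (𝒮.curvDerS α β γ i δ l - 𝒮.curvDerS β α γ i δ l))

theorem omTrace_curvS (b : Fin 6) (α δ : Fin 4) : omTrace (fun l i => 𝒮.curvS b α i δ l) = 0 := by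
  simp only [curvS, omTrace_sum, omTrace_smul, omTrace_add, omTrace_sub, omTrace_curvDerS, sub_zero,
    smul_zero, Finset.sum_const_zero, add_zero]

theorem has_comm_Q_P {L : Set Slot} (hL : L ⊆ spinorSlots) (b : Fin 6) (α i : Fin 4) :
    𝒮.Has L (comm (𝒮.Q α i) (𝒮.P b))
      (Slot.ofQ (𝒮.torsQ b α i) + Slot.ofS (𝒮.curvS b α i)) := by
  have h := 𝒮.has_curvDer hL
  rw [comm_P_eq]
  simp only [comm_Q_Pss]
  refine (Gens.Has.smul_complex _ <| Gens.Has.sum _ fun β => Gens.Has.sum _ fun γ =>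
    .smul_complex _ <| .smul_complex _ <| Gens.Has.add (.add (.smul_complex _ ((h β γ α i).sub
      (h γ β α i))) ((h γ α β i).sub (h α γ β i))) ((h α β γ i).sub (h β α γ i))).congr
      fun s hs => ?_
  cases s with
  | Q y l =>
    simp only [Pi.add_apply, Finset.sum_apply, Pi.smul_apply, Pi.sub_apply, Slot.ofQ, Slot.ofS,
      add_zero]
    -- The six terms from the solved Jacobi identity all carry ε with the same four indices, so they
    -- add up to one; contraction with the gamma matrix makes it `gL`.
    have e : ∀ β γ, (Complex.I / 20) • ((3 : ℂ) • (𝒮.curvDerQ β γ α i y l -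
        𝒮.curvDerQ γ β α i y l) + (𝒮.curvDerQ γ α β i y l - 𝒮.curvDerQ α γ β i y l) +
        (𝒮.curvDerQ α β γ i y l - 𝒮.curvDerQ β α γ i y l)) =
        ∑ x, ∑ k, (Complex.I / 4 * lc α x β γ * OmL l k) • 𝒮.W x y k i := by
      intro β γ
      simp only [curvDerQ, ← Finset.sum_sub_distrib, ← Finset.sum_add_distrib, Finset.smul_sum,
        ← sub_smul, ← add_smul, smul_smul]
      refine Finset.sum_congr rfl fun x _ => Finset.sum_congr rfl fun k _ => ?_
      congr 1
      simp only [lc]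
      push_cast
      ring
    simp only [e, torsQ, Finset.smul_sum, smul_smul]
    rw [Finset.sum_congr rfl fun β _ => Finset.sum_comm, Finset.sum_comm]
    refine Finset.sum_congr rfl fun x _ => ?_
    rw [Finset.sum_congr rfl fun β _ => Finset.sum_comm, Finset.sum_comm]
    refine Finset.sum_congr rfl fun k _ => ?_
    simp only [← Finset.sum_smul]
    congr 1
    have hg := gL_eq_lc_gtL b α x
    have : Complex.I / 8 * gL b α x * OmL l k = Complex.I / 16 * OmL l k * (2 * gL b α x) := by ring
    rw [this, ← hg]
    simp only [Finset.mul_sum]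
    exact Finset.sum_congr rfl fun _ _ => Finset.sum_congr rfl fun _ _ => by ring
  | S δ l =>
    simp only [Pi.add_apply, Finset.sum_apply, Pi.smul_apply, Pi.sub_apply, Slot.ofQ, Slot.ofS,
      zero_add]
    rfl
  | P a => exact (hL hs).elim nofun nofun
  | M a b => exact (hL hs).elim nofun nofun
  | D => exact (hL hs).elim nofun nofun
  | J a b => exact (hL hs).elim nofun nofun
  | K a => exact (hL hs).elim nofun nofun

end ConformalSuperspace

end

/-! ### The curvatures R(P) and R(D), and the gamma trace of R(Q) -/

section

section Trace

variable {V : Type*} [AddCommGroup V] [Module ℂ V]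

/-- The gamma trace of a vector-spinor is a spinor. -/
theorem slash_trace (e f : Fin 6) (δ : Fin 4) (w : Fin 6 → Fin 4 → V) :
    ∑ a, ∑ γ, gU a δ γ • (vrot e f (fun d => w d γ) a + (1 / 2 : ℂ) • ∑ α, gam2 e f α γ • w a α) =
      (-(1 / 2) : ℂ) • ∑ z, gam2 e f δ z • ∑ a, ∑ γ, gU a z γ • w a γ := by
  simp only [smul_add, Finset.sum_add_distrib]
  rw [Finset.sum_comm]
  simp only [slash_vrot, Finset.sum_add_distrib]
  have h1 : ∑ γ, (-(1 / 2) : ℂ) • ∑ z, gam2 e f δ z • ∑ d, gU d z γ • w d γ =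
      (-(1 / 2) : ℂ) • ∑ z, gam2 e f δ z • ∑ a, ∑ γ, gU a z γ • w a γ := by
    rw [← Finset.smul_sum, Finset.sum_comm]
    congr 1
    refine Finset.sum_congr rfl fun z _ => ?_
    rw [← Finset.smul_sum, Finset.sum_comm]
  have h2 : ∑ γ, (-(1 / 2) : ℂ) • ∑ z, gam2 e f γ z • ∑ d, gU d δ z • w d γ =
      -∑ a, ∑ γ, gU a δ γ • (1 / 2 : ℂ) • ∑ α, gam2 e f α γ • w a α := by
    simp only [Finset.smul_sum]
    rw [Finset.sum_congr rfl fun γ _ => Finset.sum_comm, Finset.sum_comm,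
      ← Finset.sum_neg_distrib]
    refine Finset.sum_congr rfl fun a _ => ?_
    rw [Finset.sum_comm, ← Finset.sum_neg_distrib]
    refine Finset.sum_congr rfl fun γ _ => ?_
    rw [← Finset.sum_neg_distrib]
    exact Finset.sum_congr rfl fun α _ => by module
  rw [h1, h2, neg_add_cancel_right]

theorem vrot_sum_sum {ι κ : Type*} [Fintype ι] [Fintype κ] (e f b : Fin 6) (c : ι → κ → ℂ)
    (w : Fin 6 → ι → κ → V) : vrot e f (fun d => ∑ i, ∑ k, c i k • w d i k) b =
      ∑ i, ∑ k, c i k • vrot e f (fun d => w d i k) b := by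
  simp only [vrot, smul_sub, Finset.sum_sub_distrib, Finset.smul_sum, smul_comm (eta _ _)]

end Trace

variable {A : Type*} [Ring A] [StarRing A] [Algebra ℂ A] [StarModule ℂ A]
  {𝒜 : ZMod 2 → Submodule ℂ A} [GradedAlgebra 𝒜] (𝒮 : ConformalSuperspace 𝒜)

theorem map_raise_vector_spinor (M : Module.End ℂ A) (e f : Fin 6) {t : Fin 6 → Fin 4 → Fin 4 → A}
    {b : Fin 6} {δ : Fin 4} (h : ∀ k, M (t b δ k) = vrot e f (fun d => t d δ k) b +
      (-(1 / 2) : ℂ) • ∑ z, gam2 e f δ z • t b z k) (k : Fin 4) : M (raise (t b δ) k) =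
      vrot e f (fun d => raise (t d δ) k) b +
        (-(1 / 2) : ℂ) • ∑ z, gam2 e f δ z • raise (t b z) k := by
  simp only [raise, map_sum, map_smul, h, smul_add, Finset.sum_add_distrib]
  congr 1
  · simp only [vrot, smul_sub, Finset.sum_sub_distrib, Finset.smul_sum, smul_comm (eta _ _)]
  · simp only [Finset.smul_sum]
    rw [Finset.sum_comm]
    exact Finset.sum_congr rfl fun z _ => Finset.sum_congr rfl fun l _ => by module

namespace ConformalSuperspace

/-- The components of `[∇_a, ∇_b]`. -/
def vecCurv (a b : Fin 6) : Slot → A := (𝒮.comm_PP_mem a b).choose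

theorem vecCurv_mem (a b : Fin 6) (s : Slot) : 𝒮.vecCurv a b s ∈ 𝒮.cov (4 - s.kind.wt) :=
  (𝒮.comm_PP_mem a b).choose_spec.1 s

theorem vecCurv_balanced (a b : Fin 6) : Balanced (𝒮.vecCurv a b) :=
  (𝒮.comm_PP_mem a b).choose_spec.2.1

theorem comm_PP (a b : Fin 6) : comm (𝒮.P a) (𝒮.P b) = 𝒮.expand (𝒮.vecCurv a b) :=
  (𝒮.comm_PP_mem a b).choose_spec.2.2

theorem vecCurv_antisymm (a b : Fin 6) (s : Slot) : 𝒮.vecCurv a b s = -𝒮.vecCurv b a s := by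
  have h : 𝒮.expand (𝒮.vecCurv a b) = 𝒮.expand (-𝒮.vecCurv b a) := by
    rw [map_neg, ← comm_PP, ← comm_PP, comm_swap]
  refine congrFun (𝒮.expand_injective (𝒮.vecCurv_balanced a b) ⟨fun c d => ?_, fun i j => ?_⟩ h) s
  · simp only [Pi.neg_apply]; rw [(𝒮.vecCurv_balanced b a).M]
  · simp only [Pi.neg_apply]; rw [(𝒮.vecCurv_balanced b a).J]

theorem J_vecCurv (a b : Fin 6) (i j : Fin 4) (s : Slot) : act (𝒮.J i j) 0 0 0 0 0 (jmat i j)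
    (fun k l => -jmat i j l k) (jmat i j) (𝒮.vecCurv a b) s = 0 := by
  refine 𝒮.J_slot_vector (x := fun b => 𝒮.vecCurv a b) (𝒮.vecCurv_balanced a) (fun i j c => ?_) i j b s
  rw [← comm_PP, comm_comm, 𝒮.covariant.JP, 𝒮.covariant.JP]
  simp [comm]

theorem M_vecCurv (a b c d : Fin 6) (s : Slot) : act (𝒮.M a b) (vmat a b) (vmat a b) (vmat a b)
    (fun γ δ => -(1 / 2) * gam2 a b γ δ) (fun γ δ => -(1 / 2) * gamt2 a b γ δ) 0 0 0
      (𝒮.vecCurv c d) s =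
      vrot a b (fun e => 𝒮.vecCurv e d s) c + vrot a b (fun e => 𝒮.vecCurv c e s) d := by
  have h : comm (𝒮.M a b) (𝒮.expand (𝒮.vecCurv c d)) =
      𝒮.expand (∑ e, vmat a b c e • 𝒮.vecCurv e d + ∑ e, vmat a b d e • 𝒮.vecCurv c e) := by
    rw [map_add, expand_sum_smul, expand_sum_smul, ← comm_PP, comm_comm, 𝒮.covariant.MP,
      𝒮.covariant.MP, vrot_eq_sum, vrot_eq_sum, comm_sum_right, comm_swap]
    simp only [comm_sum_right, comm_smul_right, ← comm_PP, ← Finset.sum_neg_distrib, ← smul_neg]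
    congr 1
    exact Finset.sum_congr rfl fun e _ => by rw [comm_swap (𝒮.P e), smul_neg]
  rw [(𝒮.M_actsBy a b).comm_expand (𝒮.M_der a b)] at h
  have h2 := congrFun (𝒮.expand_injective (𝒮.vecCurv_balanced c d).act ⟨fun e f => ?_, fun i j => ?_⟩
    h) s
  · rw [h2, vrot_eq_sum, vrot_eq_sum]
    simp only [Pi.add_apply, Finset.sum_apply, Pi.smul_apply]
  · have h1 := (Balanced.sum_smul Finset.univ (vmat a b c) fun e => 𝒮.vecCurv_balanced e d).M e f
    have h2 := (Balanced.sum_smul Finset.univ (vmat a b d) fun e => 𝒮.vecCurv_balanced c e).M e f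
    rw [Pi.add_apply, Pi.add_apply, h1, h2, neg_add]
  · have h1 := (Balanced.sum_smul Finset.univ (vmat a b c) fun e => 𝒮.vecCurv_balanced e d).J i j
    have h2 := (Balanced.sum_smul Finset.univ (vmat a b d) fun e => 𝒮.vecCurv_balanced c e).J i j
    rw [Pi.add_apply, Pi.add_apply, h1, h2]

/-- A `USp(4)` singlet of dimension 1. -/
theorem vecCurv_P (a b c : Fin 6) : 𝒮.vecCurv a b (.P c) = 0 :=
  𝒮.cov_two_singlet (𝒮.vecCurv_mem a b (.P c)) fun i j => by
    simpa [act] using 𝒮.J_vecCurv a b i j (.P c)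

/-- A two-vector singlet of dimension 2 is a multiple of the symmetric `WW`, but this one is
antisymmetric. -/
theorem vecCurv_D (a b : Fin 6) : 𝒮.vecCurv a b .D = 0 := by
  obtain ⟨r, hr⟩ := 𝒮.exists_eq_smul_WW (f := fun a b => 𝒮.vecCurv a b .D)
    (fun a b => 𝒮.vecCurv_mem a b .D) (fun i j a b => by
      simpa [act] using 𝒮.J_vecCurv a b i j .D) (fun a b c d => by
      simpa [act] using 𝒮.M_vecCurv a b c d .D)
  refine eq_zero_of_eq_neg ?_
  rw [← vecCurv_antisymm, hr, hr, WW_comm]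

theorem M_vecCurv_Q (e f a b : Fin 6) (γ k : Fin 4) : 𝒮.M e f (𝒮.vecCurv a b (.Q γ k)) =
    vrot e f (fun d => 𝒮.vecCurv d b (.Q γ k)) a + vrot e f (fun d => 𝒮.vecCurv a d (.Q γ k)) b +
      (1 / 2 : ℂ) • ∑ α, gam2 e f α γ • 𝒮.vecCurv a b (.Q α k) := by
  have h := 𝒮.M_vecCurv e f a b (.Q γ k)
  simp only [act, Pi.zero_apply, zero_smul, Finset.sum_const_zero, add_zero] at h
  rw [← h, Finset.smul_sum, add_assoc, ← Finset.sum_add_distrib]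
  have : ∀ α, (-(1 / 2) * gam2 e f α γ) • 𝒮.vecCurv a b (.Q α k) +
      (1 / 2 : ℂ) • gam2 e f α γ • 𝒮.vecCurv a b (.Q α k) = 0 := fun α => by module
  simp only [this, Finset.sum_const_zero, add_zero]

/-- The gamma trace of the gravitino field strength vanishes. -/
theorem vecCurv_Q_trace (b : Fin 6) (δ k : Fin 4) :
    ∑ a, ∑ γ, gU a δ γ • 𝒮.vecCurv a b (.Q γ k) = 0 := by
  -- With the `USp(4)` index raised, the gamma trace is a vector-spinor of dimension 3/2, and there
  -- is none.
  refine eq_zero_of_raise_eq_zero (x := fun k => ∑ a, ∑ γ, gU a δ γ • 𝒮.vecCurv a b (.Q γ k))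
    (fun k => ?_) k
  refine 𝒮.cov_three_vector_spinor (t := fun b δ k =>
    raise (fun k => ∑ a, ∑ γ, gU a δ γ • 𝒮.vecCurv a b (.Q γ k)) k) (fun b δ k => ?_)
    (fun i j b δ k => ?_) (fun e f b δ k => ?_) b δ k
  · exact Submodule.sum_mem _ fun l _ => Submodule.smul_mem _ _ <| Submodule.sum_mem _ fun a _ =>
      Submodule.sum_mem _ fun γ _ => Submodule.smul_mem _ _ (𝒮.vecCurv_mem a b (.Q γ l))
  · refine map_raise_of_covector (𝒮.J i j) i j (fun k => ?_) k
    have h : ∀ a γ, 𝒮.J i j (𝒮.vecCurv a b (.Q γ k)) =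
        -∑ m, jmat i j m k • 𝒮.vecCurv a b (.Q γ m) := fun a γ =>
      eq_neg_of_add_eq_zero_left (by simpa [act] using 𝒮.J_vecCurv a b i j (.Q γ k))
    simp only [map_sum, map_smul, h, smul_neg, Finset.sum_neg_distrib]
    rw [neg_add_eq_zero]
    simp only [Finset.smul_sum]
    rw [Finset.sum_congr rfl fun a _ => Finset.sum_comm, Finset.sum_comm]
    exact Finset.sum_congr rfl fun m _ => Finset.sum_congr rfl fun a _ =>
      Finset.sum_congr rfl fun γ _ => smul_comm _ _ _
  · have h : ∀ k, 𝒮.M e f (∑ a, ∑ γ, gU a δ γ • 𝒮.vecCurv a b (.Q γ k)) =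
      vrot e f (fun d => ∑ a, ∑ γ, gU a δ γ • 𝒮.vecCurv a d (.Q γ k)) b +
        (-(1 / 2) : ℂ) • ∑ z, gam2 e f δ z • ∑ a, ∑ γ, gU a z γ • 𝒮.vecCurv a b (.Q γ k) := by
      intro k
      rw [← slash_trace e f δ fun a γ => 𝒮.vecCurv a b (.Q γ k), vrot_sum_sum]
      simp only [map_sum, map_smul]
      simp only [← Finset.sum_add_distrib]
      refine Finset.sum_congr rfl fun a _ => Finset.sum_congr rfl fun γ _ => ?_
      rw [𝒮.M_vecCurv_Q, smul_add, smul_add, smul_add]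
      abel
    exact map_raise_vector_spinor (𝒮.M e f) e f (t := fun b δ k => ∑ a, ∑ γ, gU a δ γ •
      𝒮.vecCurv a b (.Q γ k)) h k

end ConformalSuperspace

end

/-! ### Bianchi identity: the terms with a vector derivative outside -/

section

/-- The labels of `∇_α^i`. -/
def qSlots : Set Slot := {s | s.kind = .Q}

theorem qSlots_subset : qSlots ⊆ spinorSlots := fun _ hs => Or.inl hs

theorem exists_of_mem_qSlots {s : Slot} (hs : s ∈ qSlots) : ∃ y l, s = .Q y l := by
  cases s with
  | Q y l => exact ⟨y, l, rfl⟩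
  | P | M | D | J | S | K => cases hs

theorem Gens.Has.of_expand {A : Type*} [Ring A] [Algebra ℂ A] {G : Gens A} {x : Slot → A}
    (bx : Balanced x) (L : Set Slot) : G.Has L (G.expand x) x := ⟨x, bx, rfl, fun _ _ => rfl⟩

variable {A : Type*} [Ring A] [StarRing A] [Algebra ℂ A] [StarModule ℂ A]
  {𝒜 : ZMod 2 → Submodule ℂ A} [GradedAlgebra 𝒜] (𝒮 : ConformalSuperspace 𝒜)

namespace ConformalSuperspace

/-- The `∇`-components of `[∇_a, X]` for the generators `X`. -/
def brP (a : Fin 6) : Slot → Slot → A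
  | .P c => 𝒮.vecCurv a c
  | .Q σ m => -Slot.ofQ (𝒮.torsQ a σ m)
  | .S σ m => (Complex.I : ℂ) • ∑ j, ∑ β, (OmL m j * gtL a σ β) • Slot.singleQ β j
  | _ => 0

theorem has_brP (a : Fin 6) (s : Slot) :
    𝒮.Has qSlots (comm (𝒮.P a) (𝒮.slot s)) (𝒮.brP a s) := by
  cases s with
  | P c =>
    rw [Gens.slot, comm_PP]
    exact .of_expand (𝒮.vecCurv_balanced a c) _
  | Q σ m =>
    rw [Gens.slot, comm_swap]
    refine (𝒮.has_comm_Q_P qSlots_subset a σ m).neg.congr fun s hs => ?_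
    obtain ⟨y, l, rfl⟩ := exists_of_mem_qSlots hs
    simp [brP, Slot.ofQ, Slot.ofS]
  | M c d =>
    rw [Gens.slot, comm_swap, 𝒮.covariant.MP]
    refine 𝒮.has_zero qSlots_subset (Submodule.neg_mem _ ?_)
    exact sub_mem (Submodule.smul_mem _ _ (𝒮.P_nonSpinor _)) (Submodule.smul_mem _ _ (𝒮.P_nonSpinor _))
  | D =>
    rw [Gens.slot, comm_swap, 𝒮.covariant.DP]
    exact 𝒮.has_zero qSlots_subset (Submodule.neg_mem _ (𝒮.P_nonSpinor _))
  | J i j =>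
    rw [Gens.slot, comm_swap, 𝒮.covariant.JP, neg_zero]
    exact .zero
  | S σ m =>
    rw [Gens.slot, comm_swap, S_eq_Sup, ← comm_swap, comm_sum_right]
    simp only [comm_smul_right]
    have h : ∀ j, 𝒮.Has qSlots (comm (𝒮.P a) (𝒮.Sup σ j))
        ((Complex.I : ℂ) • ∑ β, gtL a σ β • Slot.singleQ β j) := by
      intro j
      rw [comm_swap, 𝒮.structureFunctions.SP, Gens.flatSP]
      have h1 : 𝒮.Has qSlots ((-Complex.I) • ∑ β, gtL a σ β • 𝒮.Q β j)
          ((-Complex.I) • ∑ β, gtL a σ β • Slot.singleQ β j) :=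
        .smul_complex _ <| .sum _ fun β => .smul_complex _ (𝒮.has_Q _ _ _)
      have h2 : 𝒮.Has qSlots (∑ β, ∑ γ, ∑ k, ((Complex.I / 40) * gL a β γ) •
          (𝒮.W σ β j k • 𝒮.S γ k)) (∑ β, ∑ γ, ∑ k, ((Complex.I / 40) * gL a β γ) •
          (𝒮.W σ β j k • Slot.singleS γ k)) :=
        .sum _ fun β => .sum _ fun γ => .sum _ fun k => .smul_complex _ <| .smul _ (𝒮.has_S _ _ _)
      have h3 : 𝒮.Has qSlots (∑ c, ((1 / 160 : ℂ) • ∑ β, ∑ γ, gam2 a c β γ •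
          X36 𝒮.toGens 𝒮.W γ σ β j) • 𝒮.Kup c) 0 :=
        𝒮.has_zero qSlots_subset (Submodule.sum_mem _ fun c _ =>
          𝒮.smul_nonSpinor _ (𝒮.Kup_nonSpinor c))
      refine ((h1.add h2).add h3).neg.congr fun s hs => ?_
      obtain ⟨y, l, rfl⟩ := exists_of_mem_qSlots hs
      simp only [Pi.neg_apply, Pi.add_apply, Pi.zero_apply, Finset.sum_apply, Pi.smul_apply,
            Slot.singleS, Slot.ofS, smul_zero, Finset.sum_const_zero, add_zero, neg_smul, neg_neg]
    refine (Gens.Has.sum _ fun j => .smul_complex (OmL m j) (h j)).congr fun s _ => ?_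
    simp only [brP, Finset.smul_sum]
    rw [Finset.sum_apply, Finset.sum_apply]
    refine Finset.sum_congr rfl fun j _ => ?_
    rw [Finset.sum_apply, Finset.sum_apply]
    refine Finset.sum_congr rfl fun β _ => ?_
    simp only [Pi.smul_apply, smul_smul]
    congr 1; ring
  | K c =>
    rw [Gens.slot, comm_swap, 𝒮.structureFunctions.KP, Gens.flatKP]
    exact 𝒮.has_zero qSlots_subset (Submodule.neg_mem _ (add_mem
      (Submodule.smul_mem _ _ 𝒮.D_nonSpinor) (Submodule.smul_mem _ _ (𝒮.M_nonSpinor _ _))))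

/-- The product of two torsions. -/
def torsSq (a b : Fin 6) (α δ : Fin 4) : A :=
  ∑ i, ∑ σ, ∑ m, 𝒮.torsQ a α i σ m * 𝒮.torsQ b σ m δ i

theorem torsQ_trace (b : Fin 6) (α δ : Fin 4) : ∑ i, 𝒮.torsQ b α i δ i = 0 := by
  have h : ∑ i, 𝒮.torsQ b α i δ i = ∑ x, (Complex.I / 8 * gL b α x) •
      (-(∑ i, ∑ k, OmL i k • 𝒮.W x δ i k)) := by
    simp only [torsQ]
    rw [Finset.sum_comm]
    refine Finset.sum_congr rfl fun x _ => ?_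
    simp only [← Finset.sum_neg_distrib, Finset.smul_sum]
    refine Finset.sum_congr rfl fun i _ => Finset.sum_congr rfl fun k _ => ?_
    rw [𝒮.W_antisymm x δ k i]; module
  simp only [h, 𝒮.W_traceless, neg_zero, smul_zero, Finset.sum_const_zero]

/-- In the `USp(4)` trace of the Q-component the derivative of the torsion drops because `W` is
Ω-traceless, the S-curvature drops by `omTrace_curvS`, and there is no P-component for lack of
dimension. What survives is torsion times torsion. -/
theorem has_comm_P_QP (a b : Fin 6) (α : Fin 4) : ∃ c : Fin 4 → Slot → A,
    (∀ i, 𝒮.Has qSlots (comm (𝒮.P a) (comm (𝒮.Q α i) (𝒮.P b))) (c i)) ∧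
    ∀ δ, ∑ i, c i (.Q δ i) = -𝒮.torsSq b a α δ := by
  choose z hz bz ez using fun i => 𝒮.comm_QP_mem α i b
  have hQ : ∀ i σ m, z i (.Q σ m) = 𝒮.torsQ b α i σ m := fun i σ m => by
    have := 𝒮.has_unique (L := spinorSlots) ⟨z i, bz i, ez i, fun _ _ => rfl⟩
      (𝒮.has_comm_Q_P subset_rfl b α i) (s := .Q σ m) (Or.inl rfl)
    rw [this]; simp [Slot.ofQ, Slot.ofS]
  have hS : ∀ i σ m, z i (.S σ m) = 𝒮.curvS b α i σ m := fun i σ m => by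
    have := 𝒮.has_unique (L := spinorSlots) ⟨z i, bz i, ez i, fun _ _ => rfl⟩
      (𝒮.has_comm_Q_P subset_rfl b α i) (s := .S σ m) (Or.inr rfl)
    rw [this]; simp [Slot.ofQ, Slot.ofS]
  have hP : ∀ i d, z i (.P d) = 0 := fun i d =>
    𝒮.cov_eq_zero (m := 3 - 2) (by norm_num) (hz i (.P d))
  have bP : ∀ i, Balanced fun s => 𝒮.P a (z i s) := fun i =>
    ⟨fun c d => by rw [(bz i).M, map_neg], fun c d => by rw [(bz i).J]⟩
  refine ⟨fun i => (fun s => 𝒮.P a (z i s)) + fun t => mixC (fun s => 𝒮.brP a s t) (z i),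
    fun i => ?_, fun δ => ?_⟩
  · rw [ez i, (𝒮.P_der a).comm_expand]
    exact .add (.of_expand (bP i) _) (.mix (𝒮.has_brP a) _)
  · have h1 : ∑ i, 𝒮.P a (𝒮.torsQ b α i δ i) = 0 := by
      rw [← map_sum, torsQ_trace, map_zero]
    have h2 : ∑ i, ∑ σ, ∑ m, 𝒮.curvS b α i σ m * 𝒮.brP a (.S σ m) (.Q δ i) = 0 := by
      have e : ∀ i σ m, 𝒮.curvS b α i σ m * 𝒮.brP a (.S σ m) (.Q δ i) =
          (Complex.I * gtL a σ δ) • OmL m i • 𝒮.curvS b α i σ m := by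
        intro i σ m
        have : 𝒮.brP a (.S σ m) (.Q δ i) = (Complex.I * gtL a σ δ * OmL m i) • (1 : A) := by
          simp only [brP, Pi.smul_apply, Finset.sum_apply, Slot.singleQ, Slot.ofQ]
          rw [Finset.sum_eq_single i, Finset.sum_eq_single δ]
          · rw [if_pos rfl, if_pos rfl, smul_smul]; congr 1; ring
          · intro β _ hβ; rw [if_neg hβ.symm, smul_zero]
          · simp
          · intro j _ hj; simp only [if_neg hj.symm, ite_self, smul_zero, Finset.sum_const_zero]
          · simp
        rw [this, mul_smul_comm, mul_one, smul_smul]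
      simp only [e]
      rw [Finset.sum_comm]
      refine Finset.sum_eq_zero fun σ _ => ?_
      rw [Finset.sum_comm]
      simp only [← Finset.smul_sum]
      have := 𝒮.omTrace_curvS b α σ
      rw [omTrace] at this
      rw [this, smul_zero]
    have h3 : ∀ i, mixC (fun s => 𝒮.brP a s (.Q δ i)) (z i) =
        (∑ σ, ∑ m, 𝒮.torsQ b α i σ m * -𝒮.torsQ a σ m δ i) +
        ∑ σ, ∑ m, 𝒮.curvS b α i σ m * 𝒮.brP a (.S σ m) (.Q δ i) := by
      intro i
      simp only [mixC, hP, hQ, hS]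
      simp [brP, Slot.ofQ]
    simp only [Pi.add_apply, Finset.sum_add_distrib, h3, hQ, h1, h2, zero_add, add_zero, torsSq,
      mul_neg, Finset.sum_neg_distrib]

end ConformalSuperspace

end

/-! ### Bianchi identity: the term with the spinor derivative outside -/

section

variable {A : Type*} [Ring A] [StarRing A] [Algebra ℂ A] [StarModule ℂ A]
  {𝒜 : ZMod 2 → Submodule ℂ A} [GradedAlgebra 𝒜] (𝒮 : ConformalSuperspace 𝒜)

namespace ConformalSuperspace

/-- The `∇`-components of `[∇_α^i, X}` for the generators `X`. -/
def brQ (α i : Fin 4) : Slot → Slot → A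
  | .P c => Slot.ofQ (𝒮.torsQ c α i)
  | .M c d => (1 / 2 : ℂ) • ∑ σ, gam2 c d α σ • Slot.singleQ σ i
  | .D => (-(1 / 2) : ℂ) • Slot.singleQ α i
  | .J j k => (-(1 / 2) : ℂ) • (OmU i j • Slot.singleQ α k + OmU i k • Slot.singleQ α j)
  | _ => 0

theorem has_smul_S (f : A) (σ m : Fin 4) : 𝒮.Has qSlots (f • 𝒮.S σ m) 0 :=
  ((𝒮.has_S qSlots σ m).smul f).congr fun s hs => by
    obtain ⟨y, l, rfl⟩ := exists_of_mem_qSlots hs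
    simp [Slot.singleS, Slot.ofS]

theorem has_smul_Sup (c : ℂ) (σ m : Fin 4) : 𝒮.Has qSlots (c • 𝒮.Sup σ m) 0 := by
  have : 𝒮.Has qSlots (c • ∑ j, OmU m j • (1 : A) • 𝒮.S σ j) (c • ∑ j : Fin 4, OmU m j • (0 : Slot → A)) :=
    .smul_complex _ <| .sum _ fun j => .smul_complex _ (𝒮.has_smul_S 1 σ j)
  simp only [one_smul, smul_zero, Finset.sum_const_zero] at this
  exact this

theorem has_curvQQ (α i β j : Fin 4) : 𝒮.Has qSlots (curvQQ 𝒮.toGens 𝒮.W α i β j) 0 := by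
  have h1 : 𝒮.Has qSlots (∑ γ, ∑ δ, ∑ ε, (-(1 / 2) * lc α β γ ε) • (𝒮.W γ δ i j • 𝒮.Mss δ ε)) 0 :=
    𝒮.has_zero qSlots_subset <| Submodule.sum_mem _ fun _ _ => Submodule.sum_mem _ fun _ _ =>
      Submodule.sum_mem _ fun _ _ => Submodule.smul_mem _ _ (𝒮.smul_nonSpinor _ (𝒮.Mss_nonSpinor _ _))
  have h2 : 𝒮.Has qSlots (∑ γ, ∑ δ, ∑ k, ((1 / 40) * lc α β γ δ) •
      (X16 𝒮.toGens 𝒮.W γ k i j • 𝒮.S δ k)) (∑ γ, ∑ δ, ∑ _k : Fin 4, ((1 / 40) * lc α β γ δ) •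
        (0 : Slot → A)) :=
    .sum _ fun _ => .sum _ fun _ => .sum _ fun _ => .smul_complex _ (𝒮.has_smul_S _ _ _)
  have h3 : 𝒮.Has qSlots (∑ a, 𝒮.curvK α i β j a • 𝒮.Kup a) 0 :=
    𝒮.has_zero qSlots_subset <| Submodule.sum_mem _ fun _ _ => 𝒮.smul_nonSpinor _ (𝒮.Kup_nonSpinor _)
  simp only [smul_zero, Finset.sum_const_zero] at h2
  have := (h1.add h2).add h3
  rw [curvQQ_eq]
  simpa only [add_zero] using this

theorem has_brQ (α i : Fin 4) (s : Slot) :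
    𝒮.Has qSlots (𝒮.oddBr (𝒮.Q α i) s) (𝒮.brQ α i s) := by
  cases s with
  | P c =>
    refine (𝒮.has_comm_Q_P qSlots_subset c α i).congr fun s hs => ?_
    obtain ⟨y, l, rfl⟩ := exists_of_mem_qSlots hs
    simp [brQ, Slot.ofQ, Slot.ofS]
  | Q β j =>
    have h1 : 𝒮.Has qSlots (𝒮.flatQQ α i β j) 0 :=
      𝒮.has_zero qSlots_subset (Submodule.smul_mem _ _ (𝒮.Pss_nonSpinor _ _))
    have := (h1.add (𝒮.has_curvQQ α i β j)).neg
    rw [add_zero, neg_zero] at this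
    rw [Gens.oddBr, 𝒮.QQ]
    exact this
  | M c d =>
    rw [Gens.oddBr, comm_swap, 𝒮.covariant.MQ]
    have h : 𝒮.Has qSlots ((1 / 2 : ℂ) • ∑ σ, gam2 c d α σ • 𝒮.Q σ i) (𝒮.brQ α i (.M c d)) :=
      .smul_complex _ <| .sum _ fun σ => .smul_complex _ (𝒮.has_Q _ _ _)
    rw [neg_smul_end, neg_neg]
    exact h
  | D =>
    rw [Gens.oddBr, comm_swap, 𝒮.covariant.DQ, ← neg_smul_end]
    exact (𝒮.has_Q _ _ _).smul_complex _
  | J j k =>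
    rw [Gens.oddBr, comm_swap, 𝒮.covariant.JQ, jrot, ← neg_smul_end]
    exact .smul_complex _ (((𝒮.has_Q _ _ _).smul_complex _).add ((𝒮.has_Q _ _ _).smul_complex _))
  | S σ m =>
    rw [Gens.oddBr, acomm_swap]
    exact 𝒮.has_zero qSlots_subset (Submodule.neg_mem _ (𝒮.acomm_SQ_nonSpinor _ _ _ _))
  | K c =>
    rw [Gens.oddBr, comm_swap, 𝒮.structureFunctions.KQ, Gens.flatKQ]
    have h : 𝒮.Has qSlots ((-Complex.I) • ∑ β, gL c α β • 𝒮.Sup β i)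
        ((-Complex.I) • ∑ _β : Fin 4, (0 : Slot → A)) :=
      .smul_complex _ <| .sum _ fun β => 𝒮.has_smul_Sup _ _ _
    rw [Finset.sum_const_zero, smul_zero] at h
    have := h.neg
    rwa [neg_zero] at this

/-- P and D components of the curvature vanish, and J drops because its generators are traceless on
a `USp(4)` index. The rotation keeps unit weight: 1/2 from the expansion, 1/2 from the action on
spinors, 4 from the trace. -/
theorem has_comm_Q_PP (a b : Fin 6) (α : Fin 4) : ∃ c : Fin 4 → Slot → A,
    (∀ i, 𝒮.Has qSlots (comm (𝒮.Q α i) (comm (𝒮.P a) (𝒮.P b))) (c i)) ∧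
    ∀ δ, ∑ i, c i (.Q δ i) = ∑ i, 𝒮.Q α i (𝒮.vecCurv a b (.Q δ i)) +
      ∑ c, ∑ d, gam2 c d α δ • 𝒮.vecCurv a b (.M c d) := by
  have bQ : ∀ i, Balanced fun s => 𝒮.Q α i (𝒮.vecCurv a b s) := fun i =>
    ⟨fun c d => by rw [(𝒮.vecCurv_balanced a b).M, map_neg],
      fun c d => by rw [(𝒮.vecCurv_balanced a b).J]⟩
  refine ⟨fun i => (fun s => 𝒮.Q α i (𝒮.vecCurv a b s)) +
    fun t => mixC (fun s => 𝒮.brQ α i s t) (𝒮.vecCurv a b), fun i => ?_, fun δ => ?_⟩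
  · rw [comm_PP, (𝒮.Q_der α i).comm_expand _ (𝒮.grade_parity (m := 4) (𝒮.vecCurv_mem a b)
      ⟨2, rfl⟩)]
    exact .add (.of_expand (bQ i) _) (.mix (𝒮.has_brQ α i) _)
  · have h1 : ∀ i c d, 𝒮.vecCurv a b (.M c d) * (1 / 2 : ℂ) • 𝒮.brQ α i (.M c d) (.Q δ i) =
        (1 / 4 : ℂ) • gam2 c d α δ • 𝒮.vecCurv a b (.M c d) := by
      intro i c d
      have : 𝒮.brQ α i (.M c d) (.Q δ i) = (1 / 2 * gam2 c d α δ) • (1 : A) := by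
        simp only [brQ, Pi.smul_apply, Finset.sum_apply, Slot.singleQ, Slot.ofQ]
        rw [Finset.sum_eq_single δ]
        · rw [if_pos rfl, if_pos trivial, smul_smul]
        · intro β _ hβ; rw [if_neg hβ.symm, smul_zero]
        · simp
      rw [this, mul_smul_comm, mul_smul_comm, mul_one, smul_smul, smul_smul]
      congr 1; ring
    have h2 : ∑ i, ∑ j, ∑ k, 𝒮.vecCurv a b (.J j k) * 𝒮.brQ α i (.J j k) (.Q δ i) = 0 := by
      rw [Finset.sum_comm]
      refine Finset.sum_eq_zero fun j _ => ?_
      rw [Finset.sum_comm]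
      refine Finset.sum_eq_zero fun k _ => ?_
      rw [← Finset.mul_sum]
      have : ∑ i, 𝒮.brQ α i (.J j k) (.Q δ i) = 0 := by
        simp only [brQ, Pi.smul_apply, Pi.add_apply, Slot.singleQ, Slot.ofQ, smul_add,
          Finset.sum_add_distrib]
        rw [Finset.sum_eq_single k, Finset.sum_eq_single j]
        · rw [if_pos rfl, if_pos rfl, OmU_antisymm j k]; module
        · intro i _ hi; simp [hi]
        · simp
        · intro i _ hi; simp [hi]
        · simp
      rw [this, mul_zero]
    have h3 : ∀ i, mixC (fun s => 𝒮.brQ α i s (.Q δ i)) (𝒮.vecCurv a b) =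
        (∑ c, ∑ d, (1 / 4 : ℂ) • gam2 c d α δ • 𝒮.vecCurv a b (.M c d)) +
        ∑ j, ∑ k, 𝒮.vecCurv a b (.J j k) * 𝒮.brQ α i (.J j k) (.Q δ i) := by
      intro i
      rw [← Finset.sum_congr rfl fun c _ => Finset.sum_congr rfl fun d _ => h1 i c d]
      simp only [mixC, vecCurv_P, vecCurv_D, zero_mul, Finset.sum_const_zero, zero_add, add_zero]
      have e1 : ∀ β j, 𝒮.brQ α i (.Q β j) = 0 := fun _ _ => rfl
      have e2 : ∀ β j, 𝒮.brQ α i (.S β j) = 0 := fun _ _ => rfl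
      have e3 : ∀ c, 𝒮.brQ α i (.K c) = 0 := fun _ => rfl
      simp only [e1, e2, e3, Pi.zero_apply, mul_zero, Finset.sum_const_zero, zero_add, add_zero]
    simp only [Pi.add_apply, Finset.sum_add_distrib, h3, h2, add_zero]
    congr 1
    simp only [Finset.sum_const, Finset.card_univ, Fintype.card_fin, ← Finset.smul_sum]
    rw [← Nat.cast_smul_eq_nsmul ℂ, smul_smul]
    norm_num

/-- The trace over `USp(4)` of the spinor part of the Bianchi identity for `∇_α^i, ∇_a, ∇_b`. -/
theorem bianchi_QPP (a b : Fin 6) (α δ : Fin 4) : ∑ i, 𝒮.Q α i (𝒮.vecCurv a b (.Q δ i)) +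
    ∑ c, ∑ d, gam2 c d α δ • 𝒮.vecCurv a b (.M c d) = 𝒮.torsSq a b α δ - 𝒮.torsSq b a α δ := by
  obtain ⟨c, hc, ec⟩ := 𝒮.has_comm_Q_PP a b α
  obtain ⟨d, hd, ed⟩ := 𝒮.has_comm_P_QP a b α
  obtain ⟨e, he, ee⟩ := 𝒮.has_comm_P_QP b a α
  have h : ∀ i, c i (.Q δ i) = d i (.Q δ i) - e i (.Q δ i) := by
    intro i
    refine 𝒮.has_unique (L := qSlots) (c' := d i - e i) (hc i) ?_ (s := .Q δ i) rfl
    rw [comm_comm, comm_swap _ (𝒮.P b), add_comm, ← sub_eq_add_neg]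
    exact (hd i).sub (he i)
  rw [← ec, Finset.sum_congr rfl fun i _ => h i, Finset.sum_sub_distrib, ed, ee]
  abel

end ConformalSuperspace

end

/-! ### The gamma trace of the Bianchi identity -/

section

theorem sum_comm_two_two {ι κ ι' κ' V : Type*} [Fintype ι] [Fintype κ] [Fintype ι'] [Fintype κ']
    [AddCommMonoid V] (F : ι → κ → ι' → κ' → V) :
    ∑ i, ∑ m, ∑ x, ∑ y, F i m x y = ∑ x, ∑ y, ∑ i, ∑ m, F i m x y := by
  have := Finset.sum_comm (s := (Finset.univ : Finset (ι × κ)))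
    (t := (Finset.univ : Finset (ι' × κ'))) (f := fun p q => F p.1 p.2 q.1 q.2)
  simpa only [Fintype.sum_prod_type] using this

theorem gam2_self_trace (c d : Fin 6) : ∑ α, gam2 c d α α = 0 := by
  have h : ∀ c d : Fin 6, ∑ α, gammaTwoZ c d α α = 0 := by decide +kernel
  have h2 := congrArg GaussianInt.toComplex (h c d)
  rw [map_sum, map_zero] at h2
  simp only [gam2_eq_toComplex, ← Finset.mul_sum]
  rw [h2, mul_zero]

theorem sum_gtL_gU (e a : Fin 6) (α δ : Fin 4) :
    ∑ μ, gtL e μ α * gU a μ δ = eta a a * (gam2 e a δ α + eta e a * kd α δ) := by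
  have h1 : ∑ μ, gtL e μ α * gU a μ δ = -eta a a * (gtL e * gL a) α δ := by
    rw [Matrix.mul_apply, Finset.mul_sum]
    refine Finset.sum_congr rfl fun μ _ => ?_
    rw [gtL_antisymm e α μ, gL_apply]
    linear_combination -(gtL e μ α * gU a μ δ) * eta_mul_self a
  have h2 : (gtL e * gL a) α δ = gamt2 e a α δ - eta e a * kd α δ := by
    have h := congrFun (congrFun (gtL_gL_clifford e a) α) δ
    simp only [Matrix.add_apply, Matrix.smul_apply, Matrix.one_apply, smul_eq_mul] at h
    simp only [gamt2, Matrix.smul_apply, Matrix.sub_apply, smul_eq_mul, kd]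
    linear_combination (1 / 2) * h
  rw [h1, h2, gamt2_eq]; ring

theorem sum_gtL_gU_gam2 (e a c d : Fin 6) : ∑ α, ∑ δ, (∑ μ, gtL e μ α * gU a μ δ) * gam2 c d α δ =
    4 * eta a a * (eta a c * eta e d - eta e c * eta a d) := by
  have h : ∀ α δ, (∑ μ, gtL e μ α * gU a μ δ) * gam2 c d α δ =
      eta a a * (gam2 e a δ α * gam2 c d α δ) + (eta a a * eta e a) * (kd α δ * gam2 c d α δ) :=
    fun α δ => by rw [sum_gtL_gU]; ring
  simp only [h, Finset.sum_add_distrib, ← Finset.mul_sum]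
  rw [gam2_trace]
  have h2 : ∑ α, ∑ δ, kd α δ * gam2 c d α δ = 0 := by
    rw [← gam2_self_trace c d]
    exact Finset.sum_congr rfl fun α _ => by simp [kd]
  rw [h2]; ring

variable {A : Type*} [Ring A] [StarRing A] [Algebra ℂ A] [StarModule ℂ A]
  {𝒜 : ZMod 2 → Submodule ℂ A} [GradedAlgebra 𝒜] (𝒮 : ConformalSuperspace 𝒜)

namespace ConformalSuperspace

theorem bil_eq_low_mul_low (x σ y δ : Fin 4) : 𝒮.bil x σ y δ = ∑ i, ∑ m,
    low (fun k => 𝒮.W x σ k i) m * low (fun l => 𝒮.W y δ l m) i := by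
  have h : ∀ i m, low (fun k => 𝒮.W x σ k i) m * low (fun l => 𝒮.W y δ l m) i =
      ∑ k, ∑ l, (OmL m k * OmL i l) • (𝒮.W x σ k i * 𝒮.W y δ l m) := fun i m => by
    simp only [low, Finset.sum_mul_sum, smul_mul_smul_comm]
  simp only [h]
  simp only [bil, low2, Finset.mul_sum, mul_smul_comm]
  rw [Finset.sum_comm]
  refine Finset.sum_congr rfl fun i _ => ?_
  rw [Finset.sum_comm]
  refine Finset.sum_congr rfl fun m _ => Finset.sum_congr rfl fun k _ =>
    Finset.sum_congr rfl fun l _ => ?_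
  rw [OmL_antisymm k m, 𝒮.W_antisymm y δ m l, mul_neg, smul_neg, ← neg_smul]
  congr 1; ring

theorem torsQ_eq (b : Fin 6) (α i y l : Fin 4) : 𝒮.torsQ b α i y l =
    ∑ x, (Complex.I / 8 * gL b α x) • low (fun k => 𝒮.W x y k i) l := by
  simp only [torsQ, low, Finset.smul_sum, smul_smul]

theorem torsSq_eq (a b : Fin 6) (α δ : Fin 4) : 𝒮.torsSq a b α δ =
    (-(1 / 64) : ℂ) • ∑ σ, ∑ x, ∑ y, (gL a α x * gL b σ y) • 𝒮.bil x σ y δ := by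
  have h : ∀ i σ m, 𝒮.torsQ a α i σ m * 𝒮.torsQ b σ m δ i = ∑ x, ∑ y,
      (-(1 / 64) * (gL a α x * gL b σ y)) •
        (low (fun k => 𝒮.W x σ k i) m * low (fun l => 𝒮.W y δ l m) i) := by
    intro i σ m
    simp only [torsQ_eq, Finset.sum_mul_sum, smul_mul_assoc, mul_smul_comm, smul_smul]
    refine Finset.sum_congr rfl fun x _ => Finset.sum_congr rfl fun y _ => ?_
    congr 1
    linear_combination (1 / 64 * (gL a α x * gL b σ y)) * Complex.I_mul_I
  simp only [torsSq, h, bil_eq_low_mul_low, Finset.smul_sum, smul_smul]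
  rw [Finset.sum_comm]
  refine Finset.sum_congr rfl fun σ _ => ?_
  exact sum_comm_two_two fun i m x y => (-(1 / 64) * (gL a α x * gL b σ y)) •
    (low (fun k => 𝒮.W x σ k i) m * low (fun l => 𝒮.W y δ l m) i)

/-- The trace `(γ̃_e)^{μα} (γ^a)_{μδ} t_{aα}^δ`. -/
def gtrace (e : Fin 6) (t : Fin 6 → Fin 4 → Fin 4 → A) : A :=
  ∑ a, ∑ α, ∑ δ, (∑ μ, gtL e μ α * gU a μ δ) • t a α δ

theorem gtrace_quadratic (e : Fin 6) (c : ℂ) (f : Fin 6 → Fin 4 → Fin 4 → Fin 4 → Fin 4 → ℂ) :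
    gtrace e (fun a α δ => c • ∑ σ, ∑ x, ∑ y, f a α σ x y • 𝒮.bil x σ y δ) =
      c • ∑ δ, ∑ σ, ∑ x, ∑ y, (∑ a, ∑ α, (∑ μ, gtL e μ α * gU a μ δ) * f a α σ x y) •
        𝒮.bil x σ y δ := by
  have h := Finset.sum_comm (s := (Finset.univ : Finset (Fin 6 × Fin 4)))
    (t := (Finset.univ : Finset (Fin 4 × Fin 4 × Fin 4 × Fin 4)))
    (f := fun p q => ((∑ μ, gtL e μ p.2 * gU p.1 μ q.1) * f p.1 p.2 q.2.1 q.2.2.1 q.2.2.2) •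
      𝒮.bil q.2.2.1 q.2.1 q.2.2.2 q.1)
  simp only [Fintype.sum_prod_type] at h
  simp only [Finset.sum_smul]
  rw [← h, Finset.smul_sum]
  simp only [Finset.smul_sum, gtrace]
  exact Finset.sum_congr rfl fun _ _ => Finset.sum_congr rfl fun _ _ =>
    Finset.sum_congr rfl fun _ _ => Finset.sum_congr rfl fun _ _ => Finset.sum_congr rfl fun _ _ =>
      Finset.sum_congr rfl fun _ _ => by
        simp only [smul_smul]; congr 1; ring

/-- The sum over the vector index gives ε by completeness, ε lowers the second gamma matrix, and
what remains is the contraction pattern of `WW`. -/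
theorem gtrace_torsSq_left (e b : Fin 6) :
    gtrace e (fun a α δ => 𝒮.torsSq a b α δ) = (-(1 / 16) : ℂ) • WW 𝒮.W e b := by
  simp only [torsSq_eq]
  rw [gtrace_quadratic (f := fun a α σ x y => gL a α x * gL b σ y)]
  have h : ∀ δ σ x y, ∑ a, ∑ α, (∑ μ, gtL e μ α * gU a μ δ) * (gL a α x * gL b σ y) =
      4 * (gL e δ x * gL b y σ) := by
    intro δ σ x y
    have h1 : ∑ a, ∑ α, (∑ μ, gtL e μ α * gU a μ δ) * (gL a α x * gL b σ y) =
        (∑ μ, ∑ α, gtL e μ α * ∑ a, gU a μ δ * gL a α x) * gL b σ y := by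
      simp only [Finset.sum_mul, Finset.mul_sum]
      rw [Finset.sum_congr rfl fun a _ => Finset.sum_comm, Finset.sum_comm]
      refine Finset.sum_congr rfl fun μ _ => ?_
      rw [Finset.sum_comm]
      exact Finset.sum_congr rfl fun _ _ => Finset.sum_congr rfl fun _ _ => by ring
    have h2 : ∑ μ, ∑ α, gtL e μ α * (2 * lc μ δ α x) = -2 * (2 * gL e δ x) := by
      rw [← gL_eq_lc_gtL]
      simp only [Finset.mul_sum]
      refine Finset.sum_congr rfl fun μ _ => Finset.sum_congr rfl fun α _ => ?_
      simp only [lc]; push_cast; ring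
    rw [h1]
    simp only [gU_completeness, h2]
    rw [gL_antisymm b σ y]; ring
  have h3 : WW 𝒮.W e b = ∑ δ, ∑ σ, ∑ x, ∑ y, (gL e δ x * gL b y σ) • 𝒮.bil x σ y δ := by
    rw [WW_eq]
    refine Finset.sum_congr rfl fun δ _ => ?_
    simp only [Finset.smul_sum, smul_smul]
    conv_rhs => rw [Finset.sum_comm]
    refine Finset.sum_congr rfl fun x _ => ?_
    rw [Finset.sum_comm]
    refine Finset.sum_congr rfl fun σ _ => Finset.sum_congr rfl fun y _ => ?_
    rw [𝒮.bil_exchange x, 𝒮.bil_symm_left y]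
  rw [h3]
  simp only [h, mul_smul (4 : ℂ), ← Finset.smul_sum]
  rw [smul_smul]
  norm_num

/-- Here completeness produces an ε antisymmetric in two spinor indices of the same `W`. -/
theorem gtrace_torsSq_right (e b : Fin 6) :
    gtrace e (fun a α δ => 𝒮.torsSq b a α δ) = 0 := by
  simp only [torsSq_eq]
  rw [gtrace_quadratic (f := fun a α σ x y => gL b α x * gL a σ y)]
  have h : ∀ δ σ x y, ∑ a, ∑ α, (∑ μ, gtL e μ α * gU a μ δ) * (gL b α x * gL a σ y) =
      ∑ μ, ∑ α, gtL e μ α * (2 * lc μ δ σ y) * gL b α x := by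
    intro δ σ x y
    simp only [← gU_completeness, Finset.sum_mul, Finset.mul_sum]
    rw [Finset.sum_congr rfl fun a _ => Finset.sum_comm, Finset.sum_comm]
    refine Finset.sum_congr rfl fun μ _ => ?_
    rw [Finset.sum_comm]
    exact Finset.sum_congr rfl fun _ _ => Finset.sum_congr rfl fun _ _ => by ring
  have h2 : ∑ δ, ∑ σ, ∑ x, ∑ y, (∑ μ, ∑ α, gtL e μ α * (2 * lc μ δ σ y) * gL b α x) •
      𝒮.bil x σ y δ = 0 := by
    rw [Finset.sum_comm]
    refine Finset.sum_eq_zero fun σ _ => ?_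
    rw [Finset.sum_comm]
    refine Finset.sum_eq_zero fun x _ => eq_zero_of_eq_neg ?_
    conv_lhs => rw [Finset.sum_comm]
    simp only [← Finset.sum_neg_distrib]
    refine Finset.sum_congr rfl fun δ _ => Finset.sum_congr rfl fun y _ => ?_
    rw [𝒮.bil_symm_right, ← neg_smul]
    simp only [← Finset.sum_neg_distrib]
    congr 1
    refine Finset.sum_congr rfl fun μ _ => Finset.sum_congr rfl fun α _ => ?_
    simp only [lc]; push_cast; ring
  simp only [h, h2, smul_zero]

/-- The numerical gamma matrices pass through the derivative, which then acts on the vanishing gamma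
trace of R(Q). -/
theorem gtrace_Q (e b : Fin 6) :
    gtrace e (fun a α δ => ∑ i, 𝒮.Q α i (𝒮.vecCurv a b (.Q δ i))) = 0 := by
  have h : ∀ α i, ∑ a, ∑ δ, (∑ μ, gtL e μ α * gU a μ δ) • 𝒮.vecCurv a b (.Q δ i) = 0 := by
    intro α i
    simp only [Finset.sum_smul, mul_smul]
    rw [Finset.sum_congr rfl fun a _ => Finset.sum_comm, Finset.sum_comm]
    simp only [← Finset.smul_sum, vecCurv_Q_trace, smul_zero, Finset.sum_const_zero]
  rw [gtrace, Finset.sum_comm]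
  refine Finset.sum_eq_zero fun α _ => ?_
  simp only [Finset.smul_sum]
  rw [Finset.sum_congr rfl fun a _ => Finset.sum_comm, Finset.sum_comm]
  refine Finset.sum_eq_zero fun i _ => ?_
  simp only [← map_smul, ← map_sum]
  rw [h, map_zero]

theorem gtrace_M (e b : Fin 6) :
    gtrace e (fun a α δ => ∑ c, ∑ d, gam2 c d α δ • 𝒮.vecCurv a b (.M c d)) =
      (-8 * eta e e) • ∑ a, 𝒮.vecCurv a b (.M e a) := by
  rw [gtrace, Finset.smul_sum]
  refine Finset.sum_congr rfl fun a _ => ?_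
  simp only [Finset.smul_sum, smul_smul]
  rw [sum_comm_two_two]
  simp only [← Finset.sum_smul, sum_gtL_gU_gam2]
  have h : ∀ c d, (4 * eta a a * (eta a c * eta e d - eta e c * eta a d)) •
      𝒮.vecCurv a b (.M c d) = (4 * eta a a) • eta a c • eta e d • 𝒮.vecCurv a b (.M c d) -
        (4 * eta a a) • eta e c • eta a d • 𝒮.vecCurv a b (.M c d) := fun c d => by module
  simp only [h, Finset.sum_sub_distrib, ← Finset.smul_sum, sum_eta_smul]
  rw [(𝒮.vecCurv_balanced a b).M a e]
  simp only [smul_neg, smul_smul]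
  have h2 : 4 * eta a a * (eta a a * eta e e) = 4 * eta e e := by
    linear_combination (4 * eta e e) * eta_mul_self a
  have h3 : 4 * eta a a * (eta e e * eta a a) = 4 * eta e e := by
    linear_combination (4 * eta e e) * eta_mul_self a
  rw [h2, h3]
  module

/-- The traced identity reads -8η times the Ricci trace equals -(1/16) `WW`. -/
theorem vecCurv_ricci (b e : Fin 6) :
    ∑ a, 𝒮.vecCurv a b (.M e a) = (1 / 128 * eta e e) • WW 𝒮.W e b := by
  have h : gtrace e (fun a α δ => ∑ i, 𝒮.Q α i (𝒮.vecCurv a b (.Q δ i)) +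
      ∑ c, ∑ d, gam2 c d α δ • 𝒮.vecCurv a b (.M c d)) =
      gtrace e (fun a α δ => 𝒮.torsSq a b α δ - 𝒮.torsSq b a α δ) := by
    simp only [bianchi_QPP]
  have h1 : ∀ t t' : Fin 6 → Fin 4 → Fin 4 → A, gtrace e (fun a α δ => t a α δ + t' a α δ) =
      gtrace e t + gtrace e t' := fun t t' => by
    simp only [gtrace, smul_add, Finset.sum_add_distrib]
  have h2 : ∀ t t' : Fin 6 → Fin 4 → Fin 4 → A, gtrace e (fun a α δ => t a α δ - t' a α δ) =
      gtrace e t - gtrace e t' := fun t t' => by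
    simp only [gtrace, smul_sub, Finset.sum_sub_distrib]
  rw [h1, h2, gtrace_Q, gtrace_M, gtrace_torsSq_left, gtrace_torsSq_right, zero_add, sub_zero] at h
  have h3 := congrArg ((-(1 / 8) * eta e e) • ·) h
  simp only [smul_smul] at h3
  have e1 : -(1 / 8) * eta e e * (-8 * eta e e) = 1 := by linear_combination eta_mul_self e
  rw [e1, one_smul] at h3
  rw [h3]
  congr 1; ring

end ConformalSuperspace

end

/-! ### Curvatures of the deformed derivatives -/

section

theorem neg_field_smul {A : Type*} [Ring A] [Algebra ℂ A] (f : A) (X : Module.End ℂ A) :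
    (-f) • X = -(f • X) :=
  LinearMap.ext fun h => neg_mul f (X h)

variable {A : Type*} [Ring A] [StarRing A] [Algebra ℂ A] [StarModule ℂ A]
  {𝒜 : ZMod 2 → Submodule ℂ A} [GradedAlgebra 𝒜] (𝒮 : ConformalSuperspace 𝒜)

namespace ConformalSuperspace

/-- Contracting the vector indices gives ε, antisymmetric in a spinor pair in which `W` is
symmetric. -/
theorem WW_trace : ∑ a, eta a a • WW 𝒮.W a a = 0 := by
  have h : ∀ α β γ δ, ∑ a, eta a a * (gL a α β * gL a γ δ) = 2 * lc α β γ δ := by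
    intro α β γ δ
    rw [← gU_completeness]
    refine Finset.sum_congr rfl fun a _ => ?_
    rw [gL_apply a α β]
    linear_combination (gU a α β * gL a γ δ) * eta_mul_self a
  have h1 : ∑ a, eta a a • WW 𝒮.W a a =
      ∑ α, ∑ β, ∑ γ, ∑ δ, (2 * lc α β γ δ) • 𝒮.bil α γ β δ := by
    simp only [← h, WW_eq, Finset.smul_sum, Finset.sum_smul, smul_smul]
    have := Finset.sum_comm (s := (Finset.univ : Finset (Fin 6)))
      (t := (Finset.univ : Finset (Fin 4 × Fin 4 × Fin 4 × Fin 4))) (f := fun a q =>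
        (eta a a * (gL a q.1 q.2.1 * gL a q.2.2.1 q.2.2.2)) • 𝒮.bil q.1 q.2.2.1 q.2.1 q.2.2.2)
    simp only [Fintype.sum_prod_type] at this
    rw [← this]
  rw [h1]
  have h2 : ∀ α, ∑ β, ∑ γ, ∑ δ, (2 * lc α β γ δ) • 𝒮.bil α γ β δ =
      ∑ γ, ∑ β, ∑ δ, (2 * lc α β γ δ) • 𝒮.bil α γ β δ := fun α => Finset.sum_comm
  simp only [h2]
  refine eq_zero_of_eq_neg ?_
  conv_lhs => rw [Finset.sum_comm]
  simp only [← Finset.sum_neg_distrib]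
  refine Finset.sum_congr rfl fun α _ => Finset.sum_congr rfl fun γ _ =>
    Finset.sum_congr rfl fun β _ => Finset.sum_congr rfl fun δ _ => ?_
  rw [𝒮.bil_symm_left, ← neg_smul]
  congr 1
  simp only [lc]; push_cast; ring

/-- The components of `[∇_a, ∑_c WW b c K^c]`. -/
def shiftCurv (a b : Fin 6) : Slot → A :=
  (Slot.ofK fun c => 𝒮.P a (eta c c • WW 𝒮.W b c)) + (Slot.ofD ((-2 : ℂ) • WW 𝒮.W b a)) +
    Slot.ofM fun c d => (-2 : ℂ) • ((if d = a then eta c c else 0) • WW 𝒮.W b c -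
      (if c = a then eta d d else 0) • WW 𝒮.W b d)

theorem shiftCurv_balanced (a b : Fin 6) : Balanced (𝒮.shiftCurv a b) where
  M c d := by
    simp only [shiftCurv, Pi.add_apply, Slot.ofK, Slot.ofD, Slot.ofM, zero_add]
    rw [← smul_neg, neg_sub]
  J _ _ := rfl

theorem comm_P_shift (a b : Fin 6) :
    comm (𝒮.P a) (𝒮.shift b) = 𝒮.expand (𝒮.shiftCurv a b) := by
  have hM : ∑ c, ∑ d, ((-2 : ℂ) • ((if d = a then eta c c else 0) • WW 𝒮.W b c -
      (if c = a then eta d d else 0) • WW 𝒮.W b d)) • (1 / 2 : ℂ) • 𝒮.M c d =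
      ∑ c, (eta c c • WW 𝒮.W b c) • ((-2 : ℂ) • 𝒮.M c a) := by
    have e : ∀ c d, ((-2 : ℂ) • ((if d = a then eta c c else 0) • WW 𝒮.W b c -
      (if c = a then eta d d else 0) • WW 𝒮.W b d)) • (1 / 2 : ℂ) • 𝒮.M c d =
      (if d = a then (eta c c • WW 𝒮.W b c) • ((-1 : ℂ) • 𝒮.M c d) else 0) +
      if c = a then (eta d d • WW 𝒮.W b d) • ((-1 : ℂ) • 𝒮.M d c) else 0 := by
      intro c d
      refine LinearMap.ext fun f => ?_
      rw [𝒮.bosonic.M_antisymm d c]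
      split_ifs <;>
      simp only [LinearMap.add_apply, LinearMap.smul_apply, LinearMap.neg_apply,
        LinearMap.zero_apply, smul_eq_mul, zero_smul, sub_zero, zero_sub, mul_smul_comm, smul_zero,
        smul_mul_assoc, sub_mul, smul_sub, neg_mul, mul_neg, smul_neg, smul_smul, zero_mul,
        add_zero] <;>
      module
    simp only [e, Finset.sum_add_distrib, Finset.sum_ite_eq', Finset.mem_univ, if_true]
    rw [Finset.sum_comm]
    simp only [Finset.sum_ite_eq', Finset.mem_univ, if_true, ← Finset.sum_add_distrib]
    refine Finset.sum_congr rfl fun c _ => ?_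
    rw [← smul_add, ← add_smul, show (-1 : ℂ) + -1 = -2 by norm_num]
  have hD : ∑ c, (eta c c • WW 𝒮.W b c) • ((-2 * eta c a) • 𝒮.D) =
      ((-2 : ℂ) • WW 𝒮.W b a) • 𝒮.D := by
    rw [Finset.sum_eq_single a]
    · refine LinearMap.ext fun f => ?_
      simp only [LinearMap.smul_apply, smul_eq_mul, mul_smul_comm, smul_mul_assoc, smul_smul]
      congr 1
      linear_combination (-2) * eta_mul_self a
    · intro c _ hc
      rw [eta_of_ne hc, mul_zero, zero_smul, smul_zero]
    · simp
  rw [shiftCurv, map_add, map_add, Gens.expand_ofK, Gens.expand_ofD, Gens.expand_ofM, hM, ← hD,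
    shift_eq_expand, Gens.expand_ofK, comm_sum_right, add_assoc, ← Finset.sum_add_distrib,
    ← Finset.sum_add_distrib]
  refine Finset.sum_congr rfl fun c _ => ?_
  rw [(𝒮.P_der a).comm_smul, comm_swap, 𝒮.structureFunctions.KP, Gens.flatKP, ← smul_add]
  congr 2
  refine LinearMap.ext fun f => ?_
  simp only [LinearMap.add_apply, LinearMap.smul_apply, LinearMap.neg_apply]
  module

/-- The components of `[∇̂_a, ∇̂_b]`. -/
def hatCurv (lam : ℝ) (a b : Fin 6) : Slot → A :=
  𝒮.vecCurv a b - (lam : ℂ) • (𝒮.shiftCurv a b - 𝒮.shiftCurv b a)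

theorem hatCurv_balanced (lam : ℝ) (a b : Fin 6) : Balanced (𝒮.hatCurv lam a b) where
  M c d := by
    simp only [hatCurv, Pi.sub_apply, Pi.smul_apply]
    rw [(𝒮.vecCurv_balanced a b).M, (𝒮.shiftCurv_balanced a b).M, (𝒮.shiftCurv_balanced b a).M]
    module
  J i j := by
    simp only [hatCurv, Pi.sub_apply, Pi.smul_apply]
    rw [(𝒮.vecCurv_balanced a b).J, (𝒮.shiftCurv_balanced a b).J, (𝒮.shiftCurv_balanced b a).J]

theorem comm_hatP_hatP_eq_expand (lam : ℝ) (a b : Fin 6) :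
    comm (𝒮.hatP lam a) (𝒮.hatP lam b) = 𝒮.expand (𝒮.hatCurv lam a b) := by
  rw [comm_hatP_hatP, comm_PP, comm_P_shift, comm_P_shift, hatCurv, map_sub,
    LinearMap.map_smul_of_tower, map_sub]

theorem hatCurv_P (lam : ℝ) (a b c : Fin 6) : 𝒮.hatCurv lam a b (.P c) = 0 := by
  simp [hatCurv, shiftCurv, vecCurv_P, Slot.ofK, Slot.ofD, Slot.ofM]

theorem hatCurv_Q_trace (lam : ℝ) (b : Fin 6) (δ k : Fin 4) :
    ∑ a, ∑ γ, gU a δ γ • 𝒮.hatCurv lam a b (.Q γ k) = 0 := by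
  rw [← 𝒮.vecCurv_Q_trace b δ k]
  simp [hatCurv, shiftCurv, Slot.ofK, Slot.ofD, Slot.ofM]

/-- In units of η `WW` the undeformed trace is -1/128 and the two brackets with `shift` contribute
-λ(-2 + 10) = -8λ. By `TT_eq` the unit is -32 times the square of T, whence 1/4 + 256λ. -/
theorem hatCurv_ricci (lam : ℝ) (a c : Fin 6) :
    ∑ d, 𝒮.hatCurv lam a d (.M c d) = (1 / 4 + 256 * (lam : ℂ)) • TT 𝒮.W a c := by
  have h1 : ∑ d, 𝒮.vecCurv a d (.M c d) = (-(1 / 128) * eta c c) • WW 𝒮.W a c := by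
    have := 𝒮.vecCurv_ricci a c
    rw [𝒮.WW_comm c a] at this
    rw [neg_mul, neg_smul, ← this, ← Finset.sum_neg_distrib]
    exact Finset.sum_congr rfl fun d _ => 𝒮.vecCurv_antisymm a d _
  have h2 : ∑ d, 𝒮.shiftCurv a d (.M c d) = (-2 * eta c c) • WW 𝒮.W a c := by
    have e : ∀ d, 𝒮.shiftCurv a d (.M c d) = (if d = a then (-2 * eta c c) • WW 𝒮.W a c else 0) +
        (if c = a then (2 : ℂ) else 0) • eta d d • WW 𝒮.W d d := by
      intro d
      simp only [shiftCurv, Pi.add_apply, Slot.ofK, Slot.ofD, Slot.ofM, zero_add]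
      by_cases hd : d = a
      · subst hd
        split_ifs <;> module
      · split_ifs <;> module
    simp only [e, Finset.sum_add_distrib, ← Finset.smul_sum, WW_trace, smul_zero, add_zero,
      Finset.sum_ite_eq', Finset.mem_univ, if_true]
  -- The six values of d give -12, and the term with d = c gives back 2.
  have h3 : ∑ d, 𝒮.shiftCurv d a (.M c d) = (-10 * eta c c) • WW 𝒮.W a c := by
    have e : ∀ d, 𝒮.shiftCurv d a (.M c d) = (-2 * eta c c) • WW 𝒮.W a c +
        if c = d then (2 * eta c c) • WW 𝒮.W a c else 0 := by
      intro d
      simp only [shiftCurv, Pi.add_apply, Slot.ofK, Slot.ofD, Slot.ofM, zero_add, if_true]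
      by_cases hd : c = d
      · subst hd
        rw [if_pos rfl, if_pos rfl]; module
      · rw [if_neg hd, if_neg hd]; module
    simp only [e, Finset.sum_add_distrib, Finset.sum_ite_eq, Finset.mem_univ, if_true,
      Finset.sum_const, Finset.card_univ, Fintype.card_fin]
    module
  simp only [hatCurv, Pi.sub_apply, Pi.smul_apply, Finset.sum_sub_distrib, ← Finset.smul_sum,
    h1, h2, h3, TT_eq]
  module

theorem expand_neg_vectorCurvature {lam : ℝ} (R : VectorCurvature (𝒮.deformed lam))
    (a b : Fin 6) : ∃ y, Balanced y ∧ comm (𝒮.hatP lam a) (𝒮.hatP lam b) = 𝒮.expand y ∧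
      (∀ c, y (.P c) = -R.RP a b c) ∧ (∀ γ k, y (.Q γ k) = -R.RQ a b γ k) ∧
      ∀ c d, y (.M c d) = -R.RM a b c d := by
  let y : Slot → A := fun
    | .P c => -R.RP a b c
    | .Q γ k => -R.RQ a b γ k
    | .M c d => -R.RM a b c d
    | .D => -R.RD a b
    | .J i j => -R.RJ a b i j
    | .S γ k => -R.RS a b γ k
    | .K c => -R.RK a b c
  -- Expressing the deformed derivative by the original one adds multiples of K only, so components
  -- along P, Q and M can be compared directly.
  have hS : ∑ c, R.RP a b c • 𝒮.hatP lam c = (∑ c, R.RP a b c • 𝒮.P c) -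
      𝒮.expand ((lam : ℂ) • ∑ c, R.RP a b c • Slot.ofK fun d => eta d d • WW 𝒮.W c d) := by
    simp only [LinearMap.map_smul_of_tower, map_sum, map_smul, ← shift_eq_expand, hatP_eq,
      smul_sub, Finset.sum_sub_distrib, Finset.smul_sum, smul_comm (lam : ℂ)]
  refine ⟨y + (lam : ℂ) • ∑ c, R.RP a b c • Slot.ofK fun d => eta d d • WW 𝒮.W c d,
    ⟨fun c d => ?_, fun i j => ?_⟩, ?_, fun c => ?_, fun γ k => ?_, fun c d => ?_⟩
  · simp [y, Slot.ofK, R.RM_antisymm a b c d]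
  · simp [y, Slot.ofK, R.RJ_symm a b i j]
  · have h := R.expansion a b
    change comm (𝒮.hatP lam a) (𝒮.hatP lam b) = -(∑ c, R.RP a b c • 𝒮.hatP lam c) - _ - _ - _ - _ -
      _ - _ at h
    rw [hS] at h
    rw [h, map_add, Gens.expand_apply _ y]
    have e : (1 / 2 : ℂ) • ∑ c, ∑ d, R.RM a b c d • (𝒮.deformed lam).M c d =
        ∑ c, ∑ d, R.RM a b c d • (1 / 2 : ℂ) • 𝒮.M c d := by
      simp only [Finset.smul_sum]
      exact Finset.sum_congr rfl fun c _ => Finset.sum_congr rfl fun d _ => smul_comm _ _ _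
    rw [e]
    simp only [y, neg_field_smul, Finset.sum_neg_distrib]
    change _ - (∑ γ, ∑ k, R.RQ a b γ k • 𝒮.Q γ k) - _ - (∑ i, ∑ j, R.RJ a b i j • 𝒮.J i j) -
      R.RD a b • 𝒮.D - (∑ γ, ∑ k, R.RS a b γ k • 𝒮.S γ k) - (∑ c, R.RK a b c • 𝒮.K c) = _
    abel
  all_goals simp [y, Slot.ofK]

/-- An expansion with the symmetries of M and J is unique by linear independence, so statements
about one expansion hold for all. -/
theorem vectorCurvature_eq {lam : ℝ} (R : VectorCurvature (𝒮.deformed lam)) (a b : Fin 6) :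
    (∀ c, R.RP a b c = 0) ∧ (∀ γ k, R.RQ a b γ k = -𝒮.hatCurv lam a b (.Q γ k)) ∧
      ∀ c d, R.RM a b c d = -𝒮.hatCurv lam a b (.M c d) := by
  obtain ⟨y, hb, hy, hP, hQ, hM⟩ := 𝒮.expand_neg_vectorCurvature R a b
  rw [comm_hatP_hatP_eq_expand] at hy
  have h := 𝒮.expand_injective (𝒮.hatCurv_balanced lam a b) hb hy
  refine ⟨fun c => ?_, fun γ k => ?_, fun c d => ?_⟩
  · rw [← neg_eq_zero, ← hP, ← h, hatCurv_P]
  · rw [h, hQ, neg_neg]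
  · rw [h, hM, neg_neg]

theorem nonempty_vectorCurvature (lam : ℝ) : Nonempty (VectorCurvature (𝒮.deformed lam)) := by
  refine ⟨⟨fun _ _ _ => 0, fun a b γ k => -𝒮.hatCurv lam a b (.Q γ k),
    fun a b c d => -𝒮.hatCurv lam a b (.M c d), fun a b i j => -𝒮.hatCurv lam a b (.J i j),
    fun a b => -𝒮.hatCurv lam a b .D, fun a b γ k => -𝒮.hatCurv lam a b (.S γ k),
    fun a b c => -𝒮.hatCurv lam a b (.K c), fun a b c d => ?_, fun a b i j => ?_, fun a b => ?_⟩⟩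
  · rw [(𝒮.hatCurv_balanced lam a b).M]
  · rw [(𝒮.hatCurv_balanced lam a b).J]
  · have h := 𝒮.comm_hatP_hatP_eq_expand lam a b
    rw [Gens.expand_apply] at h
    change comm (𝒮.hatP lam a) (𝒮.hatP lam b) = _
    rw [h]
    have e : (1 / 2 : ℂ) • ∑ c, ∑ d, (-𝒮.hatCurv lam a b (.M c d)) • (𝒮.deformed lam).M c d =
        -∑ c, ∑ d, 𝒮.hatCurv lam a b (.M c d) • (1 / 2 : ℂ) • 𝒮.M c d := by
      simp only [Finset.smul_sum, ← Finset.sum_neg_distrib]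
      exact Finset.sum_congr rfl fun c _ => Finset.sum_congr rfl fun d _ => by
        rw [neg_field_smul, smul_neg, smul_comm]; rfl
    rw [e]
    simp only [hatCurv_P, zero_smul, Finset.sum_const_zero, neg_field_smul, Finset.sum_neg_distrib,
      sub_neg_eq_add, neg_zero, zero_add]
    change _ = (∑ γ, ∑ k, 𝒮.hatCurv lam a b (.Q γ k) • 𝒮.Q γ k) + _ +
      (∑ i, ∑ j, 𝒮.hatCurv lam a b (.J i j) • 𝒮.J i j) +
      𝒮.hatCurv lam a b .D • 𝒮.D + (∑ γ, ∑ k, 𝒮.hatCurv lam a b (.S γ k) • 𝒮.S γ k) +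
      (∑ c, 𝒮.hatCurv lam a b (.K c) • 𝒮.K c)
    abel

theorem traceRM_eq {lam : ℝ} (R : VectorCurvature (𝒮.deformed lam)) (a c : Fin 6) :
    R.traceRM a c = (-(1 / 4 + 256 * (lam : ℂ))) • TT 𝒮.W a c := by
  rw [neg_smul, ← hatCurv_ricci, VectorCurvature.traceRM, ← Finset.sum_neg_distrib]
  exact Finset.sum_congr rfl fun d _ => (𝒮.vectorCurvature_eq R a d).2.2 c d

theorem conventional_constraints {lam : ℝ} (R : VectorCurvature (𝒮.deformed lam)) :
    (∀ a b c, R.RP a b c = 0) ∧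
      (∀ a c, R.traceRM a c = (-(1 / 4 + 256 * (lam : ℂ))) • TT 𝒮.W a c) ∧
      ∀ b δ k, ∑ a, ∑ γ, gU a δ γ • R.RQ a b γ k = 0 := by
  refine ⟨fun a b => (𝒮.vectorCurvature_eq R a b).1, 𝒮.traceRM_eq R, fun b δ k => ?_⟩
  simp only [fun a γ k => (𝒮.vectorCurvature_eq R a b).2.1 γ k, smul_neg, Finset.sum_neg_distrib,
    hatCurv_Q_trace, neg_zero]

theorem traceRM_traceless (R : VectorCurvature (𝒮.deformed (-1 / 1024))) (a c : Fin 6) :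
    R.traceRM a c = 0 := by
  rw [traceRM_eq]
  push_cast
  norm_num

theorem hatP_injective (h : ∃ a c, TT 𝒮.W a c ≠ 0) : Function.Injective 𝒮.hatP := by
  obtain ⟨a, c, hT⟩ := h
  intro l l' hl
  by_contra hne
  have h1 : ∀ a, ((l - l' : ℝ) : ℂ) • 𝒮.shift a = 0 := fun a => by
    have h2 := congrFun hl a
    rw [hatP_eq, hatP_eq, sub_right_inj] at h2
    refine LinearMap.ext fun f => ?_
    have h3 := congrArg (fun X : Module.End ℂ A => X f) h2
    simp only [LinearMap.smul_apply] at h3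
    rw [LinearMap.smul_apply, Complex.ofReal_sub, sub_smul, h3, sub_self, LinearMap.zero_apply]
  have h3 := 𝒮.WW_eq_zero_of_smul_shift_eq h1 a c
  have h4 : ((l - l' : ℝ) : ℂ) ≠ 0 := by exact_mod_cast sub_ne_zero.mpr hne
  rw [smul_eq_zero_iff_right h4] at h3
  exact hT (by rw [TT_eq, h3, smul_zero])

theorem eq_of_traceRM_eq_zero (h : ∃ a c, TT 𝒮.W a c ≠ 0) {lam : ℝ}
    (R : VectorCurvature (𝒮.deformed lam)) (hR : ∀ a c, R.traceRM a c = 0) :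
    lam = -1 / 1024 := by
  obtain ⟨a, c, hT⟩ := h
  have h1 := hR a c
  rw [traceRM_eq] at h1
  have h2 : -(1 / 4 + 256 * (lam : ℂ)) = 0 := (smul_eq_zero.mp h1).resolve_right hT
  have h3 : ((1 / 4 + 256 * lam : ℝ) : ℂ) = 0 := by
    push_cast
    linear_combination -h2
  have h4 := Complex.ofReal_eq_zero.mp h3
  linarith

end ConformalSuperspace

end

end SixD

end

theorem mainTheorem2 {A : Type*} [Ring A] [StarRing A] [Algebra ℂ A] [StarModule ℂ A]
    (𝒜 : ZMod 2 → Submodule ℂ A) [GradedAlgebra 𝒜] (𝒮 : SixD.ConformalSuperspace 𝒜) :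
    -- the undeformed algebra is a gauged algebra, built from the covariant fields
    SixD.IsGaugedAlgebra 𝒮.IsCov 𝒮.toGens ∧
    -- rigidity: `S`, `K`, `∇_α^i` cannot be deformed, `∇_a` only by one real parameter;
    -- it is enough that the deformed generators are `M`, `D`, `J`-covariant
    (∀ G : SixD.Gens A, 𝒮.IsFieldDeformation G →
      ((SixD.IsGaugedAlgebra 𝒮.IsCov G ↔ ∃ lam : ℝ, G.S = 𝒮.S ∧ G.K = 𝒮.K ∧ G.Q = 𝒮.Q ∧
          G.P = 𝒮.hatP lam) ∧
        (G.IsCovariant ↔ ∃ lam : ℝ, G.S = 𝒮.S ∧ G.K = 𝒮.K ∧ G.Q = 𝒮.Q ∧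
          G.P = 𝒮.hatP lam))) ∧
    -- every real `λ` occurs, and the structure functions are not affected
    (∀ lam : ℝ, 𝒮.IsFieldDeformation (𝒮.deformed lam) ∧
      SixD.IsGaugedAlgebra 𝒮.IsCov (𝒮.deformed lam) ∧
      SixD.HasStructureFunctions (𝒮.deformed lam) 𝒮.W) ∧
    -- the conventional constraints
    (∀ lam : ℝ, Nonempty (SixD.VectorCurvature (𝒮.deformed lam)) ∧
      ∀ R : SixD.VectorCurvature (𝒮.deformed lam),
        (∀ a b c, R.RP a b c = 0) ∧
        (∀ a c, R.traceRM a c = (-(1 / 4 + 256 * (lam : ℂ))) • SixD.TT 𝒮.W a c) ∧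
        (∀ b δ k, ∑ a, ∑ γ, SixD.gU a δ γ • R.RQ a b γ k = 0)) ∧
    -- the traceless frame
    (∀ R : SixD.VectorCurvature (𝒮.deformed (-1 / 1024)), ∀ a c, R.traceRM a c = 0) ∧
    -- the parameter is effective unless `T_{aef}^{ij} T^{cef}_{ij}` vanishes identically
    ((∃ a c, SixD.TT 𝒮.W a c ≠ 0) →
      Function.Injective 𝒮.hatP ∧
      ∀ (lam : ℝ) (R : SixD.VectorCurvature (𝒮.deformed lam)),
        (∀ a c, R.traceRM a c = 0) → lam = -1 / 1024) := by
  exact ⟨𝒮.isGaugedAlgebra, fun G hG => 𝒮.rigidity hG,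
    fun lam => ⟨𝒮.deformed_isFieldDeformation lam, 𝒮.deformed_isGaugedAlgebra lam,
      𝒮.deformed_structureFunctions lam⟩,
    fun lam => ⟨𝒮.nonempty_vectorCurvature lam, 𝒮.conventional_constraints⟩,
    𝒮.traceRM_traceless,
    fun h => ⟨𝒮.hatP_injective h, fun _ R hR => 𝒮.eq_of_traceRM_eq_zero h R hR⟩⟩
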